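/- **Setting.** Let $d\ge 1$, $m,n\ge 0$ be integers. All space-time norms are over $[0,1]\times\mathbb R^d$. *Littlewood–Paley pieces.* Fix a real, smooth, radial $\varphi$ on $\mathbb R^d$ with $\varphi(\xi)=1$ for $|\xi|\le 1$ and $\varphi(\xi)=0$ for $|\xi|\ge 2$, and put $\varphi_0=\varphi$, $\varphi_i(\xi)=\varphi(2^{-i}\xi)-\varphi(2^{-i+1}\xi)$ for $i\ge1$; $S_i=\varphi_i(D)$ with $D=-i\nabla$ acts in the space variable, and $S_{<N}=\sum_{0\le i<N}S_i$ (which is $0$ if $N\le 0$). A function $u(t,x)$ is localized at frequency $2^j$ if, for every $t\in[0,1]$, its spatial Fourier transform is supported in $2^{j-1}\le|\xi|\le2^{j+1}$ when $j\ge 1$, and in $|\xi|\le 2$ when $j=0$. *Cubes.* For $j\ge0$ let $\mathcal Q_j=\{2^j(k+[0,1)^d):k\in\mathbb Z^d\}$. Fix a smooth, compactly supported $\chi\ge0$ with $\sum_{k\in\mathbb Z^d}\chi(x-k)=1$ for all $x$, put $\chi_Q(x)=\chi(2^{-j}x-k)$ for $Q=2^j(k+[0,1)^d)$, and for a normed space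 $U$ of functions on $[0,1]\times\mathbb R^d$ put $\|u\|_{l^2_jU}^2=\sum_{Q\in\mathcal Q_j}\|\chi_Qu\|_U^2$. *Norms.* $$\|u\|_X=\sup_{l\ge0}\sup_{Q\in\mathcal Q_l}2^{-l/2}\|u\|_{L^2([0,1]\times Q)},\qquad \|u\|_{X_j}=2^{j/2}\|u\|_X+\|u\|_{L^\infty_tL^2_x},$$ $$\|w\|_{l^2X^s}^2=\sum_{j\ge0}2^{2js}\|S_jw\|_{l^2_jX_j}^2 .$$ The elements of $l^2X^s$ are the measurable functions $w$ with $w(t,\cdot)\in L^2(\mathbb R^d)$ for almost every $t\in[0,1]$ and $\|w\|_{l^2X^s}<\infty$. An atom of $Y$ is a function $a$ that, for some $l\ge0$ and $Q\in\mathcal Q_l$, is supported in $[0,1]\times Q$ and satisfies $\|a\|_{L^2}\le2^{-l/2}$; $\|f\|_Y=\inf\{\sum_k|c_k| : f=\sum_kc_ka_k,\ a_k\text{ atoms}\}$, and $$\|f\|_{Y_j}=\inf_{f=2^{j/2}f_1+f_2}\left(\|f_1\|_Y+\|f_2\|_{L^1_tL^2_x}\right).$$ *Equation.* Let $h=(h^{kl})$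 be a smooth map from $\mathbb C^n$ to the real symmetric $d\times d$ matrices (smooth in the real sense), with $h(z)=O(|z|^2)$ as $z\to0$. For a function $w:[0,1]\times\mathbb R^d\to\mathbb C^n$ let $g^{kl}=\delta^{kl}+h^{kl}(w(t,x))$, and let $g^{kl}_{<j-4}=\delta^{kl}+S_{<j-4}(g^{kl}-\delta^{kl})$ (which equals $S_{<j-4}g^{kl}$ if $j\ge5$). We consider $$(\ast)\qquad (i\partial_t+\partial_k\,g^{kl}_{<j-4}\,\partial_l)u_j=f_j,\qquad u_j(0)=u_{0j},$$ with summation over repeated indices, where $u_j\in C([0,1];L^2(\mathbb R^d;\mathbb C^m))$, $f_j$ is locally integrable on $[0,1]\times\mathbb R^d$, and the equation holds in the sense of distributions on $(0,1)\times\mathbb R^d$. **Proposition.** Let $s>\frac{d+3}{2}$. There are $\varepsilon>0$ and $C<\infty$, depending only on $d,m,n,s,h$ and the fixed $\varphi,\chi$, such that the following holds. If $w\in l^2X^s$ satisfies $\|w\|_{l^2X^s}\le\varepsilon$, then for every integer $j\ge0$ and every solution $u_j$ of $(\ast)$ that is localized at frequency $2^j$, $$\|u_j\|_{l^2_jX_j}\le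 C\left(\|u_{0j}\|_{L^2}+\|f_j\|_{l^2_jY_j}\right).$$ -/

import Mathlib

open MeasureTheory Filter Topology Set
open scoped ENNReal NNReal FourierTransform ContDiff

noncomputable section

namespace QuasiSchrodinger

/-- The Euclidean space `ℝ^d`. -/
abbrev Rd (d : ℕ) := EuclideanSpace ℝ (Fin d)

/-- Lebesgue measure on the space-time slab `[0,1] × ℝ^d`. -/
def slab (d : ℕ) : Measure (ℝ × Rd d) :=
  ((volume : Measure ℝ).restrict (Icc 0 1)).prod (volume : Measure (Rd d))

/-- The cube `2^j (k + [0,1)^d)`. For fixed `j`, the cubes with `k ∈ ℤ^d` form the partition `Q_j` of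
`ℝ^d` into cubes of side length `2^j`. -/
def cube {d : ℕ} (j : ℕ) (k : Fin d → ℤ) : Set (Rd d) :=
  {x | ∀ i, (2 : ℝ) ^ j * (k i : ℝ) ≤ x i ∧ x i < (2 : ℝ) ^ j * ((k i : ℝ) + 1)}

/-- The integer vector `k`, as a point of `ℝ^d`. -/
def latticePoint {d : ℕ} (k : Fin d → ℤ) : Rd d := WithLp.toLp 2 fun i => (k i : ℝ)

/-- The profile of a smooth, compactly supported partition of unity that is associated with the
integer translates of the unit cube; its rescaled translates form the partitions of unity
associated with the families of cubes `Q_j`. -/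
structure CubePartition (d : ℕ) where
  profile : Rd d → ℝ
  smooth : ContDiff ℝ ∞ profile
  compact : HasCompactSupport profile
  nonneg : ∀ x, 0 ≤ profile x
  hasSum_one : ∀ x, HasSum (fun k : Fin d → ℤ => profile (x - latticePoint k)) 1

/-- Such partitions of unity exist. -/
theorem CubePartition.exists_partition (d : ℕ) : Nonempty (CubePartition d) := by
  let η : ℝ → ℝ := fun s => Real.smoothTransition (s+1) - Real.smoothTransition s
  have hη : ContDiff ℝ ∞ η := (Real.smoothTransition.contDiff.comp (by fun_prop)).sub Real.smoothTransition.contDiff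
  have h0 : ∀ s, s ≤ -1 ∨ 1 ≤ s → η s = 0 := by
    intro s hs
    rcases hs with hs | hs
    · simp only [η]; rw [Real.smoothTransition.zero_of_nonpos (by linarith), Real.smoothTransition.zero_of_nonpos (by linarith)]; simp
    · simp only [η]; rw [Real.smoothTransition.one_of_one_le (by linarith), Real.smoothTransition.one_of_one_le (by linarith)]; simp
  have hnn : ∀ s, 0 ≤ η s := by
    intro s
    simp only [η, sub_nonneg]
    rcases le_total s 0 with hs | hs
    · rw [Real.smoothTransition.zero_of_nonpos hs]; exact Real.smoothTransition.nonneg _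
    · rw [Real.smoothTransition.one_of_one_le (by linarith : 1 ≤ s+1)]; exact Real.smoothTransition.le_one _
  refine ⟨⟨fun x => ∏ i, η (x i), ?_, ?_, ?_, ?_⟩⟩
  · exact contDiff_prod fun i _ => hη.comp (by fun_prop)
  · apply HasCompactSupport.of_support_subset_isCompact (K := WithLp.ofLp ⁻¹' (Set.pi univ fun _ => Icc (-1:ℝ) 1))
    · exact (PiLp.homeomorph 2 _).isCompact_preimage.2 (isCompact_univ_pi fun _ => isCompact_Icc)
    · intro x hx i _
      rw [Function.mem_support, Finset.prod_ne_zero_iff] at hx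
      have := hx i (Finset.mem_univ _)
      by_contra hc
      apply this; apply h0
      rw [mem_Icc, not_and_or] at hc
      rcases hc with hc | hc
      · left; exact (not_le.1 hc).le
      · right; exact (not_le.1 hc).le
  · intro x; exact Finset.prod_nonneg fun i _ => hnn _
  · intro x
    let t : Fin d → Finset ℤ := fun i => {⌊x i⌋, ⌊x i⌋ + 1}
    have h1 : ∑ k ∈ Fintype.piFinset t, ∏ i, η ((x - latticePoint k) i) = 1 := by
      have := Finset.prod_univ_sum t (fun i (k:ℤ) => η (x i - k))
      simp only [latticePoint, PiLp.sub_apply]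
      rw [← this]
      apply Finset.prod_eq_one
      intro i _
      have hne : ⌊x i⌋ ≠ ⌊x i⌋ + 1 := by omega
      simp only [t]
      rw [Finset.sum_pair hne]
      have a1 := Int.floor_le (x i)
      have a2 := Int.lt_floor_add_one (x i)
      simp only [η]; push_cast
      rw [Real.smoothTransition.one_of_one_le (by linarith), Real.smoothTransition.zero_of_nonpos (x := x i - (⌊x i⌋+1)) (by linarith)]
      ring_nf
    rw [← h1]
    apply hasSum_sum_of_ne_finset_zero
    intro k hk
    rw [Fintype.mem_piFinset] at hk
    push Not at hk
    obtain ⟨i, hi⟩ := hk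
    apply Finset.prod_eq_zero (Finset.mem_univ i)
    apply h0
    simp only [t, Finset.mem_insert, Finset.mem_singleton, not_or] at hi
    simp only [latticePoint, PiLp.sub_apply]
    by_contra hc
    push Not at hc
    apply hi.2
    have : ⌊x i⌋ = k i ∨ ⌊x i⌋ = k i - 1 := by
      by_cases hh : (k i:ℝ) ≤ x i
      · left; rw [Int.floor_eq_iff]; constructor <;> linarith
      · right; rw [Int.floor_eq_iff]; push_cast; push Not at hh; constructor <;> linarith
    omega

/-- The cutoff `χ_Q(x) = χ(2^{-j} x - k)` associated with the cube `Q = 2^j (k + [0,1)^d)`. -/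
def CubePartition.cutoff {d : ℕ} (χ : CubePartition d) (j : ℕ) (k : Fin d → ℤ) (x : Rd d) : ℝ :=
  χ.profile (((2 : ℝ) ^ j)⁻¹ • x - latticePoint k)

/-- The radial bump function from which a Littlewood-Paley decomposition is built. -/
structure LPBump (d : ℕ) where
  bump : Rd d → ℝ
  smooth : ContDiff ℝ ∞ bump
  radial : ∀ ξ η, ‖ξ‖ = ‖η‖ → bump ξ = bump η
  eq_one : ∀ ξ, ‖ξ‖ ≤ 1 → bump ξ = 1
  eq_zero : ∀ ξ, 2 ≤ ‖ξ‖ → bump ξ = 0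

/-- Such bump functions exist. -/
theorem LPBump.exists_bump (d : ℕ) : Nonempty (LPBump d) := by
  refine ⟨⟨fun ξ => Real.smoothTransition (2 - ‖ξ‖), ?_, ?_, ?_, ?_⟩⟩
  · rw [contDiff_iff_contDiffAt]
    intro x
    by_cases hx : x = 0
    · subst hx
      have : (fun ξ : Rd d => Real.smoothTransition (2 - ‖ξ‖)) =ᶠ[𝓝 0] fun _ => 1 := by
        filter_upwards [Metric.ball_mem_nhds (0 : Rd d) one_pos] with y hy
        apply Real.smoothTransition.one_of_one_le
        simp at hy; linarith
      exact contDiffAt_const.congr_of_eventuallyEq this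
    · exact (Real.smoothTransition.contDiff.contDiffAt).comp x (contDiffAt_const.sub (contDiffAt_norm ℝ hx))
  · intro a b h; simp [h]
  · intro a h; apply Real.smoothTransition.one_of_one_le; linarith
  · intro a h; apply Real.smoothTransition.zero_of_nonpos; linarith

/-- The symbol `φ_i(ξ)` of `S_i(D)`: `φ_0` is the bump, which lives in `|ξ| ≤ 2`, and
`φ_i(ξ) = φ_0(2^{-i} ξ) - φ_0(2^{-i+1} ξ)` lives in `2^{i-1} ≤ |ξ| ≤ 2^{i+1}` for `i > 0`.
The sum of all the symbols is `1`. -/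
def LPBump.symbol {d : ℕ} (φ : LPBump d) : ℕ → Rd d → ℝ
  | 0, ξ => φ.bump ξ
  | i + 1, ξ => φ.bump (((2 : ℝ) ^ (i + 1))⁻¹ • ξ) - φ.bump (((2 : ℝ) ^ i)⁻¹ • ξ)

/-- The convolution kernel of `S_i(D)`, `D = -i∇`. Mathlib's Fourier transform uses the characters
`exp (2 π i x·ξ)`, for which `D` is multiplication by `2 π ξ`. -/
def LPBump.kernel {d : ℕ} (φ : LPBump d) (i : ℕ) : Rd d → ℂ :=
  𝓕⁻ (fun ξ : Rd d => ((φ.symbol i ((2 * Real.pi) • ξ) : ℝ) : ℂ))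

section Spaces

variable {d : ℕ} {V : Type*} [NormedAddCommGroup V] [NormedSpace ℂ V]

/-- The Littlewood-Paley piece `S_i v`. -/
def LPBump.proj (φ : LPBump d) (i : ℕ) (v : Rd d → V) (x : Rd d) : V :=
  ∫ y, φ.kernel i (x - y) • v y

/-- The low frequency part `S_{<N} v = ∑_{i < N} S_i v`. -/
def LPBump.low (φ : LPBump d) (N : ℕ) (v : Rd d → V) (x : Rd d) : V :=
  ∑ i ∈ Finset.range N, φ.proj i v x

/-- The norm of `X`: the supremum over `l ≥ 0` and `Q ∈ Q_l` of
`2^{-l/2} ‖u‖_{L²([0,1] × Q)}`. -/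
def normX (u : ℝ × Rd d → V) : ℝ≥0∞ :=
  ⨆ (l : ℕ) (k : Fin d → ℤ),
    (2 : ℝ≥0∞) ^ (-(l : ℝ) / 2) * eLpNorm u 2 ((slab d).restrict (univ ×ˢ cube l k))

/-- The norm of `L^∞([0,1]; L²(ℝ^d))`. -/
def normLinftyL2 (u : ℝ × Rd d → V) : ℝ≥0∞ :=
  essSup (fun t => eLpNorm (fun x => u (t, x)) 2 (volume : Measure (Rd d)))
    ((volume : Measure ℝ).restrict (Icc 0 1))

/-- The norm of `L^1([0,1]; L²(ℝ^d))`. -/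
def normL1L2 (f : ℝ × Rd d → V) : ℝ≥0∞ :=
  ∫⁻ t in Icc (0 : ℝ) 1, eLpNorm (fun x => f (t, x)) 2 (volume : Measure (Rd d))

/-- An atom of `Y`: for some `j ≥ 0` and `Q ∈ Q_j` it is supported in `[0,1] × Q`, with `L²` norm at
most `2^{-j/2}`. -/
def IsAtomY (a : ℝ × Rd d → V) : Prop :=
  AEStronglyMeasurable a (slab d) ∧ ∃ (j : ℕ) (k : Fin d → ℤ),
    (∀ᵐ z ∂(slab d), z.2 ∉ cube j k → a z = 0) ∧
      eLpNorm a 2 (slab d) ≤ (2 : ℝ≥0∞) ^ (-(j : ℝ) / 2)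

/-- The atomic norm of `Y`: the infimum of `∑ |c_k|` over all representations `f = ∑ c_k a_k` by
atoms. It is infinite if there is none. As atoms have `L²` norm at most `1`, the series converges
absolutely in `L²([0,1] × ℝ^d)`, and also absolutely almost everywhere. -/
def normY (f : ℝ × Rd d → V) : ℝ≥0∞ :=
  ⨅ (c : ℕ → ℂ) (a : ℕ → ℝ × Rd d → V) (_ : ∀ k, IsAtomY (a k)) (_ : Summable fun k => ‖c k‖)
    (_ : ∀ᵐ z ∂(slab d), HasSum (fun k => c k • a k z) (f z)), ∑' k, ‖c k‖ₑ

/-- The norm of `X_j = 2^{-j/2} X ∩ L^∞ L²`. -/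
def normXj (j : ℕ) (u : ℝ × Rd d → V) : ℝ≥0∞ :=
  (2 : ℝ≥0∞) ^ ((j : ℝ) / 2) * normX u + normLinftyL2 u

/-- The norm of `Y_j = 2^{j/2} Y + L^1 L²`. -/
def normYj (j : ℕ) (f : ℝ × Rd d → V) : ℝ≥0∞ :=
  ⨅ (f₁ : ℝ × Rd d → V) (f₂ : ℝ × Rd d → V) (_ : AEStronglyMeasurable f₂ (slab d))
    (_ : f =ᵐ[slab d] fun z => (((2 : ℝ) ^ ((j : ℝ) / 2) : ℝ) : ℂ) • f₁ z + f₂ z),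
    normY f₁ + normL1L2 f₂

/-- The norm of `l²_j U`: the square root of `∑_{Q ∈ Q_j} ‖χ_Q u‖_U²`. -/
def l2Norm (χ : CubePartition d) (j : ℕ) (normU : (ℝ × Rd d → V) → ℝ≥0∞) (u : ℝ × Rd d → V) :
    ℝ≥0∞ :=
  (∑' k : Fin d → ℤ, normU (fun z => ((χ.cutoff j k z.2 : ℝ) : ℂ) • u z) ^ 2) ^ (1 / 2 : ℝ)

/-- The norm of `l² X^s`: the square root of `∑_{j ≥ 0} 2^{2js} ‖S_j w‖_{l²_j X_j}²`. -/
def norml2Xs (φ : LPBump d) (χ : CubePartition d) (s : ℝ) (w : ℝ × Rd d → V) : ℝ≥0∞ :=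
  (∑' j : ℕ, (2 : ℝ≥0∞) ^ (2 * (j : ℝ) * s) *
    l2Norm χ j (normXj j) (fun z => φ.proj j (fun y => w (z.1, y)) z.2) ^ 2) ^ (1 / 2 : ℝ)

/-- Membership in `l² X^s`. That almost every time slice is in `L²` makes the Littlewood-Paley pieces
meaningful; a tempered distribution of finite `l² X^s` norm has this property. -/
structure Meml2Xs (φ : LPBump d) (χ : CubePartition d) (s : ℝ) (w : ℝ × Rd d → V) : Prop where
  measurable : AEStronglyMeasurable w (slab d)
  slices : ∀ᵐ t ∂((volume : Measure ℝ).restrict (Icc 0 1)),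
    MemLp (fun x => w (t, x)) 2 (volume : Measure (Rd d))
  finite : norml2Xs φ χ s w < ⊤

end Spaces

/-- The frequencies of size `2^j`: `2^{j-1} ≤ |ξ| ≤ 2^{j+1}` for `j > 0`, and all of `|ξ| ≤ 2` for
`j = 0`. -/
def IsFrequency {d : ℕ} (j : ℕ) (ξ : Rd d) : Prop :=
  ‖ξ‖ ≤ (2 : ℝ) ^ (j + 1) ∧ (0 < j → (2 : ℝ) ^ (j - 1) ≤ ‖ξ‖)

/-- The function `v` is in `L²` and is localized at frequency `2^j`. -/
def FreqLocalized {d : ℕ} {V : Type*} [NormedAddCommGroup V] [InnerProductSpace ℂ V]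
    [CompleteSpace V] (j : ℕ) (v : Rd d → V) : Prop :=
  ∃ hv : MemLp v 2 (volume : Measure (Rd d)),
    ∀ᵐ ξ : Rd d, ¬ IsFrequency j ((2 * Real.pi) • ξ) → (𝓕 (hv.toLp v) : Lp V 2 volume) ξ = 0

/-- The frequency truncated metric `g_{<N}^{kl} = δ^{kl} + S_{<N} (g^{kl} - δ^{kl})`. For `N > 0` this
is `S_{<N} g^{kl}`, as `S_{<N}` fixes the constants. -/
def lowMetric {d : ℕ} (φ : LPBump d) (N : ℕ) (g : ℝ × Rd d → Matrix (Fin d) (Fin d) ℝ)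
    (k l : Fin d) (z : ℝ × Rd d) : ℂ :=
  (((1 : Matrix (Fin d) (Fin d) ℝ) k l : ℝ) : ℂ) +
    φ.low N (fun y => (((g (z.1, y) - 1) k l : ℝ) : ℂ)) z.2

/-- The time derivative `∂_t ψ`. -/
def dt {d : ℕ} (ψ : ℝ × Rd d → ℂ) (z : ℝ × Rd d) : ℂ := deriv (fun t => ψ (t, z.2)) z.1

/-- The spatial derivative `∂_k ψ`. -/
def dx {d : ℕ} (k : Fin d) (ψ : ℝ × Rd d → ℂ) (z : ℝ × Rd d) : ℂ :=
  fderiv ℝ (fun x => ψ (z.1, x)) z.2 (EuclideanSpace.single k 1)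

/-- The function `u ∈ C([0,1]; L²)` solves
`(i ∂_t + ∂_k a^{kl} ∂_l) u = f` in the sense of distributions on `(0,1) × ℝ^d`, with `u(0) = u₀`.
The coefficients `a^{kl}` are smooth in `x` in the case of interest, so that all the derivatives can
be moved to the test function. -/
structure IsSolution {d : ℕ} {V : Type*} [NormedAddCommGroup V] [NormedSpace ℂ V]
    (a : Fin d → Fin d → ℝ × Rd d → ℂ) (u₀ : Rd d → V) (u f : ℝ × Rd d → V) : Prop where
  measurable : AEStronglyMeasurable u (slab d)
  memL2 : ∀ t ∈ Icc (0 : ℝ) 1, MemLp (fun x => u (t, x)) 2 (volume : Measure (Rd d))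
  continuous : ∀ t₀ ∈ Icc (0 : ℝ) 1,
    Tendsto (fun t => eLpNorm (fun x => u (t, x) - u (t₀, x)) 2 (volume : Measure (Rd d)))
      (𝓝[Icc 0 1] t₀) (𝓝 0)
  forcing : LocallyIntegrableOn f (Icc (0 : ℝ) 1 ×ˢ univ)
    ((volume : Measure ℝ).prod (volume : Measure (Rd d)))
  initial : (fun x => u (0, x)) =ᵐ[(volume : Measure (Rd d))] u₀
  equation : ∀ ψ : ℝ × Rd d → ℂ, ContDiff ℝ ∞ ψ → HasCompactSupport ψ →
    tsupport ψ ⊆ Ioo (0 : ℝ) 1 ×ˢ univ →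
    ∫ z, (-Complex.I * dt ψ z + ∑ k, ∑ l, dx l (fun y => a k l y * dx k ψ y) z) • u z ∂(slab d)
      = ∫ z, ψ z • f z ∂(slab d)

end QuasiSchrodinger

end

open QuasiSchrodinger

noncomputable section

namespace QuasiSchrodinger

open scoped SchwartzMap LineDeriv ComplexConjugate

/-- The unit time interval. -/
local notation "𝕀" => Icc (0 : ℝ) 1

/-- Real coefficients that depend on space and time. -/
abbrev Coeff (d : ℕ) := Fin d → Fin d → ℝ × Rd d → ℝ

variable {d : ℕ} {φ : LPBump d} {H : Coeff d} {P : Rd d → ℝ≥0∞} {B : ℝ≥0∞} {u₀ : Rd d → ℂ}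
  {U f : ℝ × Rd d → ℂ}

section FourierFacts

variable {V : Type*} [NormedAddCommGroup V] [NormedSpace ℂ V]

/-- Convolution of a scalar kernel with a vector valued function. -/
def cv (κ : Rd d → ℂ) (v : Rd d → V) (x : Rd d) : V := ∫ y, κ (x - y) • v y

/-- The functions of at most polynomial growth in the mean; these have a convolution with every
Schwartz function. -/
def ConvDefined (v : Rd d → V) : Prop :=
  AEStronglyMeasurable v volume ∧ ∃ n : ℕ, Integrable fun y => ((1 + ‖y‖) ^ n)⁻¹ * ‖v y‖

/-- Schwartz functions decay faster than any power. -/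
theorem schwartz_decay {F : Type*} [NormedAddCommGroup F] [NormedSpace ℝ F] (κ : 𝓢(Rd d, F))
    (n : ℕ) : ∃ C : ℝ, 0 ≤ C ∧ ∀ x, ‖κ x‖ ≤ C * ((1 + ‖x‖) ^ n)⁻¹ := by
  refine ⟨2 ^ n * (Finset.Iic (n, 0)).sup (fun m => SchwartzMap.seminorm ℝ m.1 m.2) κ,
    by positivity, fun x => ?_⟩
  have h := SchwartzMap.one_add_le_sup_seminorm_apply (𝕜 := ℝ) (m := (n, 0)) (k := n) (n := 0)
    le_rfl le_rfl κ x
  rw [norm_iteratedFDeriv_zero] at h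
  rw [← div_eq_mul_inv, le_div_iff₀ (by positivity), mul_comm]
  exact h

theorem inv_one_add_sub_pow_le (n : ℕ) (x y : Rd d) :
    ((1 + ‖x - y‖) ^ n)⁻¹ ≤ (1 + ‖x‖) ^ n * ((1 + ‖y‖) ^ n)⁻¹ := by
  rw [inv_le_iff_one_le_mul₀ (by positivity), mul_comm, ← mul_assoc, ← mul_pow,
    ← div_eq_mul_inv, le_div_iff₀ (by positivity), one_mul]
  gcongr
  have : ‖y‖ ≤ ‖x‖ + ‖x - y‖ := by
    have := norm_sub_le x (x - y)
    simpa using this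
  nlinarith [norm_nonneg x, norm_nonneg (x - y)]

theorem ConvDefined.integrable {v : Rd d → V} (hv : ConvDefined v) (κ : 𝓢(Rd d, ℂ)) (x : Rd d) :
    Integrable fun y => κ (x - y) • v y := by
  obtain ⟨hm, n, hn⟩ := hv
  obtain ⟨C, hC0, hC⟩ := schwartz_decay κ n
  refine Integrable.mono' (hn.const_mul (C * (1 + ‖x‖) ^ n))
    ((by fun_prop : Continuous fun y => κ (x - y)).aestronglyMeasurable.smul hm)
    (Eventually.of_forall fun y => ?_)
  rw [norm_smul, mul_assoc, ← mul_assoc ((1 + ‖x‖) ^ n), ← mul_assoc]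
  gcongr
  exact (hC _).trans (by gcongr; exact inv_one_add_sub_pow_le n x y)

theorem cv_eq_integral_sub (κ : Rd d → ℂ) (v : Rd d → V) (x : Rd d) :
    cv κ v x = ∫ y, κ y • v (x - y) := by
  rw [cv, ← integral_sub_left_eq_self (fun y => κ y • v (x - y)) volume x]
  simp

/-- The symbol of the low frequency projection to frequencies up to size `2^r`. -/
def LPBump.lowSymbol (φ : LPBump d) (r : ℕ) (ξ : Rd d) : ℝ :=
  φ.bump (((2 : ℝ) ^ r)⁻¹ • ((2 * Real.pi) • ξ))

theorem LPBump.lowSymbol_contDiff (φ : LPBump d) (r : ℕ) : ContDiff ℝ ∞ (φ.lowSymbol r) :=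
  φ.smooth.comp (by fun_prop)

theorem LPBump.lowSymbol_eq_one (φ : LPBump d) (r : ℕ) {ξ : Rd d}
    (h : ‖(2 * Real.pi) • ξ‖ ≤ 2 ^ r) : φ.lowSymbol r ξ = 1 := by
  apply φ.eq_one
  rw [norm_smul, norm_inv, norm_pow, Real.norm_ofNat, inv_mul_le_iff₀ (by positivity)]
  simpa using h

theorem LPBump.lowSymbol_eq_zero (φ : LPBump d) (r : ℕ) {ξ : Rd d}
    (h : 2 ^ (r + 1) ≤ ‖(2 * Real.pi) • ξ‖) : φ.lowSymbol r ξ = 0 := by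
  apply φ.eq_zero
  rw [norm_smul, norm_inv, norm_pow, Real.norm_ofNat, le_inv_mul_iff₀ (by positivity)]
  rwa [pow_succ] at h

theorem LPBump.lowSymbol_neg (φ : LPBump d) (r : ℕ) (ξ : Rd d) :
    φ.lowSymbol r (-ξ) = φ.lowSymbol r ξ := by
  apply φ.radial
  simp

theorem LPBump.lowSymbol_hasCompactSupport (φ : LPBump d) (r : ℕ) :
    HasCompactSupport (φ.lowSymbol r) := by
  apply HasCompactSupport.intro (isCompact_closedBall (0 : Rd d) ((2 : ℝ) ^ (r + 1)))
  intro ξ hξ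
  apply φ.lowSymbol_eq_zero
  rw [mem_closedBall_zero_iff, not_le] at hξ
  rw [norm_smul, Real.norm_eq_abs, abs_of_pos (by positivity)]
  have h1 : (1 : ℝ) ≤ 2 * Real.pi := by linarith [Real.pi_gt_three]
  have h0 : (0 : ℝ) ≤ ‖ξ‖ := norm_nonneg _
  nlinarith

/-- The symbol of the low frequency projection, as a Schwartz function. -/
def LPBump.symS (φ : LPBump d) (r : ℕ) : 𝓢(Rd d, ℂ) :=
  HasCompactSupport.toSchwartzMap (f := fun ξ : Rd d => ((φ.lowSymbol r ξ : ℝ) : ℂ))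
    ((φ.lowSymbol_hasCompactSupport r).comp_left (g := fun x : ℝ => (x : ℂ)) (by simp))
    (Complex.ofRealCLM.contDiff.comp (φ.lowSymbol_contDiff r))

theorem LPBump.symS_apply (φ : LPBump d) (r : ℕ) (ξ : Rd d) :
    φ.symS r ξ = ((φ.lowSymbol r ξ : ℝ) : ℂ) := rfl

/-- The convolution kernel of the low frequency projection. -/
def LPBump.Phi (φ : LPBump d) (r : ℕ) : 𝓢(Rd d, ℂ) := 𝓕⁻ (φ.symS r)

theorem LPBump.Phi_apply (φ : LPBump d) (r : ℕ) (x : Rd d) :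
    φ.Phi r x = 𝓕⁻ (fun ξ : Rd d => ((φ.lowSymbol r ξ : ℝ) : ℂ)) x := by
  rw [LPBump.Phi, SchwartzMap.fourierInv_coe]
  rfl

theorem LPBump.fourier_Phi (φ : LPBump d) (r : ℕ) : 𝓕 (φ.Phi r) = φ.symS r := by
  simp [LPBump.Phi]

theorem LPBump.fourierInv_Phi (φ : LPBump d) (r : ℕ) : 𝓕⁻ (φ.Phi r) = φ.symS r := by
  ext ξ
  rw [SchwartzMap.fourierInv_coe, Real.fourierInv_eq_fourier_neg, ← SchwartzMap.fourier_coe,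
    φ.fourier_Phi, φ.symS_apply, φ.symS_apply, φ.lowSymbol_neg]

theorem LPBump.Phi_neg (φ : LPBump d) (r : ℕ) (x : Rd d) : φ.Phi r (-x) = φ.Phi r x := by
  have h : φ.Phi r = 𝓕 (φ.symS r) := by
    rw [← φ.fourierInv_Phi]; simp
  conv_rhs => rw [h, SchwartzMap.fourier_coe]
  rw [LPBump.Phi, SchwartzMap.fourierInv_coe, Real.fourierInv_eq_fourier_neg, neg_neg]

theorem LPBump.Phi_real (φ : LPBump d) (r : ℕ) (x : Rd d) :
    ((φ.Phi r x).re : ℂ) = φ.Phi r x := by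
  rw [← Complex.conj_eq_iff_re]
  conv_rhs => rw [← φ.Phi_neg]
  rw [φ.Phi_apply, φ.Phi_apply, Real.fourierInv_eq', Real.fourierInv_eq', ← integral_conj]
  apply integral_congr_ae
  filter_upwards with ξ
  simp only [smul_eq_mul, map_mul, Complex.conj_ofReal, ← Complex.exp_conj]
  congr 2
  simp

theorem LPBump.Phi_dilate (φ : LPBump d) (r : ℕ) (x : Rd d) :
    φ.Phi r x = ((2 : ℝ) ^ r) ^ d * φ.Phi 0 ((2 : ℝ) ^ r • x) := by
  rw [φ.Phi_apply, φ.Phi_apply, Real.fourierInv_eq', Real.fourierInv_eq']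
  have h := Measure.integral_comp_inv_smul (volume : Measure (Rd d))
    (fun v : Rd d => Complex.exp (↑(2 * Real.pi * inner ℝ v ((2 : ℝ) ^ r • x)) * Complex.I) •
      ((φ.lowSymbol 0 v : ℝ) : ℂ)) ((2 : ℝ) ^ r)
  simp only [finrank_euclideanSpace, Fintype.card_fin] at h
  rw [abs_of_pos (by positivity)] at h
  rw [Complex.real_smul] at h
  push_cast at h ⊢
  rw [← h]
  apply integral_congr_ae
  filter_upwards with ξ
  have h1 : φ.lowSymbol r ξ = φ.lowSymbol 0 (((2 : ℝ) ^ r)⁻¹ • ξ) := by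
    simp only [LPBump.lowSymbol]
    congr 1
    rw [smul_comm]
    simp
  rw [h1]
  congr 4
  rw [real_inner_smul_left, real_inner_smul_right]
  push_cast
  field_simp

theorem LPBump.kernel_zero (φ : LPBump d) : φ.kernel 0 = φ.Phi 0 := by
  ext x
  rw [φ.Phi_apply]
  simp [LPBump.kernel, LPBump.symbol, LPBump.lowSymbol]

theorem LPBump.kernel_succ (φ : LPBump d) (i : ℕ) (x : Rd d) :
    φ.kernel (i + 1) x = φ.Phi (i + 1) x - φ.Phi i x := by
  have h : φ.Phi (i + 1) x - φ.Phi i x = (φ.Phi (i + 1) - φ.Phi i) x := rfl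
  have h2 : φ.Phi (i + 1) - φ.Phi i = 𝓕⁻ (φ.symS (i + 1) - φ.symS i) := by
    simp only [LPBump.Phi, sub_eq_add_neg, FourierTransform.fourierInv_add,
      FourierTransform.fourierInv_neg]
  have h3 : (fun ξ : Rd d => ((φ.symbol (i + 1) ((2 * Real.pi) • ξ) : ℝ) : ℂ))
      = ⇑(φ.symS (i + 1) - φ.symS i) := by
    funext ξ
    simp [LPBump.symbol, φ.symS_apply, LPBump.lowSymbol]
  rw [h, h2, SchwartzMap.fourierInv_coe, LPBump.kernel, h3]

theorem LPBump.integral_Phi (φ : LPBump d) (r : ℕ) : ∫ x, φ.Phi r x = 1 := by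
  have h : 𝓕 (φ.Phi r) 0 = 1 := by
    rw [φ.fourier_Phi, φ.symS_apply, φ.lowSymbol_eq_one] <;> simp
  rw [SchwartzMap.fourier_coe, Real.fourier_eq'] at h
  simpa using h

theorem LPBump.proj_zero (φ : LPBump d) (v : Rd d → V) : φ.proj 0 v = cv (φ.Phi 0) v := by
  ext x
  simp [LPBump.proj, cv, φ.kernel_zero]

theorem LPBump.proj_succ (φ : LPBump d) {v : Rd d → V} (hv : ConvDefined v) (i : ℕ) :
    φ.proj (i + 1) v = cv (φ.Phi (i + 1)) v - cv (φ.Phi i) v := by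
  ext x
  simp only [LPBump.proj, cv, φ.kernel_succ, Pi.sub_apply, sub_smul]
  exact integral_sub (hv.integrable _ x) (hv.integrable _ x)

theorem LPBump.low_zero (φ : LPBump d) (v : Rd d → V) : φ.low 0 v = 0 := by
  ext x; simp [LPBump.low]

theorem LPBump.low_succ (φ : LPBump d) {v : Rd d → V} (hv : ConvDefined v) (N : ℕ) :
    φ.low (N + 1) v = cv (φ.Phi N) v := by
  induction N with
  | zero => ext x; simp [LPBump.low, φ.proj_zero]
  | succ N ih =>
    ext x
    have h := congrFun ih x
    simp only [LPBump.low] at h ⊢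
    rw [Finset.sum_range_succ, h, φ.proj_succ hv]
    simp

theorem integrable_inv_one_add_norm_pow {n : ℕ} (hn : d < n) :
    Integrable fun y : Rd d => ((1 + ‖y‖) ^ n)⁻¹ := by
  have h := integrable_one_add_norm (E := Rd d) (μ := volume) (r := n) (by simpa using hn)
  refine h.congr (Eventually.of_forall fun y => ?_)
  simp only
  rw [Real.rpow_neg (by positivity), Real.rpow_natCast]

omit [NormedSpace ℂ V] in
theorem ConvDefined.of_memLp_two {v : Rd d → V} (hv : MemLp v 2 volume) : ConvDefined v := by
  refine ⟨hv.1, d + 1, ?_⟩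
  have h1 : Integrable fun y : Rd d => ((1 + ‖y‖) ^ (2 * (d + 1)))⁻¹ + ‖v y‖ ^ 2 :=
    (integrable_inv_one_add_norm_pow (by omega)).add ((memLp_two_iff_integrable_sq_norm hv.1).1 hv)
  refine h1.mono' ?_ (Eventually.of_forall fun y => ?_)
  · have : Continuous fun y : Rd d => ((1 + ‖y‖) ^ (d + 1))⁻¹ := by
      apply Continuous.inv₀ (by fun_prop)
      intro y; positivity
    exact this.aestronglyMeasurable.mul hv.1.norm
  · rw [Real.norm_of_nonneg (by positivity), mul_comm 2, pow_mul]
    set a := (1 + ‖y‖) ^ (d + 1)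
    rw [show (a ^ 2)⁻¹ = a⁻¹ ^ 2 by rw [inv_pow]]
    nlinarith [sq_nonneg (a⁻¹ - ‖v y‖), sq_nonneg (‖v y‖), sq_nonneg a⁻¹]

omit [NormedSpace ℂ V] in
theorem ConvDefined.of_bounded {v : Rd d → V} (hv : AEStronglyMeasurable v volume) (C : ℝ)
    (hC : ∀ᵐ x, ‖v x‖ ≤ C) : ConvDefined v := by
  refine ⟨hv, d + 1, ?_⟩
  have := (integrable_inv_one_add_norm_pow (d := d) (n := d + 1) (by omega)).smul_bdd (f := fun y => ‖v y‖) C hv.norm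
    (by simpa using hC)
  exact this

theorem LPBump.cv_Phi_Phi (φ : LPBump d) {q r : ℕ} (h : q < r) :
    cv (φ.Phi r) (φ.Phi q) = φ.Phi q := by
  have h1 : SchwartzMap.convolution (ContinuousLinearMap.mul ℂ ℂ) (φ.Phi q) (φ.Phi r) = φ.Phi q := by
    have : 𝓕 (SchwartzMap.convolution (ContinuousLinearMap.mul ℂ ℂ) (φ.Phi q) (φ.Phi r))
        = φ.symS q := by
      rw [SchwartzMap.fourier_convolution, φ.fourier_Phi, φ.fourier_Phi]
      ext ξ
      simp only [SchwartzMap.pairing_apply_apply, ContinuousLinearMap.mul_apply', φ.symS_apply]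
      by_cases hξ : ‖(2 * Real.pi) • ξ‖ ≤ 2 ^ r
      · rw [φ.lowSymbol_eq_one r hξ]; simp
      · rw [φ.lowSymbol_eq_zero q]; · simp
        exact (pow_le_pow_right₀ (by norm_num) h).trans (not_le.1 hξ).le
    conv_rhs => rw [LPBump.Phi, ← this]
    simp
  ext x
  have h2 := congrArg (fun f : 𝓢(Rd d, ℂ) => f x) h1
  simp only [SchwartzMap.convolution_apply] at h2
  rw [← h2, cv, convolution_def]
  congr 1
  ext y
  simp [mul_comm]

end FourierFacts

section L2

variable {V : Type*} [NormedAddCommGroup V] [InnerProductSpace ℂ V] [CompleteSpace V]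

omit [CompleteSpace V] in
theorem integral_norm_cv_le (κ : 𝓢(Rd d, ℂ)) {v : Rd d → V} (hv : MemLp v 2 volume) (x : Rd d) :
    ∫ y, ‖κ (x - y) • v y‖ ≤ (eLpNorm κ 2 volume).toReal * (eLpNorm v 2 volume).toReal := by
  simp_rw [norm_smul]
  have h1 : MemLp (fun y => κ (x - y)) 2 (volume : Measure (Rd d)) :=
    (κ.memLp 2 volume).comp_measurePreserving (Measure.measurePreserving_sub_left volume x)
  have h2 := integral_mul_norm_le_Lp_mul_Lq (μ := (volume : Measure (Rd d))) (p := 2) (q := 2)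
    (f := fun y => ‖κ (x - y)‖) (g := fun y => ‖v y‖) Real.HolderConjugate.two_two
    (by simpa using h1.norm) (by simpa using hv.norm)
  simp only [norm_norm] at h2
  refine h2.trans (le_of_eq ?_)
  have e1 : eLpNorm (fun y => κ (x - y)) 2 (volume : Measure (Rd d)) = eLpNorm κ 2 volume :=
    eLpNorm_comp_measurePreserving (κ.continuous.aestronglyMeasurable)
      (Measure.measurePreserving_sub_left volume x)
  rw [← e1, h1.eLpNorm_eq_integral_rpow_norm (by norm_num) (by norm_num),
    hv.eLpNorm_eq_integral_rpow_norm (by norm_num) (by norm_num),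
    ENNReal.toReal_ofReal (by positivity), ENNReal.toReal_ofReal (by positivity)]
  norm_num

omit [CompleteSpace V] in
theorem norm_cv_le (κ : 𝓢(Rd d, ℂ)) {v : Rd d → V} (hv : MemLp v 2 volume) (x : Rd d) :
    ‖cv κ v x‖ ≤ (eLpNorm κ 2 volume).toReal * (eLpNorm v 2 volume).toReal :=
  (norm_integral_le_integral_norm _).trans (integral_norm_cv_le κ hv x)

omit [CompleteSpace V] in
theorem cv_kernel_prod_integrable (κ : 𝓢(Rd d, ℂ)) {ψ : Rd d → ℂ} (hψc : Continuous ψ)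
    (hψ : Integrable ψ volume) {v : Rd d → V} (hv : MemLp v 2 volume) :
    Integrable (fun p : Rd d × Rd d => (ψ p.1 * κ (p.1 - p.2)) • v p.2)
      ((volume : Measure (Rd d)).prod volume) := by
  have hm : AEStronglyMeasurable (fun p : Rd d × Rd d => (ψ p.1 * κ (p.1 - p.2)) • v p.2)
      ((volume : Measure (Rd d)).prod volume) := by
    apply AEStronglyMeasurable.smul
    · exact (by fun_prop : Continuous fun p : Rd d × Rd d => ψ p.1 * κ (p.1 - p.2)).aestronglyMeasurable
    · exact hv.1.comp_snd
  rw [integrable_prod_iff hm]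
  constructor
  · filter_upwards with x
    have := ((ConvDefined.of_memLp_two hv).integrable κ x).smul (ψ x)
    refine this.congr (Eventually.of_forall fun y => ?_)
    simp [smul_smul]
  · refine Integrable.mono' (hψ.norm.mul_const
      ((eLpNorm κ 2 volume).toReal * (eLpNorm v 2 volume).toReal))
      (hm.norm.integral_prod_right') (Eventually.of_forall fun x => ?_)
    rw [Real.norm_of_nonneg (integral_nonneg fun _ => norm_nonneg _)]
    simp_rw [mul_smul, norm_smul (ψ x)]
    rw [integral_const_mul]
    gcongr
    exact integral_norm_cv_le κ hv x

/-- Convolution with a low frequency kernel, in terms of the Fourier transform. -/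
theorem integral_smul_cv (φ : LPBump d) (r : ℕ) (ψ : 𝓢(Rd d, ℂ)) {v : Rd d → V}
    (hv : MemLp v 2 volume) :
    ∫ x, ψ x • cv (φ.Phi r) v x = ∫ ξ, (φ.symS r ξ * 𝓕⁻ ψ ξ) • (𝓕 (hv.toLp v) : Lp V 2 volume) ξ := by
  have h1 : ∫ x, ψ x • cv (φ.Phi r) v x
      = ∫ y, (SchwartzMap.convolution (ContinuousLinearMap.mul ℂ ℂ) ψ (φ.Phi r)) y • v y := by
    have e1 : ∀ x, ψ x • cv (φ.Phi r) v x = ∫ y, (ψ x * φ.Phi r (x - y)) • v y := by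
      intro x
      rw [cv, ← integral_smul]
      simp_rw [smul_smul]
    simp_rw [e1]
    rw [integral_integral_swap (cv_kernel_prod_integrable (φ.Phi r) ψ.continuous ψ.integrable hv)]
    congr 1
    ext y
    rw [integral_smul_const, SchwartzMap.convolution_apply, convolution_def]
    congr 2
    ext x
    rw [ContinuousLinearMap.mul_apply', ← φ.Phi_neg r (y - x), neg_sub]
  rw [h1]
  set χ := SchwartzMap.convolution (ContinuousLinearMap.mul ℂ ℂ) ψ (φ.Phi r) with hχ
  have h2 : ∀ ξ, 𝓕⁻ χ ξ = φ.symS r ξ * 𝓕⁻ ψ ξ := by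
    intro ξ
    have a1 : ∀ g : 𝓢(Rd d, ℂ), 𝓕⁻ g ξ = 𝓕 g (-ξ) := by
      intro g
      rw [SchwartzMap.fourierInv_coe, Real.fourierInv_eq_fourier_neg, SchwartzMap.fourier_coe]
    rw [a1, a1, hχ, SchwartzMap.fourier_convolution, SchwartzMap.pairing_apply_apply, φ.fourier_Phi,
      φ.symS_apply, φ.symS_apply, φ.lowSymbol_neg]
    simp [mul_comm]
  have h3 : ∫ y, χ y • v y = ∫ y, χ y • (hv.toLp v) y := by
    apply integral_congr_ae
    filter_upwards [hv.coeFn_toLp] with y hy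
    rw [hy]
  have h4 : (Lp.toTemperedDistribution (𝓕 (hv.toLp v) : Lp V 2 volume)) (𝓕⁻ χ)
      = Lp.toTemperedDistribution (hv.toLp v) χ := by
    rw [← Lp.fourier_toTemperedDistribution_eq, TemperedDistribution.fourier_apply]
    simp
  rw [Lp.toTemperedDistribution_apply, Lp.toTemperedDistribution_apply] at h4
  rw [h3, ← h4]
  simp_rw [h2]

theorem integral_smul_eq_fourier (ψ : 𝓢(Rd d, ℂ)) {v : Rd d → V} (hv : MemLp v 2 volume) :
    ∫ x, ψ x • v x = ∫ ξ, (𝓕⁻ ψ ξ) • (𝓕 (hv.toLp v) : Lp V 2 volume) ξ := by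
  have h3 : ∫ y, ψ y • v y = ∫ y, ψ y • (hv.toLp v) y := by
    apply integral_congr_ae
    filter_upwards [hv.coeFn_toLp] with y hy
    rw [hy]
  have h4 : (Lp.toTemperedDistribution (𝓕 (hv.toLp v) : Lp V 2 volume)) (𝓕⁻ ψ)
      = Lp.toTemperedDistribution (hv.toLp v) ψ := by
    rw [← Lp.fourier_toTemperedDistribution_eq, TemperedDistribution.fourier_apply]
    simp
  rw [Lp.toTemperedDistribution_apply, Lp.toTemperedDistribution_apply] at h4
  rw [h3, ← h4]

end L2

section ConvSmooth

variable {V : Type*} [NormedAddCommGroup V] [NormedSpace ℂ V]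

theorem norm_smulRight_le (c : Rd d →L[ℝ] ℂ) (v : V) : ‖c.smulRight v‖ ≤ ‖c‖ * ‖v‖ := by
  refine ContinuousLinearMap.opNorm_le_bound _ (by positivity) fun x => ?_
  rw [ContinuousLinearMap.smulRight_apply, norm_smul]
  calc ‖c x‖ * ‖v‖ ≤ ‖c‖ * ‖x‖ * ‖v‖ := by gcongr; exact c.le_opNorm x
    _ = ‖c‖ * ‖v‖ * ‖x‖ := by ring

theorem cv_deriv_aestronglyMeasurable (κ : 𝓢(Rd d, ℂ)) {v : Rd d → V}
    (hm : AEStronglyMeasurable v volume) (x : Rd d) :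
    AEStronglyMeasurable (fun y => (fderiv ℝ κ (x - y)).smulRight (v y)) volume := by
  have h1 : Continuous fun y => fderiv ℝ κ (x - y) :=
    ((κ.smooth 1).continuous_fderiv (by norm_num)).comp (by fun_prop)
  have h2 : Continuous fun p : (Rd d →L[ℝ] ℂ) × V => p.1.smulRight p.2 := by
    have e : (fun p : (Rd d →L[ℝ] ℂ) × V => p.1.smulRight p.2) = fun p =>
        ((ContinuousLinearMap.lsmul ℝ ℂ (E := V)).flip p.2).comp p.1 := by
      ext p h; simp
    rw [e]
    fun_prop
  exact h2.comp_aestronglyMeasurable (h1.aestronglyMeasurable.prodMk hm)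

theorem cv_deriv_integrable (κ : 𝓢(Rd d, ℂ)) {v : Rd d → V} (hv : ConvDefined v) (x : Rd d) :
    Integrable (fun y => (fderiv ℝ κ (x - y)).smulRight (v y)) volume := by
  obtain ⟨hm, n, hn⟩ := hv
  obtain ⟨C, hC0, hC⟩ := schwartz_decay (SchwartzMap.fderivCLM ℝ (Rd d) ℂ κ) n
  refine Integrable.mono' (hn.const_mul (C * (1 + ‖x‖) ^ n)) (cv_deriv_aestronglyMeasurable κ hm x)
    (Eventually.of_forall fun y => ?_)
  refine (norm_smulRight_le _ _).trans ?_
  rw [mul_assoc, ← mul_assoc ((1 + ‖x‖) ^ n), ← mul_assoc]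
  gcongr
  exact (hC _).trans (by gcongr; exact inv_one_add_sub_pow_le n x y)

theorem cv_hasFDerivAt (κ : 𝓢(Rd d, ℂ)) {v : Rd d → V} (hv : ConvDefined v) (x : Rd d) :
    HasFDerivAt (cv κ v) (∫ y, (fderiv ℝ κ (x - y)).smulRight (v y)) x := by
  obtain ⟨hm, n, hn⟩ := hv
  obtain ⟨C, hC0, hC⟩ := schwartz_decay (SchwartzMap.fderivCLM ℝ (Rd d) ℂ κ) n
  have hd : ∀ z, HasFDerivAt κ (fderiv ℝ κ z) z := fun z => (κ.differentiableAt).hasFDerivAt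
  apply hasFDerivAt_integral_of_dominated_of_fderiv_le (𝕜 := ℝ) (s := Metric.ball x 1)
    (F' := fun x y => (fderiv ℝ κ (x - y)).smulRight (v y))
    (bound := fun y => C * (1 + (‖x‖ + 1)) ^ n * (((1 + ‖y‖) ^ n)⁻¹ * ‖v y‖))
    (Metric.ball_mem_nhds x one_pos)
  · filter_upwards with z
    exact (by fun_prop : Continuous fun y => κ (z - y)).aestronglyMeasurable.smul hm
  · exact ConvDefined.integrable ⟨hm, n, hn⟩ κ x
  · exact cv_deriv_aestronglyMeasurable κ hm x
  · filter_upwards with y z hz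
    refine (norm_smulRight_le _ _).trans ?_
    rw [mul_assoc, ← mul_assoc (_ ^ n), ← mul_assoc]
    gcongr
    refine (hC _).trans ?_
    gcongr
    refine (inv_one_add_sub_pow_le n z y).trans ?_
    gcongr
    have : ‖z‖ ≤ ‖x‖ + ‖z - x‖ := by
      have := norm_add_le x (z - x); simpa using this
    rw [Metric.mem_ball, dist_eq_norm] at hz
    linarith
  · exact hn.const_mul _
  · filter_upwards with y z hz
    exact ((hd (z - y)).comp z ((hasFDerivAt_id z).sub_const y)).smul_const (v y)

theorem cv_fderiv_apply (κ : 𝓢(Rd d, ℂ)) {v : Rd d → V} (hv : ConvDefined v) (x e : Rd d) :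
    fderiv ℝ (cv κ v) x e = cv (∂_{e} κ : 𝓢(Rd d, ℂ)) v x := by
  rw [(cv_hasFDerivAt κ hv x).fderiv, ContinuousLinearMap.integral_apply]
  · simp [cv, SchwartzMap.lineDerivOp_apply_eq_fderiv]
  · exact cv_deriv_integrable κ hv x

theorem cv_contDiff (κ : 𝓢(Rd d, ℂ)) {v : Rd d → V} (hv : ConvDefined v) :
    ContDiff ℝ ∞ (cv κ v) := by
  rw [contDiff_infty]
  intro n
  induction n generalizing κ with
  | zero => 
    rw [Nat.cast_zero, contDiff_zero]
    exact continuous_iff_continuousAt.2 fun x => (cv_hasFDerivAt κ hv x).continuousAt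
  | succ n ih =>
    push_cast
    rw [contDiff_succ_iff_fderiv_apply]
    refine ⟨fun x => (cv_hasFDerivAt κ hv x).differentiableAt, by simp, fun e => ?_⟩
    simp_rw [cv_fderiv_apply κ hv]
    exact ih _

theorem cv_continuous (κ : 𝓢(Rd d, ℂ)) {v : Rd d → V} (hv : ConvDefined v) :
    Continuous (cv κ v) := (cv_contDiff κ hv).continuous

end ConvSmooth

section FreqLoc

variable {V : Type*} [NormedAddCommGroup V] [InnerProductSpace ℂ V] [CompleteSpace V]

theorem ae_eq_of_integral_schwartz_smul_eq {f g : Rd d → V} (hf : LocallyIntegrable f volume)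
    (hg : LocallyIntegrable g volume)
    (h : ∀ ψ : 𝓢(Rd d, ℂ), HasCompactSupport ψ → ∫ x, ψ x • f x = ∫ x, ψ x • g x) :
    f =ᵐ[volume] g := by
  apply ae_eq_of_integral_contDiff_smul_eq hf hg
  intro ψ hψ hc
  have := h (HasCompactSupport.toSchwartzMap (f := fun x => ((ψ x : ℝ) : ℂ))
    (hc.comp_left (g := fun x : ℝ => (x : ℂ)) (by simp)) (Complex.ofRealCLM.contDiff.comp hψ))
    (hc.comp_left (g := fun x : ℝ => (x : ℂ)) (by simp))
  have e : ∀ (F : Rd d → V), ∫ x, ψ x • F x = ∫ x, ((ψ x : ℝ) : ℂ) • F x := fun F => by simp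
  rw [e, e]
  exact this

theorem FreqLocalized.cv_eq_self (φ : LPBump d) {j r : ℕ} (hr : j + 1 ≤ r) {v : Rd d → V}
    (hv : FreqLocalized j v) : cv (φ.Phi r) v =ᵐ[volume] v := by
  obtain ⟨hv, h⟩ := hv
  apply ae_eq_of_integral_schwartz_smul_eq
    (cv_continuous _ (ConvDefined.of_memLp_two hv)).locallyIntegrable
    (hv.locallyIntegrable (by norm_num))
  intro ψ _
  rw [integral_smul_cv φ r ψ hv, integral_smul_eq_fourier ψ hv]
  apply integral_congr_ae
  filter_upwards [h] with ξ hξ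
  by_cases hf : IsFrequency j ((2 * Real.pi) • ξ)
  · rw [φ.symS_apply, φ.lowSymbol_eq_one r (hf.1.trans (pow_le_pow_right₀ (by norm_num) hr))]
    simp
  · simp [hξ hf]

theorem FreqLocalized.cv_eq_zero (φ : LPBump d) {j r : ℕ} (hr : r + 2 ≤ j) {v : Rd d → V}
    (hv : FreqLocalized j v) : cv (φ.Phi r) v = 0 := by
  obtain ⟨hv, h⟩ := hv
  have hc := cv_continuous (φ.Phi r) (ConvDefined.of_memLp_two hv)
  refine (Continuous.ae_eq_iff_eq volume hc continuous_zero).1 ?_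
  apply ae_eq_of_integral_schwartz_smul_eq hc.locallyIntegrable
    (continuous_const (y := (0 : V))).locallyIntegrable
  intro ψ _
  rw [integral_smul_cv φ r ψ hv]
  simp only [smul_zero, integral_zero]
  rw [← integral_zero (Rd d) V (μ := volume)]
  apply integral_congr_ae
  filter_upwards [h] with ξ hξ
  by_cases hf : IsFrequency j ((2 * Real.pi) • ξ)
  · rw [φ.symS_apply, φ.lowSymbol_eq_zero r]
    · simp
    · exact (pow_le_pow_right₀ (by norm_num) (by omega)).trans (hf.2 (by omega))
  · simp [hξ hf]

theorem cv_Phi_cv_Phi (φ : LPBump d) {q r : ℕ} (h : q < r) {v : Rd d → V}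
    (hv : MemLp v 2 volume) : cv (φ.Phi r) (cv (φ.Phi q) v) = cv (φ.Phi q) v := by
  ext x
  have hψ : Integrable (fun y => φ.Phi r (x - y)) volume := (φ.Phi r).integrable.comp_sub_left x
  have e1 : ∀ y, φ.Phi r (x - y) • cv (φ.Phi q) v y
      = ∫ z, (φ.Phi r (x - y) * φ.Phi q (y - z)) • v z := by
    intro y
    rw [cv, ← integral_smul]
    simp_rw [smul_smul]
  rw [cv]
  simp_rw [e1]
  rw [integral_integral_swap (cv_kernel_prod_integrable (φ.Phi q)
    (ψ := fun y => φ.Phi r (x - y)) (by fun_prop) hψ hv), cv]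
  congr 1
  ext z
  rw [integral_smul_const]
  congr 1
  rw [← congrFun (φ.cv_Phi_Phi h) (x - z), cv,
    ← integral_sub_right_eq_self (fun y => φ.Phi r (x - z - y) • φ.Phi q y) z]
  simp

theorem ae_eq_of_tendsto_cv (φ : LPBump d) {v W : Rd d → V} (hv : MemLp v 2 volume)
    (hW : Continuous W) {B : ℝ} (hB : ∀ N x, ‖cv (φ.Phi N) v x‖ ≤ B)
    (hlim : ∀ x, Tendsto (fun N => cv (φ.Phi N) v x) atTop (𝓝 (W x))) : v =ᵐ[volume] W := by
  apply ae_eq_of_integral_schwartz_smul_eq (hv.locallyIntegrable (by norm_num)) hW.locallyIntegrable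
  intro ψ _
  have h1 : Tendsto (fun N => ∫ x, ψ x • cv (φ.Phi N) v x) atTop (𝓝 (∫ x, ψ x • W x)) := by
    apply tendsto_integral_of_dominated_convergence (fun x => ‖ψ x‖ * B)
    · intro N
      exact (ψ.continuous.smul (cv_continuous _ (ConvDefined.of_memLp_two hv))).aestronglyMeasurable
    · exact (ψ.integrable).norm.mul_const B
    · intro N
      filter_upwards with x
      rw [norm_smul]
      gcongr
      exact hB N x
    · filter_upwards with x
      exact (hlim x).const_smul _
  obtain ⟨M, hM⟩ : ∃ M : ℝ, ∀ ξ : Rd d, |φ.bump ξ| ≤ M := by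
    have hc : HasCompactSupport φ.bump :=
      HasCompactSupport.intro (isCompact_closedBall (0 : Rd d) 2) fun ξ hξ =>
        φ.eq_zero ξ (by simpa using (not_le.1 (by simpa using hξ)).le)
    obtain ⟨M, hM⟩ := hc.exists_bound_of_continuous φ.smooth.continuous
    exact ⟨M, hM⟩
  have hI : Integrable (fun ξ => (𝓕⁻ ψ ξ) • (𝓕 (hv.toLp v) : Lp V 2 volume) ξ) volume := by
    have := (Lp.memLp (𝓕 (hv.toLp v) : Lp V 2 volume)).smul (r := 1) ((𝓕⁻ ψ).memLp 2 volume)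
    exact memLp_one_iff_integrable.1 this
  have h2 : Tendsto (fun N => ∫ x, ψ x • cv (φ.Phi N) v x) atTop (𝓝 (∫ x, ψ x • v x)) := by
    simp_rw [fun N => integral_smul_cv φ N ψ hv]
    rw [integral_smul_eq_fourier ψ hv]
    apply tendsto_integral_of_dominated_convergence
      (fun ξ => M * ‖(𝓕⁻ ψ ξ) • (𝓕 (hv.toLp v) : Lp V 2 volume) ξ‖)
    · intro N
      exact (((φ.symS N).continuous.mul (𝓕⁻ ψ).continuous).aestronglyMeasurable).smul
        (Lp.aestronglyMeasurable _)
    · exact hI.norm.const_mul M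
    · intro N
      filter_upwards with ξ
      rw [mul_smul, norm_smul (φ.symS N ξ)]
      gcongr
      rw [φ.symS_apply, Complex.norm_real]
      exact hM _
    · filter_upwards with ξ
      apply tendsto_const_nhds.congr'
      obtain ⟨N, hN⟩ := pow_unbounded_of_one_lt ‖(2 * Real.pi) • ξ‖ (one_lt_two (α := ℝ))
      filter_upwards [eventually_ge_atTop N] with n hn
      rw [φ.symS_apply, φ.lowSymbol_eq_one n (hN.le.trans (pow_le_pow_right₀ (by norm_num) hn))]
      simp
  exact tendsto_nhds_unique h2 h1

end FreqLoc

section JointContinuity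

variable {V : Type*} [NormedAddCommGroup V] [InnerProductSpace ℂ V]

theorem cv_sub (κ : 𝓢(Rd d, ℂ)) {v w : Rd d → V} (hv : ConvDefined v) (hw : ConvDefined w)
    (x : Rd d) : cv κ (fun y => v y - w y) x = cv κ v x - cv κ w x := by
  simp only [cv, smul_sub]
  exact integral_sub (hv.integrable _ x) (hw.integrable _ x)

theorem cv_jointly_continuousOn (κ : 𝓢(Rd d, ℂ)) {u : ℝ → Rd d → V} {I : Set ℝ}
    (hu : ∀ t ∈ I, MemLp (u t) 2 volume)
    (hc : ∀ t₀ ∈ I, Tendsto (fun t => eLpNorm (fun x => u t x - u t₀ x) 2 volume)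
      (𝓝[I] t₀) (𝓝 0)) :
    ContinuousOn (fun z : ℝ × Rd d => cv κ (u z.1) z.2) (I ×ˢ univ) := by
  rintro ⟨t₀, x₀⟩ ⟨ht₀, -⟩
  simp only at ht₀
  have h1 : Tendsto (fun z : ℝ × Rd d => cv κ (u z.1) z.2 - cv κ (u t₀) z.2)
      (𝓝[I ×ˢ univ] (t₀, x₀)) (𝓝 0) := by
    rw [tendsto_zero_iff_norm_tendsto_zero]
    have h2 : Tendsto (fun z : ℝ × Rd d => (eLpNorm κ 2 volume).toReal *
        (eLpNorm (fun x => u z.1 x - u t₀ x) 2 volume).toReal) (𝓝[I ×ˢ univ] (t₀, x₀)) (𝓝 0) := by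
      have h3 : Tendsto (fun z : ℝ × Rd d => z.1) (𝓝[I ×ˢ univ] (t₀, x₀)) (𝓝[I] t₀) := by
        apply tendsto_nhdsWithin_of_tendsto_nhds_of_eventually_within
        · exact (continuous_fst.tendsto (t₀, x₀)).mono_left nhdsWithin_le_nhds
        · filter_upwards [self_mem_nhdsWithin] with z hz using hz.1
      have h4 := ((ENNReal.tendsto_toReal ENNReal.zero_ne_top).comp ((hc t₀ ht₀).comp h3)).const_mul
        (eLpNorm κ 2 volume).toReal
      simpa using h4
    refine squeeze_zero' (Eventually.of_forall fun _ => norm_nonneg _) ?_ h2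
    filter_upwards [self_mem_nhdsWithin] with z hz
    rw [← cv_sub κ (ConvDefined.of_memLp_two (hu _ hz.1)) (ConvDefined.of_memLp_two (hu _ ht₀))]
    exact norm_cv_le κ ((hu _ hz.1).sub (hu _ ht₀)) z.2
  have h2 : Tendsto (fun z : ℝ × Rd d => cv κ (u t₀) z.2) (𝓝[I ×ˢ univ] (t₀, x₀))
      (𝓝 (cv κ (u t₀) x₀)) :=
    (((cv_continuous κ (ConvDefined.of_memLp_two (hu _ ht₀))).comp continuous_snd).tendsto
      (t₀, x₀)).mono_left nhdsWithin_le_nhds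
  have := h1.add h2
  simpa [ContinuousWithinAt] using this

end JointContinuity

theorem lintegral_mul_sq_le {α : Type*} [MeasurableSpace α] {μ : Measure α} {f g : α → ℝ≥0∞}
    (hf : AEMeasurable f μ) (hg : AEMeasurable g μ) :
    (∫⁻ x, f x * g x ∂μ) ^ 2 ≤ (∫⁻ x, f x ^ 2 ∂μ) * ∫⁻ x, g x ^ 2 ∂μ := by
  have h := ENNReal.lintegral_mul_le_Lp_mul_Lq μ Real.HolderConjugate.two_two hf hg
  calc (∫⁻ x, f x * g x ∂μ) ^ 2 ≤ ((∫⁻ x, f x ^ (2 : ℝ) ∂μ) ^ (1 / 2 : ℝ) *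
        (∫⁻ x, g x ^ (2 : ℝ) ∂μ) ^ (1 / 2 : ℝ)) ^ 2 := by gcongr; exact h
    _ = _ := by
      rw [mul_pow, ← ENNReal.rpow_mul_natCast, ← ENNReal.rpow_mul_natCast]
      norm_num

theorem lintegral_mul_sq_le_weighted {α : Type*} [MeasurableSpace α] {μ : Measure α}
    {f g : α → ℝ≥0∞} (hf : AEMeasurable f μ) (hg : AEMeasurable g μ) :
    (∫⁻ x, f x * g x ∂μ) ^ 2 ≤ (∫⁻ x, f x ∂μ) * ∫⁻ x, f x * g x ^ 2 ∂μ := by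
  have e : ∀ x, f x = (f x) ^ (1 / 2 : ℝ) * (f x) ^ (1 / 2 : ℝ) := fun x => by
    rw [← ENNReal.rpow_add_of_nonneg _ _ (by norm_num) (by norm_num)]; norm_num
  have e2 : ∀ x, ((f x) ^ (1 / 2 : ℝ)) ^ 2 = f x := fun x => by rw [sq, ← e]
  have h := lintegral_mul_sq_le (hf.pow_const (1 / 2 : ℝ)) ((hf.pow_const (1 / 2 : ℝ)).mul hg)
  simp only [Pi.mul_apply, mul_pow, e2, ← mul_assoc, ← e] at h
  exact h

theorem eLpNorm_two_sq {α : Type*} [MeasurableSpace α] {μ : Measure α} {E : Type*}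
    [NormedAddCommGroup E] (f : α → E) : eLpNorm f 2 μ ^ 2 = ∫⁻ x, ‖f x‖ₑ ^ 2 ∂μ := by
  have h := eLpNorm_nnreal_pow_eq_lintegral (f := f) (μ := μ) (p := 2) (by norm_num)
  simpa using h

theorem eLpNorm_two_eq {α : Type*} [MeasurableSpace α] {μ : Measure α} {E : Type*}
    [NormedAddCommGroup E] (f : α → E) :
    eLpNorm f 2 μ = (∫⁻ x, ‖f x‖ₑ ^ 2 ∂μ) ^ (1 / 2 : ℝ) := by
  rw [← eLpNorm_two_sq, ← ENNReal.rpow_natCast_mul]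
  norm_num

section Moments

variable {V : Type*} [NormedAddCommGroup V]

/-- The moments of a kernel. -/
def mom (κ : Rd d → V) (N : ℕ) : ℝ≥0∞ := ∫⁻ y, ‖κ y‖ₑ * (1 + ‖y‖ₑ) ^ N

theorem mom_mono (κ : Rd d → V) {N M : ℕ} (h : N ≤ M) : mom κ N ≤ mom κ M := by
  unfold mom
  gcongr
  exact le_self_add

theorem one_add_enorm (y : Rd d) (N : ℕ) :
    (1 + ‖y‖ₑ) ^ N = ENNReal.ofReal ((1 + ‖y‖) ^ N) := by
  rw [ENNReal.ofReal_pow (by positivity), ENNReal.ofReal_add (by positivity) (by positivity),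
    ofReal_norm, ENNReal.ofReal_one]

theorem mom_lt_top [NormedSpace ℝ V] (κ : 𝓢(Rd d, V)) (N : ℕ) : mom κ N < ⊤ := by
  obtain ⟨C, hC0, hC⟩ := schwartz_decay κ (N + (d + 1))
  have h1 := ((integrable_inv_one_add_norm_pow (d := d) (n := d + 1) (by omega)).const_mul C).2
  refine lt_of_le_of_lt (lintegral_mono fun y => ?_) h1
  rw [one_add_enorm, ← ofReal_norm, ← ENNReal.ofReal_mul (by positivity), ← ofReal_norm]
  apply ENNReal.ofReal_le_ofReal
  rw [Real.norm_of_nonneg (by positivity)]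
  calc ‖κ y‖ * (1 + ‖y‖) ^ N ≤ C * ((1 + ‖y‖) ^ (N + (d + 1)))⁻¹ * (1 + ‖y‖) ^ N := by
        gcongr; exact hC y
    _ = C * ((1 + ‖y‖) ^ (d + 1))⁻¹ := by
        rw [pow_add]
        field_simp

theorem lintegral_dilate (r : ℕ) (F : Rd d → ℝ≥0∞) :
    ∫⁻ y, ENNReal.ofReal (((2 : ℝ) ^ r) ^ d) * F ((2 : ℝ) ^ r • y) = ∫⁻ y, F y := by
  have h2 : ((2 : ℝ) ^ r) ≠ 0 := by positivity
  rw [lintegral_const_mul' _ _ ENNReal.ofReal_ne_top]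
  have h := (Homeomorph.smulOfNeZero ((2 : ℝ) ^ r) h2).toMeasurableEquiv.measurableEmbedding.lintegral_map
    F (μ := (volume : Measure (Rd d)))
  have e : (⇑(Homeomorph.smulOfNeZero ((2 : ℝ) ^ r) h2).toMeasurableEquiv : Rd d → Rd d)
      = ((2 : ℝ) ^ r • ·) := rfl
  rw [e, Measure.map_addHaar_smul _ h2, lintegral_smul_measure] at h
  rw [← h]
  rw [finrank_euclideanSpace, Fintype.card_fin, abs_of_pos (by positivity), smul_eq_mul, ← mul_assoc,
    ← ENNReal.ofReal_mul (by positivity), mul_inv_cancel₀ (by positivity)]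
  simp

theorem enorm_two_pow_smul_ge (r : ℕ) (y : Rd d) : ‖y‖ₑ ≤ ‖(2 : ℝ) ^ r • y‖ₑ := by
  rw [enorm_smul]
  have : (1 : ℝ≥0∞) ≤ ‖(2 : ℝ) ^ r‖ₑ := by
    rw [← ofReal_norm, norm_pow, Real.norm_ofNat, ENNReal.one_le_ofReal]
    exact one_le_pow₀ (by norm_num)
  calc ‖y‖ₑ = 1 * ‖y‖ₑ := by simp
    _ ≤ _ := by gcongr

theorem LPBump.enorm_Phi (φ : LPBump d) (r : ℕ) (y : Rd d) :
    ‖φ.Phi r y‖ₑ = ENNReal.ofReal (((2 : ℝ) ^ r) ^ d) * ‖φ.Phi 0 ((2 : ℝ) ^ r • y)‖ₑ := by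
  rw [φ.Phi_dilate, enorm_mul, ← ofReal_norm]
  simp

theorem LPBump.mom_Phi (φ : LPBump d) (r N : ℕ) : mom (φ.Phi r) N ≤ mom (φ.Phi 0) N := by
  unfold mom
  rw [← lintegral_dilate r (fun y => ‖φ.Phi 0 y‖ₑ * (1 + ‖y‖ₑ) ^ N)]
  apply lintegral_mono
  intro y
  simp only
  rw [φ.enorm_Phi, mul_assoc]
  gcongr
  exact enorm_two_pow_smul_ge r y

theorem LPBump.mom_Phi_mul (φ : LPBump d) (r N : ℕ) :
    ∫⁻ y, ‖φ.Phi r y‖ₑ * ‖y‖ₑ * (1 + ‖y‖ₑ) ^ N ≤ (2 ^ r)⁻¹ * mom (φ.Phi 0) (N + 1) := by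
  unfold mom
  rw [← lintegral_dilate r (fun y => ‖φ.Phi 0 y‖ₑ * (1 + ‖y‖ₑ) ^ (N + 1)),
    ← lintegral_const_mul' _ _ (by simp)]
  apply lintegral_mono
  intro y
  simp only
  have e : ‖y‖ₑ = (2 ^ r)⁻¹ * ‖(2 : ℝ) ^ r • y‖ₑ := by
    rw [enorm_smul, ← ofReal_norm ((2 : ℝ) ^ r), norm_pow, Real.norm_ofNat, ENNReal.ofReal_pow (by norm_num),
      ← mul_assoc, ENNReal.ofReal_ofNat, ENNReal.inv_mul_cancel (by positivity) (by simp), one_mul]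
  rw [φ.enorm_Phi, pow_succ']
  calc _ = ENNReal.ofReal (((2 : ℝ) ^ r) ^ d) * ‖φ.Phi 0 ((2 : ℝ) ^ r • y)‖ₑ * 
        ((2 ^ r)⁻¹ * ‖(2 : ℝ) ^ r • y‖ₑ) * (1 + ‖y‖ₑ) ^ N := by rw [← e]
    _ = (2 ^ r)⁻¹ * (ENNReal.ofReal (((2 : ℝ) ^ r) ^ d) * (‖φ.Phi 0 ((2 : ℝ) ^ r • y)‖ₑ *
        (‖(2 : ℝ) ^ r • y‖ₑ * (1 + ‖y‖ₑ) ^ N))) := by ring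
    _ ≤ _ := by
      gcongr
      · exact le_add_self
      · exact enorm_two_pow_smul_ge r y

theorem LPBump.lineDeriv_Phi_dilate (φ : LPBump d) (r : ℕ) (e x : Rd d) :
    (∂_{e} (φ.Phi r) : 𝓢(Rd d, ℂ)) x
      = ((2 : ℝ) ^ r) ^ d * (2 : ℝ) ^ r * (∂_{e} (φ.Phi 0) : 𝓢(Rd d, ℂ)) ((2 : ℝ) ^ r • x) := by
  rw [SchwartzMap.lineDerivOp_apply_eq_fderiv, SchwartzMap.lineDerivOp_apply_eq_fderiv]
  have h0 : HasFDerivAt (φ.Phi 0) (fderiv ℝ (φ.Phi 0) ((2 : ℝ) ^ r • x)) ((2 : ℝ) ^ r • x) :=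
    (φ.Phi 0).differentiableAt.hasFDerivAt
  have h1 : HasFDerivAt (fun x => (((2 : ℝ) ^ r : ℝ) : ℂ) ^ d * φ.Phi 0 ((2 : ℝ) ^ r • x)) _ x :=
    (h0.comp x ((hasFDerivAt_id x).const_smul ((2 : ℝ) ^ r))).const_mul
      ((((2 : ℝ) ^ r : ℝ) : ℂ) ^ d)
  have h2 : ⇑(φ.Phi r) = fun x => (((2 : ℝ) ^ r : ℝ) : ℂ) ^ d * φ.Phi 0 ((2 : ℝ) ^ r • x) := by
    ext x
    rw [φ.Phi_dilate]
    push_cast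
    ring
  conv_lhs => rw [h2, h1.fderiv]
  simp
  ring

theorem LPBump.mom_lineDeriv_Phi (φ : LPBump d) (r N : ℕ) (e : Rd d) :
    mom (∂_{e} (φ.Phi r) : 𝓢(Rd d, ℂ)) N ≤ 2 ^ r * mom (∂_{e} (φ.Phi 0) : 𝓢(Rd d, ℂ)) N := by
  unfold mom
  rw [← lintegral_dilate r (fun y => ‖(∂_{e} (φ.Phi 0) : 𝓢(Rd d, ℂ)) y‖ₑ * (1 + ‖y‖ₑ) ^ N),
    ← lintegral_const_mul' _ _ (by simp)]
  apply lintegral_mono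
  intro y
  simp only
  have e1 : ‖(∂_{e} (φ.Phi r) : 𝓢(Rd d, ℂ)) y‖ₑ = ENNReal.ofReal (((2 : ℝ) ^ r) ^ d) * 2 ^ r *
      ‖(∂_{e} (φ.Phi 0) : 𝓢(Rd d, ℂ)) ((2 : ℝ) ^ r • y)‖ₑ := by
    rw [φ.lineDeriv_Phi_dilate, enorm_mul, enorm_mul, ← ofReal_norm, ← ofReal_norm]
    congr 2
    · simp
    · simp [ENNReal.ofReal_pow]
  rw [e1]
  calc _ = 2 ^ r * (ENNReal.ofReal (((2 : ℝ) ^ r) ^ d) *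
      (‖(∂_{e} (φ.Phi 0) : 𝓢(Rd d, ℂ)) ((2 : ℝ) ^ r • y)‖ₑ * (1 + ‖y‖ₑ) ^ N)) := by ring
    _ ≤ _ := by
      gcongr
      exact enorm_two_pow_smul_ge r y

end Moments

section Schur

variable {V : Type*} [NormedAddCommGroup V] [NormedSpace ℂ V]

theorem enorm_cv_sq_le {κ : Rd d → ℂ} (hκ : AEMeasurable (fun y => ‖κ y‖ₑ) volume) {v : Rd d → V}
    (hv : AEStronglyMeasurable v volume) (x : Rd d) :
    ‖cv κ v x‖ₑ ^ 2 ≤ mom κ 0 * ∫⁻ y, ‖κ y‖ₑ * ‖v (x - y)‖ₑ ^ 2 := by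
  have h1 : ‖cv κ v x‖ₑ ≤ ∫⁻ y, ‖κ y‖ₑ * ‖v (x - y)‖ₑ := by
    rw [cv_eq_integral_sub]
    refine (enorm_integral_le_lintegral_enorm _).trans (le_of_eq ?_)
    simp_rw [enorm_smul]
  have h2 : AEMeasurable (fun y => ‖v (x - y)‖ₑ) volume :=
    (hv.comp_measurePreserving (Measure.measurePreserving_sub_left volume x)).enorm
  calc _ ≤ (∫⁻ y, ‖κ y‖ₑ * ‖v (x - y)‖ₑ) ^ 2 := by gcongr
    _ ≤ _ := by
      refine (lintegral_mul_sq_le_weighted hκ h2).trans (le_of_eq ?_)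
      simp [mom]

/-- A weighted bound for a convolution in terms of the weighted bounds for the translates. -/
theorem lintegral_cv_sq_le {T : Type*} [MeasurableSpace T] {τ : Measure T} [SFinite τ]
    {κ : Rd d → ℂ} (hκ : Measurable fun y => ‖κ y‖ₑ) {v : T × Rd d → V}
    (hv : AEStronglyMeasurable v (τ.prod volume)) {W : Rd d → ℝ≥0∞} (hW : Measurable W) {N : ℕ}
    {K : ℝ≥0∞}
    (hK : ∀ y, ∫⁻ z, W z.2 * ‖v (z.1, z.2 - y)‖ₑ ^ 2 ∂(τ.prod volume) ≤ K * (1 + ‖y‖ₑ) ^ N) :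
    ∫⁻ z, W z.2 * ‖cv κ (fun y => v (z.1, y)) z.2‖ₑ ^ 2 ∂(τ.prod volume)
      ≤ mom κ 0 * mom κ N * K := by
  have hmp : Measure.QuasiMeasurePreserving (fun p : (T × Rd d) × Rd d => (p.1.1, p.1.2 - p.2))
      ((τ.prod volume).prod volume) (τ.prod volume) := by
    have h1 : Measure.QuasiMeasurePreserving (fun q : Rd d × Rd d => q.1 - q.2)
      ((volume : Measure (Rd d)).prod volume) volume := by
      exact quasiMeasurePreserving_sub (volume : Measure (Rd d)) volume
    have h2 := QuasiMeasurePreserving.prodMap (MeasurePreserving.id τ).quasiMeasurePreserving h1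
    exact h2.comp (measurePreserving_prodAssoc τ volume volume).quasiMeasurePreserving
  have hv2 : AEMeasurable (fun p : (T × Rd d) × Rd d =>
      W p.1.2 * (‖κ p.2‖ₑ * ‖v (p.1.1, p.1.2 - p.2)‖ₑ ^ 2)) ((τ.prod volume).prod volume) := by
    have h3 := (hv.comp_quasiMeasurePreserving hmp).enorm.pow_const 2
    have h4 : Measurable fun p : (T × Rd d) × Rd d => ‖κ p.2‖ₑ := hκ.comp measurable_snd
    have h5 : Measurable fun p : (T × Rd d) × Rd d => W p.1.2 := hW.comp (by fun_prop)
    exact h5.aemeasurable.mul (h4.aemeasurable.mul h3)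
  have hsl : ∀ᵐ z : T × Rd d ∂(τ.prod volume),
      AEStronglyMeasurable (fun y => v (z.1, y)) (volume : Measure (Rd d)) := by
    have := hv.prodMk_left
    exact Measure.quasiMeasurePreserving_fst.ae this
  calc _ ≤ ∫⁻ z, W z.2 * (mom κ 0 * ∫⁻ y, ‖κ y‖ₑ * ‖v (z.1, z.2 - y)‖ₑ ^ 2) ∂(τ.prod volume) := by
        apply lintegral_mono_ae
        filter_upwards [hsl] with z hz
        gcongr
        exact enorm_cv_sq_le hκ.aemeasurable hz z.2
    _ = ∫⁻ z, mom κ 0 * (∫⁻ y, W z.2 * (‖κ y‖ₑ * ‖v (z.1, z.2 - y)‖ₑ ^ 2)) ∂(τ.prod volume) := by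
        apply lintegral_congr_ae
        filter_upwards [hsl] with z hz
        rw [lintegral_const_mul'']
        · ring
        · exact hκ.aemeasurable.mul
            ((hz.comp_measurePreserving (Measure.measurePreserving_sub_left volume z.2)).enorm.pow_const 2)
    _ = mom κ 0 * ∫⁻ z, (∫⁻ y, W z.2 * (‖κ y‖ₑ * ‖v (z.1, z.2 - y)‖ₑ ^ 2)) ∂(τ.prod volume) := by
        rw [lintegral_const_mul'']
        exact hv2.lintegral_prod_right'
    _ = mom κ 0 * ∫⁻ y, ∫⁻ z, (W z.2 * (‖κ y‖ₑ * ‖v (z.1, z.2 - y)‖ₑ ^ 2)) ∂(τ.prod volume) := by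
        rw [lintegral_lintegral_swap hv2]
    _ ≤ mom κ 0 * ∫⁻ y, ‖κ y‖ₑ * (1 + ‖y‖ₑ) ^ N * K := by
        gcongr with y
        calc _ = ∫⁻ z, ‖κ y‖ₑ * (W z.2 * ‖v (z.1, z.2 - y)‖ₑ ^ 2) ∂(τ.prod volume) := by
              congr 1; ext z; ring
          _ = ‖κ y‖ₑ * ∫⁻ z, (W z.2 * ‖v (z.1, z.2 - y)‖ₑ ^ 2) ∂(τ.prod volume) := by
              rw [lintegral_const_mul' _ _ enorm_ne_top]
          _ ≤ ‖κ y‖ₑ * (K * (1 + ‖y‖ₑ) ^ N) := by gcongr; exact hK y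
          _ = _ := by ring
    _ = _ := by
        rw [lintegral_mul_const'']
        · rw [← mom, mul_assoc]
        · exact (hκ.mul (by fun_prop)).aemeasurable

end Schur

section XNorm

variable {V : Type*} [NormedAddCommGroup V]

/-- Lebesgue measure on the time interval. -/
abbrev tm : Measure ℝ := (volume : Measure ℝ).restrict (Icc 0 1)

theorem measurableSet_cube (l : ℕ) (k : Fin d → ℤ) : MeasurableSet (cube l k) := by
  have : cube l k = ⋂ i, {x : Rd d | (2 : ℝ) ^ l * (k i : ℝ) ≤ x i ∧ x i < (2 : ℝ) ^ l * ((k i : ℝ) + 1)} := by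
    ext x; simp [cube]
  rw [this]
  refine MeasurableSet.iInter fun i => ?_
  have hm : Measurable fun x : Rd d => x i := (by fun_prop : Continuous fun x : Rd d => x i).measurable
  exact (measurableSet_le measurable_const hm).inter (measurableSet_lt hm measurable_const)

/-- The square of the norm of `X`, as a supremum of integrals. -/
def Xsq (v : ℝ × Rd d → V) : ℝ≥0∞ :=
  ⨆ (l : ℕ) (k : Fin d → ℤ),
    (2 ^ l)⁻¹ * ∫⁻ z, (cube l k).indicator 1 z.2 * ‖v z‖ₑ ^ 2 ∂(slab d)

theorem restrict_cube_lintegral (l : ℕ) (k : Fin d → ℤ) (F : ℝ × Rd d → ℝ≥0∞) :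
    ∫⁻ z, (cube l k).indicator 1 z.2 * F z ∂(slab d)
      = ∫⁻ z in univ ×ˢ cube l k, F z ∂(slab d) := by
  rw [← lintegral_indicator (MeasurableSet.univ.prod (measurableSet_cube l k))]
  congr 1
  ext z
  by_cases hz : z.2 ∈ cube l k <;> simp [indicator, hz]

theorem normX_sq (v : ℝ × Rd d → V) : normX v ^ 2 = Xsq v := by
  have hp : ∀ l : ℕ, ((2 : ℝ≥0∞) ^ (-(l : ℝ) / 2)) ^ 2 = (2 ^ l)⁻¹ := by
    intro l
    rw [← ENNReal.rpow_mul_natCast, ← ENNReal.rpow_natCast, ← ENNReal.rpow_neg]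
    congr 1
    push_cast
    ring
  have hs : ∀ {ι : Sort _} (f : ι → ℝ≥0∞), (⨆ i, f i) ^ 2 = ⨆ i, f i ^ 2 := by
    intro ι f
    have := (ENNReal.orderIsoRpow 2 (by norm_num)).map_iSup f
    simpa only [ENNReal.orderIsoRpow_apply, ENNReal.rpow_ofNat] using this
  unfold normX Xsq
  rw [hs]
  congr 1
  ext l
  rw [hs]
  congr 1
  ext k
  rw [mul_pow, hp, eLpNorm_two_sq, restrict_cube_lintegral]

theorem le_Xsq (v : ℝ × Rd d → V) (l : ℕ) (k : Fin d → ℤ) :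
    ∫⁻ z, (cube l k).indicator 1 z.2 * ‖v z‖ₑ ^ 2 ∂(slab d) ≤ 2 ^ l * Xsq v := by
  have h : (2 ^ l)⁻¹ * ∫⁻ z, (cube l k).indicator 1 z.2 * ‖v z‖ₑ ^ 2 ∂(slab d) ≤ Xsq v :=
    le_iSup₂ (f := fun (l : ℕ) (k : Fin d → ℤ) =>
      (2 ^ l)⁻¹ * ∫⁻ z, (cube l k).indicator 1 z.2 * ‖v z‖ₑ ^ 2 ∂(slab d)) l k
  calc _ = 2 ^ l * ((2 ^ l)⁻¹ * ∫⁻ z, (cube l k).indicator 1 z.2 * ‖v z‖ₑ ^ 2 ∂(slab d)) := by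
        rw [← mul_assoc, ENNReal.mul_inv_cancel (by positivity) (by simp), one_mul]
    _ ≤ _ := by gcongr

theorem Xsq_le {v : ℝ × Rd d → V}
    (h : ∀ l k, ∫⁻ z, (cube l k).indicator 1 z.2 * ‖v z‖ₑ ^ 2 ∂(slab d) ≤ 2 ^ l * B) :
    Xsq v ≤ B := by
  refine iSup₂_le fun l k => ?_
  calc _ ≤ (2 ^ l)⁻¹ * (2 ^ l * B) := by gcongr; exact h l k
    _ = B := by rw [← mul_assoc, ENNReal.inv_mul_cancel (by positivity) (by simp), one_mul]

theorem Xsq_mono {V' : Type*} [NormedAddCommGroup V'] {v : ℝ × Rd d → V} {w : ℝ × Rd d → V'}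
    (h : ∀ᵐ z ∂(slab d), ‖v z‖ₑ ≤ ‖w z‖ₑ) : Xsq v ≤ Xsq w := by
  refine Xsq_le fun l k => (lintegral_mono_ae ?_).trans (le_Xsq w l k)
  filter_upwards [h] with z hz
  gcongr

theorem cube_index_exists (l : ℕ) (x : Rd d) : ∃ k : Fin d → ℤ, x ∈ cube l k := by
  refine ⟨fun i => ⌊(2 ^ l : ℝ)⁻¹ * x i⌋, fun i => ?_⟩
  have h1 := Int.floor_le ((2 ^ l : ℝ)⁻¹ * x i)
  have h2 := Int.lt_floor_add_one ((2 ^ l : ℝ)⁻¹ * x i)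
  rw [le_inv_mul_iff₀ (by positivity)] at h1
  rw [inv_mul_lt_iff₀ (by positivity)] at h2
  exact ⟨h1, h2⟩

/-- A translate of a cube is covered by `2^d` cubes of the same size. -/
theorem indicator_translate_le (l : ℕ) (k : Fin d → ℤ) (y : Rd d) :
    ∃ k' : Fin d → ℤ, ∀ x : Rd d, (cube l k).indicator (1 : Rd d → ℝ≥0∞) (x + y)
      ≤ ∑ e : Fin d → Fin 2, (cube l (fun i => k' i + (e i : ℕ))).indicator 1 x := by
  let q : Fin d → ℤ := fun i => ⌊-((2 ^ l : ℝ)⁻¹ * y i)⌋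
  refine ⟨fun i => k i + q i, fun x => ?_⟩
  by_cases hx : x + y ∈ cube l k
  · rw [indicator_of_mem hx]
    obtain ⟨c, hc⟩ := cube_index_exists l x
    have key : ∀ i, c i = k i + q i ∨ c i = k i + q i + 1 := by
      intro i
      have h1 := hx i
      have h2 := hc i
      have h3 := Int.floor_le (-((2 ^ l : ℝ)⁻¹ * y i))
      have h4 := Int.lt_floor_add_one (-((2 ^ l : ℝ)⁻¹ * y i))
      have hy : y i = 2 ^ l * ((2 ^ l : ℝ)⁻¹ * y i) := by field_simp
      set s := (2 ^ l : ℝ)⁻¹ * y i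
      have hp : (0 : ℝ) < 2 ^ l := by positivity
      simp only [PiLp.add_apply] at h1
      rw [hy] at h1
      have a1 : (k i : ℝ) - s - 1 < c i := by
        have : (2 : ℝ) ^ l * (k i - s) < 2 ^ l * (c i + 1) := by nlinarith
        have := lt_of_mul_lt_mul_left this hp.le
        linarith
      have a2 : (c i : ℝ) < k i + 1 - s := by
        have : (2 : ℝ) ^ l * (c i) < 2 ^ l * (k i + 1 - s) := by nlinarith
        exact lt_of_mul_lt_mul_left this hp.le
      have b1 : ((k i + q i - 1 : ℤ) : ℝ) < (c i : ℤ) := by push_cast; simp only [q]; linarith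
      have b2 : ((c i : ℤ) : ℝ) < ((k i + q i + 2 : ℤ) : ℝ) := by push_cast; simp only [q]; linarith
      have b1' := Int.cast_lt.1 b1
      have b2' := Int.cast_lt.1 b2
      omega
    let e : Fin d → Fin 2 := fun i => if c i = k i + q i then 0 else 1
    have he : (fun i => k i + q i + ((e i : ℕ) : ℤ)) = c := by
      ext i
      simp only [e]
      rcases key i with h | h
      · simp [h]
      · have : c i ≠ k i + q i := by omega
        simp [this]; omega
    calc (1 : Rd d → ℝ≥0∞) (x + y) = (cube l (fun i => k i + q i + ((e i : ℕ) : ℤ))).indicator (1 : Rd d → ℝ≥0∞) x := by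
          rw [he, indicator_of_mem hc]; rfl
      _ ≤ _ := Finset.single_le_sum (f := fun e : Fin d → Fin 2 =>
          (cube l (fun i => k i + q i + ((e i : ℕ) : ℤ))).indicator (1 : Rd d → ℝ≥0∞) x)
          (fun _ _ => zero_le) (Finset.mem_univ e)
  · rw [indicator_of_notMem hx]
    exact zero_le

theorem slab_translate (y : Rd d) :
    MeasurePreserving (fun z : ℝ × Rd d => (z.1, z.2 + y)) (slab d) (slab d) :=
  (MeasurePreserving.id tm).prod (measurePreserving_add_right volume y)

theorem lintegral_slab_translate (y : Rd d) (F : ℝ × Rd d → ℝ≥0∞) :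
    ∫⁻ z, F (z.1, z.2 - y) ∂(slab d) = ∫⁻ z, F z ∂(slab d) := by
  have hme : MeasurableEmbedding fun z : ℝ × Rd d => (z.1, z.2 + -y) :=
    (MeasurableEquiv.prodCongr (MeasurableEquiv.refl ℝ) (MeasurableEquiv.addRight (-y))).measurableEmbedding
  have := (slab_translate (-y)).lintegral_comp_emb hme F
  simpa [sub_eq_add_neg] using this

theorem aemeasurable_cube_mul {v : ℝ × Rd d → V} (hv : AEStronglyMeasurable v (slab d)) (l : ℕ)
    (k : Fin d → ℤ) :
    AEMeasurable (fun z => (cube l k).indicator 1 z.2 * ‖v z‖ₑ ^ 2) (slab d) := by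
  refine AEMeasurable.mul ?_ (hv.enorm.pow_const 2)
  exact ((measurable_one.indicator (measurableSet_cube l k)).comp measurable_snd).aemeasurable

theorem Xsq_translate {v : ℝ × Rd d → V} (hv : AEStronglyMeasurable v (slab d)) (y : Rd d) :
    Xsq (fun z => v (z.1, z.2 - y)) ≤ 2 ^ d * Xsq v := by
  refine Xsq_le fun l k => ?_
  obtain ⟨k', hk'⟩ := indicator_translate_le l k y
  have e := lintegral_slab_translate y
    (fun z => (cube l k).indicator 1 (z.2 + y) * ‖v z‖ₑ ^ 2)
  simp only [sub_add_cancel] at e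
  rw [e]
  calc _ ≤ ∫⁻ z, ∑ e : Fin d → Fin 2, (cube l (fun i => k' i + (e i : ℕ))).indicator 1 z.2 *
        ‖v z‖ₑ ^ 2 ∂(slab d) := by
        gcongr with z
        rw [← Finset.sum_mul]
        gcongr
        exact hk' z.2
    _ = ∑ e : Fin d → Fin 2, ∫⁻ z, (cube l (fun i => k' i + (e i : ℕ))).indicator 1 z.2 *
        ‖v z‖ₑ ^ 2 ∂(slab d) :=
        lintegral_finsetSum' _ fun e _ => aemeasurable_cube_mul hv _ _
    _ ≤ ∑ e : Fin d → Fin 2, 2 ^ l * Xsq v := Finset.sum_le_sum fun e _ => le_Xsq v _ _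
    _ = _ := by
        simp
        ring

/-- A positive weight that varies slowly at the unit scale. -/
structure SlowWeight (K : ℝ) (N : ℕ) (θ : Rd d → ℝ) : Prop where
  pos : ∀ x, 0 < θ x
  cont : Continuous θ
  slow : ∀ x y, θ x ≤ K * (1 + ‖y‖) ^ N * θ (x - y)

theorem SlowWeight.enorm_le {K : ℝ} {N : ℕ} {θ : Rd d → ℝ} (h : SlowWeight K N θ) (x y : Rd d) :
    ‖θ x‖ₑ ≤ ENNReal.ofReal K * (1 + ‖y‖ₑ) ^ N * ‖θ (x - y)‖ₑ := by
  have hK : 0 ≤ K := by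
    have := h.slow 0 0
    simp at this
    have h0 := h.pos 0
    nlinarith
  rw [one_add_enorm, ← ENNReal.ofReal_mul hK, ← ofReal_norm, ← ofReal_norm, ← ENNReal.ofReal_mul
    (by positivity), Real.norm_of_nonneg (h.pos x).le, Real.norm_of_nonneg (h.pos _).le]
  exact ENNReal.ofReal_le_ofReal (h.slow x y)

end XNorm

section Conv

variable {V : Type*} [NormedAddCommGroup V] [NormedSpace ℂ V] [NormedSpace ℝ V]

theorem Xsq_weighted_cv_le {κ : 𝓢(Rd d, ℂ)} {v : ℝ × Rd d → V}
    (hv : AEStronglyMeasurable v (slab d)) {K : ℝ} {N : ℕ} {θ : Rd d → ℝ} (hθ : SlowWeight K N θ) :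
    Xsq (fun z => θ z.2 • cv κ (fun y => v (z.1, y)) z.2)
      ≤ mom κ 0 * mom κ (2 * N) * (ENNReal.ofReal K ^ 2 * 2 ^ d) * Xsq (fun z => θ z.2 • v z) := by
  have hθv : AEStronglyMeasurable (fun z => θ z.2 • v z) (slab d) :=
    (hθ.cont.comp continuous_snd).aestronglyMeasurable.smul hv
  refine Xsq_le fun l k => ?_
  have h := lintegral_cv_sq_le (τ := tm) (κ := κ) (κ.continuous.enorm.measurable) hv
    (W := fun x => (cube l k).indicator 1 x * ‖θ x‖ₑ ^ 2)
    ((measurable_one.indicator (measurableSet_cube l k)).mul (hθ.cont.enorm.measurable.pow_const 2))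
    (N := 2 * N) (K := ENNReal.ofReal K ^ 2 * (2 ^ l * (2 ^ d * Xsq (fun z => θ z.2 • v z)))) ?_
  · calc _ = ∫⁻ z, (cube l k).indicator 1 z.2 * ‖θ z.2‖ₑ ^ 2 * ‖cv κ (fun y => v (z.1, y)) z.2‖ₑ ^ 2
          ∂(slab d) := by simp_rw [enorm_smul, mul_pow, mul_assoc]
      _ ≤ _ := h
      _ = _ := by ring
  · intro y
    calc _ ≤ ∫⁻ z, (ENNReal.ofReal K ^ 2 * (1 + ‖y‖ₑ) ^ (2 * N)) * ((cube l k).indicator 1 z.2 *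
          ‖θ (z.2 - y) • v (z.1, z.2 - y)‖ₑ ^ 2) ∂(slab d) := by
          apply lintegral_mono
          intro z
          simp only
          rw [enorm_smul]
          calc _ ≤ (cube l k).indicator 1 z.2 * (ENNReal.ofReal K * (1 + ‖y‖ₑ) ^ N *
                ‖θ (z.2 - y)‖ₑ) ^ 2 * ‖v (z.1, z.2 - y)‖ₑ ^ 2 := by
                gcongr
                exact hθ.enorm_le _ _
            _ = _ := by ring
      _ = (ENNReal.ofReal K ^ 2 * (1 + ‖y‖ₑ) ^ (2 * N)) * ∫⁻ z, ((cube l k).indicator 1 z.2 *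
          ‖θ (z.2 - y) • v (z.1, z.2 - y)‖ₑ ^ 2) ∂(slab d) := by
          rw [lintegral_const_mul' _ _ (by finiteness)]
      _ ≤ (ENNReal.ofReal K ^ 2 * (1 + ‖y‖ₑ) ^ (2 * N)) *
          (2 ^ l * (2 ^ d * Xsq (fun z => θ z.2 • v z))) := by
          gcongr
          exact (le_Xsq (fun z => θ (z.2 - y) • v (z.1, z.2 - y)) l k).trans
            (by gcongr; exact Xsq_translate hθv y)
      _ = _ := by ring

omit [NormedSpace ℝ V] in
theorem lintegral_weighted_cv_le {κ : 𝓢(Rd d, ℂ)} {v : Rd d → V}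
    (hv : AEStronglyMeasurable v volume) {K : ℝ} {N : ℕ} {ρ : Rd d → ℝ} (hρ : SlowWeight K N ρ) :
    ∫⁻ x, ‖ρ x‖ₑ * ‖cv κ v x‖ₑ ^ 2
      ≤ mom κ 0 * mom κ N * ENNReal.ofReal K * ∫⁻ x, ‖ρ x‖ₑ * ‖v x‖ₑ ^ 2 := by
  have h := lintegral_cv_sq_le (τ := Measure.dirac ()) (κ := κ) (κ.continuous.enorm.measurable)
    (v := fun z => v z.2) hv.comp_snd (W := fun x => ‖ρ x‖ₑ) hρ.cont.enorm.measurable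
    (N := N) (K := ENNReal.ofReal K * ∫⁻ x, ‖ρ x‖ₑ * ‖v x‖ₑ ^ 2) ?_
  · have hm : Measurable fun z : Unit × Rd d => z.2 := measurable_snd
    rw [Measure.dirac_prod, (measurableEmbedding_prodMk_left ()).lintegral_map] at h
    exact h.trans (le_of_eq (by ring))
  · intro y
    rw [Measure.dirac_prod, (measurableEmbedding_prodMk_left ()).lintegral_map]
    simp only
    calc _ ≤ ∫⁻ x, ENNReal.ofReal K * (1 + ‖y‖ₑ) ^ N * (‖ρ (x - y)‖ₑ * ‖v (x - y)‖ₑ ^ 2) := by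
          apply lintegral_mono
          intro x
          simp only
          rw [← mul_assoc]
          gcongr
          exact hρ.enorm_le _ _
      _ = _ := by
          rw [lintegral_const_mul' _ _ (by finiteness),
            lintegral_sub_right_eq_self (fun x => ‖ρ x‖ₑ * ‖v x‖ₑ ^ 2) y]
          ring

end Conv

theorem enorm_sub_le_lintegral_fderiv {v : Rd d → ℂ} (hv : ContDiff ℝ 1 v) (x y : Rd d) :
    ‖v x - v (x - y)‖ₑ ≤ ‖y‖ₑ * ∫⁻ s in 𝕀, ‖fderiv ℝ v (x - s • y)‖ₑ := by
  have hcd : Continuous fun s : ℝ => fderiv ℝ v (x - s • y) :=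
    (hv.continuous_fderiv (by norm_num)).comp (by fun_prop)
  have h1 : ∀ s : ℝ, HasDerivAt (fun s : ℝ => v (x - s • y)) (-(fderiv ℝ v (x - s • y) y)) s := by
    intro s
    have h2 : HasDerivAt (fun s : ℝ => x - s • y) (-y) s := by
      simpa using ((hasDerivAt_id s).smul_const y).const_sub x
    have h3 := ((hv.differentiable (by norm_num)) (x - s • y)).hasFDerivAt.comp_hasDerivAt s h2
    rw [map_neg] at h3
    exact h3
  have h4 := intervalIntegral.integral_eq_sub_of_hasDerivAt (a := 0) (b := 1) (fun s _ => h1 s)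
    ((hcd.clm_apply continuous_const).neg.intervalIntegrable 0 1)
  simp only [one_smul, zero_smul, sub_zero] at h4
  rw [← neg_sub (v (x - y)), ← h4, enorm_neg, intervalIntegral.integral_of_le zero_le_one,
    ← integral_Icc_eq_integral_Ioc]
  refine (enorm_integral_le_lintegral_enorm _).trans ?_
  rw [← lintegral_const_mul' _ _ enorm_ne_top]
  apply lintegral_mono
  intro s
  simp only [enorm_neg]
  rw [mul_comm]
  exact (fderiv ℝ v (x - s • y)).le_opENorm y

/-- A function without low frequencies is controlled by its gradient. -/
theorem lintegral_weighted_le_fderiv (φ : LPBump d) (r : ℕ) {v : Rd d → ℂ} (hv : ContDiff ℝ 1 v)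
    (hc : ConvDefined v) (h0 : cv (φ.Phi r) v = 0) {K : ℝ} {N : ℕ} {ρ : Rd d → ℝ}
    (hρ : SlowWeight K N ρ) :
    ∫⁻ x, ‖ρ x‖ₑ * ‖v x‖ₑ ^ 2 ≤ ((2 ^ r)⁻¹ * mom (φ.Phi 0) (N + 1)) ^ 2 * ENNReal.ofReal K *
      ∫⁻ x, ‖ρ x‖ₑ * ‖fderiv ℝ v x‖ₑ ^ 2 := by
  set G : Rd d → ℝ≥0∞ := fun x => ‖fderiv ℝ v x‖ₑ with hG
  have hGc : Continuous G := (hv.continuous_fderiv (by norm_num)).enorm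
  obtain ⟨m, hm⟩ : ∃ m : ℝ≥0∞, m = (2 ^ r)⁻¹ * mom (φ.Phi 0) (N + 1) := ⟨_, rfl⟩
  rw [← hm]
  let P : Measure (Rd d × ℝ) := (volume : Measure (Rd d)).prod tm
  let A : Rd d × ℝ → ℝ≥0∞ := fun p => ‖φ.Phi r p.1‖ₑ * ‖p.1‖ₑ
  have hA : Measurable A :=
    (((φ.Phi r).continuous.enorm.measurable).comp measurable_fst).mul
      (measurable_enorm.comp measurable_fst)
  have hAint : ∫⁻ p, A p ∂P ≤ m := by
    rw [lintegral_prod _ hA.aemeasurable]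
    simp only [A, lintegral_const]
    calc _ = ∫⁻ y, ‖φ.Phi r y‖ₑ * ‖y‖ₑ := by simp [tm]
      _ ≤ ∫⁻ y, ‖φ.Phi r y‖ₑ * ‖y‖ₑ * (1 + ‖y‖ₑ) ^ N := by
          apply lintegral_mono
          intro y
          simp only
          conv_lhs => rw [← mul_one (_ * _)]
          gcongr
          exact one_le_pow₀ le_self_add
      _ ≤ m := hm ▸ φ.mom_Phi_mul r N
  have hpt : ∀ x, ‖v x‖ₑ ≤ ∫⁻ p, A p * G (x - p.2 • p.1) ∂P := by
    intro x
    have hi := (φ.Phi r).integrable (μ := volume)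
    have e1 : v x = ∫ y, φ.Phi r y • (v x - v (x - y)) := by
      simp_rw [smul_sub]
      rw [integral_sub (hi.smul_const (v x)), integral_smul_const, φ.integral_Phi,
        ← cv_eq_integral_sub, h0]
      · simp
      · have := (hc.integrable (φ.Phi r) x).comp_sub_left x
        simpa using this
    have hmG : Measurable fun p : Rd d × ℝ => G (x - p.2 • p.1) :=
      (hGc.comp (by fun_prop)).measurable
    have hAG : Measurable fun p : Rd d × ℝ => A p * G (x - p.2 • p.1) := hA.mul hmG
    rw [lintegral_prod _ hAG.aemeasurable]
    conv_lhs => rw [e1]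
    refine (enorm_integral_le_lintegral_enorm _).trans (lintegral_mono fun y => ?_)
    simp only [A]
    rw [lintegral_const_mul' _ _ (by finiteness), enorm_smul, mul_assoc]
    gcongr
    exact enorm_sub_le_lintegral_fderiv hv x y
  have hmG2 : Measurable fun q : Rd d × (Rd d × ℝ) => ‖ρ q.1‖ₑ * (A q.2 * G (q.1 - q.2.2 • q.2.1) ^ 2) := by
    have h1 : Measurable fun q : Rd d × (Rd d × ℝ) => G (q.1 - q.2.2 • q.2.1) :=
      (hGc.comp (by fun_prop)).measurable
    have h2 : Measurable fun q : Rd d × (Rd d × ℝ) => ‖ρ q.1‖ₑ :=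
      (hρ.cont.comp continuous_fst).enorm.measurable
    exact h2.mul ((hA.comp measurable_snd).mul (h1.pow_const 2))
  calc _ ≤ ∫⁻ x, ‖ρ x‖ₑ * (m * ∫⁻ p, A p * G (x - p.2 • p.1) ^ 2 ∂P) := by
        apply lintegral_mono
        intro x
        simp only
        gcongr
        calc _ ≤ (∫⁻ p, A p * G (x - p.2 • p.1) ∂P) ^ 2 := by gcongr; exact hpt x
          _ ≤ _ := lintegral_mul_sq_le_weighted hA.aemeasurable
              (hGc.comp (by fun_prop)).measurable.aemeasurable
          _ ≤ _ := by gcongr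
    _ = m * ∫⁻ x, ∫⁻ p, ‖ρ x‖ₑ * (A p * G (x - p.2 • p.1) ^ 2) ∂P := by
        rw [← lintegral_const_mul m hmG2.lintegral_prod_right']
        congr 1
        ext x
        simp only
        rw [lintegral_const_mul' _ _ enorm_ne_top]
        ring
    _ = m * ∫⁻ p, (∫⁻ x : Rd d, ‖ρ x‖ₑ * (A p * G (x - p.2 • p.1) ^ 2)) ∂P := by
        rw [lintegral_lintegral_swap hmG2.aemeasurable]
    _ ≤ m * ∫⁻ p, A p * (1 + ‖p.1‖ₑ) ^ N * (ENNReal.ofReal K * ∫⁻ x, ‖ρ x‖ₑ * G x ^ 2) ∂P := by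
        refine mul_le_mul' le_rfl ?_
        have hs : ∀ᵐ p ∂P, p.2 ∈ 𝕀 :=
          Measure.quasiMeasurePreserving_snd.ae (ae_restrict_mem measurableSet_Icc)
        apply lintegral_mono_ae
        filter_upwards [hs] with p hp
        calc _ = A p * ∫⁻ x, ‖ρ x‖ₑ * G (x - p.2 • p.1) ^ 2 := by
              rw [← lintegral_const_mul' _ _ (by simp only [A]; finiteness)]
              congr 1; ext x; ring
          _ ≤ A p * ∫⁻ x, ENNReal.ofReal K * (1 + ‖p.1‖ₑ) ^ N *
                (‖ρ (x - p.2 • p.1)‖ₑ * G (x - p.2 • p.1) ^ 2) := by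
              gcongr A p * ?_
              apply lintegral_mono
              intro x
              simp only
              rw [← mul_assoc]
              gcongr
              refine (hρ.enorm_le x (p.2 • p.1)).trans ?_
              gcongr
              rw [enorm_smul]
              calc _ ≤ 1 * ‖p.1‖ₑ := by
                    gcongr
                    rw [← ofReal_norm, ENNReal.ofReal_le_one, Real.norm_of_nonneg hp.1]
                    exact hp.2
                _ = _ := one_mul _
          _ = _ := by
              rw [lintegral_const_mul' _ _ (by finiteness),
                lintegral_sub_right_eq_self (fun x => ‖ρ x‖ₑ * G x ^ 2)]
              ring
    _ ≤ m * (m * (ENNReal.ofReal K * ∫⁻ x, ‖ρ x‖ₑ * G x ^ 2)) := by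
        refine mul_le_mul' le_rfl ?_
        have hA2 : Measurable fun p : Rd d × ℝ => A p * (1 + ‖p.1‖ₑ) ^ N :=
          hA.mul ((measurable_const.add (measurable_enorm.comp measurable_fst)).pow_const N)
        rw [lintegral_mul_const _ hA2]
        gcongr
        rw [lintegral_prod _ hA2.aemeasurable]
        simp only [A, lintegral_const]
        refine le_trans (le_of_eq ?_) ((φ.mom_Phi_mul r N).trans hm.ge)
        simp [tm]
    _ = _ := by ring

section Duality

variable {V V' : Type*} [NormedAddCommGroup V] [NormedSpace ℂ V] [NormedAddCommGroup V']

omit [NormedSpace ℂ V] in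
theorem lintegral_atom_le {a : ℝ × Rd d → V} (ha : IsAtomY a) {Φ : ℝ × Rd d → V'}
    (hΦ : AEStronglyMeasurable Φ (slab d)) :
    ∫⁻ z, ‖a z‖ₑ * ‖Φ z‖ₑ ∂(slab d) ≤ normX Φ := by
  obtain ⟨hm, l, k, hs, hn⟩ := ha
  have e1 : ∫⁻ z, ‖a z‖ₑ * ‖Φ z‖ₑ ∂(slab d) = ∫⁻ z in univ ×ˢ cube l k, ‖a z‖ₑ * ‖Φ z‖ₑ ∂(slab d) := by
    rw [← restrict_cube_lintegral]
    apply lintegral_congr_ae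
    filter_upwards [hs] with z hz
    by_cases h : z.2 ∈ cube l k
    · simp [h]
    · simp [h, hz h]
  have h2 := ENNReal.lintegral_mul_le_Lp_mul_Lq ((slab d).restrict (univ ×ˢ cube l k))
    Real.HolderConjugate.two_two hm.restrict.enorm hΦ.restrict.enorm
  simp only [ENNReal.rpow_two] at h2
  rw [← eLpNorm_two_eq, ← eLpNorm_two_eq] at h2
  rw [e1]
  calc _ ≤ _ := h2
    _ ≤ (2 : ℝ≥0∞) ^ (-(l : ℝ) / 2) * eLpNorm Φ 2 ((slab d).restrict (univ ×ˢ cube l k)) := by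
        gcongr
        exact (eLpNorm_mono_measure _ Measure.restrict_le_self).trans hn
    _ ≤ normX Φ := le_iSup₂ (f := fun (l : ℕ) (k : Fin d → ℤ) => (2 : ℝ≥0∞) ^ (-(l : ℝ) / 2) *
        eLpNorm Φ 2 ((slab d).restrict (univ ×ˢ cube l k))) l k

theorem lintegral_le_of_normY_lt {f : ℝ × Rd d → V} {Φ : ℝ × Rd d → V'}
    (hB : normY f < B) (hΦ : AEStronglyMeasurable Φ (slab d)) :
    ∫⁻ z, ‖f z‖ₑ * ‖Φ z‖ₑ ∂(slab d) ≤ B * normX Φ := by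
  unfold normY at hB
  simp only [iInf_lt_iff] at hB
  obtain ⟨c, a, ha, -, hsum, hlt⟩ := hB
  calc _ ≤ ∫⁻ z, ∑' k, ‖c k‖ₑ * (‖a k z‖ₑ * ‖Φ z‖ₑ) ∂(slab d) := by
        apply lintegral_mono_ae
        filter_upwards [hsum] with z hz
        rw [← hz.tsum_eq]
        simp_rw [← mul_assoc]
        rw [ENNReal.tsum_mul_right]
        gcongr
        refine (enorm_tsum_le_tsum_enorm).trans (le_of_eq ?_)
        simp_rw [enorm_smul]
    _ = ∑' k, ‖c k‖ₑ * ∫⁻ z, (‖a k z‖ₑ * ‖Φ z‖ₑ) ∂(slab d) := by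
        rw [lintegral_tsum]
        · congr 1
          ext k
          rw [lintegral_const_mul' _ _ enorm_ne_top]
        · intro k
          exact aemeasurable_const.mul ((ha k).1.enorm.mul hΦ.enorm)
    _ ≤ ∑' k, ‖c k‖ₑ * normX Φ := by
        gcongr with k
        exact lintegral_atom_le (ha k) hΦ
    _ ≤ B * normX Φ := by
        rw [ENNReal.tsum_mul_right]
        gcongr

theorem lintegral_slab {F : ℝ × Rd d → ℝ≥0∞} (hF : AEMeasurable F (slab d)) :
    ∫⁻ z, F z ∂(slab d) = ∫⁻ t in 𝕀, ∫⁻ x, F (t, x) :=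
  lintegral_prod _ hF

omit [NormedSpace ℂ V] in
theorem lintegral_le_L1L2 {f : ℝ × Rd d → V} {Φ : ℝ × Rd d → V'}
    (hf : AEStronglyMeasurable f (slab d)) (hΦ : AEStronglyMeasurable Φ (slab d)) :
    ∫⁻ z, ‖f z‖ₑ * ‖Φ z‖ₑ ∂(slab d) ≤ normL1L2 f * normLinftyL2 Φ := by
  have hf2 : ∀ᵐ t ∂tm, AEStronglyMeasurable (fun x => f (t, x)) (volume : Measure (Rd d)) :=
    AEStronglyMeasurable.prodMk_left hf
  have hΦ2 : ∀ᵐ t ∂tm, AEStronglyMeasurable (fun x => Φ (t, x)) (volume : Measure (Rd d)) :=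
    AEStronglyMeasurable.prodMk_left hΦ
  have hfΦ : AEMeasurable (fun z => ‖f z‖ₑ * ‖Φ z‖ₑ) (slab d) := hf.enorm.mul hΦ.enorm
  rw [lintegral_slab hfΦ]
  calc _ ≤ ∫⁻ t in 𝕀, eLpNorm (fun x => f (t, x)) 2 volume * normLinftyL2 Φ := by
        apply lintegral_mono_ae
        filter_upwards [hf2, hΦ2, ENNReal.ae_le_essSup fun t => eLpNorm (fun x => Φ (t, x)) 2 volume]
          with t h1 h2 h3
        have h4 := ENNReal.lintegral_mul_le_Lp_mul_Lq volume Real.HolderConjugate.two_two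
          h1.enorm h2.enorm
        simp only [ENNReal.rpow_two] at h4
        rw [← eLpNorm_two_eq, ← eLpNorm_two_eq] at h4
        refine h4.trans ?_
        gcongr
        exact h3
    _ ≤ _ := by
        rw [lintegral_mul_const'']
        · rfl
        · simp_rw [eLpNorm_two_eq]
          exact ((hf.enorm.pow_const 2).lintegral_prod_right').pow_const _

theorem lintegral_le_of_normYj_lt {j : ℕ} {f : ℝ × Rd d → V} {Φ : ℝ × Rd d → V'}
    (hB : normYj j f < B) (hΦ : AEStronglyMeasurable Φ (slab d)) :
    ∫⁻ z, ‖f z‖ₑ * ‖Φ z‖ₑ ∂(slab d) ≤ B * normXj j Φ := by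
  unfold normYj at hB
  simp only [iInf_lt_iff] at hB
  obtain ⟨f₁, f₂, hm, hf, hlt⟩ := hB
  have h1 : normY f₁ < B - normL1L2 f₂ := by
    exact lt_tsub_iff_right.2 hlt
  have hB2 : normL1L2 f₂ ≤ B := le_trans le_add_self hlt.le
  calc _ ≤ ∫⁻ z, (2 : ℝ≥0∞) ^ ((j : ℝ) / 2) * (‖f₁ z‖ₑ * ‖Φ z‖ₑ) + ‖f₂ z‖ₑ * ‖Φ z‖ₑ ∂(slab d) := by
        apply lintegral_mono_ae
        filter_upwards [hf] with z hz
        rw [hz, ← mul_assoc, ← add_mul]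
        gcongr
        refine (enorm_add_le _ _).trans ?_
        gcongr
        rw [enorm_smul]
        apply le_of_eq
        congr 1
        rw [← ofReal_norm, Complex.norm_real, Real.norm_of_nonneg (by positivity),
          ← ENNReal.ofReal_rpow_of_pos (by norm_num)]
        simp
    _ = (2 : ℝ≥0∞) ^ ((j : ℝ) / 2) * ∫⁻ z, (‖f₁ z‖ₑ * ‖Φ z‖ₑ) ∂(slab d) +
          ∫⁻ z, ‖f₂ z‖ₑ * ‖Φ z‖ₑ ∂(slab d) := by
        have hfΦ : AEMeasurable (fun z => ‖f₂ z‖ₑ * ‖Φ z‖ₑ) (slab d) := hm.enorm.mul hΦ.enorm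
        rw [lintegral_add_right' _ hfΦ, lintegral_const_mul' _ _ (by finiteness)]
    _ ≤ (2 : ℝ≥0∞) ^ ((j : ℝ) / 2) * ((B - normL1L2 f₂) * normX Φ) + normL1L2 f₂ * normLinftyL2 Φ := by
        gcongr
        · exact lintegral_le_of_normY_lt h1 hΦ
        · exact lintegral_le_L1L2 hm hΦ
    _ = (B - normL1L2 f₂) * ((2 : ℝ≥0∞) ^ ((j : ℝ) / 2) * normX Φ) + normL1L2 f₂ * normLinftyL2 Φ := by
        ring
    _ ≤ (B - normL1L2 f₂) * normXj j Φ + normL1L2 f₂ * normXj j Φ := by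
        unfold normXj
        gcongr
        · exact le_self_add
        · exact le_add_self
    _ = B * normXj j Φ := by
        rw [← add_mul, tsub_add_cancel_of_le hB2]

/-- The duality between `Y_j` and `X_j`. -/
theorem lintegral_le_normYj_mul_normXj {j : ℕ} {f : ℝ × Rd d → V} {Φ : ℝ × Rd d → V'}
    (hf : normYj j f ≠ ⊤) (hΦ : AEStronglyMeasurable Φ (slab d)) (hX : normXj j Φ ≠ ⊤) :
    ∫⁻ z, ‖f z‖ₑ * ‖Φ z‖ₑ ∂(slab d) ≤ normYj j f * normXj j Φ := by
  by_cases h0 : normXj j Φ = 0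
  · have := lintegral_le_of_normYj_lt (B := normYj j f + 1)
      (ENNReal.lt_add_right hf one_ne_zero) hΦ
    rw [h0, mul_zero] at this ⊢
    exact this
  · rw [← ENNReal.div_le_iff h0 hX]
    apply le_of_forall_gt_imp_ge_of_dense
    intro B hB
    rw [ENNReal.div_le_iff h0 hX]
    exact lintegral_le_of_normYj_lt hB hΦ

end Duality

section Lattice

/-- A summable weight on the lattice, extended to `ℝ^d`. -/
def bw (z : Rd d) : ℝ≥0∞ := ((1 + ‖z‖ₑ) ^ (d + 1))⁻¹

theorem bw_le_one (z : Rd d) : bw z ≤ 1 := by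
  rw [bw, ENNReal.inv_le_one]
  exact one_le_pow₀ le_self_add

theorem bw_le (z z' : Rd d) : bw z ≤ (1 + ‖z - z'‖ₑ) ^ (d + 1) * bw z' := by
  unfold bw
  rw [← div_eq_mul_inv, ENNReal.le_div_iff_mul_le (by simp) (by simp), mul_comm, ← div_eq_mul_inv]
  apply ENNReal.div_le_of_le_mul
  rw [← mul_pow]
  gcongr
  have h : ‖z'‖ₑ ≤ ‖z‖ₑ + ‖z - z'‖ₑ := by
    have := enorm_sub_le (a := z) (b := z - z')
    simpa using this
  calc 1 + ‖z'‖ₑ ≤ 1 + (‖z‖ₑ + ‖z - z'‖ₑ) := by gcongr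
    _ ≤ 1 + (‖z‖ₑ + ‖z - z'‖ₑ) + ‖z - z'‖ₑ * ‖z‖ₑ := le_self_add
    _ = _ := by ring

theorem bw_neg (z : Rd d) : bw (-z) = bw z := by simp [bw]

theorem bw_measurable : Measurable (bw : Rd d → ℝ≥0∞) :=
  ((measurable_const.add measurable_enorm).pow_const _).inv

theorem lintegral_bw_lt_top : ∫⁻ z : Rd d, bw z < ⊤ := by
  have h := (integrable_inv_one_add_norm_pow (d := d) (n := d + 1) (by omega)).2
  refine lt_of_le_of_lt (lintegral_mono fun y => ?_) h
  rw [bw, one_add_enorm, ← ofReal_norm, Real.norm_of_nonneg (by positivity),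
    ENNReal.ofReal_inv_of_pos (by positivity)]

theorem CubePartition.exists_radius (χ : CubePartition d) :
    ∃ R : ℝ≥0, ∀ x, χ.profile x ≠ 0 → ‖x‖ₑ ≤ R := by
  obtain ⟨R, hR⟩ := χ.compact.isCompact.isBounded.exists_norm_le
  refine ⟨R.toNNReal, fun x hx => ?_⟩
  have := hR x (subset_tsupport _ hx)
  rw [← ofReal_norm]
  exact ENNReal.ofReal_le_ofReal this

theorem CubePartition.tsum_ofReal (χ : CubePartition d) (x : Rd d) :
    ∑' c : Fin d → ℤ, ENNReal.ofReal (χ.profile (x - latticePoint c)) = 1 := by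
  rw [← ENNReal.ofReal_tsum_of_nonneg (fun c => χ.nonneg _) (χ.hasSum_one x).summable,
    (χ.hasSum_one x).tsum_eq, ENNReal.ofReal_one]

theorem CubePartition.measurable_profile (χ : CubePartition d) :
    Measurable fun x => ENNReal.ofReal (χ.profile x) :=
  χ.smooth.continuous.measurable.ennreal_ofReal

theorem CubePartition.lintegral_profile_ne_zero (χ : CubePartition d) :
    ∫⁻ x, ENNReal.ofReal (χ.profile x) ≠ 0 := by
  intro h
  have h1 : ∫⁻ x : Rd d, ∑' c : Fin d → ℤ, ENNReal.ofReal (χ.profile (x - latticePoint c)) = 0 := by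
    rw [lintegral_tsum]
    · simp only [lintegral_sub_right_eq_self (fun x => ENNReal.ofReal (χ.profile x)), h, tsum_zero]
    · intro c
      exact (χ.measurable_profile.comp (measurable_sub_const _)).aemeasurable
  simp only [χ.tsum_ofReal, lintegral_one] at h1
  exact (Measure.measure_univ_ne_zero.2 (NeZero.ne (volume : Measure (Rd d)))) h1

theorem tsum_bw_lt_top (d : ℕ) : ∑' c : Fin d → ℤ, bw (latticePoint c) < ⊤ := by
  obtain ⟨χ⟩ := CubePartition.exists_partition d
  obtain ⟨R, hR⟩ := χ.exists_radius
  have h1 : (∑' c : Fin d → ℤ, bw (latticePoint c)) * ∫⁻ x, ENNReal.ofReal (χ.profile x)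
      ≤ (1 + R) ^ (d + 1) * ∫⁻ z : Rd d, bw z := by
    have e : ∫⁻ z : Rd d, bw z = ∫⁻ z : Rd d, ∑' c : Fin d → ℤ,
        ENNReal.ofReal (χ.profile (z - latticePoint c)) * bw z := by
      simp_rw [ENNReal.tsum_mul_right, χ.tsum_ofReal, one_mul]
    rw [e, lintegral_tsum, ← ENNReal.tsum_mul_right, ← ENNReal.tsum_mul_left]
    · apply ENNReal.tsum_le_tsum
      intro c
      rw [← lintegral_sub_right_eq_self _ (latticePoint c),
        ← lintegral_const_mul' _ _ (ne_top_of_le_ne_top ENNReal.one_ne_top (bw_le_one _)),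
        ← lintegral_const_mul' _ _ (by finiteness)]
      apply lintegral_mono
      intro x
      simp only
      by_cases hx : χ.profile (x - latticePoint c) = 0
      · simp [hx]
      · calc _ ≤ ((1 + ‖latticePoint c - x‖ₑ) ^ (d + 1) * bw x) *
              ENNReal.ofReal (χ.profile (x - latticePoint c)) := by
              gcongr
              exact bw_le _ _
          _ ≤ ((1 + R) ^ (d + 1) * bw x) * ENNReal.ofReal (χ.profile (x - latticePoint c)) := by
              gcongr
              rw [← enorm_neg, neg_sub]
              exact hR _ hx
          _ = _ := by ring
    · intro c
      exact ((χ.measurable_profile.comp (measurable_sub_const _)).mul bw_measurable).aemeasurable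
  have h2 : (∑' c : Fin d → ℤ, bw (latticePoint c)) * ∫⁻ x, ENNReal.ofReal (χ.profile x) < ⊤ :=
    h1.trans_lt (ENNReal.mul_lt_top (by finiteness) lintegral_bw_lt_top)
  by_contra hc
  rw [not_lt, top_le_iff] at hc
  rw [hc, ENNReal.top_mul χ.lintegral_profile_ne_zero] at h2
  exact lt_irrefl _ h2

theorem enorm_sub_latticePoint_le {l : ℕ} {k : Fin d → ℤ} {x : Rd d} (hx : x ∈ cube l k) :
    ‖((2 : ℝ) ^ l)⁻¹ • x - latticePoint k‖ₑ ≤ d := by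
  rw [← ofReal_norm, ← ENNReal.ofReal_natCast]
  apply ENNReal.ofReal_le_ofReal
  have h1 : ∀ i, |(((2 : ℝ) ^ l)⁻¹ • x - latticePoint k) i| ≤ 1 := by
    intro i
    have h := hx i
    simp only [PiLp.sub_apply, PiLp.smul_apply, latticePoint, smul_eq_mul]
    have hp : (0 : ℝ) < 2 ^ l := by positivity
    have a1 : (k i : ℝ) ≤ ((2 : ℝ) ^ l)⁻¹ * x i := by
      rw [le_inv_mul_iff₀ hp]; exact h.1
    have a2 : ((2 : ℝ) ^ l)⁻¹ * x i < k i + 1 := by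
      rw [inv_mul_lt_iff₀ hp]; exact h.2
    rw [abs_le]; constructor <;> linarith
  rw [EuclideanSpace.norm_eq]
  apply Real.sqrt_le_iff.2
  refine ⟨by positivity, ?_⟩
  calc ∑ i, ‖(((2 : ℝ) ^ l)⁻¹ • x - latticePoint k) i‖ ^ 2 ≤ ∑ i : Fin d, (1 : ℝ) := by
        apply Finset.sum_le_sum
        intro i _
        rw [Real.norm_eq_abs]
        have := h1 i
        have := abs_nonneg ((((2 : ℝ) ^ l)⁻¹ • x - latticePoint k) i)
        nlinarith
    _ = d := by simp
    _ ≤ (d : ℝ) ^ 2 := by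
        have : (d : ℝ) = 0 ∨ (1 : ℝ) ≤ d := by
          rcases Nat.eq_zero_or_pos d with h | h
          · left; simp [h]
          · right; exact_mod_cast h
        rcases this with h | h
        · simp [h]
        · nlinarith

/-- The sum of `bw` over the translates of the lattice, up to a constant. -/
def latticeConst (d : ℕ) : ℝ≥0∞ := (1 + d) ^ (d + 1) * ∑' c : Fin d → ℤ, bw (latticePoint c)

theorem latticeConst_lt_top (d : ℕ) : latticeConst d < ⊤ :=
  ENNReal.mul_lt_top (by finiteness) (tsum_bw_lt_top d)

theorem latticePoint_sub (a b : Fin d → ℤ) : latticePoint (a - b) = latticePoint a - latticePoint b := by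
  ext i; simp [latticePoint]

theorem tsum_bw_lattice_sub (a : Fin d → ℤ) :
    ∑' c : Fin d → ℤ, bw (latticePoint a - latticePoint c) = ∑' c : Fin d → ℤ, bw (latticePoint c) := by
  simp_rw [← latticePoint_sub]
  exact (Equiv.subLeft a).tsum_eq (fun c => bw (latticePoint c))

theorem bw_cube_le {l : ℕ} {k : Fin d → ℤ} {x : Rd d} (hx : x ∈ cube l k) (c : Fin d → ℤ) :
    bw (((2 : ℝ) ^ l)⁻¹ • x - latticePoint c)
      ≤ (1 + d) ^ (d + 1) * bw (latticePoint k - latticePoint c) := by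
  refine (bw_le _ (latticePoint k - latticePoint c)).trans ?_
  gcongr
  rw [sub_sub_sub_cancel_right]
  exact enorm_sub_latticePoint_le hx

theorem tsum_bw_sub_le (l : ℕ) (x : Rd d) :
    ∑' c : Fin d → ℤ, bw (((2 : ℝ) ^ l)⁻¹ • x - latticePoint c) ≤ latticeConst d := by
  obtain ⟨k, hk⟩ := cube_index_exists l x
  calc _ ≤ ∑' c : Fin d → ℤ, (1 + d) ^ (d + 1) * bw (latticePoint k - latticePoint c) :=
        ENNReal.tsum_le_tsum fun c => bw_cube_le hk c
    _ = _ := by rw [ENNReal.tsum_mul_left, tsum_bw_lattice_sub]; rfl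

theorem cube_disjoint (l : ℕ) {k k' : Fin d → ℤ} {x : Rd d} (h : x ∈ cube l k) (h' : x ∈ cube l k') :
    k = k' := by
  ext i
  have a := h i
  have b := h' i
  have hp : (0 : ℝ) < 2 ^ l := by positivity
  have c1 : (k i : ℝ) < k' i + 1 := lt_of_mul_lt_mul_left (a.1.trans_lt b.2) hp.le
  have c2 : (k' i : ℝ) < k i + 1 := lt_of_mul_lt_mul_left (b.1.trans_lt a.2) hp.le
  have c1' : k i < k' i + 1 := by exact_mod_cast c1
  have c2' : k' i < k i + 1 := by exact_mod_cast c2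
  omega

theorem tsum_cube_indicator (l : ℕ) (x : Rd d) :
    ∑' k : Fin d → ℤ, (cube l k).indicator (1 : Rd d → ℝ≥0∞) x = 1 := by
  obtain ⟨k, hk⟩ := cube_index_exists l x
  rw [tsum_eq_single k]
  · simp [hk]
  · intro k' hk'
    exact indicator_of_notMem (fun h => hk' (cube_disjoint l h hk)) _

variable {V : Type*} [NormedAddCommGroup V]

/-- The mass of a function near a cube of size `2^l` is controlled by the norm of `X`. -/
theorem lintegral_bw_le {v : ℝ × Rd d → V} (hv : AEStronglyMeasurable v (slab d)) (l : ℕ)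
    (c : Fin d → ℤ) :
    ∫⁻ z, bw (((2 : ℝ) ^ l)⁻¹ • z.2 - latticePoint c) * ‖v z‖ₑ ^ 2 ∂(slab d)
      ≤ latticeConst d * (2 ^ l * Xsq v) := by
  calc _ ≤ ∫⁻ z, ∑' k : Fin d → ℤ, ((1 + d) ^ (d + 1) * bw (latticePoint c - latticePoint k)) *
        ((cube l k).indicator 1 z.2 * ‖v z‖ₑ ^ 2) ∂(slab d) := by
        apply lintegral_mono
        intro z
        simp only
        refine le_trans (le_of_eq (b := (∑' k : Fin d → ℤ, (cube l k).indicator (1 : Rd d → ℝ≥0∞) z.2) *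
          (bw (((2 : ℝ) ^ l)⁻¹ • z.2 - latticePoint c) * ‖v z‖ₑ ^ 2)) ?_) ?_
        · rw [tsum_cube_indicator, one_mul]
        rw [← ENNReal.tsum_mul_right]
        apply ENNReal.tsum_le_tsum
        intro k
        by_cases h : z.2 ∈ cube l k
        · simp only [h, indicator_of_mem, Pi.one_apply, one_mul]
          gcongr
          refine (bw_cube_le h c).trans_eq ?_
          rw [← bw_neg (latticePoint c - latticePoint k), neg_sub]
        · simp [h]
    _ = ∑' k : Fin d → ℤ, ((1 + d) ^ (d + 1) * bw (latticePoint c - latticePoint k)) *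
        ∫⁻ z, ((cube l k).indicator 1 z.2 * ‖v z‖ₑ ^ 2) ∂(slab d) := by
        rw [lintegral_tsum]
        · congr 1
          ext k
          rw [lintegral_const_mul'' _ (aemeasurable_cube_mul hv _ _)]
        · intro k
          exact aemeasurable_const.mul (aemeasurable_cube_mul hv _ _)
    _ ≤ ∑' k : Fin d → ℤ, ((1 + d) ^ (d + 1) * bw (latticePoint c - latticePoint k)) *
        (2 ^ l * Xsq v) := by
        gcongr with k
        exact le_Xsq v l k
    _ = _ := by
        rw [ENNReal.tsum_mul_right, ENNReal.tsum_mul_left, tsum_bw_lattice_sub]; rfl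

theorem tsum_mul_sq_le_weighted {ι : Type*} [Countable ι] (f g : ι → ℝ≥0∞) :
    (∑' i, f i * g i) ^ 2 ≤ (∑' i, f i) * ∑' i, f i * g i ^ 2 := by
  let _ : MeasurableSpace ι := ⊤
  have h := lintegral_mul_sq_le_weighted (μ := Measure.count) (f := f) (g := g)
    (measurable_of_countable f).aemeasurable (measurable_of_countable g).aemeasurable
  simpa only [lintegral_count] using h

/-- A discrete convolution with the weight `bw`. -/
def latticeSmooth (l : ℕ) (a : (Fin d → ℤ) → ℝ≥0∞) (x : Rd d) : ℝ≥0∞ :=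
  ∑' c : Fin d → ℤ, bw (((2 : ℝ) ^ l)⁻¹ • x - latticePoint c) * a c

theorem measurable_bw_sub (l : ℕ) (c : Fin d → ℤ) :
    Measurable fun x : Rd d => bw (((2 : ℝ) ^ l)⁻¹ • x - latticePoint c) :=
  bw_measurable.comp (by fun_prop : Continuous fun x : Rd d => ((2 : ℝ) ^ l)⁻¹ • x - latticePoint c).measurable

theorem measurable_latticeSmooth (l : ℕ) (a : (Fin d → ℤ) → ℝ≥0∞) :
    Measurable (latticeSmooth l a) :=
  Measurable.tsum fun c => (measurable_bw_sub l c).mul_const _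

theorem latticeSmooth_sq_le (l : ℕ) (a : (Fin d → ℤ) → ℝ≥0∞) (x : Rd d) :
    latticeSmooth l a x ^ 2 ≤ latticeConst d *
      ∑' c : Fin d → ℤ, bw (((2 : ℝ) ^ l)⁻¹ • x - latticePoint c) * a c ^ 2 := by
  refine (tsum_mul_sq_le_weighted _ _).trans ?_
  gcongr
  exact tsum_bw_sub_le l x

theorem latticeSmooth_sq_le_sum (l : ℕ) (a : (Fin d → ℤ) → ℝ≥0∞) (x : Rd d) :
    latticeSmooth l a x ^ 2 ≤ latticeConst d * ∑' c : Fin d → ℤ, a c ^ 2 := by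
  refine (latticeSmooth_sq_le l a x).trans ?_
  gcongr with c
  calc _ ≤ 1 * a c ^ 2 := by gcongr; exact bw_le_one _
    _ = _ := one_mul _

theorem lintegral_latticeSmooth_le {v : ℝ × Rd d → V} (hv : AEStronglyMeasurable v (slab d)) (l : ℕ)
    (a : (Fin d → ℤ) → ℝ≥0∞) :
    ∫⁻ z, latticeSmooth l a z.2 ^ 2 * ‖v z‖ₑ ^ 2 ∂(slab d)
      ≤ latticeConst d ^ 2 * (2 ^ l * (∑' c : Fin d → ℤ, a c ^ 2) * Xsq v) := by
  have hm : ∀ c, AEMeasurable (fun z : ℝ × Rd d =>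
      bw (((2 : ℝ) ^ l)⁻¹ • z.2 - latticePoint c) * ‖v z‖ₑ ^ 2) (slab d) := fun c =>
    ((measurable_bw_sub l c).comp measurable_snd).aemeasurable.mul (hv.enorm.pow_const 2)
  calc _ ≤ ∫⁻ z, ∑' c : Fin d → ℤ, latticeConst d * a c ^ 2 *
        (bw (((2 : ℝ) ^ l)⁻¹ • z.2 - latticePoint c) * ‖v z‖ₑ ^ 2) ∂(slab d) := by
        apply lintegral_mono
        intro z
        simp only
        calc _ ≤ (latticeConst d * ∑' c : Fin d → ℤ,
              bw (((2 : ℝ) ^ l)⁻¹ • z.2 - latticePoint c) * a c ^ 2) * ‖v z‖ₑ ^ 2 := by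
              gcongr
              exact latticeSmooth_sq_le l a z.2
          _ = _ := by
              rw [← ENNReal.tsum_mul_left, ← ENNReal.tsum_mul_right]
              congr 1; ext c; ring
    _ = ∑' c : Fin d → ℤ, latticeConst d * a c ^ 2 *
        ∫⁻ z, (bw (((2 : ℝ) ^ l)⁻¹ • z.2 - latticePoint c) * ‖v z‖ₑ ^ 2) ∂(slab d) := by
        rw [lintegral_tsum]
        · congr 1
          ext c
          rw [lintegral_const_mul'' _ (hm c)]
        · intro c
          exact aemeasurable_const.mul (hm c)
    _ ≤ ∑' c : Fin d → ℤ, latticeConst d * a c ^ 2 * (latticeConst d * (2 ^ l * Xsq v)) := by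
        gcongr with c
        exact lintegral_bw_le hv l c
    _ = _ := by
        rw [ENNReal.tsum_mul_right, ENNReal.tsum_mul_left]
        ring

end Lattice

section Bernstein

variable {V : Type*} [NormedAddCommGroup V] [NormedSpace ℂ V]

/-- A weighted `L²` norm (squared) of a kernel. -/
def mom2 (κ : Rd d → ℂ) : ℝ≥0∞ := ∫⁻ z, ((1 + ‖z‖ₑ) ^ (d + 1) * ‖κ z‖ₑ) ^ 2

theorem mom2_lt_top (κ : 𝓢(Rd d, ℂ)) : mom2 κ < ⊤ := by
  obtain ⟨C, hC0, hC⟩ := schwartz_decay κ 0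
  refine lt_of_le_of_lt (b := ENNReal.ofReal C * mom κ (2 * (d + 1))) ?_
    (ENNReal.mul_lt_top ENNReal.ofReal_lt_top (mom_lt_top κ _))
  unfold mom2 mom
  rw [← lintegral_const_mul' _ _ ENNReal.ofReal_ne_top]
  apply lintegral_mono
  intro z
  simp only
  have : ‖κ z‖ₑ ≤ ENNReal.ofReal C := by
    rw [← ofReal_norm]
    exact ENNReal.ofReal_le_ofReal (by simpa using hC z)
  calc _ = ‖κ z‖ₑ * (‖κ z‖ₑ * (1 + ‖z‖ₑ) ^ (2 * (d + 1))) := by ring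
    _ ≤ _ := by gcongr

theorem enorm_cutoff_smul (χ : CubePartition d) (k : ℕ) (c : Fin d → ℤ) (y : Rd d) (v : V) :
    ‖(χ.cutoff k c y : ℂ) • v‖ₑ
      = ENNReal.ofReal (χ.profile (((2 : ℝ) ^ k)⁻¹ • y - latticePoint c)) * ‖v‖ₑ := by
  rw [enorm_smul, ← ofReal_norm, Complex.norm_real, CubePartition.cutoff,
    Real.norm_of_nonneg (χ.nonneg _)]

theorem enorm_inv_two_pow_smul_le (k r : ℕ) (x : Rd d) :
    ‖((2 : ℝ) ^ k)⁻¹ • x‖ₑ ≤ ‖(2 : ℝ) ^ r • x‖ₑ := by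
  refine le_trans ?_ (enorm_two_pow_smul_ge r x)
  rw [enorm_smul]
  calc _ ≤ 1 * ‖x‖ₑ := by
        gcongr
        rw [← ofReal_norm, ENNReal.ofReal_le_one, norm_inv, norm_pow, Real.norm_ofNat]
        exact inv_le_one_of_one_le₀ (one_le_pow₀ (by norm_num))
    _ = _ := one_mul _

/-- The cubewise Bernstein inequality. -/
theorem lintegral_kernel_le (χ : CubePartition d) {R : ℝ≥0}
    (hR : ∀ x, χ.profile x ≠ 0 → ‖x‖ₑ ≤ R) {κ κ₀ : Rd d → ℂ} (hκ : Continuous κ)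
    {k r : ℕ} {L : ℝ≥0∞}
    (hκ₀ : ∀ z, ‖κ z‖ₑ = ENNReal.ofReal (((2 : ℝ) ^ r) ^ d) * L * ‖κ₀ ((2 : ℝ) ^ r • z)‖ₑ)
    (hL : L ≠ ⊤)
    {v : Rd d → V} (hv : AEStronglyMeasurable v volume) {a : (Fin d → ℤ) → ℝ≥0∞}
    (ha : ∀ c, eLpNorm (fun y => (χ.cutoff k c y : ℂ) • v y) 2 volume ≤ a c) (x : Rd d) :
    ∫⁻ y, ‖κ (x - y)‖ₑ * ‖v y‖ₑ ≤ (1 + R) ^ (d + 1) * mom2 κ₀ ^ (1 / 2 : ℝ) * L *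
      ENNReal.ofReal (((2 : ℝ) ^ r) ^ d) ^ (1 / 2 : ℝ) * latticeSmooth k a x := by
  set A := ENNReal.ofReal (((2 : ℝ) ^ r) ^ d) with hA
  have hhalf : ∀ t : ℝ≥0∞, (t ^ (1 / 2 : ℝ)) ^ 2 = t := fun t => by
    rw [← ENNReal.rpow_mul_natCast]; norm_num
  have hcut : ∀ c : Fin d → ℤ, Continuous fun y : Rd d => (χ.cutoff k c y : ℂ) := fun c =>
    Complex.continuous_ofReal.comp (χ.smooth.continuous.comp (by fun_prop))
  have hterm : ∀ c : Fin d → ℤ,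
      ∫⁻ y, ‖κ (x - y)‖ₑ * ‖(χ.cutoff k c y : ℂ) • v y‖ₑ ≤
        (1 + R) ^ (d + 1) * mom2 κ₀ ^ (1 / 2 : ℝ) * L * A ^ (1 / 2 : ℝ) *
          (bw (((2 : ℝ) ^ k)⁻¹ • x - latticePoint c) * a c) := by
    intro c
    set b := bw (((2 : ℝ) ^ k)⁻¹ • x - latticePoint c) with hb
    have hκm : Measurable fun y => (1 + ‖(2 : ℝ) ^ r • (x - y)‖ₑ) ^ (d + 1) * ‖κ (x - y)‖ₑ := by
      have h1 : Measurable fun y => (1 + ‖(2 : ℝ) ^ r • (x - y)‖ₑ) ^ (d + 1) :=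
        (measurable_const.add (by fun_prop : Continuous fun y : Rd d => (2 : ℝ) ^ r • (x - y)).enorm.measurable).pow_const _
      have h2 : Measurable fun y => ‖κ (x - y)‖ₑ := (hκ.comp (by fun_prop)).enorm.measurable
      exact h1.mul h2
    have hvm : AEMeasurable (fun y => ‖(χ.cutoff k c y : ℂ) • v y‖ₑ) volume :=
      ((hcut c).aestronglyMeasurable.smul hv).enorm
    have h1 : ∫⁻ y, ((1 + ‖(2 : ℝ) ^ r • (x - y)‖ₑ) ^ (d + 1) * ‖κ (x - y)‖ₑ) ^ 2
        = A * L ^ 2 * mom2 κ₀ := by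
      rw [lintegral_sub_left_eq_self
        (fun y => ((1 + ‖(2 : ℝ) ^ r • y‖ₑ) ^ (d + 1) * ‖κ y‖ₑ) ^ 2) x]
      unfold mom2
      rw [← lintegral_dilate r (fun z => ((1 + ‖z‖ₑ) ^ (d + 1) * ‖κ₀ z‖ₑ) ^ 2),
        ← lintegral_const_mul' _ _ (by finiteness)]
      congr 1
      ext y
      rw [hκ₀ y]
      ring
    have h2 := lintegral_mul_sq_le hκm.aemeasurable hvm (μ := volume)
    rw [h1, ← eLpNorm_two_sq] at h2
    have h3 : ∫⁻ y, (1 + ‖(2 : ℝ) ^ r • (x - y)‖ₑ) ^ (d + 1) * ‖κ (x - y)‖ₑ *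
        ‖(χ.cutoff k c y : ℂ) • v y‖ₑ ≤ mom2 κ₀ ^ (1 / 2 : ℝ) * L * A ^ (1 / 2 : ℝ) * a c := by
      rw [← ENNReal.pow_le_pow_left_iff two_ne_zero]
      refine h2.trans ?_
      rw [mul_pow, mul_pow, mul_pow, hhalf, hhalf]
      calc _ ≤ A * L ^ 2 * mom2 κ₀ * a c ^ 2 := by gcongr; exact ha c
        _ = _ := by ring
    calc _ ≤ ∫⁻ y, ((1 + R) ^ (d + 1) * b) * ((1 + ‖(2 : ℝ) ^ r • (x - y)‖ₑ) ^ (d + 1) *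
          ‖κ (x - y)‖ₑ * ‖(χ.cutoff k c y : ℂ) • v y‖ₑ) := by
          apply lintegral_mono
          intro y
          simp only
          by_cases h0 : χ.profile (((2 : ℝ) ^ k)⁻¹ • y - latticePoint c) = 0
          · have : χ.cutoff k c y = 0 := h0
            simp [this]
          · have hz := hR _ h0
            have e1 : (1 : ℝ≥0∞) ≤ (1 + R) ^ (d + 1) * bw (((2 : ℝ) ^ k)⁻¹ • y - latticePoint c) := by
              rw [bw, ← div_eq_mul_inv, ENNReal.le_div_iff_mul_le (by simp) (by simp), one_mul]
              gcongr
            have e2 := bw_le (((2 : ℝ) ^ k)⁻¹ • y - latticePoint c) (((2 : ℝ) ^ k)⁻¹ • x - latticePoint c)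
            rw [sub_sub_sub_cancel_right, ← smul_sub, ← hb, ← enorm_neg, ← smul_neg, neg_sub] at e2
            have e3 : (1 : ℝ≥0∞) ≤ (1 + R) ^ (d + 1) * ((1 + ‖(2 : ℝ) ^ r • (x - y)‖ₑ) ^ (d + 1) * b) := by
              refine e1.trans ?_
              gcongr
              refine e2.trans ?_
              gcongr
              exact enorm_inv_two_pow_smul_le k r _
            calc _ = 1 * (‖κ (x - y)‖ₑ * ‖(χ.cutoff k c y : ℂ) • v y‖ₑ) := by rw [one_mul]
              _ ≤ ((1 + R) ^ (d + 1) * ((1 + ‖(2 : ℝ) ^ r • (x - y)‖ₑ) ^ (d + 1) * b)) *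
                  (‖κ (x - y)‖ₑ * ‖(χ.cutoff k c y : ℂ) • v y‖ₑ) := by gcongr
              _ = _ := by ring
      _ = ((1 + R) ^ (d + 1) * b) * ∫⁻ y, ((1 + ‖(2 : ℝ) ^ r • (x - y)‖ₑ) ^ (d + 1) *
          ‖κ (x - y)‖ₑ * ‖(χ.cutoff k c y : ℂ) • v y‖ₑ) := by
          rw [lintegral_const_mul'']
          exact hκm.aemeasurable.mul hvm
      _ ≤ ((1 + R) ^ (d + 1) * b) * (mom2 κ₀ ^ (1 / 2 : ℝ) * L * A ^ (1 / 2 : ℝ) * a c) := by gcongr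
      _ = _ := by ring
  calc _ = ∫⁻ y, ∑' c : Fin d → ℤ, ‖κ (x - y)‖ₑ * ‖(χ.cutoff k c y : ℂ) • v y‖ₑ := by
        congr 1
        ext y
        simp_rw [enorm_cutoff_smul]
        rw [ENNReal.tsum_mul_left, ENNReal.tsum_mul_right, χ.tsum_ofReal, one_mul]
    _ = ∑' c : Fin d → ℤ, ∫⁻ y, ‖κ (x - y)‖ₑ * ‖(χ.cutoff k c y : ℂ) • v y‖ₑ := by
        rw [lintegral_tsum]
        intro c
        exact (hκ.comp (by fun_prop : Continuous fun y => x - y)).enorm.measurable.aemeasurable.mul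
          ((hcut c).aestronglyMeasurable.smul hv).enorm
    _ ≤ _ := by
        unfold latticeSmooth
        rw [← ENNReal.tsum_mul_left]
        exact ENNReal.tsum_le_tsum hterm

/-- The standard basis vectors. -/
abbrev eb (i : Fin d) : Rd d := EuclideanSpace.single i 1

theorem opNorm_le_sum_basis {F : Type*} [NormedAddCommGroup F] [NormedSpace ℝ F] (A : Rd d →L[ℝ] F) :
    ‖A‖ ≤ ∑ i, ‖A (eb i)‖ := by
  refine A.opNorm_le_bound (Finset.sum_nonneg fun _ _ => norm_nonneg _) fun x => ?_
  have hx : x = ∑ i, x i • eb i := by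
    have := (EuclideanSpace.basisFun (Fin d) ℝ).sum_repr x
    simpa using this.symm
  conv_lhs => rw [hx, map_sum]
  refine (norm_sum_le _ _).trans ?_
  rw [Finset.sum_mul]
  refine Finset.sum_le_sum fun i _ => ?_
  rw [map_smul, norm_smul, mul_comm]
  gcongr
  exact PiLp.norm_apply_le x i

theorem opENorm_le_sum_basis {F : Type*} [NormedAddCommGroup F] [NormedSpace ℝ F]
    (A : Rd d →L[ℝ] F) : ‖A‖ₑ ≤ ∑ i, ‖A (eb i)‖ₑ := by
  simp_rw [← ofReal_norm]
  rw [← ENNReal.ofReal_sum_of_nonneg fun _ _ => norm_nonneg _]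
  exact ENNReal.ofReal_le_ofReal (opNorm_le_sum_basis A)

end Bernstein

section Envelope

variable {V : Type*} [NormedAddCommGroup V] [InnerProductSpace ℂ V] [CompleteSpace V]

/-- The constant in the cubewise Bernstein inequality for the Littlewood-Paley pieces and their
gradients. -/
def LPBump.bernsteinConst (φ : LPBump d) (R : ℝ≥0) : ℝ≥0∞ :=
  (1 + R) ^ (d + 1) * (mom2 (φ.Phi 0) ^ (1 / 2 : ℝ) +
    ∑ i, mom2 (∂_{(eb i : Rd d)} (φ.Phi 0) : 𝓢(Rd d, ℂ)) ^ (1 / 2 : ℝ))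

theorem LPBump.bernsteinConst_lt_top (φ : LPBump d) (R : ℝ≥0) : φ.bernsteinConst R < ⊤ := by
  have h : ∀ κ : 𝓢(Rd d, ℂ), mom2 κ ^ (1 / 2 : ℝ) < ⊤ := fun κ =>
    ENNReal.rpow_lt_top_of_nonneg (by norm_num) (mom2_lt_top κ).ne
  exact ENNReal.mul_lt_top (by finiteness) (ENNReal.add_lt_top.2 ⟨h _, ENNReal.sum_lt_top.2 fun i _ => h _⟩)

/-- The growth of the constants in the Bernstein inequality. -/
def growth (d k : ℕ) : ℝ≥0∞ := 2 ^ (k + 1) * ENNReal.ofReal (((2 : ℝ) ^ (k + 1)) ^ d) ^ (1 / 2 : ℝ)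

theorem proj_eq_cv (φ : LPBump d) {v : Rd d → V} (hv : MemLp v 2 volume) (k : ℕ) :
    cv (φ.Phi (k + 1)) (φ.proj k v) = φ.proj k v := by
  have hd := ConvDefined.of_memLp_two hv
  cases k with
  | zero =>
    rw [φ.proj_zero]
    exact cv_Phi_cv_Phi φ (by omega) hv
  | succ k =>
    have hc : ∀ r, cv (φ.Phi r) v = fun y => cv (φ.Phi r) v y := fun r => rfl
    have hb : ∀ r, ConvDefined (cv (φ.Phi r) v) := fun r =>
      ConvDefined.of_bounded (cv_continuous _ hd).aestronglyMeasurable _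
        (Eventually.of_forall (norm_cv_le _ hv))
    rw [φ.proj_succ hd]
    ext x
    rw [show cv (φ.Phi (k + 1)) v - cv (φ.Phi k) v = fun y => cv (φ.Phi (k + 1)) v y - cv (φ.Phi k) v y from rfl,
      cv_sub _ (hb _) (hb _), cv_Phi_cv_Phi φ (by omega) hv, cv_Phi_cv_Phi φ (by omega) hv]

omit [CompleteSpace V] in
theorem ConvDefined.proj (φ : LPBump d) {v : Rd d → V} (hv : MemLp v 2 volume) (k : ℕ) :
    ConvDefined (φ.proj k v) := by
  have hd := ConvDefined.of_memLp_two hv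
  have hb : ∀ r, MemLp (cv (φ.Phi r) v) ⊤ volume := fun r =>
    memLp_top_of_bound (cv_continuous _ hd).aestronglyMeasurable _
      (Eventually.of_forall (norm_cv_le _ hv))
  have : MemLp (φ.proj k v) ⊤ volume := by
    cases k with
    | zero => rw [φ.proj_zero]; exact hb 0
    | succ k => rw [φ.proj_succ hd]; exact (hb _).sub (hb _)
  refine ConvDefined.of_bounded this.1 (eLpNorm (φ.proj k v) ⊤ volume).toReal ?_
  rw [eLpNorm_exponent_top]
  filter_upwards [ae_le_eLpNormEssSup (f := φ.proj k v) (μ := volume)] with x hx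
  have := ENNReal.toReal_mono (by rw [← eLpNorm_exponent_top]; exact this.2.ne) hx
  simpa using this

theorem enorm_proj_le (φ : LPBump d) (χ : CubePartition d) {R : ℝ≥0}
    (hR : ∀ x, χ.profile x ≠ 0 → ‖x‖ₑ ≤ R) {v : Rd d → V} (hv : MemLp v 2 volume) (k : ℕ)
    {a : (Fin d → ℤ) → ℝ≥0∞}
    (ha : ∀ c, eLpNorm (fun y => (χ.cutoff k c y : ℂ) • φ.proj k v y) 2 volume ≤ a c)
    (x : Rd d) :
    ‖φ.proj k v x‖ₑ ≤ φ.bernsteinConst R * growth d k * latticeSmooth k a x ∧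
    ‖fderiv ℝ (φ.proj k v) x‖ₑ ≤ φ.bernsteinConst R * growth d k * latticeSmooth k a x := by
  have hm := (ConvDefined.proj φ hv k)
  have hcv : ∀ (κ : Rd d → ℂ), ‖cv κ (φ.proj k v) x‖ₑ ≤ ∫⁻ y, ‖κ (x - y)‖ₑ * ‖φ.proj k v y‖ₑ := by
    intro κ
    refine (enorm_integral_le_lintegral_enorm _).trans (le_of_eq ?_)
    simp_rw [enorm_smul]
  constructor
  · have h1 := lintegral_kernel_le χ hR (κ := φ.Phi (k + 1)) (κ₀ := φ.Phi 0) (φ.Phi (k + 1)).continuous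
      (L := 1) (r := k + 1) (fun z => by rw [φ.enorm_Phi, mul_one]) (by simp) hm.1 ha x
    conv_lhs => rw [← proj_eq_cv φ hv k]
    refine (hcv _).trans (h1.trans ?_)
    gcongr ?_ * _
    unfold LPBump.bernsteinConst growth
    calc _ = (1 + R) ^ (d + 1) * mom2 (φ.Phi 0) ^ (1 / 2 : ℝ) *
          (1 * ENNReal.ofReal (((2 : ℝ) ^ (k + 1)) ^ d) ^ (1 / 2 : ℝ)) := by ring
      _ ≤ _ := by
          gcongr
          · exact le_self_add
          · exact one_le_pow₀ (by norm_num)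
  · refine (opENorm_le_sum_basis _).trans ?_
    have h1 : ∀ i : Fin d, ‖fderiv ℝ (φ.proj k v) x (eb i)‖ₑ ≤
        (1 + R) ^ (d + 1) * mom2 (∂_{(eb i : Rd d)} (φ.Phi 0) : 𝓢(Rd d, ℂ)) ^ (1 / 2 : ℝ) *
        growth d k * latticeSmooth k a x := by
      intro i
      have h2 := lintegral_kernel_le χ hR (κ := (∂_{(eb i : Rd d)} (φ.Phi (k + 1)) : 𝓢(Rd d, ℂ)))
        (κ₀ := (∂_{(eb i : Rd d)} (φ.Phi 0) : 𝓢(Rd d, ℂ))) (SchwartzMap.continuous _)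
        (L := 2 ^ (k + 1)) (r := k + 1) (fun z => by
          rw [φ.lineDeriv_Phi_dilate, enorm_mul, enorm_mul, ← ofReal_norm, ← ofReal_norm]
          congr 2
          · simp
          · simp [ENNReal.ofReal_pow]) (by finiteness) hm.1 ha x
      rw [← proj_eq_cv φ hv k, cv_fderiv_apply _ hm]
      refine (hcv _).trans (h2.trans (le_of_eq ?_))
      unfold growth
      ring
    refine (Finset.sum_le_sum fun i _ => h1 i).trans ?_
    rw [← Finset.sum_mul, ← Finset.sum_mul, ← Finset.mul_sum]
    unfold LPBump.bernsteinConst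
    gcongr
    exact le_add_self

theorem proj_contDiff (φ : LPBump d) {v : Rd d → V} (hv : MemLp v 2 volume) (k : ℕ) :
    ContDiff ℝ ∞ (φ.proj k v) := by
  rw [← proj_eq_cv φ hv k]
  exact cv_contDiff _ (ConvDefined.proj φ hv k)

/-- A function whose Littlewood-Paley pieces have summable `C¹` norms is continuously
differentiable. -/
theorem exists_contDiff_of_summable (φ : LPBump d) {v : Rd d → V} (hv : MemLp v 2 volume)
    {b : ℕ → ℝ≥0∞} (hb : ∑' k, b k ≠ ⊤) (h0 : ∀ k x, ‖φ.proj k v x‖ₑ ≤ b k)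
    (h1 : ∀ k x, ‖fderiv ℝ (φ.proj k v) x‖ₑ ≤ b k) :
    ∃ W : Rd d → V, ContDiff ℝ 1 W ∧ v =ᵐ[volume] W ∧
      (∀ x, ‖W x‖ₑ ≤ ∑' k, ‖φ.proj k v x‖ₑ) ∧
      ∀ x, ‖fderiv ℝ W x‖ₑ ≤ ∑' k, ‖fderiv ℝ (φ.proj k v) x‖ₑ := by
  have hbt : ∀ k, b k ≠ ⊤ := ENNReal.ne_top_of_tsum_ne_top hb
  have hsum : Summable fun k => (b k).toReal := ENNReal.summable_toReal hb
  have n0 : ∀ k x, ‖φ.proj k v x‖ ≤ (b k).toReal := fun k x => by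
    have := ENNReal.toReal_mono (hbt k) (h0 k x); simpa using this
  have n1 : ∀ k x, ‖fderiv ℝ (φ.proj k v) x‖ ≤ (b k).toReal := fun k x => by
    have := ENNReal.toReal_mono (hbt k) (h1 k x); simpa using this
  have hd := ConvDefined.of_memLp_two hv
  have hcd : ∀ k, ContDiff ℝ 1 (φ.proj k v) := fun k => (proj_contDiff φ hv k).of_le (by norm_cast)
  have hs : ∀ x, HasSum (fun k => φ.proj k v x) (∑' k, φ.proj k v x) := fun x =>
    (Summable.of_norm_bounded hsum (fun k => n0 k x)).hasSum
  have hW : ContDiff ℝ 1 (fun x => ∑' k, φ.proj k v x) := by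
    refine contDiff_tsum (v := fun _ k => (b k).toReal) hcd (fun _ _ => hsum) ?_
    intro i k x hi
    have hi' : i ≤ 1 := by exact_mod_cast hi
    interval_cases i
    · rw [norm_iteratedFDeriv_zero]; exact n0 k x
    · rw [norm_iteratedFDeriv_one]; exact n1 k x
  refine ⟨fun x => ∑' k, φ.proj k v x, hW, ?_, fun x => enorm_tsum_le_tsum_enorm, fun x => ?_⟩
  · refine ae_eq_of_tendsto_cv φ hv hW.continuous (B := ∑' k, (b k).toReal) ?_ ?_
    · intro N x
      rw [← φ.low_succ hd]
      refine (norm_sum_le _ _).trans ((Finset.sum_le_sum fun k _ => n0 k x).trans ?_)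
      exact hsum.sum_le_tsum _ (fun _ _ => ENNReal.toReal_nonneg)
    · intro x
      have := (hs x).tendsto_sum_nat.comp (tendsto_add_atTop_nat 1)
      refine this.congr fun N => ?_
      rw [← φ.low_succ hd]
      rfl
  · have e : fderiv ℝ (fun x => ∑' k, φ.proj k v x) x = ∑' k, fderiv ℝ (φ.proj k v) x :=
      fderiv_tsum_apply hsum (fun k => (hcd k).differentiable (by norm_num)) (fun k x => n1 k x)
        (x₀ := x) (hs x).summable x
    have h2 : Summable fun k => ‖fderiv ℝ (φ.proj k v) x‖ :=
      Summable.of_nonneg_of_le (fun _ => norm_nonneg _) (fun k => n1 k x) hsum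
    rw [e, ← ofReal_norm]
    refine (ENNReal.ofReal_le_ofReal (norm_tsum_le_tsum_norm h2)).trans ?_
    rw [ENNReal.ofReal_tsum_of_nonneg (fun _ => norm_nonneg _) h2]
    simp_rw [ofReal_norm]
    rfl

end Envelope

section Envelope

variable {V : Type*} [NormedAddCommGroup V] [InnerProductSpace ℂ V] [CompleteSpace V]

theorem ennreal_half_sq (t : ℝ≥0∞) : (t ^ (1 / 2 : ℝ)) ^ 2 = t := by
  rw [← ENNReal.rpow_mul_natCast]; norm_num

theorem tsum_two_rpow_lt_top {δ : ℝ} (hδ : 0 < δ) :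
    ∑' k : ℕ, (2 : ℝ≥0∞) ^ (-(δ * (k : ℝ))) < ⊤ := by
  have h : ∀ k : ℕ, (2 : ℝ≥0∞) ^ (-(δ * (k : ℝ))) = ((2 : ℝ≥0∞) ^ (-δ)) ^ k := fun k => by
    rw [← ENNReal.rpow_mul_natCast, neg_mul]
  simp_rw [h]
  rw [ENNReal.tsum_geometric, ENNReal.inv_lt_top, tsub_pos_iff_lt]
  exact ENNReal.rpow_lt_one_of_one_lt_of_neg (by norm_num) (by linarith)

theorem growth_sq (s : ℝ) (k : ℕ) :
    (2 : ℝ≥0∞) ^ ((2 * s - d - 3) * (k : ℝ)) * growth d k ^ 2 * 2 ^ k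
      = 2 ^ (d + 2) * (2 : ℝ≥0∞) ^ (2 * (k : ℝ) * s) := by
  rw [growth, mul_pow, ennreal_half_sq]
  rw [ENNReal.ofReal_pow (by positivity), ENNReal.ofReal_pow (by norm_num), ENNReal.ofReal_ofNat]
  simp_rw [← pow_mul, ← ENNReal.rpow_natCast]
  simp_rw [← ENNReal.rpow_add _ _ (two_ne_zero : (2 : ℝ≥0∞) ≠ 0) ENNReal.ofNat_ne_top]
  congr 1
  push_cast
  ring

omit [CompleteSpace V] in
/-- The sum of the squared `l²` norms of the coefficients that control the pieces. -/
theorem tsum_normLinftyL2_le (φ : LPBump d) (χ : CubePartition d) (s : ℝ) (w : ℝ × Rd d → V) :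
    ∑' k : ℕ, (2 : ℝ≥0∞) ^ (2 * (k : ℝ) * s) * ∑' c : Fin d → ℤ,
      normLinftyL2 (fun z => (χ.cutoff k c z.2 : ℂ) • φ.proj k (fun y => w (z.1, y)) z.2) ^ 2
      ≤ norml2Xs φ χ s w ^ 2 := by
  rw [norml2Xs, ennreal_half_sq]
  simp_rw [l2Norm, ennreal_half_sq]
  gcongr with k c
  exact le_add_self

/-- A time independent envelope for functions in `l² X^s` and their gradients. -/
theorem exists_envelope (φ : LPBump d) (χ : CubePartition d) {s : ℝ} (hs : ((d : ℝ) + 3) / 2 < s) :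
    ∃ C : ℝ≥0∞, C < ⊤ ∧ ∀ w : ℝ × Rd d → V, Meml2Xs φ χ s w →
      ∃ P : Rd d → ℝ≥0∞, Measurable P ∧ (∀ x, P x ≤ C * norml2Xs φ χ s w ^ 2) ∧
        (∀ v : ℝ × Rd d → ℂ, AEStronglyMeasurable v (slab d) →
          ∫⁻ z, P z.2 * ‖v z‖ₑ ^ 2 ∂(slab d) ≤ C * norml2Xs φ χ s w ^ 2 * Xsq v) ∧
        ∀ᵐ t ∂tm, MemLp (fun x => w (t, x)) 2 (volume : Measure (Rd d)) ∧
          ∃ W : Rd d → V, ContDiff ℝ 1 W ∧ (fun x => w (t, x)) =ᵐ[volume] W ∧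
            (∀ x, ‖W x‖ₑ ^ 2 ≤ P x) ∧ ∀ x, ‖fderiv ℝ W x‖ₑ ^ 2 ≤ P x := by
  obtain ⟨R, hR⟩ := χ.exists_radius
  set δ : ℝ := 2 * s - d - 3 with hδ
  have hδ0 : 0 < δ := by rw [hδ]; linarith
  set Q : ℝ≥0∞ := ∑' k : ℕ, (2 : ℝ≥0∞) ^ (-(δ * (k : ℝ))) with hQ
  have hQt : Q < ⊤ := tsum_two_rpow_lt_top hδ0
  set B := φ.bernsteinConst R with hB
  have hBt : B < ⊤ := φ.bernsteinConst_lt_top R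
  set Λ := latticeConst d with hΛ
  have hΛt : Λ < ⊤ := latticeConst_lt_top d
  set C : ℝ≥0∞ := Q * B ^ 2 * (Λ + Λ ^ 2) * 2 ^ (d + 2) with hC
  have hCt : C < ⊤ := by rw [hC]; finiteness
  refine ⟨C, hCt, fun w hw => ?_⟩
  set a : ℕ → (Fin d → ℤ) → ℝ≥0∞ := fun k c =>
    normLinftyL2 (fun z => (χ.cutoff k c z.2 : ℂ) • φ.proj k (fun y => w (z.1, y)) z.2) with ha
  set M := norml2Xs φ χ s w ^ 2 with hM
  have hN : ∑' k : ℕ, (2 : ℝ≥0∞) ^ (2 * (k : ℝ) * s) * ∑' c, a k c ^ 2 ≤ M :=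
    tsum_normLinftyL2_le φ χ s w
  have hMt : M < ⊤ := ENNReal.pow_lt_top hw.finite
  -- the weighted Cauchy-Schwarz inequality
  have cs : ∀ β : ℕ → ℝ≥0∞, (∑' k, B * growth d k * β k) ^ 2 ≤
      Q * ∑' k : ℕ, 2 ^ (δ * (k : ℝ)) * growth d k ^ 2 * (B ^ 2 * β k ^ 2) := by
    intro β
    have h := tsum_mul_sq_le_weighted (fun k : ℕ => (2 : ℝ≥0∞) ^ (-(δ * (k : ℝ))))
      (fun k => 2 ^ (δ * (k : ℝ)) * (B * growth d k * β k))
    have e : ∀ k : ℕ, (2 : ℝ≥0∞) ^ (-(δ * (k : ℝ))) * 2 ^ (δ * (k : ℝ)) = 1 := fun k => by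
      rw [← ENNReal.rpow_add _ _ two_ne_zero ENNReal.ofNat_ne_top, neg_add_cancel, ENNReal.rpow_zero]
    have e1 : ∀ k : ℕ, (2 : ℝ≥0∞) ^ (-(δ * (k : ℝ))) * (2 ^ (δ * (k : ℝ)) * (B * growth d k * β k))
        = B * growth d k * β k := fun k => by rw [← mul_assoc, e, one_mul]
    have e2 : ∀ k : ℕ, (2 : ℝ≥0∞) ^ (-(δ * (k : ℝ))) * (2 ^ (δ * (k : ℝ)) * (B * growth d k * β k)) ^ 2
        = 2 ^ (δ * (k : ℝ)) * growth d k ^ 2 * (B ^ 2 * β k ^ 2) := fun k => by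
      rw [sq, ← mul_assoc, e1]; ring
    simp_rw [e1, e2] at h
    exact h
  have key : ∀ k : ℕ, (2 : ℝ≥0∞) ^ (δ * (k : ℝ)) * growth d k ^ 2 * (2 ^ k * ∑' c, a k c ^ 2)
      = 2 ^ (d + 2) * (2 ^ (2 * (k : ℝ) * s) * ∑' c, a k c ^ 2) := fun k => by
    rw [← mul_assoc, growth_sq, mul_assoc]
  have key' : ∀ k : ℕ, (2 : ℝ≥0∞) ^ (δ * (k : ℝ)) * growth d k ^ 2 * (∑' c, a k c ^ 2)
      ≤ 2 ^ (d + 2) * (2 ^ (2 * (k : ℝ) * s) * ∑' c, a k c ^ 2) := fun k => by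
    rw [← key]
    gcongr
    exact le_mul_of_one_le_left (by positivity) (one_le_pow₀ (by norm_num))
  have sum' : Q * ∑' k : ℕ, 2 ^ (δ * (k : ℝ)) * growth d k ^ 2 * (B ^ 2 * (Λ * ∑' c, a k c ^ 2))
      ≤ C * M := by
    calc _ ≤ Q * ∑' k : ℕ, B ^ 2 * Λ * (2 ^ (d + 2) * (2 ^ (2 * (k : ℝ) * s) * ∑' c, a k c ^ 2)) := by
          refine mul_le_mul' le_rfl (ENNReal.tsum_le_tsum fun k => ?_)
          calc _ = B ^ 2 * Λ * (2 ^ (δ * (k : ℝ)) * growth d k ^ 2 * (∑' c, a k c ^ 2)) := by ring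
            _ ≤ _ := mul_le_mul' le_rfl (key' k)
      _ = Q * B ^ 2 * Λ * 2 ^ (d + 2) * ∑' k : ℕ, (2 ^ (2 * (k : ℝ) * s) * ∑' c, a k c ^ 2) := by
          rw [ENNReal.tsum_mul_left, ENNReal.tsum_mul_left]; ring
      _ ≤ Q * B ^ 2 * (Λ + Λ ^ 2) * 2 ^ (d + 2) * M := by
          gcongr
          exact le_self_add
  refine ⟨fun x => Q * ∑' k : ℕ, 2 ^ (δ * (k : ℝ)) * growth d k ^ 2 *
    (B ^ 2 * latticeSmooth k (a k) x ^ 2), ?_, ?_, ?_, ?_⟩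
  · exact (Measurable.tsum fun k =>
      (((measurable_latticeSmooth k (a k)).pow_const 2).const_mul _).const_mul _).const_mul _
  · intro x
    refine le_trans ?_ sum'
    refine mul_le_mul' le_rfl (ENNReal.tsum_le_tsum fun k => ?_)
    gcongr
    exact latticeSmooth_sq_le_sum k (a k) x
  · intro v hv
    have hm : ∀ k, AEMeasurable (fun z : ℝ × Rd d => latticeSmooth k (a k) z.2 ^ 2 * ‖v z‖ₑ ^ 2) (slab d) :=
      fun k => (((measurable_latticeSmooth k (a k)).comp measurable_snd).pow_const 2).aemeasurable.mul
        (hv.enorm.pow_const 2)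
    calc _ = ∫⁻ z, Q * ∑' k : ℕ, 2 ^ (δ * (k : ℝ)) * growth d k ^ 2 * B ^ 2 *
          (latticeSmooth k (a k) z.2 ^ 2 * ‖v z‖ₑ ^ 2) ∂(slab d) := by
          congr 1; ext z
          rw [mul_assoc]
          refine congrArg (Q * ·) ?_
          rw [← ENNReal.tsum_mul_right]
          exact tsum_congr fun k => by ring
      _ = Q * ∑' k : ℕ, 2 ^ (δ * (k : ℝ)) * growth d k ^ 2 * B ^ 2 *
          ∫⁻ z, (latticeSmooth k (a k) z.2 ^ 2 * ‖v z‖ₑ ^ 2) ∂(slab d) := by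
          rw [lintegral_const_mul' _ _ hQt.ne, lintegral_tsum]
          · exact congrArg _ (tsum_congr fun k => by rw [lintegral_const_mul'' _ (hm k)])
          · exact fun k => (hm k).const_mul _
      _ ≤ Q * ∑' k : ℕ, 2 ^ (δ * (k : ℝ)) * growth d k ^ 2 * B ^ 2 *
          (Λ ^ 2 * (2 ^ k * (∑' c, a k c ^ 2) * Xsq v)) := by
          refine mul_le_mul' le_rfl (ENNReal.tsum_le_tsum fun k => mul_le_mul' le_rfl ?_)
          exact lintegral_latticeSmooth_le hv k (a k)
      _ = Q * ∑' k : ℕ, B ^ 2 * Λ ^ 2 * Xsq v *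
          (2 ^ (d + 2) * (2 ^ (2 * (k : ℝ) * s) * ∑' c, a k c ^ 2)) := by
          exact congrArg _ (tsum_congr fun k => by rw [← key]; ring)
      _ = Q * B ^ 2 * Λ ^ 2 * 2 ^ (d + 2) * (∑' k : ℕ, (2 ^ (2 * (k : ℝ) * s) * ∑' c, a k c ^ 2)) *
          Xsq v := by
          rw [ENNReal.tsum_mul_left, ENNReal.tsum_mul_left]; ring
      _ ≤ Q * B ^ 2 * (Λ + Λ ^ 2) * 2 ^ (d + 2) * M * Xsq v := by
          gcongr
          exact le_add_self
  · have hae : ∀ᵐ t ∂tm, ∀ k c, eLpNorm (fun y => (χ.cutoff k c y : ℂ) •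
        φ.proj k (fun y => w (t, y)) y) 2 volume ≤ a k c := by
      rw [ae_all_iff]; intro k
      rw [ae_all_iff]; intro c
      exact ENNReal.ae_le_essSup _
    filter_upwards [hae, hw.slices] with t ht hwt
    refine ⟨hwt, ?_⟩
    have hp := fun k x => enorm_proj_le φ χ hR hwt k (ht k) x
    have hls : ∀ k x, latticeSmooth k (a k) x ≤ (Λ * ∑' c, a k c ^ 2) ^ (1 / 2 : ℝ) := by
      intro k x
      rw [← ENNReal.pow_le_pow_left_iff two_ne_zero, ennreal_half_sq]
      exact latticeSmooth_sq_le_sum k (a k) x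
    obtain ⟨W, hW, hwW, hW0, hW1⟩ := exists_contDiff_of_summable φ hwt
      (b := fun k => B * growth d k * (Λ * ∑' c, a k c ^ 2) ^ (1 / 2 : ℝ)) (by
        have := cs fun k => (Λ * ∑' c, a k c ^ 2) ^ (1 / 2 : ℝ)
        simp_rw [ennreal_half_sq] at this
        have h2 := (this.trans sum').trans_lt (ENNReal.mul_lt_top hCt hMt)
        intro h
        rw [h] at h2
        simp at h2)
      (fun k x => (hp k x).1.trans (by gcongr; exact hls k x))
      (fun k x => (hp k x).2.trans (by gcongr; exact hls k x))
    refine ⟨W, hW, hwW, fun x => ?_, fun x => ?_⟩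
    · refine le_trans ?_ (cs fun k => latticeSmooth k (a k) x)
      gcongr
      exact (hW0 x).trans (ENNReal.tsum_le_tsum fun k => (hp k x).1)
    · refine le_trans ?_ (cs fun k => latticeSmooth k (a k) x)
      gcongr
      exact (hW1 x).trans (ENNReal.tsum_le_tsum fun k => (hp k x).2)

end Envelope

section Nonlinearity

variable {V : Type*} [NormedAddCommGroup V] [NormedSpace ℝ V] [FiniteDimensional ℝ V]

/-- A smooth function that vanishes to second order is quadratically small on the unit ball, and its
derivative is linearly small. -/
theorem exists_quadratic_bound {h : V → ℝ} (hh : ContDiff ℝ ∞ h)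
    (hq : h =O[𝓝 0] fun y => ‖y‖ ^ 2) :
    ∃ C : ℝ≥0, ∀ z, ‖z‖ ≤ 1 → ‖h z‖ ≤ C * ‖z‖ ^ 2 ∧ ‖fderiv ℝ h z‖ ≤ C * ‖z‖ := by
  have h0 : fderiv ℝ h 0 = 0 := by
    have : h =O[𝓝 0] fun y => ‖y - 0‖ ^ 2 := by simpa using hq
    exact (this.hasFDerivAt (by norm_num)).fderiv
  have hz : h 0 = 0 := by
    simpa using hq.eq_zero_imp.self_of_nhds (by simp)
  have hd : ContDiff ℝ 1 (fderiv ℝ h) := hh.fderiv_right (by norm_cast)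
  obtain ⟨C, hC⟩ := (hd.contDiffOn (s := Metric.closedBall 0 1)).exists_lipschitzOnWith (by norm_num)
    (convex_closedBall _ _) (isCompact_closedBall _ _)
  have h1 : ∀ z, ‖z‖ ≤ 1 → ‖fderiv ℝ h z‖ ≤ C * ‖z‖ := fun z hz1 => by
    have := hC.norm_sub_le (x := z) (y := 0) (by simpa using hz1) (by simp)
    simpa [h0] using this
  refine ⟨C, fun z hz1 => ⟨?_, h1 z hz1⟩⟩
  have := (convex_closedBall (0 : V) ‖z‖).norm_image_sub_le_of_norm_fderiv_le (𝕜 := ℝ) (f := h)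
    (C := C * ‖z‖) (x := 0) (y := z) (fun x _ => (hh.differentiable (by norm_num)) x)
    (fun x hx => by
      have hx' : ‖x‖ ≤ ‖z‖ := by simpa using hx
      exact (h1 x (hx'.trans hz1)).trans (by gcongr)) (by simp) (by simp)
  rw [hz] at this
  simpa [sq, mul_assoc] using this

end Nonlinearity

/-- The convolution with the absolute value of a kernel. -/
def absConv (κ : Rd d → ℂ) (P : Rd d → ℝ≥0∞) (x : Rd d) : ℝ≥0∞ := ∫⁻ y, ‖κ y‖ₑ * P (x - y)

theorem measurable_absConv (κ : 𝓢(Rd d, ℂ)) (hP : Measurable P) :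
    Measurable (absConv κ P) := by
  unfold absConv
  apply Measurable.lintegral_prod_right'
    (f := fun p : Rd d × Rd d => ‖κ p.2‖ₑ * P (p.1 - p.2))
  exact (κ.continuous.enorm.measurable.comp measurable_snd).mul
    (hP.comp (measurable_fst.sub measurable_snd))

theorem absConv_le (κ : Rd d → ℂ) (hB : B ≠ ⊤) (hP : ∀ x, P x ≤ B)
    (x : Rd d) : absConv κ P x ≤ mom κ 0 * B := by
  unfold absConv mom
  rw [← lintegral_mul_const' _ _ hB]
  apply lintegral_mono
  intro y
  simp only [pow_zero, mul_one]
  gcongr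
  exact hP _

theorem lintegral_absConv_mul_le (κ : 𝓢(Rd d, ℂ)) (hP : Measurable P)
    (hPX : ∀ v : ℝ × Rd d → ℂ, AEStronglyMeasurable v (slab d) →
      ∫⁻ z, P z.2 * ‖v z‖ₑ ^ 2 ∂(slab d) ≤ B * Xsq v)
    {v : ℝ × Rd d → ℂ} (hv : AEStronglyMeasurable v (slab d)) :
    ∫⁻ z, absConv κ P z.2 * ‖v z‖ₑ ^ 2 ∂(slab d) ≤ mom κ 0 * 2 ^ d * B * Xsq v := by
  have hκ : Measurable fun y => ‖κ y‖ₑ := κ.continuous.enorm.measurable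
  have hm : AEMeasurable (fun p : (ℝ × Rd d) × Rd d => ‖κ p.2‖ₑ * P (p.1.2 - p.2) * ‖v p.1‖ₑ ^ 2)
      ((slab d).prod volume) := by
    have h1 : Measurable fun p : (ℝ × Rd d) × Rd d => ‖κ p.2‖ₑ * P (p.1.2 - p.2) :=
      (hκ.comp measurable_snd).mul (hP.comp ((measurable_snd.comp measurable_fst).sub measurable_snd))
    have h2 : AEMeasurable (fun p : (ℝ × Rd d) × Rd d => ‖v p.1‖ₑ ^ 2) ((slab d).prod volume) :=
      (hv.enorm.pow_const 2).comp_quasiMeasurePreserving Measure.quasiMeasurePreserving_fst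
    exact h1.aemeasurable.mul h2
  have : SFinite (slab d) := by unfold slab; infer_instance
  calc _ = ∫⁻ z, (∫⁻ y, ‖κ y‖ₑ * P (z.2 - y) * ‖v z‖ₑ ^ 2) ∂(slab d) := by
        apply lintegral_congr
        intro z
        rw [absConv, lintegral_mul_const']
        finiteness
    _ = ∫⁻ y, (∫⁻ z, ‖κ y‖ₑ * P (z.2 - y) * ‖v z‖ₑ ^ 2 ∂(slab d)) := lintegral_lintegral_swap hm
    _ ≤ ∫⁻ y, ‖κ y‖ₑ * (2 ^ d * B * Xsq v) := by
        apply lintegral_mono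
        intro y
        simp only
        have e : ∀ z : ℝ × Rd d, ‖κ y‖ₑ * P (z.2 - y) * ‖v z‖ₑ ^ 2 =
            ‖κ y‖ₑ * (fun z' : ℝ × Rd d => P z'.2 * ‖v (z'.1, z'.2 - -y)‖ₑ ^ 2) (z.1, z.2 - y) := by
          intro z; simp [mul_assoc]
        simp_rw [e]
        rw [lintegral_const_mul' _ _ (by finiteness), lintegral_slab_translate y
          (fun z' : ℝ × Rd d => P z'.2 * ‖v (z'.1, z'.2 - -y)‖ₑ ^ 2)]
        refine mul_le_mul' le_rfl ?_
        have hv' : AEStronglyMeasurable (fun z : ℝ × Rd d => v (z.1, z.2 - -y)) (slab d) := by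
          simpa [Function.comp_def] using hv.comp_measurePreserving (slab_translate y)
        refine (hPX _ hv').trans ?_
        calc _ ≤ B * (2 ^ d * Xsq v) := by gcongr; exact Xsq_translate hv (-y)
          _ = _ := by ring
    _ = _ := by
        rw [lintegral_mul_const _ hκ, mom]
        simp only [pow_zero, mul_one]
        ring

theorem enorm_cv_le_absConv (κ : Rd d → ℂ) {v : Rd d → ℂ}
    (hv : ∀ x, ‖v x‖ₑ ≤ P x) (x : Rd d) : ‖cv κ v x‖ₑ ≤ absConv κ P x := by
  rw [cv_eq_integral_sub]
  refine (enorm_integral_le_lintegral_enorm _).trans (lintegral_mono fun y => ?_)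
  simp only [enorm_smul]
  gcongr
  exact hv _

theorem cv_fderiv_apply_eq_cv_fderiv (κ : 𝓢(Rd d, ℂ)) {v : Rd d → ℂ} (hv : ContDiff ℝ 1 v)
    {B : ℝ} (h0 : ∀ x, ‖v x‖ ≤ B) (h1 : ∀ x, ‖fderiv ℝ v x‖ ≤ B) (x e : Rd d) :
    fderiv ℝ (cv κ v) x e = cv κ (fun y => fderiv ℝ v y e) x := by
  have hc : ConvDefined v := ConvDefined.of_bounded hv.continuous.aestronglyMeasurable B
    (Eventually.of_forall h0)
  have hc' : ConvDefined fun y => fderiv ℝ v y e :=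
    ConvDefined.of_bounded ((hv.continuous_fderiv (by norm_num)).clm_apply continuous_const).aestronglyMeasurable (B * ‖e‖)
    (Eventually.of_forall fun y => (ContinuousLinearMap.le_opNorm _ _).trans (by gcongr; exact h1 y))
  rw [cv_fderiv_apply κ hc]
  have hk : ∀ y, fderiv ℝ (fun y => κ (x - y)) y e = - (∂_{e} κ : 𝓢(Rd d, ℂ)) (x - y) := by
    intro y
    have h2 : HasFDerivAt (fun y : Rd d => x - y) (-ContinuousLinearMap.id ℝ (Rd d)) y :=
      (hasFDerivAt_id y).const_sub x
    have h3 := ((κ.differentiableAt (x := x - y)).hasFDerivAt).comp y h2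
    rw [show (fun y => κ (x - y)) = (κ ∘ fun y => x - y) from rfl, h3.fderiv]
    simp [SchwartzMap.lineDerivOp_apply_eq_fderiv]
  have ibp := integral_mul_fderiv_eq_neg_fderiv_mul_of_integrable (μ := (volume : Measure (Rd d)))
    (f := fun y => κ (x - y)) (g := v) (v := e)
    (by simp_rw [hk, neg_mul]; exact (hc.integrable (∂_{e} κ : 𝓢(Rd d, ℂ)) x).neg)
    (hc'.integrable κ x) (hc.integrable κ x)
    (fun y _ => (κ.differentiable.comp (by fun_prop : Differentiable ℝ fun y : Rd d => x - y)) y)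
    (fun y _ => hv.differentiable (by norm_num) y)
  unfold cv
  simp only [smul_eq_mul]
  rw [ibp]
  simp_rw [hk, neg_mul]
  rw [integral_neg, neg_neg]

theorem enorm_fderiv_cv_le_absConv (κ : 𝓢(Rd d, ℂ)) {v : Rd d → ℂ} (hv : ContDiff ℝ 1 v)
    (hB : B ≠ ⊤) (hP : ∀ x, P x ≤ B) (h0 : ∀ x, ‖v x‖ₑ ≤ P x)
    (h1 : ∀ x, ‖fderiv ℝ v x‖ₑ ≤ P x) (x : Rd d) :
    ‖fderiv ℝ (cv κ v) x‖ₑ ≤ d * absConv κ P x := by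
  refine (opENorm_le_sum_basis _).trans ?_
  have hreal : ∀ {E : Type} [NormedAddCommGroup E] (a : E), ‖a‖ₑ ≤ B → ‖a‖ ≤ B.toReal := by
    intro E _ a ha
    have := ENNReal.toReal_mono hB ha
    simpa using this
  calc _ ≤ ∑ i : Fin d, absConv κ P x := by
        refine Finset.sum_le_sum fun i _ => ?_
        rw [cv_fderiv_apply_eq_cv_fderiv κ hv (B := B.toReal)
          (fun x => hreal _ ((h0 x).trans (hP x))) (fun x => hreal _ ((h1 x).trans (hP x)))]
        refine enorm_cv_le_absConv κ (fun y => ?_) x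
        refine (ContinuousLinearMap.le_opENorm _ _).trans ?_
        refine le_trans ?_ (h1 y)
        rw [show ‖(eb i : Rd d)‖ₑ = 1 by rw [← ofReal_norm]; simp, mul_one]
    _ = _ := by simp

theorem aestronglyMeasurable_cv (κ : 𝓢(Rd d, ℂ)) {v : ℝ × Rd d → ℂ}
    (hv : AEStronglyMeasurable v (slab d)) :
    AEStronglyMeasurable (fun z : ℝ × Rd d => cv κ (fun y => v (z.1, y)) z.2) (slab d) := by
  unfold cv
  apply AEStronglyMeasurable.integral_prod_right' (μ := slab d) (ν := (volume : Measure (Rd d)))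
    (f := fun p : (ℝ × Rd d) × Rd d => κ (p.1.2 - p.2) • v (p.1.1, p.2))
  have h1 : AEStronglyMeasurable (fun p : (ℝ × Rd d) × Rd d => κ (p.1.2 - p.2))
      ((slab d).prod volume) := (κ.continuous.comp (by fun_prop)).aestronglyMeasurable
  have h2 : AEStronglyMeasurable (fun p : (ℝ × Rd d) × Rd d => v (p.1.1, p.2))
      ((slab d).prod volume) := by
    refine hv.comp_quasiMeasurePreserving (f := fun p : (ℝ × Rd d) × Rd d => (p.1.1, p.2)) ?_
    unfold slab
    exact QuasiMeasurePreserving.prodMap Measure.quasiMeasurePreserving_fst (.id _)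
  exact h1.smul h2

theorem cv_real {κ : Rd d → ℂ} (hκ : ∀ x, ((κ x).re : ℂ) = κ x) (v : Rd d → ℝ) (x : Rd d) :
    (((cv κ (fun y => ((v y : ℝ) : ℂ)) x).re : ℝ) : ℂ) = cv κ (fun y => ((v y : ℝ) : ℂ)) x := by
  have : cv κ (fun y => ((v y : ℝ) : ℂ)) x = ((∫ y, (κ (x - y)).re * v y : ℝ) : ℂ) := by
    unfold cv
    rw [← integral_complex_ofReal]
    congr 1
    ext y
    rw [smul_eq_mul, ← hκ (x - y)]
    push_cast
    simp
  rw [this, Complex.ofReal_re]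

/-- A small perturbation `H` of the flat metric: it and its gradient are bounded by a time
independent function `P` that is small as a weight on the space `X`. -/
structure TamePerturbation (H : Coeff d) (P : Rd d → ℝ≥0∞) (B : ℝ≥0∞) :
    Prop where
  measurable_bound : Measurable P
  bound_le_one : ∀ x, P x ≤ 1
  bound_le : ∀ v : ℝ × Rd d → ℂ, AEStronglyMeasurable v (slab d) →
    ∫⁻ z, P z.2 * ‖v z‖ₑ ^ 2 ∂(slab d) ≤ B * Xsq v
  contDiff : ∀ᵐ t ∂tm, ∀ k l, ContDiff ℝ 1 fun x => H k l (t, x)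
  symm : ∀ᵐ t ∂tm, ∀ k l x, H k l (t, x) = H l k (t, x)
  enorm_le : ∀ᵐ t ∂tm, ∀ k l x, ‖H k l (t, x)‖ₑ ≤ P x
  enorm_fderiv_le : ∀ᵐ t ∂tm, ∀ k l x, ‖fderiv ℝ (fun y => H k l (t, y)) x‖ₑ ≤ P x
  measurable : ∀ k l, AEStronglyMeasurable (H k l) (slab d)
  measurable_fderiv : ∀ k l e, AEStronglyMeasurable
    (fun z => fderiv ℝ (fun y => H k l (z.1, y)) z.2 e) (slab d)

theorem contDiff_enorm_comp_le {V : Type*} [NormedAddCommGroup V] [NormedSpace ℝ V] {h : V → ℝ}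
    (hh : ContDiff ℝ ∞ h) {C : ℝ≥0}
    (hC : ∀ z, ‖z‖ ≤ 1 → ‖h z‖ ≤ C * ‖z‖ ^ 2 ∧ ‖fderiv ℝ h z‖ ≤ C * ‖z‖) {W : Rd d → V}
    (hW : ContDiff ℝ 1 W) (hP : ∀ x, P x ≤ 1) (h0 : ∀ x, ‖W x‖ₑ ^ 2 ≤ P x)
    (h1 : ∀ x, ‖fderiv ℝ W x‖ₑ ^ 2 ≤ P x) :
    ContDiff ℝ 1 (fun x => ((h (W x) : ℝ) : ℂ)) ∧ (∀ x, ‖((h (W x) : ℝ) : ℂ)‖ₑ ≤ C * P x) ∧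
      ∀ x, ‖fderiv ℝ (fun x => ((h (W x) : ℝ) : ℂ)) x‖ₑ ≤ C * P x := by
  have hW1 : ∀ x, ‖W x‖ ≤ 1 := fun x => by
    have : ‖W x‖ₑ ≤ 1 := by
      rw [← ENNReal.pow_le_pow_left_iff two_ne_zero, one_pow]
      exact (h0 x).trans (hP x)
    rwa [← ofReal_norm, ENNReal.ofReal_le_one] at this
  have hc : ContDiff ℝ 1 h := hh.of_le (by norm_cast)
  refine ⟨Complex.ofRealCLM.contDiff.comp (hc.comp hW), fun x => ?_, fun x => ?_⟩
  · rw [← ofReal_norm, Complex.norm_real]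
    refine (ENNReal.ofReal_le_ofReal (hC _ (hW1 x)).1).trans ?_
    rw [ENNReal.ofReal_mul (by positivity), ENNReal.ofReal_pow (by positivity), ofReal_norm,
      ENNReal.ofReal_coe_nnreal]
    gcongr
    exact h0 x
  · have hd : HasFDerivAt (fun x => ((h (W x) : ℝ) : ℂ))
        (Complex.ofRealCLM.comp ((fderiv ℝ h (W x)).comp (fderiv ℝ W x))) x :=
      Complex.ofRealCLM.hasFDerivAt.comp x
        (((hc.differentiable (by norm_num) _).hasFDerivAt).comp x
          (hW.differentiable (by norm_num) x).hasFDerivAt)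
    rw [hd.fderiv, ← ofReal_norm]
    have hn : ‖Complex.ofRealCLM.comp ((fderiv ℝ h (W x)).comp (fderiv ℝ W x))‖
        ≤ C * (‖W x‖ * ‖fderiv ℝ W x‖) := by
      refine (ContinuousLinearMap.opNorm_comp_le _ _).trans ?_
      rw [Complex.ofRealCLM_norm, one_mul]
      refine (ContinuousLinearMap.opNorm_comp_le _ _).trans ?_
      rw [← mul_assoc]
      gcongr
      exact (hC _ (hW1 x)).2
    refine (ENNReal.ofReal_le_ofReal hn).trans ?_
    rw [ENNReal.ofReal_mul (by positivity), ENNReal.ofReal_mul (by positivity), ofReal_norm,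
      ofReal_norm, ENNReal.ofReal_coe_nnreal]
    gcongr
    rw [← ENNReal.pow_le_pow_left_iff two_ne_zero, mul_pow, sq (P x)]
    gcongr
    · exact h0 x
    · exact h1 x

/-- The truncated metrics of small functions in `l² X^s` are tame perturbations of the flat metric. -/
theorem exists_tamePerturbation {n : ℕ} {s : ℝ} (hs : ((d : ℝ) + 3) / 2 < s)
    (φ : LPBump d) (χ : CubePartition d) (h : EuclideanSpace ℂ (Fin n) → Matrix (Fin d) (Fin d) ℝ)
    (h_smooth : ∀ k l, ContDiff ℝ ∞ fun y => h y k l)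
    (h_symm : ∀ y, (h y).IsSymm)
    (h_quad : ∀ k l, (fun y => h y k l) =O[𝓝 0] fun y => ‖y‖ ^ 2) :
    ∃ C : ℝ≥0, ∀ (w : ℝ × Rd d → EuclideanSpace ℂ (Fin n))
      (g : ℝ × Rd d → Matrix (Fin d) (Fin d) ℝ), Meml2Xs φ χ s w → C * norml2Xs φ χ s w ^ 2 ≤ 1 →
        (∀ᵐ z ∂(slab d), g z - 1 = h (w z)) → ∀ N, ∃ H P,
          TamePerturbation H P (C * norml2Xs φ χ s w ^ 2) ∧ ∀ᵐ t ∂tm, ∀ k l x,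
            lowMetric φ N g k l (t, x) =
              (((1 : Matrix (Fin d) (Fin d) ℝ) k l : ℝ) : ℂ) + ((H k l (t, x) : ℝ) : ℂ) := by
  obtain ⟨C₁, hC₁, henv⟩ := exists_envelope (V := EuclideanSpace ℂ (Fin n)) φ χ hs
  choose Ch hCh using fun k l => exists_quadratic_bound (h_smooth k l) (h_quad k l)
  set C₂ : ℝ≥0 := ∑ k, ∑ l, Ch k l with hC₂
  have hC₂' : ∀ k l, Ch k l ≤ C₂ := fun k l =>
    (Finset.single_le_sum (f := fun l => Ch k l) (fun _ _ => zero_le) (Finset.mem_univ l)).trans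
      (Finset.single_le_sum (f := fun k => ∑ l, Ch k l) (fun _ _ => zero_le) (Finset.mem_univ k))
  have hm0 : mom (φ.Phi 0) 0 < ⊤ := mom_lt_top _ _
  set D : ℝ≥0∞ := (d + 1) * C₂ * mom (φ.Phi 0) 0 * 2 ^ d * C₁ with hD
  have hDt : D ≠ ⊤ := by rw [hD]; finiteness
  refine ⟨C₁.toNNReal + D.toNNReal, fun w g hw hsmall hg N => ?_⟩
  set M := norml2Xs φ χ s w ^ 2 with hM
  have hMt : M < ⊤ := ENNReal.pow_lt_top hw.finite
  rw [ENNReal.coe_add, ENNReal.coe_toNNReal hC₁.ne, ENNReal.coe_toNNReal hDt] at hsmall ⊢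
  obtain ⟨P, hPm, hP1, hPX, hW⟩ := henv w hw
  have hC1 : C₁ * M ≤ 1 := le_trans (by gcongr; exact le_self_add) hsmall
  have hP1' : ∀ x, P x ≤ 1 := fun x => (hP1 x).trans hC1
  have hslices : ∀ᵐ t ∂tm, ∀ᵐ y, g (t, y) - 1 = h (w (t, y)) := Measure.ae_ae_of_ae_prod hg
  have toz : ∀ {p : ℝ → Prop}, (∀ᵐ t ∂tm, p t) → ∀ᵐ z ∂(slab d), p z.1 := fun hp =>
    Measure.quasiMeasurePreserving_fst.ae hp
  set G : Fin d → Fin d → ℝ × Rd d → ℂ := fun k l z => (((g z - 1) k l : ℝ) : ℂ) with hG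
  have hGm : ∀ k l, AEStronglyMeasurable (G k l) (slab d) := fun k l => by
    have h1 : AEStronglyMeasurable (fun z => ((h (w z) k l : ℝ) : ℂ)) (slab d) :=
      (Complex.continuous_ofReal.comp (h_smooth k l).continuous).comp_aestronglyMeasurable hw.measurable
    refine h1.congr ?_
    filter_upwards [hg] with z hz
    simp only [hG, hz]
  cases N with
  | zero =>
    refine ⟨fun _ _ _ => 0, 0, ⟨measurable_zero, by simp, by simp, ?_, by simp,
      Eventually.of_forall (by simp), Eventually.of_forall fun t k l x => ?_, ?_, ?_⟩, ?_⟩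
    · exact Eventually.of_forall fun _ _ _ => contDiff_const
    · rw [fderiv_fun_const]
      exact (enorm_zero (E := Rd d →L[ℝ] ℝ)).le
    · exact fun _ _ => aestronglyMeasurable_const
    · intro k l e; simpa using aestronglyMeasurable_const
    · refine Eventually.of_forall fun t k l x => ?_
      simp [lowMetric, φ.low_zero]
  | succ N =>
    set κ := φ.Phi N with hκ
    have key : ∀ᵐ t ∂tm, ∀ k l, ∃ v : Rd d → ℝ, ContDiff ℝ 1 (fun y => ((v y : ℝ) : ℂ)) ∧
        (∀ x, ‖((v x : ℝ) : ℂ)‖ₑ ≤ C₂ * P x) ∧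
        (∀ x, ‖fderiv ℝ (fun x => ((v x : ℝ) : ℂ)) x‖ₑ ≤ C₂ * P x) ∧
        (fun y => G k l (t, y)) =ᵐ[volume] (fun y => ((v y : ℝ) : ℂ)) := by
      filter_upwards [hslices, hW] with t ht hWt k l
      obtain ⟨hwt, W, hWc, hwW, hW0, hW1⟩ := hWt
      obtain ⟨c1, c2, c3⟩ := contDiff_enorm_comp_le (h_smooth k l) (C := C₂) (fun z hz =>
        ⟨((hCh k l) z hz).1.trans (by gcongr; exact hC₂' k l),
          ((hCh k l) z hz).2.trans (by gcongr; exact hC₂' k l)⟩) hWc hP1' hW0 hW1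
      refine ⟨fun y => h (W y) k l, c1, c2, c3, ?_⟩
      filter_upwards [ht, hwW] with y hy hy'
      simp only [hG, hy]
      rw [show w (t, y) = W y from hy']
    have hCP : ∀ x, C₂ * P x ≤ C₂ * (C₁ * M) := fun x => by gcongr; exact hP1 x
    have hCPt : (C₂ : ℝ≥0∞) * (C₁ * M) ≠ ⊤ :=
      ENNReal.mul_ne_top ENNReal.coe_ne_top (ENNReal.mul_lt_top hC₁ hMt).ne
    set Q : Rd d → ℝ≥0∞ := fun x => (d + 1) * absConv κ (fun x => C₂ * P x) x with hQ
    have hQ1 : ∀ x, absConv κ (fun x => C₂ * P x) x ≤ Q x := fun x => by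
      rw [hQ]; exact le_mul_of_one_le_left' le_add_self
    have hQ2 : ∀ x, d * absConv κ (fun x => C₂ * P x) x ≤ Q x := fun x => by
      simp only [hQ]; gcongr; exact le_self_add
    have hDM : D * M ≤ (C₁ + D) * M := by gcongr; exact le_add_self
    set H : Coeff d := fun k l z =>
      (cv κ (fun y => G k l (z.1, y)) z.2).re with hH
    have facts : ∀ᵐ t ∂tm, ∀ k l, ConvDefined (fun y => G k l (t, y)) ∧
        (∀ x, ‖cv κ (fun y => G k l (t, y)) x‖ₑ ≤ Q x) ∧
        (∀ x, ‖fderiv ℝ (cv κ (fun y => G k l (t, y))) x‖ₑ ≤ Q x) := by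
      filter_upwards [key] with t ht k l
      obtain ⟨v, c1, c2, c3, c4⟩ := ht k l
      have e : cv κ (fun y => G k l (t, y)) = cv κ (fun y => ((v y : ℝ) : ℂ)) := by
        ext x
        apply integral_congr_ae
        filter_upwards [c4] with y hy
        rw [hy]
      refine ⟨?_, fun x => ?_, fun x => ?_⟩
      · refine ConvDefined.of_bounded (c1.continuous.aestronglyMeasurable.congr c4.symm)
          (C₂ * (C₁ * M)).toReal ?_
        filter_upwards [c4] with y hy
        rw [hy]
        have := ENNReal.toReal_mono hCPt ((c2 y).trans (hCP y))
        simpa using this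
      · rw [e]
        exact (enorm_cv_le_absConv κ c2 x).trans (hQ1 x)
      · rw [e]
        exact (enorm_fderiv_cv_le_absConv κ c1 hCPt hCP c2 c3 x).trans (hQ2 x)
    have hder : ∀ {t : ℝ} {k l : Fin d}, ConvDefined (fun y => G k l (t, y)) → ∀ x,
        HasFDerivAt (fun y => H k l (t, y))
          (Complex.reCLM.comp (fderiv ℝ (cv κ (fun y => G k l (t, y))) x)) x := fun hc x =>
      Complex.reCLM.hasFDerivAt.comp x
        ((cv_contDiff κ hc).differentiable (by norm_num) x).hasFDerivAt
    refine ⟨H, Q, ⟨(measurable_absConv κ (hPm.const_mul _)).const_mul _, ?_, ?_, ?_, ?_, ?_, ?_, ?_, ?_⟩, ?_⟩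
    · intro x
      refine le_trans ?_ (hDM.trans hsmall)
      calc Q x ≤ (d + 1) * (mom (φ.Phi 0) 0 * (C₂ * (C₁ * M))) := by
            simp only [hQ]
            gcongr
            refine (absConv_le κ hCPt hCP x).trans ?_
            gcongr
            exact φ.mom_Phi N 0
        _ = (d + 1) * C₂ * mom (φ.Phi 0) 0 * 1 * C₁ * M := by ring
        _ ≤ D * M := by
            rw [hD]
            gcongr
            exact one_le_pow₀ (by norm_num)
    · intro v hv
      refine le_trans ?_ (mul_le_mul_left hDM _)
      have h1 := lintegral_absConv_mul_le κ (hPm.const_mul (C₂ : ℝ≥0∞)) (B := C₂ * (C₁ * M)) (fun v hv => by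
        simp_rw [mul_assoc (C₂ : ℝ≥0∞)]
        rw [lintegral_const_mul' _ _ ENNReal.coe_ne_top]
        refine mul_le_mul' le_rfl ?_
        exact hPX v hv) hv
      calc _ = (d + 1) * ∫⁻ z, absConv κ (fun x => C₂ * P x) z.2 * ‖v z‖ₑ ^ 2 ∂(slab d) := by
            rw [← lintegral_const_mul' _ _ (by finiteness)]
            simp_rw [hQ, mul_assoc]
        _ ≤ (d + 1) * (mom (φ.Phi 0) 0 * 2 ^ d * (C₂ * (C₁ * M)) * Xsq v) := by
            gcongr
            refine h1.trans ?_
            gcongr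
            exact φ.mom_Phi N 0
        _ = _ := by rw [hD]; ring
    · filter_upwards [facts] with t ht k l
      exact Complex.reCLM.contDiff.comp ((cv_contDiff κ (ht k l).1).of_le (by norm_cast))
    · filter_upwards [hslices] with t ht k l x
      simp only [hH]
      congr 1
      apply integral_congr_ae
      filter_upwards [ht] with y hy
      simp only [hG, hy]
      rw [(h_symm (w (t, y))).apply]
    · filter_upwards [facts] with t ht k l x
      refine le_trans ?_ ((ht k l).2.1 x)
      rw [← ofReal_norm, ← ofReal_norm]
      exact ENNReal.ofReal_le_ofReal (Complex.abs_re_le_norm _)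
    · filter_upwards [facts] with t ht k l x
      refine le_trans ?_ ((ht k l).2.2 x)
      rw [(hder (ht k l).1 x).fderiv, ← ofReal_norm, ← ofReal_norm]
      refine ENNReal.ofReal_le_ofReal ((ContinuousLinearMap.opNorm_comp_le _ _).trans ?_)
      rw [Complex.reCLM_norm, one_mul]
    · intro k l
      exact Complex.continuous_re.comp_aestronglyMeasurable (aestronglyMeasurable_cv κ (hGm k l))
    · intro k l e
      refine (Complex.continuous_re.comp_aestronglyMeasurable
        (aestronglyMeasurable_cv (∂_{e} κ : 𝓢(Rd d, ℂ)) (hGm k l))).congr ?_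
      filter_upwards [toz facts] with z hz
      rw [(hder (hz k l).1 z.2).fderiv]
      simp [cv_fderiv_apply κ (hz k l).1]
    · filter_upwards [facts] with t ht k l x
      rw [lowMetric]
      congr 1
      simp only
      rw [φ.low_succ (ht k l).1, hH]
      exact (cv_real (φ.Phi_real N) (fun y => (g (t, y) - 1) k l) x).symm

theorem exists_primitive {σ : ℝ → ℝ} (hσ : ContDiff ℝ ∞ σ) (hc : HasCompactSupport σ)
    (hs : tsupport σ ⊆ Ioo 0 1) (h0 : ∫ x in (0 : ℝ)..1, σ x = 0) :
    ∃ η : ℝ → ℝ, ContDiff ℝ ∞ η ∧ HasCompactSupport η ∧ tsupport η ⊆ Ioo 0 1 ∧ deriv η = σ := by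
  obtain ⟨a, b, ha, hb, hab⟩ : ∃ a b : ℝ, 0 < a ∧ b < 1 ∧ tsupport σ ⊆ Icc a b := by
    rcases (tsupport σ).eq_empty_or_nonempty with he | hne
    · exact ⟨1 / 2, 1 / 2, by norm_num, by norm_num, by simp [he]⟩
    · obtain ⟨a, ha⟩ := hc.isCompact.exists_isLeast hne
      obtain ⟨b, hb⟩ := hc.isCompact.exists_isGreatest hne
      exact ⟨a, b, (hs ha.1).1, (hs hb.1).2, fun x hx => ⟨ha.2 hx, hb.2 hx⟩⟩
  have hz : ∀ x, x ∉ Icc a b → σ x = 0 := fun x hx => by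
    by_contra h
    exact hx (hab (subset_tsupport _ h))
  have hi : ∀ p q : ℝ, IntervalIntegrable σ volume p q := fun p q =>
    hσ.continuous.intervalIntegrable p q
  have hd : ∀ x, HasDerivAt (fun x => ∫ t in (0 : ℝ)..x, σ t) (σ x) x := fun x =>
    intervalIntegral.integral_hasDerivAt_right (hi _ _)
      hσ.continuous.aestronglyMeasurable.stronglyMeasurableAtFilter hσ.continuous.continuousAt
  have hzero : ∀ x, x ∉ Icc a b → ∫ t in (0 : ℝ)..x, σ t = 0 := by
    intro x hx
    rw [mem_Icc, not_and_or, not_le, not_le] at hx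
    rcases hx with hx | hx
    · apply intervalIntegral.integral_zero_ae
      refine Eventually.of_forall fun t ht => hz t fun h => ?_
      have := ht.2
      rcases le_total 0 x with h' | h'
      · rw [max_eq_right h'] at this; linarith [h.1]
      · rw [max_eq_left h'] at this; linarith [h.1]
    · rw [← intervalIntegral.integral_add_adjacent_intervals (hi 0 1) (hi 1 x), h0, zero_add]
      apply intervalIntegral.integral_zero_ae
      refine Eventually.of_forall fun t ht => hz t fun h => ?_
      have := ht.1
      rcases le_total 1 x with h' | h'
      · rw [min_eq_left h'] at this; linarith [h.2]
      · rw [min_eq_right h'] at this; linarith [h.2]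
  have hsub : tsupport (fun x => ∫ t in (0 : ℝ)..x, σ t) ⊆ Icc a b :=
    closure_minimal (fun x hx => by by_contra h; exact hx (hzero x h)) isClosed_Icc
  have hde : deriv (fun x => ∫ t in (0 : ℝ)..x, σ t) = σ := funext fun x => (hd x).deriv
  refine ⟨fun x => ∫ t in (0 : ℝ)..x, σ t, ?_, ?_, ?_, hde⟩
  · exact contDiff_infty_iff_deriv.2 ⟨fun x => (hd x).differentiableAt, by rwa [hde]⟩
  · exact isCompact_Icc.of_isClosed_subset (isClosed_tsupport _) hsub
  · exact hsub.trans fun x hx => ⟨ha.trans_le hx.1, hx.2.trans_lt hb⟩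

/-- A continuous function with an integrable weak derivative is the integral of it. -/
theorem sub_eq_integral_of_weak_deriv {m φ : ℝ → ℝ} (hm : ContinuousOn m (Icc 0 1))
    (hφ : IntegrableOn φ (Icc 0 1))
    (h : ∀ η : ℝ → ℝ, ContDiff ℝ ∞ η → HasCompactSupport η → tsupport η ⊆ Ioo 0 1 →
      ∫ t in (0 : ℝ)..1, m t * deriv η t = -∫ t in (0 : ℝ)..1, φ t * η t) {t : ℝ}
    (ht : t ∈ 𝕀) : m t - m 0 = ∫ τ in (0 : ℝ)..t, φ τ := by
  have hφi : IntervalIntegrable φ volume 0 1 := by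
    rw [intervalIntegrable_iff_integrableOn_Icc_of_le zero_le_one]; exact hφ
  set M : ℝ → ℝ := fun t => ∫ τ in (0 : ℝ)..t, φ τ with hM
  have hMac : AbsolutelyContinuousOnInterval M 0 1 :=
    hφi.absolutelyContinuousOnInterval_intervalIntegral (by simp)
  have hMc : ContinuousOn M (Icc 0 1) := by
    have := hMac.continuousOn; rwa [uIcc_of_le zero_le_one] at this
  set D : ℝ → ℝ := fun t => m t - M t with hD
  have hDc : ContinuousOn D (Icc 0 1) := hm.sub hMc
  have hDi : ∀ η : ℝ → ℝ, Continuous η → IntervalIntegrable (fun t => D t * η t) volume 0 1 := by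
    intro η hη
    apply ContinuousOn.intervalIntegrable
    rw [uIcc_of_le zero_le_one]
    exact hDc.mul hη.continuousOn
  have hD0 : ∀ η : ℝ → ℝ, ContDiff ℝ ∞ η → HasCompactSupport η → tsupport η ⊆ Ioo 0 1 →
      ∫ t in (0 : ℝ)..1, D t * deriv η t = 0 := by
    intro η h1 h2 h3
    have hη0 : η 0 = 0 := by
      by_contra hh; have := h3 (subset_tsupport _ hh); simp at this
    have hη1 : η 1 = 0 := by
      by_contra hh; have := h3 (subset_tsupport _ hh); simp at this
    have hηd : Continuous (deriv η) := h1.continuous_deriv (by norm_cast)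
    have hηac : AbsolutelyContinuousOnInterval η 0 1 :=
      ContDiffOn.absolutelyContinuousOnInterval (h1.of_le (by norm_cast)).contDiffOn
    have ibp := hMac.integral_mul_deriv_eq_deriv_mul hηac
    have e1 : ∫ x in (0 : ℝ)..1, deriv M x * η x = ∫ x in (0 : ℝ)..1, φ x * η x := by
      apply intervalIntegral.integral_congr_ae
      filter_upwards [hφi.ae_hasDerivAt_integral] with x hx hx'
      rw [(hx (uIoc_subset_uIcc hx') 0 (by simp)).deriv]
    rw [hη0, hη1, e1] at ibp
    have e2 : ∫ t in (0 : ℝ)..1, D t * deriv η t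
        = (∫ t in (0 : ℝ)..1, m t * deriv η t) - ∫ t in (0 : ℝ)..1, M t * deriv η t := by
      rw [← intervalIntegral.integral_sub]
      · simp only [hD, sub_mul]
      · apply ContinuousOn.intervalIntegrable
        rw [uIcc_of_le zero_le_one]
        exact hm.mul hηd.continuousOn
      · apply ContinuousOn.intervalIntegrable
        rw [uIcc_of_le zero_le_one]
        exact hMc.mul hηd.continuousOn
    rw [e2, ibp, h η h1 h2 h3]
    ring
  let b : ContDiffBump (1 / 2 : ℝ) := ⟨1 / 8, 1 / 4, by norm_num, by norm_num⟩
  set ρ₀ : ℝ → ℝ := b.normed volume with hρ₀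
  have hρc : ContDiff ℝ ∞ ρ₀ := b.contDiff_normed
  have hρs : HasCompactSupport ρ₀ := b.hasCompactSupport_normed
  have hρt : tsupport ρ₀ ⊆ Ioo 0 1 := by
    rw [hρ₀, b.tsupport_normed_eq, Real.closedBall_eq_Icc]
    intro x hx
    constructor <;> norm_num [b] at hx ⊢ <;> linarith [hx.1, hx.2]
  have full : ∀ {F : ℝ → ℝ}, (∀ x, x ∉ Ioo (0 : ℝ) 1 → F x = 0) →
      ∫ x, F x = ∫ x in (0 : ℝ)..1, F x := by
    intro F hF
    rw [intervalIntegral.integral_of_le zero_le_one]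
    refine (setIntegral_eq_integral_of_forall_compl_eq_zero fun x hx => hF x fun h => ?_).symm
    exact hx (Ioo_subset_Ioc_self h)
  have out : ∀ {ρ : ℝ → ℝ}, tsupport ρ ⊆ Ioo 0 1 → ∀ x, x ∉ Ioo (0 : ℝ) 1 → ρ x = 0 :=
    fun h x hx => by by_contra hh; exact hx (h (subset_tsupport _ hh))
  have hρ1 : ∫ x in (0 : ℝ)..1, ρ₀ x = 1 := by
    rw [← full (out hρt)]; exact b.integral_normed
  set c₀ := ∫ x in (0 : ℝ)..1, D x * ρ₀ x with hc₀
  have hae : ∀ᵐ x : ℝ, x ∈ Ioo (0 : ℝ) 1 → D x - c₀ = 0 := by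
    refine isOpen_Ioo.ae_eq_zero_of_integral_contDiff_smul_eq_zero ?_ ?_
    · exact ((hDc.mono Ioo_subset_Icc_self).sub continuousOn_const).locallyIntegrableOn
        measurableSet_Ioo
    · intro ρ h1 h2 h3
      set c := ∫ x in (0 : ℝ)..1, ρ x with hc
      have hcρ : Continuous fun x => c * ρ₀ x := continuous_const.mul hρc.continuous
      have hsupp : tsupport (fun x => ρ x - c * ρ₀ x) ⊆ Ioo 0 1 := by
        refine (closure_minimal ?_ ((isClosed_tsupport ρ).union (isClosed_tsupport ρ₀))).trans
          (union_subset h3 hρt)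
        intro x hx
        by_contra hh
        rw [mem_union, not_or] at hh
        apply hx
        simp [image_eq_zero_of_notMem_tsupport hh.1, image_eq_zero_of_notMem_tsupport hh.2]
      obtain ⟨η, e1, e2, e3, e4⟩ := exists_primitive (σ := fun x => ρ x - c * ρ₀ x)
        (h1.sub (contDiff_const.mul hρc)) (h2.sub hρs.mul_left) hsupp (by
          rw [intervalIntegral.integral_sub (h1.continuous.intervalIntegrable _ _)
            (hcρ.intervalIntegrable _ _),
            intervalIntegral.integral_const_mul, hρ1, ← hc]
          ring)
      have e5 := hD0 η e1 e2 e3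
      rw [e4] at e5
      simp only [mul_sub] at e5
      rw [intervalIntegral.integral_sub (hDi _ h1.continuous) (hDi _ hcρ)] at e5
      have e6 : ∫ x in (0 : ℝ)..1, D x * (c * ρ₀ x) = c * c₀ := by
        rw [hc₀, ← intervalIntegral.integral_const_mul]
        congr 1; ext x; ring
      rw [e6] at e5
      rw [full fun x hx => by rw [out h3 x hx, zero_smul]]
      simp only [smul_eq_mul, mul_sub]
      rw [intervalIntegral.integral_sub, intervalIntegral.integral_mul_const, ← hc]
      · simp_rw [mul_comm (ρ _)]
        exact e5
      · simpa only [mul_comm] using hDi ρ h1.continuous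
      · exact (h1.continuous.mul continuous_const).intervalIntegrable _ _
  have hEq : EqOn D (fun _ => c₀) (Icc 0 1) := by
    refine Measure.eqOn_Icc_of_ae_eq (μ := volume) zero_ne_one ?_ hDc continuousOn_const
    rw [← restrict_Ioo_eq_restrict_Icc]
    filter_upwards [ae_restrict_of_ae hae, ae_restrict_mem measurableSet_Ioo] with x hx hx'
    linarith [hx hx']
  have a1 := hEq ht
  have a2 := hEq (left_mem_Icc.2 zero_le_one)
  simp only [hD, hM, intervalIntegral.integral_same] at a1 a2
  linarith

theorem sub_eq_integral_of_weak_deriv_complex {m φ : ℝ → ℂ} (hm : ContinuousOn m (Icc 0 1))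
    (hφ : IntegrableOn φ (Icc 0 1))
    (h : ∀ η : ℝ → ℝ, ContDiff ℝ ∞ η → HasCompactSupport η → tsupport η ⊆ Ioo 0 1 →
      ∫ t in 𝕀, ((deriv η t : ℝ) : ℂ) * m t = -∫ t in 𝕀, (η t : ℂ) * φ t)
    {t : ℝ} (ht : t ∈ 𝕀) : m t - m 0 = ∫ τ in (0 : ℝ)..t, φ τ := by
  have hφi : IntervalIntegrable φ volume 0 t := by
    rw [intervalIntegrable_iff_integrableOn_Icc_of_le ht.1]
    exact hφ.mono_set (Icc_subset_Icc_right ht.2)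
  have key : ∀ η : ℝ → ℝ, ContDiff ℝ ∞ η → HasCompactSupport η → tsupport η ⊆ Ioo 0 1 →
      ∀ L : ℂ →L[ℝ] ℝ, ∫ t in (0 : ℝ)..1, L (m t) * deriv η t = -∫ t in (0 : ℝ)..1, L (φ t) * η t := by
    intro η h1 h2 h3 L
    have e := congrArg L (h η h1 h2 h3)
    have hηd : Continuous (deriv η) := h1.continuous_deriv (by norm_cast)
    have i1 : IntegrableOn (fun t => ((deriv η t : ℝ) : ℂ) * m t) (Icc 0 1) :=
      ((Complex.continuous_ofReal.comp hηd).continuousOn.mul hm).integrableOn_Icc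
    have i2 : IntegrableOn (fun t => (η t : ℂ) * φ t) (Icc 0 1) :=
      hφ.continuousOn_mul (Complex.continuous_ofReal.comp h1.continuous).continuousOn isCompact_Icc
    rw [map_neg, ← L.integral_comp_comm i1, ← L.integral_comp_comm i2] at e
    rw [intervalIntegral.integral_of_le zero_le_one, intervalIntegral.integral_of_le zero_le_one,
      ← integral_Icc_eq_integral_Ioc, ← integral_Icc_eq_integral_Ioc]
    have hL : ∀ (r : ℝ) (z : ℂ), L ((r : ℂ) * z) = L z * r := fun r z => by
      rw [← Complex.real_smul, map_smul, smul_eq_mul, mul_comm]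
    simp_rw [hL] at e
    exact e
  have fin : ∀ L : ℂ →L[ℝ] ℝ, L (m t - m 0) = L (∫ τ in (0 : ℝ)..t, φ τ) := by
    intro L
    rw [map_sub, ← L.intervalIntegral_comp_comm hφi]
    exact sub_eq_integral_of_weak_deriv (L.continuous.comp_continuousOn hm)
      (L.integrable_comp hφ) (fun η h1 h2 h3 => key η h1 h2 h3 L) ht
  apply Complex.ext
  · exact fin Complex.reCLM
  · exact fin Complex.imCLM

theorem slab_eq : slab d = ((volume : Measure ℝ).prod (volume : Measure (Rd d))).restrict
    (𝕀 ×ˢ univ) := by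
  rw [slab, ← Measure.prod_restrict, Measure.restrict_univ]

theorem ae_slab_mem : ∀ᵐ z ∂(slab d), z ∈ 𝕀 ×ˢ (univ : Set (Rd d)) := by
  rw [slab_eq]
  exact ae_restrict_mem (measurableSet_Icc.prod MeasurableSet.univ)

theorem ae_slab_of_ae_tm {p : ℝ → Prop} (hp : ∀ᵐ t ∂tm, p t) : ∀ᵐ z ∂(slab d), p z.1 :=
  Measure.quasiMeasurePreserving_fst.ae hp

theorem ae_tm_mem : ∀ᵐ t ∂tm, t ∈ 𝕀 := ae_restrict_mem measurableSet_Icc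

theorem slab_restrict (K : Set (Rd d)) : (slab d).restrict (univ ×ˢ K) =
    ((volume : Measure ℝ).prod (volume : Measure (Rd d))).restrict (𝕀 ×ˢ K) := by
  rw [slab, ← Measure.prod_restrict, Measure.restrict_univ, ← Measure.prod_restrict]

theorem continuousOn_aestronglyMeasurable {E : Type*} [NormedAddCommGroup E] {F : ℝ × Rd d → E}
    (hF : ContinuousOn F (𝕀 ×ˢ univ)) : AEStronglyMeasurable F (slab d) := by
  rw [slab_eq]
  exact hF.aestronglyMeasurable (measurableSet_Icc.prod MeasurableSet.univ)

theorem continuousOn_integrableOn {E : Type*} [NormedAddCommGroup E] {F : ℝ × Rd d → E}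
    (hF : ContinuousOn F (𝕀 ×ˢ univ)) {K : Set (Rd d)} (hK : IsCompact K) :
    IntegrableOn F (univ ×ˢ K) (slab d) := by
  rw [IntegrableOn, slab_restrict]
  exact (hF.mono (prod_mono le_rfl (subset_univ _))).integrableOn_compact (isCompact_Icc.prod hK)

/-- A locally integrable function stays integrable after multiplication with a bounded function of
spatially compact support. -/
theorem integrable_smul_of_bounded {V : Type*} [NormedAddCommGroup V] [NormedSpace ℂ V]
    {u : ℝ × Rd d → V} {K : Set (Rd d)} (hu : IntegrableOn u (univ ×ˢ K) (slab d))
    {F : ℝ × Rd d → ℂ} (hF : AEStronglyMeasurable F (slab d)) {C : ℝ}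
    (hC : ∀ᵐ z ∂(slab d), ‖F z‖ ≤ C) (h0 : ∀ᵐ z ∂(slab d), z.2 ∉ K → F z = 0) :
    Integrable (fun z => F z • u z) (slab d) := by
  have h1 : IntegrableOn (fun z => F z • u z) (univ ×ˢ K) (slab d) :=
    Integrable.bdd_smul hu C hF.restrict (ae_restrict_of_ae hC)
  refine h1.integrable_of_ae_notMem_eq_zero ?_
  filter_upwards [h0] with z hz hzK
  rw [hz (fun h => hzK ⟨mem_univ _, h⟩), zero_smul]

theorem dx_eq {ψ : ℝ × Rd d → ℂ} (hψ : Differentiable ℝ ψ) (k : Fin d) (z : ℝ × Rd d) :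
    dx k ψ z = fderiv ℝ ψ z (0, eb k) := by
  have h1 : HasFDerivAt (fun x : Rd d => (z.1, x)) (ContinuousLinearMap.inr ℝ ℝ (Rd d)) z.2 :=
    hasFDerivAt_prodMk_right z.1 z.2
  have h2 : HasFDerivAt (fun x : Rd d => ψ (z.1, x))
      ((fderiv ℝ ψ z).comp (ContinuousLinearMap.inr ℝ ℝ (Rd d))) z.2 :=
    (hψ z).hasFDerivAt.comp z.2 h1
  rw [dx, h2.fderiv]
  simp

theorem dt_eq {ψ : ℝ × Rd d → ℂ} (hψ : Differentiable ℝ ψ) (z : ℝ × Rd d) :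
    dt ψ z = fderiv ℝ ψ z (1, 0) := by
  have h1 : HasFDerivAt (fun t : ℝ => (t, z.2)) (ContinuousLinearMap.inl ℝ ℝ (Rd d)) z.1 :=
    hasFDerivAt_prodMk_left z.1 z.2
  have h2 : HasFDerivAt (fun t : ℝ => ψ (t, z.2))
      ((fderiv ℝ ψ z).comp (ContinuousLinearMap.inl ℝ ℝ (Rd d))) z.1 :=
    (hψ z).hasFDerivAt.comp z.1 h1
  rw [dt, h2.hasDerivAt.deriv]
  simp

theorem contDiff_dx {ψ : ℝ × Rd d → ℂ} (hψ : ContDiff ℝ ∞ ψ) (k : Fin d) : ContDiff ℝ ∞ (dx k ψ) := by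
  rw [funext (dx_eq (hψ.differentiable (by norm_num)) k)]
  exact (hψ.fderiv_right (by norm_cast)).clm_apply contDiff_const

theorem contDiff_dt {ψ : ℝ × Rd d → ℂ} (hψ : ContDiff ℝ ∞ ψ) : ContDiff ℝ ∞ (dt ψ) := by
  rw [funext (dt_eq (hψ.differentiable (by norm_num)))]
  exact (hψ.fderiv_right (by norm_cast)).clm_apply contDiff_const

theorem tsupport_dx_subset {ψ : ℝ × Rd d → ℂ} (hψ : ContDiff ℝ ∞ ψ) (k : Fin d) :
    tsupport (dx k ψ) ⊆ tsupport ψ := by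
  rw [funext (dx_eq (hψ.differentiable (by norm_num)) k)]
  exact (closure_mono fun z hz => by
    intro h; apply hz; simp [h]).trans (tsupport_fderiv_subset ℝ)

theorem tsupport_dt_subset {ψ : ℝ × Rd d → ℂ} (hψ : ContDiff ℝ ∞ ψ) :
    tsupport (dt ψ) ⊆ tsupport ψ := by
  rw [funext (dt_eq (hψ.differentiable (by norm_num)))]
  exact (closure_mono fun z hz => by
    intro h; apply hz; simp [h]).trans (tsupport_fderiv_subset ℝ)

/-- The action of the principal part of the equation on a test function. -/
theorem dx_mul_dx {a : ℝ × Rd d → ℂ} {H : ℝ × Rd d → ℝ} {c : ℝ} {t : ℝ}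
    (ha : ∀ x, a (t, x) = (c : ℂ) + ((H (t, x) : ℝ) : ℂ))
    (hH : ContDiff ℝ 1 fun x => H (t, x)) {ψ : ℝ × Rd d → ℂ} (hψ : ContDiff ℝ ∞ ψ) (k l : Fin d)
    (x : Rd d) :
    dx l (fun y => a y * dx k ψ y) (t, x) =
      ((fderiv ℝ (fun y => H (t, y)) x (eb l) : ℝ) : ℂ) * dx k ψ (t, x)
        + ((c : ℂ) + ((H (t, x) : ℝ) : ℂ)) * dx l (dx k ψ) (t, x) := by
  have h1 : HasFDerivAt (fun y => a (t, y))
      (Complex.ofRealCLM.comp (fderiv ℝ (fun y => H (t, y)) x)) x := by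
    have : (fun y => a (t, y)) = fun y => (c : ℂ) + Complex.ofRealCLM (H (t, y)) := by
      ext y; exact ha y
    rw [this]
    exact (Complex.ofRealCLM.hasFDerivAt.comp x
      (hH.differentiable (by norm_num) x).hasFDerivAt).const_add _
  have h2 : DifferentiableAt ℝ (fun y => dx k ψ (t, y)) x :=
    ((contDiff_dx hψ k).differentiable (by norm_num)).comp (by fun_prop : Differentiable ℝ fun y : Rd d => (t, y)) x
  have h3 := h1.mul h2.hasFDerivAt
  rw [dx]
  simp only
  rw [show (fun x => a (t, x) * dx k ψ (t, x)) = (fun y => a (t, y)) * fun y => dx k ψ (t, y) from rfl,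
    h3.fderiv]
  simp [ha, dx]
  ring

section Solutions

variable {V : Type*} [NormedAddCommGroup V] [NormedSpace ℂ V]

theorem IsSolution.exists_bound {a : Fin d → Fin d → ℝ × Rd d → ℂ} {u₀ : Rd d → V}
    {u f : ℝ × Rd d → V} (hs : IsSolution a u₀ u f) :
    ∃ M : ℝ≥0∞, M < ⊤ ∧ ∀ t ∈ 𝕀, eLpNorm (fun x => u (t, x)) 2 volume ≤ M := by
  refine IsCompact.induction_on (p := fun S => ∃ M : ℝ≥0∞, M < ⊤ ∧ ∀ t ∈ S ∩ 𝕀,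
    eLpNorm (fun x => u (t, x)) 2 volume ≤ M) (isCompact_Icc (a := (0 : ℝ)) (b := 1)) ?_ ?_ ?_ ?_ |>.imp
    fun M hM => ⟨hM.1, fun t ht => hM.2 t ⟨ht, ht⟩⟩
  · exact ⟨0, by simp, by simp⟩
  · rintro S T hST ⟨M, h1, h2⟩
    exact ⟨M, h1, fun t ht => h2 t ⟨hST ht.1, ht.2⟩⟩
  · rintro S T ⟨M, h1, h2⟩ ⟨M', h1', h2'⟩
    refine ⟨max M M', max_lt h1 h1', fun t ht => ?_⟩
    rcases ht.1 with h | h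
    · exact (h2 t ⟨h, ht.2⟩).trans (le_max_left _ _)
    · exact (h2' t ⟨h, ht.2⟩).trans (le_max_right _ _)
  · intro t₀ ht₀
    have hev := (hs.continuous t₀ ht₀).eventually (gt_mem_nhds (zero_lt_one : (0 : ℝ≥0∞) < 1))
    refine ⟨_, hev, eLpNorm (fun x => u (t₀, x)) 2 volume + 1, ?_, ?_⟩
    · exact ENNReal.add_lt_top.2 ⟨(hs.memL2 t₀ ht₀).2, by simp⟩
    · rintro t ⟨ht, htI⟩
      have h1 := eLpNorm_add_le (hs.memL2 t₀ ht₀).1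
        ((hs.memL2 t htI).1.sub (hs.memL2 t₀ ht₀).1) (p := 2) (by norm_num)
      rw [add_sub_cancel] at h1
      refine h1.trans ?_
      gcongr
      exact le_of_lt ht

theorem IsSolution.memLp_slab {a : Fin d → Fin d → ℝ × Rd d → ℂ} {u₀ : Rd d → V}
    {u f : ℝ × Rd d → V} (hs : IsSolution a u₀ u f) : MemLp u 2 (slab d) := by
  obtain ⟨M, hM, hb⟩ := hs.exists_bound
  refine ⟨hs.measurable, ?_⟩
  have : eLpNorm u 2 (slab d) ^ 2 ≤ M ^ 2 := by
    rw [eLpNorm_two_sq, lintegral_slab (hs.measurable.enorm.pow_const 2)]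
    calc _ ≤ ∫⁻ t in 𝕀, M ^ 2 := by
          refine setLIntegral_mono measurable_const fun t ht => ?_
          rw [← eLpNorm_two_sq (fun x => u (t, x))]
          gcongr
          exact hb t ht
      _ = _ := by simp
  exact (ENNReal.pow_lt_top_iff (n := 2)).1 (this.trans_lt (ENNReal.pow_lt_top hM)) |>.resolve_right (by norm_num)

theorem isFiniteMeasure_slab_restrict {K : Set (Rd d)} (hK : IsCompact K) :
    IsFiniteMeasure ((slab d).restrict (univ ×ˢ K)) := by
  rw [slab_restrict]
  exact ⟨by
    rw [Measure.restrict_apply_univ, Measure.prod_prod]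
    exact ENNReal.mul_lt_top (by simp) hK.measure_lt_top⟩

theorem IsSolution.integrableOn {a : Fin d → Fin d → ℝ × Rd d → ℂ} {u₀ : Rd d → V}
    {u f : ℝ × Rd d → V} (hs : IsSolution a u₀ u f) {K : Set (Rd d)} (hK : IsCompact K) :
    IntegrableOn u (univ ×ˢ K) (slab d) := by
  have := isFiniteMeasure_slab_restrict hK
  exact (hs.memLp_slab.restrict (univ ×ˢ K)).integrable (by norm_num)

theorem IsSolution.integrableOn_forcing {a : Fin d → Fin d → ℝ × Rd d → ℂ} {u₀ : Rd d → V}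
    {u f : ℝ × Rd d → V} (hs : IsSolution a u₀ u f) {K : Set (Rd d)} (hK : IsCompact K) :
    IntegrableOn f (univ ×ˢ K) (slab d) := by
  rw [IntegrableOn, slab_restrict]
  exact hs.forcing.integrableOn_compact_subset (prod_mono le_rfl (subset_univ _)) (isCompact_Icc.prod hK)

/-- The metric `a` is the flat metric perturbed by `H`. -/
def IsPerturbed (a : Fin d → Fin d → ℝ × Rd d → ℂ) (H : Coeff d) : Prop :=
  ∀ᵐ t ∂tm, ∀ k l x, a k l (t, x) =
    (((1 : Matrix (Fin d) (Fin d) ℝ) k l : ℝ) : ℂ) + ((H k l (t, x) : ℝ) : ℂ)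

theorem TamePerturbation.norm_le
    (hH : TamePerturbation H P B) : ∀ᵐ t ∂tm, ∀ k l x, ‖H k l (t, x)‖ ≤ 1 ∧
      ‖fderiv ℝ (fun y => H k l (t, y)) x‖ ≤ 1 := by
  filter_upwards [hH.enorm_le, hH.enorm_fderiv_le] with t h0 h1 k l x
  have a0 := (h0 k l x).trans (hH.bound_le_one x)
  have a1 := (h1 k l x).trans (hH.bound_le_one x)
  rw [← ofReal_norm, ENNReal.ofReal_le_one] at a0 a1
  exact ⟨a0, a1⟩

/-- The left hand side of the weak equation is integrable. -/
theorem integrable_test {a : Fin d → Fin d → ℝ × Rd d → ℂ}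
    (hH : TamePerturbation H P B) (ha : IsPerturbed a H)
    {u : ℝ × Rd d → V} (hu : ∀ K : Set (Rd d), IsCompact K → IntegrableOn u (univ ×ˢ K) (slab d))
    {ψ : ℝ × Rd d → ℂ} (hψ : ContDiff ℝ ∞ ψ) (hc : HasCompactSupport ψ) :
    Integrable (fun z => (-Complex.I * dt ψ z + ∑ k, ∑ l, dx l (fun y => a k l y * dx k ψ y) z) • u z)
      (slab d) := by
  set K : Set (Rd d) := Prod.snd '' tsupport ψ with hK
  have hKc : IsCompact K := hc.isCompact.image continuous_snd
  have hz : ∀ {F : ℝ × Rd d → ℂ}, tsupport F ⊆ tsupport ψ → ∀ z : ℝ × Rd d, z.2 ∉ K → F z = 0 := by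
    intro F hF z hz
    by_contra h
    exact hz ⟨z, hF (subset_tsupport _ h), rfl⟩
  have hbd : ∀ {F : ℝ × Rd d → ℂ}, Continuous F → tsupport F ⊆ tsupport ψ → ∃ C, ∀ z, ‖F z‖ ≤ C :=
    fun hF hs => hF.bounded_above_of_compact_support (hc.isCompact.of_isClosed_subset (isClosed_tsupport _) hs)
  have t1 := tsupport_dx_subset hψ
  have t2 : ∀ k l, tsupport (dx l (dx k ψ)) ⊆ tsupport ψ := fun k l =>
    (tsupport_dx_subset (contDiff_dx hψ k) l).trans (t1 k)
  have c1 := fun k => (contDiff_dx hψ k).continuous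
  have c2 := fun k l => (contDiff_dx (contDiff_dx hψ k) l).continuous
  have hterm : ∀ k l, Integrable (fun z => dx l (fun y => a k l y * dx k ψ y) z • u z) (slab d) := by
    intro k l
    obtain ⟨C1, hC1⟩ := hbd (c1 k) (t1 k)
    obtain ⟨C2, hC2⟩ := hbd (c2 k l) (t2 k l)
    have hform : ∀ᵐ z ∂(slab d), dx l (fun y => a k l y * dx k ψ y) z =
        ((fderiv ℝ (fun y => H k l (z.1, y)) z.2 (eb l) : ℝ) : ℂ) * dx k ψ z
        + ((((1 : Matrix (Fin d) (Fin d) ℝ) k l : ℝ) : ℂ) + ((H k l z : ℝ) : ℂ)) * dx l (dx k ψ) z := by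
      filter_upwards [ae_slab_of_ae_tm ha, ae_slab_of_ae_tm hH.contDiff] with z h1 h2
      exact dx_mul_dx (h1 k l) (h2 k l) hψ k l z.2
    refine integrable_smul_of_bounded (hu K hKc) ?_ (C := 1 * C1 + (1 + 1) * C2) ?_ ?_
    · refine AEStronglyMeasurable.congr ?_ (hform.mono fun z hz => hz.symm)
      exact ((Complex.continuous_ofReal.comp_aestronglyMeasurable (hH.measurable_fderiv k l (eb l))).mul
        (c1 k).aestronglyMeasurable).add ((aestronglyMeasurable_const.add
        (Complex.continuous_ofReal.comp_aestronglyMeasurable (hH.measurable k l))).mul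
        (c2 k l).aestronglyMeasurable)
    · filter_upwards [hform, ae_slab_of_ae_tm hH.norm_le] with z h1 h2
      rw [h1]
      refine (norm_add_le _ _).trans ?_
      rw [norm_mul, norm_mul]
      gcongr
      · rw [Complex.norm_real]
        refine (ContinuousLinearMap.le_opNorm _ _).trans ?_
        have := (h2 k l z.2).2
        simpa using this
      · exact hC1 z
      · refine (norm_add_le _ _).trans ?_
        rw [Complex.norm_real, Complex.norm_real]
        gcongr
        · rw [Matrix.one_apply]; split_ifs <;> simp
        · exact (h2 k l z.2).1
      · exact hC2 z
    · filter_upwards [hform] with z h1 h2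
      rw [h1, hz (t1 k) z h2, hz (t2 k l) z h2]
      simp
  have hdt : Integrable (fun z => (-Complex.I * dt ψ z) • u z) (slab d) := by
    have hcd := (contDiff_dt hψ).continuous
    obtain ⟨C, hC⟩ := hbd hcd (tsupport_dt_subset hψ)
    refine integrable_smul_of_bounded (hu K hKc)
      (continuous_const.mul hcd).aestronglyMeasurable (C := C) ?_ ?_
    · exact Eventually.of_forall fun z => by simpa using hC z
    · exact Eventually.of_forall fun z h => by simp [hz (tsupport_dt_subset hψ) z h]
  have : (fun z => (-Complex.I * dt ψ z + ∑ k, ∑ l, dx l (fun y => a k l y * dx k ψ y) z) • u z) =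
      fun z => (-Complex.I * dt ψ z) • u z + ∑ k, ∑ l, dx l (fun y => a k l y * dx k ψ y) z • u z := by
    ext z
    rw [add_smul, Finset.sum_smul]
    simp_rw [Finset.sum_smul]
  rw [this]
  exact hdt.add (integrable_finsetSum _ fun k _ => integrable_finsetSum _ fun l _ => hterm k l)

theorem integrable_test_smul {f : ℝ × Rd d → V}
    (hf : ∀ K : Set (Rd d), IsCompact K → IntegrableOn f (univ ×ˢ K) (slab d))
    {ψ : ℝ × Rd d → ℂ} (hψ : Continuous ψ) (hc : HasCompactSupport ψ) :
    Integrable (fun z => ψ z • f z) (slab d) := by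
  have hKc : IsCompact (Prod.snd '' tsupport ψ) := hc.isCompact.image continuous_snd
  obtain ⟨C, hC⟩ := hψ.bounded_above_of_compact_support hc
  refine integrable_smul_of_bounded (hf _ hKc) hψ.aestronglyMeasurable
    (Eventually.of_forall hC) (Eventually.of_forall fun z h => ?_)
  by_contra h'
  exact h ⟨z, subset_tsupport _ h', rfl⟩

/-- The components of a vector valued solution are solutions. -/
theorem IsSolution.component {m : ℕ} {a : Fin d → Fin d → ℝ × Rd d → ℂ}
    (hH : TamePerturbation H P B)
    (ha : IsPerturbed a H) {u₀ : Rd d → EuclideanSpace ℂ (Fin m)}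
    {u f : ℝ × Rd d → EuclideanSpace ℂ (Fin m)} (hs : IsSolution a u₀ u f) (c : Fin m) :
    IsSolution a (fun x => u₀ x c) (fun z => u z c) (fun z => f z c) := by
  set L : EuclideanSpace ℂ (Fin m) →L[ℂ] ℂ := EuclideanSpace.proj c with hL
  have hLn : ∀ v, ‖L v‖ ≤ ‖v‖ := fun v => PiLp.norm_apply_le v c
  constructor
  · exact L.continuous.comp_aestronglyMeasurable hs.measurable
  · exact fun t ht => L.comp_memLp' (hs.memL2 t ht)
  · intro t₀ ht₀
    refine tendsto_of_tendsto_of_tendsto_of_le_of_le tendsto_const_nhds (hs.continuous t₀ ht₀)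
      (fun _ => zero_le) fun t => eLpNorm_mono fun x => ?_
    exact hLn (u (t, x) - u (t₀, x))
  · intro z hz
    obtain ⟨S, hS, hSi⟩ := hs.forcing z hz
    exact ⟨S, hS, L.integrable_comp hSi⟩
  · filter_upwards [hs.initial] with x hx
    rw [← hx]
  · intro ψ h1 h2 h3
    have e := congrArg L (hs.equation ψ h1 h2 h3)
    rw [← L.integral_comp_comm (integrable_test hH ha (fun K hK => hs.integrableOn hK) h1 h2),
      ← L.integral_comp_comm (integrable_test_smul (fun K hK => hs.integrableOn_forcing hK) h1.continuous h2)] at e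
    simp_rw [map_smul] at e
    exact e

end Solutions

/-- The perturbed metric. -/
def met (H : Coeff d) (k l : Fin d) (z : ℝ × Rd d) : ℝ :=
  (1 : Matrix (Fin d) (Fin d) ℝ) k l + H k l z

/-- The bilinear form of the equation, tested against `v`. -/
def weakForm (H : Coeff d) (U f : ℝ × Rd d → ℂ) (v : Rd d → ℂ) (z : ℝ × Rd d) : ℂ :=
  (∑ k, ∑ l, (met H k l z : ℂ) * dx l U z * fderiv ℝ v z.2 (eb k)) + v z.2 * f z

/-- A solution whose time slices are smooth, with derivatives that are continuous in space-time. -/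
structure SmoothSolution (H : Coeff d) (u₀ : Rd d → ℂ) (U f : ℝ × Rd d → ℂ) :
    Prop where
  contDiff : ∀ t ∈ 𝕀, ContDiff ℝ ∞ fun x => U (t, x)
  continuousOn : ContinuousOn U (𝕀 ×ˢ univ)
  continuousOn_dx : ∀ k, ContinuousOn (dx k U) (𝕀 ×ˢ univ)
  continuousOn_dx_dx : ∀ k l, ContinuousOn (dx l (dx k U)) (𝕀 ×ˢ univ)
  exists_bound : ∃ M : ℝ≥0∞, M < ⊤ ∧ ∀ t ∈ 𝕀, eLpNorm (fun x => U (t, x)) 2 volume ≤ M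
  initial : (fun x => U (0, x)) =ᵐ[volume] u₀
  forcing : ∀ K : Set (Rd d), IsCompact K → IntegrableOn f (univ ×ˢ K) (slab d)
  weak : ∀ v : Rd d → ℂ, ContDiff ℝ ∞ v → HasCompactSupport v → ∀ t ∈ 𝕀,
    (∫ x, v x * U (t, x)) - ∫ x, v x * U (0, x)
      = ∫ τ in (0 : ℝ)..t, -Complex.I * ∫ x, weakForm H U f v (τ, x)

theorem norm_met_le
    (hH : TamePerturbation H P B) : ∀ᵐ t ∂tm, ∀ k l x, ‖(met H k l (t, x) : ℂ)‖ ≤ 2 := by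
  filter_upwards [hH.norm_le] with t ht k l x
  rw [Complex.norm_real, met]
  refine (norm_add_le _ _).trans ?_
  have h1 := (ht k l x).1
  have h2 : ‖(1 : Matrix (Fin d) (Fin d) ℝ) k l‖ ≤ 1 := by
    rw [Matrix.one_apply]; split_ifs <;> simp
  linarith

theorem aestronglyMeasurable_met
    (hH : TamePerturbation H P B) (k l : Fin d) :
    AEStronglyMeasurable (fun z => (met H k l z : ℂ)) (slab d) :=
  Complex.continuous_ofReal.comp_aestronglyMeasurable
    (aestronglyMeasurable_const.add (hH.measurable k l))

theorem integrable_flux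
    (hH : TamePerturbation H P B) {U : ℝ × Rd d → ℂ}
    (hU : ∀ k, ContinuousOn (dx k U) (𝕀 ×ˢ univ)) {v : Rd d → ℂ} (hv : Continuous v)
    (hc : HasCompactSupport v) (k l : Fin d) :
    Integrable (fun z => (met H k l z : ℂ) * dx l U z * v z.2) (slab d) := by
  obtain ⟨C, hC⟩ := hv.bounded_above_of_compact_support hc
  have h1 := integrable_smul_of_bounded (F := fun z : ℝ × Rd d => (met H k l z : ℂ) * v z.2) (K := tsupport v)
    (continuousOn_integrableOn (hU l) hc.isCompact)
    ((aestronglyMeasurable_met hH k l).mul (hv.comp continuous_snd).aestronglyMeasurable)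
    (C := 2 * C) (by
      filter_upwards [ae_slab_of_ae_tm (norm_met_le hH)] with z hz
      rw [norm_mul]
      exact mul_le_mul (hz k l z.2) (hC _) (norm_nonneg _) (by norm_num))
    (Eventually.of_forall fun z hz => by rw [image_eq_zero_of_notMem_tsupport hz, mul_zero])
  refine h1.congr (Eventually.of_forall fun z => ?_)
  simp only [smul_eq_mul]
  ring

theorem integrable_space_smul {V : Type*} [NormedAddCommGroup V] [NormedSpace ℂ V]
    {f : ℝ × Rd d → V}
    (hf : ∀ K : Set (Rd d), IsCompact K → IntegrableOn f (univ ×ˢ K) (slab d)) {v : Rd d → ℂ}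
    (hv : Continuous v) (hc : HasCompactSupport v) :
    Integrable (fun z => v z.2 • f z) (slab d) := by
  obtain ⟨C, hC⟩ := hv.bounded_above_of_compact_support hc
  exact integrable_smul_of_bounded (hf _ hc.isCompact)
    (hv.comp continuous_snd).aestronglyMeasurable (Eventually.of_forall fun z => hC z.2)
    (Eventually.of_forall fun z h => image_eq_zero_of_notMem_tsupport h)

theorem continuous_fderiv_apply {v : Rd d → ℂ} (hv : ContDiff ℝ ∞ v) (e : Rd d) :
    Continuous fun x => fderiv ℝ v x e :=
  (hv.continuous_fderiv (by norm_num)).clm_apply continuous_const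

theorem hasCompactSupport_fderiv_apply {v : Rd d → ℂ} (hc : HasCompactSupport v) (e : Rd d) :
    HasCompactSupport fun x => fderiv ℝ v x e :=
  (hc.fderiv ℝ).comp_left (g := fun A : Rd d →L[ℝ] ℂ => A e) (by simp)

theorem integrable_weakForm
    (hH : TamePerturbation H P B)
    (hU : ∀ k, ContinuousOn (dx k U) (𝕀 ×ˢ univ))
    (hf : ∀ K : Set (Rd d), IsCompact K → IntegrableOn f (univ ×ˢ K) (slab d)) {v : Rd d → ℂ}
    (hv : ContDiff ℝ ∞ v) (hc : HasCompactSupport v) :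
    Integrable (weakForm H U f v) (slab d) := by
  refine (integrable_finsetSum _ fun k _ => integrable_finsetSum _ fun l _ => ?_).add
    (integrable_space_smul hf hv.continuous hc)
  exact integrable_flux hH hU (continuous_fderiv_apply hv _) (hasCompactSupport_fderiv_apply hc _) k l

/-- Integration by parts in the principal part. -/
theorem integral_dx_mul {a : ℝ × Rd d → ℂ} {H : ℝ × Rd d → ℝ} {c t : ℝ}
    (ha : ∀ x, a (t, x) = (c : ℂ) + ((H (t, x) : ℝ) : ℂ)) (hH : ContDiff ℝ 1 fun x => H (t, x))
    {U : ℝ × Rd d → ℂ} (hU : ContDiff ℝ ∞ fun x => U (t, x)) {v : Rd d → ℂ} (hv : ContDiff ℝ ∞ v)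
    (hc : HasCompactSupport v) (k l : Fin d) (η : ℂ) :
    ∫ x, fderiv ℝ (fun x => a (t, x) * (η * fderiv ℝ v x (eb k))) x (eb l) * U (t, x)
      = -(η * ∫ x, a (t, x) * dx l U (t, x) * fderiv ℝ v x (eb k)) := by
  have hac : ContDiff ℝ 1 fun x => a (t, x) := by
    simp_rw [ha]
    exact contDiff_const.add (Complex.ofRealCLM.contDiff.comp hH)
  have hvk : ContDiff ℝ ∞ fun x => fderiv ℝ v x (eb k) :=
    (hv.fderiv_right (by norm_cast)).clm_apply contDiff_const
  have hg : ContDiff ℝ 1 fun x => a (t, x) * (η * fderiv ℝ v x (eb k)) :=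
    hac.mul (contDiff_const.mul (hvk.of_le (by norm_cast)))
  have hgs : HasCompactSupport fun x => a (t, x) * (η * fderiv ℝ v x (eb k)) :=
    ((hasCompactSupport_fderiv_apply hc (eb k)).mul_left (f := fun _ => η)).mul_left
  have hdg : Continuous fun x => fderiv ℝ (fun x => a (t, x) * (η * fderiv ℝ v x (eb k))) x (eb l) :=
    (hg.continuous_fderiv (by norm_num)).clm_apply continuous_const
  have hdU := continuous_fderiv_apply hU (eb l)
  have ibp := integral_mul_fderiv_eq_neg_fderiv_mul_of_integrable (μ := (volume : Measure (Rd d)))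
    (f := fun x => U (t, x)) (g := fun x => a (t, x) * (η * fderiv ℝ v x (eb k))) (v := eb l)
    ((hdU.mul hg.continuous).integrable_of_hasCompactSupport hgs.mul_left)
    ((hU.continuous.mul hdg).integrable_of_hasCompactSupport
      (hasCompactSupport_fderiv_apply hgs (eb l)).mul_left)
    ((hU.continuous.mul hg.continuous).integrable_of_hasCompactSupport hgs.mul_left)
    (fun x _ => hU.differentiable (by norm_num) x) (fun x _ => hg.differentiable (by norm_num) x)
  simp_rw [mul_comm _ (U (t, _))]
  rw [ibp, ← integral_const_mul]
  congr 2
  ext x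
  rw [dx]
  ring

theorem IsSolution.weak {a : Fin d → Fin d → ℝ × Rd d → ℂ}
    (hH : TamePerturbation H P B) (ha : IsPerturbed a H)
    {u f : ℝ × Rd d → ℂ} (hs : IsSolution a u₀ u f) {U : ℝ × Rd d → ℂ}
    (hUu : ∀ t ∈ 𝕀, (fun x => u (t, x)) =ᵐ[volume] fun x => U (t, x))
    (hU : ∀ t ∈ 𝕀, ContDiff ℝ ∞ fun x => U (t, x))
    (hU0 : ContinuousOn U (𝕀 ×ˢ univ))
    (hU1 : ∀ k, ContinuousOn (dx k U) (𝕀 ×ˢ univ)) {v : Rd d → ℂ} (hv : ContDiff ℝ ∞ v)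
    (hc : HasCompactSupport v) {t : ℝ} (ht : t ∈ 𝕀) :
    (∫ x, v x * U (t, x)) - ∫ x, v x * U (0, x)
      = ∫ τ in (0 : ℝ)..t, -Complex.I * ∫ x, weakForm H U f v (τ, x) := by
  have hwi := integrable_weakForm hH hU1 (fun K hK => hs.integrableOn_forcing hK) hv hc
  have hm : ContinuousOn (fun t => ∫ x, v x * U (t, x)) (Icc 0 1) := by
    refine continuousOn_integral_of_compact_support (k := tsupport v) hc.isCompact ?_ ?_
    · exact (hv.continuous.comp continuous_snd).continuousOn.mul hU0
    · intro t x _ hx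
      rw [image_eq_zero_of_notMem_tsupport hx, zero_mul]
  refine sub_eq_integral_of_weak_deriv_complex (m := fun t => ∫ x, v x * U (t, x)) hm
    (hwi.integral_prod_left.const_mul _) ?_ ht
  intro η h1 h2 h3
  set ψ : ℝ × Rd d → ℂ := fun z => (η z.1 : ℂ) * v z.2 with hψ
  have hηc : ContDiff ℝ ∞ fun t => (η t : ℂ) := Complex.ofRealCLM.contDiff.comp h1
  have hψc : ContDiff ℝ ∞ ψ := (hηc.comp contDiff_fst).mul (hv.comp contDiff_snd)
  have hψt : tsupport ψ ⊆ tsupport η ×ˢ tsupport v := by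
    refine closure_minimal (fun z hz => ?_) ((isClosed_tsupport η).prod (isClosed_tsupport v))
    have : (η z.1 : ℂ) * v z.2 ≠ 0 := hz
    exact ⟨subset_tsupport _ fun h => this (by rw [h]; simp), subset_tsupport _ fun h => this (by rw [h]; simp)⟩
  have hψs : HasCompactSupport ψ :=
    (h2.isCompact.prod hc.isCompact).of_isClosed_subset (isClosed_tsupport _) hψt
  have heq := hs.equation ψ hψc hψs (hψt.trans (prod_mono h3 (subset_univ _)))
  have hi1 := integrable_test hH ha (fun K hK => hs.integrableOn hK) hψc hψs
  have hi2 := integrable_test_smul (fun K hK => hs.integrableOn_forcing hK) hψc.continuous hψs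
  rw [slab, integral_prod _ hi1, integral_prod _ hi2] at heq
  have hdx : ∀ k z, dx k ψ z = (η z.1 : ℂ) * fderiv ℝ v z.2 (eb k) := fun k z => by
    rw [dx]
    simp only [hψ]
    rw [fderiv_const_mul (hv.differentiable (by norm_num) _)]
    simp
  have hdt : ∀ z, dt ψ z = ((deriv η z.1 : ℝ) : ℂ) * v z.2 := fun z => by
    rw [dt]
    simp only [hψ]
    have hd := (h1.differentiable (by norm_num) z.1).hasDerivAt.ofReal_comp
    rw [(hd.mul_const (v z.2)).deriv]
  -- the left hand side on time slices
  have hL : ∀ᵐ t ∂tm, ∫ x, (-Complex.I * dt ψ (t, x) + ∑ k, ∑ l, dx l (fun y => a k l y * dx k ψ y) (t, x)) • u (t, x)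
      = -Complex.I * ((deriv η t : ℝ) : ℂ) * (∫ x, v x * U (t, x)) - (η t : ℂ) * ∫ x, ∑ k, ∑ l,
        (met H k l (t, x) : ℂ) * dx l U (t, x) * fderiv ℝ v x (eb k) := by
    filter_upwards [ha, hH.contDiff, ae_tm_mem, norm_met_le hH] with t hat hHt htI hmet
    have hUt := hU t htI
    have hmet' : ∀ k l x, a k l (t, x) = (met H k l (t, x) : ℂ) := fun k l x => by
      rw [hat, met]; push_cast; rfl
    have hvk : ∀ k, Continuous fun x => fderiv ℝ v x (eb k) := fun k => continuous_fderiv_apply hv _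
    have hac : ∀ k l, ContDiff ℝ 1 fun x => a k l (t, x) := fun k l => by
      simp_rw [hat]
      exact contDiff_const.add (Complex.ofRealCLM.contDiff.comp (hHt k l))
    have hg : ∀ k l, ContDiff ℝ 1 fun x => a k l (t, x) * ((η t : ℂ) * fderiv ℝ v x (eb k)) :=
      fun k l => (hac k l).mul (contDiff_const.mul (((hv.fderiv_right (m := 1) (by norm_cast)).clm_apply contDiff_const)))
    have hgs : ∀ k l, HasCompactSupport fun x => a k l (t, x) * ((η t : ℂ) * fderiv ℝ v x (eb k)) :=
      fun k l => ((hasCompactSupport_fderiv_apply hc (eb k)).mul_left (f := fun _ => (η t : ℂ))).mul_left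
    have hI1 : ∀ k l, Integrable (fun x =>
        fderiv ℝ (fun x => a k l (t, x) * ((η t : ℂ) * fderiv ℝ v x (eb k))) x (eb l) * U (t, x)) := fun k l =>
      ((((hg k l).continuous_fderiv (by norm_num)).clm_apply continuous_const).mul
        hUt.continuous).integrable_of_hasCompactSupport
        (hasCompactSupport_fderiv_apply (hgs k l) (eb l)).mul_right
    have hI2 : ∀ k l, Integrable (fun x => (met H k l (t, x) : ℂ) * dx l U (t, x) * fderiv ℝ v x (eb k)) := by
      intro k l
      simp_rw [← hmet']
      exact (((hac k l).continuous.mul (continuous_fderiv_apply hUt (eb l))).mul (hvk k)).integrable_of_hasCompactSupport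
        (hasCompactSupport_fderiv_apply hc (eb k)).mul_left
    have hI3 : Integrable (fun x => v x * U (t, x)) :=
      (hv.continuous.mul hUt.continuous).integrable_of_hasCompactSupport hc.mul_right
    calc _ = ∫ x, (-Complex.I * ((deriv η t : ℝ) : ℂ) * (v x * U (t, x)) + ∑ k, ∑ l,
          fderiv ℝ (fun x => a k l (t, x) * ((η t : ℂ) * fderiv ℝ v x (eb k))) x (eb l) * U (t, x)) := by
          apply integral_congr_ae
          filter_upwards [hUu t htI] with x hx
          rw [show u (t, x) = U (t, x) from hx, hdt, smul_eq_mul, add_mul, Finset.sum_mul]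
          simp_rw [Finset.sum_mul]
          congr 1
          · ring
          · refine Finset.sum_congr rfl fun k _ => Finset.sum_congr rfl fun l _ => ?_
            rw [dx]
            simp_rw [hdx]
      _ = -Complex.I * ((deriv η t : ℝ) : ℂ) * (∫ x, v x * U (t, x)) + ∑ k, ∑ l,
          -((η t : ℂ) * ∫ x, a k l (t, x) * dx l U (t, x) * fderiv ℝ v x (eb k)) := by
          rw [integral_add (hI3.const_mul _)
            (integrable_finsetSum _ fun k _ => integrable_finsetSum _ fun l _ => hI1 k l),
            integral_const_mul, integral_finsetSum _ fun k _ => integrable_finsetSum _ fun l _ => hI1 k l]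
          congr 1
          refine Finset.sum_congr rfl fun k _ => ?_
          rw [integral_finsetSum _ fun l _ => hI1 k l]
          refine Finset.sum_congr rfl fun l _ => ?_
          exact integral_dx_mul (hat k l) (hHt k l) hUt hv hc k l _
      _ = _ := by
          rw [integral_finsetSum _ fun k _ => integrable_finsetSum _ fun l _ => hI2 k l, sub_eq_add_neg,
            Finset.mul_sum, ← Finset.sum_neg_distrib]
          congr 1
          refine Finset.sum_congr rfl fun k _ => ?_
          rw [integral_finsetSum _ fun l _ => hI2 k l, Finset.mul_sum, ← Finset.sum_neg_distrib]
          refine Finset.sum_congr rfl fun l _ => ?_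
          simp_rw [hmet']
  have hflux : Integrable (fun z : ℝ × Rd d => ∑ k, ∑ l, (met H k l z : ℂ) * dx l U z * fderiv ℝ v z.2 (eb k)) (slab d) :=
    integrable_finsetSum _ fun k _ => integrable_finsetSum _ fun l _ =>
      integrable_flux hH hU1 (continuous_fderiv_apply hv _) (hasCompactSupport_fderiv_apply hc _) k l
  have hvf : Integrable (fun z : ℝ × Rd d => v z.2 * f z) (slab d) :=
    integrable_space_smul (fun K hK => hs.integrableOn_forcing hK) hv.continuous hc
  have hS := hflux.integral_prod_left
  have hG := hvf.integral_prod_left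
  have hηS : IntegrableOn (fun t => (η t : ℂ) * ∫ x, ∑ k, ∑ l,
        (met H k l (t, x) : ℂ) * dx l U (t, x) * fderiv ℝ v x (eb k)) (Icc 0 1) :=
    IntegrableOn.continuousOn_mul hηc.continuous.continuousOn hS isCompact_Icc
  have hηG : IntegrableOn (fun t => (η t : ℂ) * ∫ x, v x * f (t, x)) (Icc 0 1) :=
    IntegrableOn.continuousOn_mul hηc.continuous.continuousOn hG isCompact_Icc
  have hηd : Continuous (deriv η) := h1.continuous_deriv (by norm_cast)
  have hηm : IntegrableOn (fun t => ((deriv η t : ℝ) : ℂ) * ∫ x, v x * U (t, x)) (Icc 0 1) :=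
    ((Complex.continuous_ofReal.comp hηd).continuousOn.mul hm).integrableOn_Icc
  rw [integral_congr_ae hL, integral_sub (by simpa only [mul_assoc] using hηm.const_mul (-Complex.I)) hηS] at heq
  simp_rw [mul_assoc (-Complex.I)] at heq
  rw [integral_const_mul] at heq
  have e1 : ∫ t in 𝕀, ∫ x, ψ (t, x) • f (t, x) = ∫ t in 𝕀, (η t : ℂ) * ∫ x, v x * f (t, x) := by
    congr 1; ext t
    rw [← integral_const_mul]
    simp only [hψ, smul_eq_mul, mul_assoc]
  rw [e1] at heq
  have e2 : ∫ t in 𝕀, (η t : ℂ) * (-Complex.I * ∫ x, weakForm H U f v (t, x)) =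
      -Complex.I * ((∫ t in 𝕀, (η t : ℂ) * ∫ x, ∑ k, ∑ l,
        (met H k l (t, x) : ℂ) * dx l U (t, x) * fderiv ℝ v x (eb k)) +
        ∫ t in 𝕀, (η t : ℂ) * ∫ x, v x * f (t, x)) := by
    rw [← integral_add hηS hηG, ← integral_const_mul]
    apply integral_congr_ae
    filter_upwards [hflux.prod_right_ae, hvf.prod_right_ae] with t h1 h2
    simp only [weakForm]
    rw [integral_add h1 h2]
    ring
  rw [e2, ← heq]
  linear_combination (∫ t in 𝕀, ((deriv η t : ℝ) : ℂ) * ∫ x, v x * U (t, x)) * Complex.I_sq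

theorem cv_component {m : ℕ} (κ : 𝓢(Rd d, ℂ)) {v : Rd d → EuclideanSpace ℂ (Fin m)}
    (hv : ConvDefined v) (c : Fin m) (x : Rd d) : cv κ (fun y => v y c) x = cv κ v x c := by
  have := (EuclideanSpace.proj c : EuclideanSpace ℂ (Fin m) →L[ℂ] ℂ).integral_comp_comm (hv.integrable κ x)
  simpa [cv] using this

theorem dx_cv (κ : 𝓢(Rd d, ℂ)) {u : ℝ × Rd d → ℂ} {z : ℝ × Rd d}
    (hu : ConvDefined fun x => u (z.1, x)) (k : Fin d) :
    dx k (fun z => cv κ (fun y => u (z.1, y)) z.2) z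
      = cv (∂_{(eb k : Rd d)} κ : 𝓢(Rd d, ℂ)) (fun y => u (z.1, y)) z.2 :=
  cv_fderiv_apply κ hu z.2 (eb k)

theorem IsSolution.smoothSolution {a : Fin d → Fin d → ℝ × Rd d → ℂ}
    (hH : TamePerturbation H P B) (ha : IsPerturbed a H) {u f : ℝ × Rd d → ℂ}
    (hs : IsSolution a u₀ u f) {κ : 𝓢(Rd d, ℂ)}
    (hκ : ∀ t ∈ 𝕀, cv κ (fun x => u (t, x)) =ᵐ[volume] fun x => u (t, x)) :
    SmoothSolution H u₀ (fun z => cv κ (fun y => u (z.1, y)) z.2) f := by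
  set U : ℝ × Rd d → ℂ := fun z => cv κ (fun y => u (z.1, y)) z.2 with hU
  have hcd : ∀ t ∈ 𝕀, ConvDefined fun x => u (t, x) := fun t ht =>
    ConvDefined.of_memLp_two (hs.memL2 t ht)
  have hcont : ∀ κ' : 𝓢(Rd d, ℂ), ContinuousOn (fun z : ℝ × Rd d => cv κ' (fun y => u (z.1, y)) z.2)
      (𝕀 ×ˢ univ) := fun κ' =>
    cv_jointly_continuousOn κ' (u := fun t x => u (t, x)) hs.memL2 hs.continuous
  have hdx : ∀ k, ∀ z ∈ 𝕀 ×ˢ (univ : Set (Rd d)), dx k U z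
      = cv (∂_{(eb k : Rd d)} κ : 𝓢(Rd d, ℂ)) (fun y => u (z.1, y)) z.2 := fun k z hz =>
    dx_cv κ (hcd z.1 hz.1) k
  have hdxx : ∀ k l, ∀ z ∈ 𝕀 ×ˢ (univ : Set (Rd d)), dx l (dx k U) z
      = cv (∂_{(eb l : Rd d)} (∂_{(eb k : Rd d)} κ) : 𝓢(Rd d, ℂ)) (fun y => u (z.1, y)) z.2 := fun k l z hz => by
    rw [← dx_cv _ (hcd z.1 hz.1) l, dx, dx]
    congr 2
    ext x
    exact hdx k (z.1, x) ⟨hz.1, mem_univ _⟩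
  have hc0 := hcont κ
  have hc1 : ∀ k, ContinuousOn (dx k U) (𝕀 ×ˢ univ) := fun k =>
    (hcont _).congr (hdx k)
  have hsm : ∀ t ∈ 𝕀, ContDiff ℝ ∞ fun x => U (t, x) := fun t ht => cv_contDiff κ (hcd t ht)
  refine ⟨hsm, hc0, hc1, fun k l => (hcont _).congr (hdxx k l), ?_, ?_, fun K hK => hs.integrableOn_forcing hK, ?_⟩
  · obtain ⟨M, hM, hb⟩ := hs.exists_bound
    exact ⟨M, hM, fun t ht => (eLpNorm_congr_ae (hκ t ht)).trans_le (hb t ht)⟩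
  · exact (hκ 0 (by simp)).trans hs.initial
  · intro v h1 h2 t ht
    exact hs.weak hH ha (fun t ht => (hκ t ht).symm) hsm hc0 hc1 h1 h2 ht

theorem SmoothSolution.integrable_weakForm
    (hH : TamePerturbation H P B)
    (hU : SmoothSolution H u₀ U f) {v : Rd d → ℂ} (hv : ContDiff ℝ ∞ v) (hc : HasCompactSupport v) :
    Integrable (weakForm H U f v) (slab d) :=
  QuasiSchrodinger.integrable_weakForm hH hU.continuousOn_dx hU.forcing hv hc

/-- A function whose increments are controlled by small multiples of the increments of a fixed
function is constant. -/
theorem eq_of_increment_le {r Φ : ℝ → ℝ} {T : ℝ} (hT : 0 ≤ T)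
    (h : ∀ ε > 0, ∃ δ > 0, ∀ s t, 0 ≤ s → s ≤ t → t ≤ T → t - s ≤ δ → |r t - r s| ≤ ε * (Φ t - Φ s)) :
    r T = r 0 := by
  have key : ∀ ε > 0, |r T - r 0| ≤ ε * (Φ T - Φ 0) := by
    intro ε hε
    obtain ⟨δ, hδ, hd⟩ := h ε hε
    obtain ⟨n, hn⟩ := exists_nat_gt (T / δ)
    have hn0 : (0 : ℝ) < n := lt_of_le_of_lt (by positivity) hn
    have hstep : ∀ i : ℕ, i ≤ n → |r (T * i / n) - r 0| ≤ ε * (Φ (T * i / n) - Φ 0) := by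
      intro i
      induction i with
      | zero => intro _; simp
      | succ i ih =>
        intro hi
        have h1 := ih (by omega)
        have hi' : ((i : ℝ) + 1) ≤ n := by exact_mod_cast hi
        have h2 := hd (T * i / n) (T * (i + 1 : ℕ) / n) (by positivity)
          (by gcongr; omega) (by
            push_cast
            rw [div_le_iff₀ hn0]
            gcongr) (by
            push_cast
            rw [← sub_div, ← mul_sub, add_sub_cancel_left, mul_one, div_le_iff₀ hn0]
            rw [div_lt_iff₀ hδ] at hn
            linarith)
        calc _ = |(r (T * (i + 1 : ℕ) / n) - r (T * i / n)) + (r (T * i / n) - r 0)| := by ring_nf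
          _ ≤ _ := abs_add_le _ _
          _ ≤ _ := add_le_add h2 h1
          _ = _ := by ring
    have := hstep n le_rfl
    rwa [mul_div_assoc, div_self hn0.ne', mul_one] at this
  have hle : |r T - r 0| ≤ 0 := by
    refine le_of_forall_pos_le_add fun ε hε => ?_
    rw [zero_add]
    have hpos : 0 < |Φ T - Φ 0| + 1 := by positivity
    refine (key (ε / (|Φ T - Φ 0| + 1)) (by positivity)).trans ?_
    calc _ ≤ ε / (|Φ T - Φ 0| + 1) * (|Φ T - Φ 0| + 1) := by
          gcongr
          exact (le_abs_self _).trans (by linarith)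
      _ = ε := by field_simp
  have := abs_nonpos_iff.1 hle
  linarith

theorem integrable_met_mul
    (hH : TamePerturbation H P B) {G : ℝ × Rd d → ℂ} (hG : ContinuousOn G (𝕀 ×ˢ univ))
    {K : Set (Rd d)} (hK : IsCompact K) (h0 : ∀ t ∈ 𝕀, ∀ x ∉ K, G (t, x) = 0)
    (k l : Fin d) : Integrable (fun z => (met H k l z : ℂ) * G z) (slab d) := by
  have h1 : IntegrableOn (fun z => (met H k l z : ℂ) * G z) (univ ×ˢ K) (slab d) := by
    refine Integrable.bdd_mul (continuousOn_integrableOn hG hK) (c := 2)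
      (aestronglyMeasurable_met hH k l).restrict (ae_restrict_of_ae ?_)
    filter_upwards [ae_slab_of_ae_tm (norm_met_le hH)] with z hz
    exact hz k l z.2
  refine h1.integrable_of_ae_notMem_eq_zero ?_
  filter_upwards [ae_slab_mem] with z hz hzK
  rw [show z = (z.1, z.2) from rfl, h0 z.1 hz.1 z.2 (fun h => hzK ⟨mem_univ _, h⟩), mul_zero]

theorem integrable_mul_forcing {f : ℝ × Rd d → ℂ}
    (hf : ∀ K : Set (Rd d), IsCompact K → IntegrableOn f (univ ×ˢ K) (slab d)) {G : ℝ × Rd d → ℂ}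
    (hG : ContinuousOn G (𝕀 ×ˢ univ)) {K : Set (Rd d)} (hK : IsCompact K)
    (h0 : ∀ t ∈ 𝕀, ∀ x ∉ K, G (t, x) = 0) : Integrable (fun z => G z * f z) (slab d) := by
  obtain ⟨C, hC⟩ := (isCompact_Icc (a := (0 : ℝ)) (b := 1)).prod hK |>.exists_bound_of_continuousOn
    (hG.mono (prod_mono le_rfl (subset_univ _)))
  refine integrable_smul_of_bounded (hf K hK) (continuousOn_aestronglyMeasurable hG) (C := max C 0) ?_ ?_
  · filter_upwards [ae_slab_mem] with z hz
    by_cases h : z.2 ∈ K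
    · exact (hC z ⟨hz.1, h⟩).trans (le_max_left _ _)
    · rw [show z = (z.1, z.2) from rfl, h0 z.1 hz.1 z.2 h]; simp
  · filter_upwards [ae_slab_mem] with z hz h
    exact h0 z.1 hz.1 z.2 h

theorem fderiv_eq_zero_of_notMem {v : Rd d → ℂ} {K : Set (Rd d)} (hK : IsClosed K)
    (h0 : ∀ x ∉ K, v x = 0) {x : Rd d} (hx : x ∉ K) : fderiv ℝ v x = 0 := by
  have : v =ᶠ[𝓝 x] fun _ => 0 := by
    filter_upwards [hK.isOpen_compl.mem_nhds hx] with y hy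
    exact h0 y hy
  rw [this.fderiv_eq]
  simp

theorem integrable_weakForm_family
    (hH : TamePerturbation H P B)
    (hU : SmoothSolution H u₀ U f) {Z : ℝ × Rd d → ℂ} {K : Set (Rd d)} (hK : IsCompact K)
    (hZ0 : ∀ t ∈ 𝕀, ∀ x ∉ K, Z (t, x) = 0)
    (hZc : ContinuousOn Z (𝕀 ×ˢ univ))
    (hZd : ∀ k, ContinuousOn (dx k Z) (𝕀 ×ˢ univ)) :
    Integrable (fun z => weakForm H U f (fun x => Z (z.1, x)) z) (slab d) := by
  refine (integrable_finsetSum _ fun k _ => integrable_finsetSum _ fun l _ => ?_).add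
    (integrable_mul_forcing hU.forcing hZc hK hZ0)
  simp_rw [mul_assoc]
  refine integrable_met_mul hH ((hU.continuousOn_dx l).mul (hZd k)) hK (fun t ht x hx => ?_) k l
  simp only [Pi.mul_apply, dx]
  rw [fderiv_eq_zero_of_notMem hK.isClosed (hZ0 t ht) hx]
  simp

/-- The time derivative of a quadratic form in a solution. -/
theorem SmoothSolution.quadratic_identity
    (hH : TamePerturbation H P B)
    (hU : SmoothSolution H u₀ U f) {Z : ℝ × Rd d → ℂ} {K : Set (Rd d)} (hK : IsCompact K)
    (hZs : ∀ t ∈ 𝕀, ContDiff ℝ ∞ fun x => Z (t, x))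
    (hZ0 : ∀ t ∈ 𝕀, ∀ x ∉ K, Z (t, x) = 0)
    (hZc : ContinuousOn Z (𝕀 ×ˢ univ))
    (hZd : ∀ k, ContinuousOn (dx k Z) (𝕀 ×ˢ univ))
    (hsym : ∀ s ∈ 𝕀, ∀ t ∈ 𝕀,
      (∫ x, Z (t, x) * U (s, x)).re = (∫ x, Z (s, x) * U (t, x)).re) {T : ℝ}
    (hT : T ∈ 𝕀) :
    (∫ x, Z (T, x) * U (T, x)).re - (∫ x, Z (0, x) * U (0, x)).re
      = ∫ τ in (0 : ℝ)..T, 2 * (∫ x, weakForm H U f (fun x => Z (τ, x)) (τ, x)).im := by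
  set q : ℝ → ℝ := fun t => (∫ x, Z (t, x) * U (t, x)).re with hq
  set D : ℝ → ℝ := fun τ => 2 * (∫ x, weakForm H U f (fun x => Z (τ, x)) (τ, x)).im with hD
  have hWi := integrable_weakForm_family hH hU hK hZ0 hZc hZd
  have hDi : IntegrableOn D (Icc 0 1) := (hWi.integral_prod_left.im).const_mul 2
  set b : ℝ × Rd d → ℝ := fun z => (univ ×ˢ K).indicator
    (fun z => (∑ _k : Fin d, ∑ l, 2 * ‖dx l U z‖) + ‖f z‖) z with hb
  have hbi : Integrable b (slab d) := by
    rw [hb, integrable_indicator_iff (MeasurableSet.univ.prod hK.measurableSet)]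
    refine Integrable.add ?_ (hU.forcing K hK).norm
    exact integrable_finsetSum _ fun k _ => integrable_finsetSum _ fun l _ =>
      ((continuousOn_integrableOn (hU.continuousOn_dx l) hK).norm).const_mul 2
  set φ : ℝ → ℝ := fun τ => ∫ x, b (τ, x) with hφ
  have hφi : IntegrableOn φ (Icc 0 1) := hbi.integral_prod_left
  have sub : ∀ {F : ℝ → ℝ}, IntegrableOn F (Icc 0 1) → ∀ s t, 0 ≤ s → s ≤ t → t ≤ 1 →
      IntervalIntegrable F volume s t := fun hF s t h0 h1 h2 => by
    rw [intervalIntegrable_iff_integrableOn_Icc_of_le h1]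
    exact hF.mono_set (Icc_subset_Icc h0 h2)
  have hmul : ∀ {A E : Rd d → ℂ}, Continuous A → Continuous E → (∀ x ∉ K, A x = 0) →
      Integrable fun x => A x * E x := fun hA hE h0 =>
    (hA.mul hE).integrable_of_hasCompactSupport
      (HasCompactSupport.intro hK fun x hx => by simp [h0 x hx])
  -- the increments of the form
  have incr : ∀ s t, 0 ≤ s → s ≤ t → t ≤ 1 → q t - q s = ∫ τ in s..t,
      (∫ x, weakForm H U f (fun x => Z (t, x) + Z (s, x)) (τ, x)).im := by
    intro s t h0 h1 h2
    have hs : s ∈ 𝕀 := ⟨h0, h1.trans h2⟩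
    have ht : t ∈ 𝕀 := ⟨h0.trans h1, h2⟩
    have hvs : ContDiff ℝ ∞ fun x => Z (t, x) + Z (s, x) := (hZs t ht).add (hZs s hs)
    have hvc : HasCompactSupport fun x => Z (t, x) + Z (s, x) :=
      HasCompactSupport.intro hK fun x hx => by simp [hZ0 t ht x hx, hZ0 s hs x hx]
    have hwi := hU.integrable_weakForm hH hvs hvc
    have wt := hU.weak _ hvs hvc t ht
    have ws := hU.weak _ hvs hvc s hs
    have ii : ∀ p r, 0 ≤ p → p ≤ r → r ≤ 1 → IntervalIntegrable (fun τ => -Complex.I *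
        ∫ x, weakForm H U f (fun x => Z (t, x) + Z (s, x)) (τ, x)) volume p r := fun p r a1 a2 a3 => by
      rw [intervalIntegrable_iff_integrableOn_Icc_of_le a2]
      exact IntegrableOn.mono_set (hwi.integral_prod_left.const_mul _) (Icc_subset_Icc a1 a3)
    have e1 : (∫ x, (Z (t, x) + Z (s, x)) * U (t, x)) - ∫ x, (Z (t, x) + Z (s, x)) * U (s, x)
        = ∫ τ in s..t, -Complex.I * ∫ x, weakForm H U f (fun x => Z (t, x) + Z (s, x)) (τ, x) := by
      rw [← intervalIntegral.integral_interval_sub_left (ii 0 t le_rfl ht.1 h2) (ii 0 s le_rfl h0 hs.2), ← wt, ← ws]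
      ring
    have e2 : ∀ r ∈ 𝕀, ∫ x, (Z (t, x) + Z (s, x)) * U (r, x)
        = (∫ x, Z (t, x) * U (r, x)) + ∫ x, Z (s, x) * U (r, x) := fun r hr => by
      rw [← integral_add (hmul (hZs t ht).continuous (hU.contDiff r hr).continuous (hZ0 t ht))
        (hmul (hZs s hs).continuous (hU.contDiff r hr).continuous (hZ0 s hs))]
      simp_rw [add_mul]
    rw [e2 t ht, e2 s hs] at e1
    have e3 := congrArg Complex.re e1
    have e4 : (∫ τ in s..t, -Complex.I * ∫ x, weakForm H U f (fun x => Z (t, x) + Z (s, x)) (τ, x)).re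
        = ∫ τ in s..t, (∫ x, weakForm H U f (fun x => Z (t, x) + Z (s, x)) (τ, x)).im := by
      have := Complex.reCLM.intervalIntegral_comp_comm (ii s t h0 h1 h2)
      rw [Complex.reCLM_apply] at this
      rw [← this]
      congr 1; ext τ
      simp
    rw [e4] at e3
    rw [← e3]
    have e5 := hsym s hs t ht
    simp only [hq, Complex.sub_re, Complex.add_re]
    linarith
  have unif : ∀ {F : ℝ × Rd d → ℂ}, ContinuousOn F (𝕀 ×ˢ univ) →
      (∀ t ∈ 𝕀, ∀ x ∉ K, F (t, x) = 0) → ∀ ε > 0, ∃ δ > 0, ∀ s ∈ 𝕀,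
      ∀ t ∈ 𝕀, |s - t| ≤ δ → ∀ x, ‖F (s, x) - F (t, x)‖ ≤ ε := by
    intro F hF h0 ε hε
    have huc := ((isCompact_Icc (a := (0 : ℝ)) (b := 1)).prod hK).uniformContinuousOn_of_continuous
      (hF.mono (prod_mono le_rfl (subset_univ _)))
    rw [Metric.uniformContinuousOn_iff] at huc
    obtain ⟨δ, hδ, h⟩ := huc ε hε
    refine ⟨δ / 2, by positivity, fun s hs t ht hst x => ?_⟩
    by_cases hx : x ∈ K
    · have := h (s, x) ⟨hs, hx⟩ (t, x) ⟨ht, hx⟩ (by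
        rw [Prod.dist_eq, dist_self, max_eq_left dist_nonneg, Real.dist_eq]
        linarith)
      rw [dist_eq_norm] at this
      exact this.le
    · rw [h0 s hs x hx, h0 t ht x hx, sub_zero, norm_zero]; exact hε.le
  have hdx0 : ∀ k, ∀ t ∈ 𝕀, ∀ x ∉ K, dx k Z (t, x) = 0 := fun k t ht x hx => by
    rw [dx, fderiv_eq_zero_of_notMem hK.isClosed (hZ0 t ht) hx]; simp
  have main := eq_of_increment_le (r := fun t => q t - ∫ τ in (0 : ℝ)..t, D τ)
    (Φ := fun t => ∫ τ in (0 : ℝ)..t, φ τ) hT.1 ?_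
  · simp only [intervalIntegral.integral_same, sub_zero] at main
    linarith
  intro ε hε
  obtain ⟨δ₀, hδ₀, hd₀⟩ := unif hZc hZ0 (ε / 2) (by positivity)
  choose δ₁ hδ₁ hd₁ using fun k => unif (hZd k) (hdx0 k) (ε / 2) (by positivity)
  obtain ⟨δ, hδ, hδle⟩ : ∃ δ > 0, δ ≤ δ₀ ∧ ∀ k, δ ≤ δ₁ k := by
    have hne : (insert δ₀ (Finset.univ.image δ₁)).Nonempty := Finset.insert_nonempty _ _
    refine ⟨(insert δ₀ (Finset.univ.image δ₁)).min' hne, ?_, ?_, fun k => ?_⟩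
    · have := Finset.min'_mem _ hne
      rw [Finset.mem_insert, Finset.mem_image] at this
      rcases this with h | ⟨k, _, h⟩
      · rw [h]; exact hδ₀
      · rw [← h]; exact hδ₁ k
    · exact Finset.min'_le _ _ (by simp)
    · exact Finset.min'_le _ _ (by simp)
  refine ⟨δ, hδ, fun s t h0 h1 h2 hst => ?_⟩
  have h2' := h2.trans hT.2
  have hs : s ∈ 𝕀 := ⟨h0, h1.trans h2'⟩
  have ht : t ∈ 𝕀 := ⟨h0.trans h1, h2'⟩
  have hvs : ContDiff ℝ ∞ fun x => Z (t, x) + Z (s, x) := (hZs t ht).add (hZs s hs)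
  have hvc : HasCompactSupport fun x => Z (t, x) + Z (s, x) :=
    HasCompactSupport.intro hK fun x hx => by simp [hZ0 t ht x hx, hZ0 s hs x hx]
  have hwi := hU.integrable_weakForm hH hvs hvc
  have hwI : IntegrableOn (fun τ => (∫ x, weakForm H U f (fun x => Z (t, x) + Z (s, x)) (τ, x)).im) (Icc 0 1) :=
    hwi.integral_prod_left.im
  have e1 : (q t - ∫ τ in (0 : ℝ)..t, D τ) - (q s - ∫ τ in (0 : ℝ)..s, D τ)
      = ∫ τ in s..t, ((∫ x, weakForm H U f (fun x => Z (t, x) + Z (s, x)) (τ, x)).im - D τ) := by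
    rw [intervalIntegral.integral_sub (sub hwI s t h0 h1 h2') (sub hDi s t h0 h1 h2'), ← incr s t h0 h1 h2',
      ← intervalIntegral.integral_interval_sub_left (sub hDi 0 t le_rfl ht.1 h2') (sub hDi 0 s le_rfl h0 hs.2)]
    ring
  rw [e1, intervalIntegral.integral_interval_sub_left (sub hφi 0 t le_rfl ht.1 h2') (sub hφi 0 s le_rfl h0 hs.2),
    ← intervalIntegral.integral_const_mul]
  rw [← Real.norm_eq_abs]
  refine intervalIntegral.norm_integral_le_of_norm_le h1 ?_ ((sub hφi s t h0 h1 h2').const_mul ε)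
  have ae1 : ∀ᵐ τ : ℝ, τ ∈ 𝕀 → Integrable (fun x => weakForm H U f (fun x => Z (t, x) + Z (s, x)) (τ, x))
      ∧ Integrable (fun x => weakForm H U f (fun x => Z (τ, x)) (τ, x)) ∧ Integrable (fun x => b (τ, x)) ∧
      ∀ k l x, ‖(met H k l (τ, x) : ℂ)‖ ≤ 2 := by
    rw [← ae_restrict_iff' measurableSet_Icc]
    filter_upwards [hwi.prod_right_ae, hWi.prod_right_ae, hbi.prod_right_ae, norm_met_le hH] with τ a1 a2 a3 a4
    exact ⟨a1, a2, a3, a4⟩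
  filter_upwards [ae1] with τ hτ hτst
  have hτI : τ ∈ 𝕀 := ⟨h0.trans hτst.1.le, hτst.2.trans h2'⟩
  obtain ⟨a1, a2, a3, a4⟩ := hτ hτI
  have htτ : |t - τ| ≤ δ := by rw [abs_of_nonneg (by linarith [hτst.2])]; linarith [hτst.1]
  have hsτ : |s - τ| ≤ δ := by rw [abs_of_nonpos (by linarith [hτst.1])]; linarith [hτst.2]
  have e2 : (∫ x, weakForm H U f (fun x => Z (t, x) + Z (s, x)) (τ, x)).im - D τ
      = (∫ x, (weakForm H U f (fun x => Z (t, x) + Z (s, x)) (τ, x) -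
          2 * weakForm H U f (fun x => Z (τ, x)) (τ, x))).im := by
    rw [integral_sub a1 (a2.const_mul 2), integral_const_mul]
    simp [hD]
  rw [e2]
  refine (Complex.abs_im_le_norm _).trans ((norm_integral_le_of_norm_le (a3.const_mul ε) ?_).trans
    (le_of_eq (integral_const_mul _ _)))
  refine Eventually.of_forall fun x => ?_
  have hdsum : ∀ k, fderiv ℝ (fun x => Z (t, x) + Z (s, x)) x (eb k) = dx k Z (t, x) + dx k Z (s, x) := fun k => by
    rw [fderiv_fun_add ((hZs t ht).differentiable (by norm_num) x) ((hZs s hs).differentiable (by norm_num) x)]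
    rfl
  have e3 : weakForm H U f (fun x => Z (t, x) + Z (s, x)) (τ, x) - 2 * weakForm H U f (fun x => Z (τ, x)) (τ, x)
      = (∑ k, ∑ l, (met H k l (τ, x) : ℂ) * dx l U (τ, x) *
          ((dx k Z (t, x) - dx k Z (τ, x)) + (dx k Z (s, x) - dx k Z (τ, x)))) +
        ((Z (t, x) - Z (τ, x)) + (Z (s, x) - Z (τ, x))) * f (τ, x) := by
    simp only [weakForm, hdsum]
    rw [mul_add, Finset.mul_sum, add_sub_add_comm, ← Finset.sum_sub_distrib]
    congr 1
    · refine Finset.sum_congr rfl fun k _ => ?_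
      rw [Finset.mul_sum, ← Finset.sum_sub_distrib]
      refine Finset.sum_congr rfl fun l _ => ?_
      rw [show fderiv ℝ (fun x => Z (τ, x)) x (eb k) = dx k Z (τ, x) from rfl]
      ring
    · ring
  rw [e3]
  by_cases hx : x ∈ K
  · have hbx : b (τ, x) = (∑ _k : Fin d, ∑ l, 2 * ‖dx l U (τ, x)‖) + ‖f (τ, x)‖ := by
      rw [hb]
      exact indicator_of_mem (show (τ, x) ∈ univ ×ˢ K from ⟨mem_univ _, hx⟩) _
    rw [hbx, mul_add, Finset.mul_sum]
    refine (norm_add_le _ _).trans (add_le_add ((norm_sum_le _ _).trans (Finset.sum_le_sum fun k _ => ?_)) ?_)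
    · rw [Finset.mul_sum]
      refine (norm_sum_le _ _).trans (Finset.sum_le_sum fun l _ => ?_)
      rw [norm_mul, norm_mul]
      have n1 : ‖(dx k Z (t, x) - dx k Z (τ, x)) + (dx k Z (s, x) - dx k Z (τ, x))‖ ≤ ε :=
        (norm_add_le _ _).trans (by
          linarith [hd₁ k t ht τ hτI (htτ.trans (hδle.2 k)) x, hd₁ k s hs τ hτI (hsτ.trans (hδle.2 k)) x])
      calc _ ≤ 2 * ‖dx l U (τ, x)‖ * ε := by gcongr; exact a4 k l x
        _ = _ := by ring
    · rw [norm_mul]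
      gcongr
      exact (norm_add_le _ _).trans (by
        linarith [hd₀ t ht τ hτI (htτ.trans hδle.1) x, hd₀ s hs τ hτI (hsτ.trans hδle.1) x])
  · have hbx : b (τ, x) = 0 := by
      rw [hb]
      exact indicator_of_notMem (fun h => hx h.2) _
    rw [hbx, hZ0 t ht x hx, hZ0 s hs x hx, hZ0 τ hτI x hx]
    simp [hdx0 _ t ht x hx, hdx0 _ s hs x hx, hdx0 _ τ hτI x hx]

/-- The norm of the spatial gradient. -/
def gradn (U : ℝ × Rd d → ℂ) (z : ℝ × Rd d) : ℝ := ‖fderiv ℝ (fun x => U (z.1, x)) z.2‖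

theorem gradn_nonneg (U : ℝ × Rd d → ℂ) (z : ℝ × Rd d) : 0 ≤ gradn U z := norm_nonneg _

theorem norm_eb (i : Fin d) : ‖(eb i : Rd d)‖ = 1 := by simp

theorem norm_dx_le (U : ℝ × Rd d → ℂ) (k : Fin d) (z : ℝ × Rd d) : ‖dx k U z‖ ≤ gradn U z := by
  refine (ContinuousLinearMap.le_opNorm _ _).trans ?_
  rw [norm_eb, mul_one]
  rfl

theorem fderiv_ofReal {β : Rd d → ℝ} (hβ : Differentiable ℝ β) (x e : Rd d) :
    fderiv ℝ (fun x => (β x : ℂ)) x e = ((fderiv ℝ β x e : ℝ) : ℂ) := by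
  have : HasFDerivAt (fun x => (β x : ℂ)) (Complex.ofRealCLM.comp (fderiv ℝ β x)) x :=
    Complex.ofRealCLM.hasFDerivAt.comp x (hβ x).hasFDerivAt
  rw [this.fderiv]; simp

theorem fderiv_conj {v : Rd d → ℂ} (hv : Differentiable ℝ v) (x e : Rd d) :
    fderiv ℝ (fun x => conj (v x)) x e = conj (fderiv ℝ v x e) := by
  have : HasFDerivAt (fun x => conj (v x)) ((Complex.conjCLE : ℂ →L[ℝ] ℂ).comp (fderiv ℝ v x)) x :=
    (Complex.conjCLE : ℂ →L[ℝ] ℂ).hasFDerivAt.comp x (hv x).hasFDerivAt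
  rw [this.fderiv]; simp

theorem contDiff_conj {v : Rd d → ℂ} {n : WithTop ℕ∞} (hv : ContDiff ℝ n v) :
    ContDiff ℝ n fun x => conj (v x) := (Complex.conjCLE : ℂ →L[ℝ] ℂ).contDiff.comp hv

theorem hermitian_sum_im (a : Fin d → Fin d → ℝ) (ha : ∀ k l, a k l = a l k) (ξ : Fin d → ℂ) :
    (∑ k, ∑ l, (a k l : ℂ) * ξ l * conj (ξ k)).im = 0 := by
  rw [← Complex.conj_eq_iff_im, map_sum]
  simp_rw [map_sum, map_mul, Complex.conj_ofReal, Complex.conj_conj]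
  rw [Finset.sum_comm]
  refine Finset.sum_congr rfl fun k _ => Finset.sum_congr rfl fun l _ => ?_
  rw [ha]; ring

theorem SmoothSolution.enorm_quadratic_le
    (hH : TamePerturbation H P B)
    (hU : SmoothSolution H u₀ U f) {Z : ℝ × Rd d → ℂ} {K : Set (Rd d)} (hK : IsCompact K)
    (hZs : ∀ t ∈ 𝕀, ContDiff ℝ ∞ fun x => Z (t, x))
    (hZ0 : ∀ t ∈ 𝕀, ∀ x ∉ K, Z (t, x) = 0)
    (hZc : ContinuousOn Z (𝕀 ×ˢ univ))
    (hZd : ∀ k, ContinuousOn (dx k Z) (𝕀 ×ˢ univ))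
    (hsym : ∀ s ∈ 𝕀, ∀ t ∈ 𝕀,
      (∫ x, Z (t, x) * U (s, x)).re = (∫ x, Z (s, x) * U (t, x)).re) {T : ℝ}
    (hT : T ∈ 𝕀) :
    ‖(∫ x, Z (T, x) * U (T, x)).re - (∫ x, Z (0, x) * U (0, x)).re‖ₑ
      ≤ ∫⁻ z, 2 * ‖(weakForm H U f (fun x => Z (z.1, x)) z).im‖ₑ ∂(slab d) := by
  have hWi := integrable_weakForm_family hH hU hK hZ0 hZc hZd
  rw [hU.quadratic_identity hH hK hZs hZ0 hZc hZd hsym hT, intervalIntegral.integral_of_le hT.1]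
  refine (enorm_integral_le_lintegral_enorm _).trans ?_
  rw [lintegral_slab ((Complex.continuous_im.comp_aestronglyMeasurable hWi.1).enorm.const_mul 2)]
  refine (lintegral_mono_set (Ioc_subset_Icc_self.trans (Icc_subset_Icc_right hT.2))).trans ?_
  refine lintegral_mono_ae ?_
  filter_upwards [hWi.prod_right_ae] with τ hτ
  have : (∫ x, weakForm H U f (fun x => Z (τ, x)) (τ, x)).im
      = ∫ x, (weakForm H U f (fun x => Z (τ, x)) (τ, x)).im := by
    have := Complex.imCLM.integral_comp_comm hτ
    simpa using this.symm
  rw [this, enorm_mul, lintegral_const_mul' _ _ (by simp)]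
  refine mul_le_mul' (by rw [← ofReal_norm]; simp) (enorm_integral_le_lintegral_enorm _)

theorem SmoothSolution.energy_le
    (hH : TamePerturbation H P B)
    (hU : SmoothSolution H u₀ U f) {β : Rd d → ℝ} (hβ : ContDiff ℝ ∞ β) (hc : HasCompactSupport β)
    (hβ0 : ∀ x, 0 ≤ β x) {T : ℝ} (hT : T ∈ 𝕀) :
    ∫⁻ x, ENNReal.ofReal (β x * ‖U (T, x)‖ ^ 2) ≤ (∫⁻ x, ENNReal.ofReal (β x * ‖U (0, x)‖ ^ 2)) +
      ∫⁻ z, ENNReal.ofReal (4 * d ^ 2 * ‖fderiv ℝ β z.2‖ * (gradn U z * ‖U z‖)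
        + 2 * β z.2 * (‖U z‖ * ‖f z‖)) ∂(slab d) := by
  set Z : ℝ × Rd d → ℂ := fun z => (β z.2 : ℂ) * conj (U z) with hZ
  have hβd : Differentiable ℝ β := hβ.differentiable (by norm_num)
  have hβc : ContDiff ℝ ∞ fun x => (β x : ℂ) := Complex.ofRealCLM.contDiff.comp hβ
  have hUd : ∀ t ∈ 𝕀, Differentiable ℝ fun x => U (t, x) := fun t ht =>
    (hU.contDiff t ht).differentiable (by norm_num)
  have hZs : ∀ t ∈ 𝕀, ContDiff ℝ ∞ fun x => Z (t, x) := fun t ht =>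
    hβc.mul (contDiff_conj (hU.contDiff t ht))
  have hZ0 : ∀ t ∈ 𝕀, ∀ x ∉ tsupport β, Z (t, x) = 0 := fun t _ x hx => by
    simp [hZ, image_eq_zero_of_notMem_tsupport hx]
  have hconj : ∀ {F : ℝ × Rd d → ℂ}, ContinuousOn F (𝕀 ×ˢ univ) →
      ContinuousOn (fun z => conj (F z)) (𝕀 ×ˢ univ) := fun hF =>
    Complex.continuous_conj.comp_continuousOn hF
  have hZc : ContinuousOn Z (𝕀 ×ˢ univ) :=
    ((hβc.continuous.comp continuous_snd).continuousOn).mul (hconj hU.continuousOn)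
  have hdx : ∀ k, ∀ z ∈ 𝕀 ×ˢ (univ : Set (Rd d)), dx k Z z =
      ((fderiv ℝ β z.2 (eb k) : ℝ) : ℂ) * conj (U z) + (β z.2 : ℂ) * conj (dx k U z) := by
    intro k z hz
    have h1 : DifferentiableAt ℝ (fun x => (β x : ℂ)) z.2 := hβc.differentiable (by norm_num) _
    have h2 : DifferentiableAt ℝ (fun x => conj (U (z.1, x))) z.2 :=
      (contDiff_conj (hU.contDiff z.1 hz.1)).differentiable (by norm_num) _
    rw [dx]
    simp only [hZ]
    rw [fderiv_fun_mul h1 h2]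
    simp only [_root_.add_apply, _root_.smul_apply, smul_eq_mul]
    rw [fderiv_ofReal hβd, fderiv_conj (hUd z.1 hz.1), dx]
    ring
  have hZd : ∀ k, ContinuousOn (dx k Z) (𝕀 ×ˢ univ) := fun k => by
    refine ContinuousOn.congr ?_ (hdx k)
    refine ContinuousOn.add (ContinuousOn.mul ?_ (hconj hU.continuousOn))
      (((hβc.continuous.comp continuous_snd).continuousOn).mul (hconj (hU.continuousOn_dx k)))
    exact (Complex.continuous_ofReal.comp (((hβ.continuous_fderiv (by norm_num)).clm_apply
      continuous_const).comp continuous_snd)).continuousOn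
  have hsym : ∀ s ∈ 𝕀, ∀ t ∈ 𝕀,
      (∫ x, Z (t, x) * U (s, x)).re = (∫ x, Z (s, x) * U (t, x)).re := by
    intro s _ t _
    rw [← Complex.conj_re, ← integral_conj]
    congr 2
    ext x
    simp only [hZ, map_mul, Complex.conj_ofReal, Complex.conj_conj]
    ring
  have hq : ∀ t ∈ 𝕀, ∫⁻ x, ENNReal.ofReal (β x * ‖U (t, x)‖ ^ 2)
      = ENNReal.ofReal (∫ x, Z (t, x) * U (t, x)).re := by
    intro t ht
    have e : ∀ x, Z (t, x) * U (t, x) = ((β x * ‖U (t, x)‖ ^ 2 : ℝ) : ℂ) := fun x => by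
      simp only [hZ]
      rw [mul_assoc, Complex.conj_mul']
      push_cast; rfl
    simp_rw [e]
    rw [integral_complex_ofReal, Complex.ofReal_re, ofReal_integral_eq_lintegral_ofReal]
    · exact (hβ.continuous.mul ((hU.contDiff t ht).continuous.norm.pow 2)).integrable_of_hasCompactSupport
        hc.mul_right
    · exact Eventually.of_forall fun x => mul_nonneg (hβ0 x) (by positivity)
  rw [hq T hT, hq 0 (by simp)]
  have hmain := hU.enorm_quadratic_le hH hc.isCompact hZs hZ0 hZc hZd hsym hT
  calc _ ≤ ENNReal.ofReal ((∫ x, Z (0, x) * U (0, x)).re +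
        ‖(∫ x, Z (T, x) * U (T, x)).re - (∫ x, Z (0, x) * U (0, x)).re‖) := by
        refine ENNReal.ofReal_le_ofReal ?_
        have := le_abs_self ((∫ x, Z (T, x) * U (T, x)).re - (∫ x, Z (0, x) * U (0, x)).re)
        rw [Real.norm_eq_abs]
        linarith
    _ ≤ _ := ENNReal.ofReal_add_le
    _ ≤ _ := by
        rw [ofReal_norm]
        refine add_le_add le_rfl (hmain.trans (lintegral_mono_ae ?_))
        filter_upwards [ae_slab_mem, ae_slab_of_ae_tm hH.symm, ae_slab_of_ae_tm (norm_met_le hH)] with z hz h1 h2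
        have hw : weakForm H U f (fun x => Z (z.1, x)) z =
            (∑ k, ∑ l, (met H k l z : ℂ) * dx l U z * (((fderiv ℝ β z.2 (eb k) : ℝ) : ℂ) * conj (U z))) +
            (β z.2 : ℂ) * (∑ k, ∑ l, (met H k l z : ℂ) * dx l U z * conj (dx k U z)) +
            (β z.2 : ℂ) * conj (U z) * f z := by
          rw [weakForm]
          congr 1
          rw [Finset.mul_sum, ← Finset.sum_add_distrib]
          refine Finset.sum_congr rfl fun k _ => ?_
          rw [Finset.mul_sum, ← Finset.sum_add_distrib]
          refine Finset.sum_congr rfl fun l _ => ?_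
          rw [show fderiv ℝ (fun x => Z (z.1, x)) z.2 (eb k) = dx k Z z from rfl, hdx k z hz]
          ring
        have him : ((β z.2 : ℂ) * (∑ k, ∑ l, (met H k l z : ℂ) * dx l U z * conj (dx k U z))).im = 0 := by
          rw [Complex.im_ofReal_mul, hermitian_sum_im (fun k l => met H k l z) (fun k l => by
            simp only [met]
            rw [← Matrix.transpose_apply 1 l k, Matrix.transpose_one]
            congr 1
            exact h1 k l z.2), mul_zero]
        have hb : |(weakForm H U f (fun x => Z (z.1, x)) z).im| ≤
            2 * d ^ 2 * ‖fderiv ℝ β z.2‖ * (gradn U z * ‖U z‖) + β z.2 * (‖U z‖ * ‖f z‖) := by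
          rw [hw, Complex.add_im, Complex.add_im, him, add_zero]
          refine (abs_add_le _ _).trans (add_le_add ((Complex.abs_im_le_norm _).trans ?_)
            ((Complex.abs_im_le_norm _).trans (le_of_eq ?_)))
          · have : ∀ k l : Fin d, ‖(met H k l z : ℂ) * dx l U z * (((fderiv ℝ β z.2 (eb k) : ℝ) : ℂ) * conj (U z))‖
                ≤ 2 * gradn U z * (‖fderiv ℝ β z.2‖ * ‖U z‖) := by
              intro k l
              have h3 : ‖((fderiv ℝ β z.2 (eb k) : ℝ) : ℂ)‖ ≤ ‖fderiv ℝ β z.2‖ := by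
                rw [Complex.norm_real]
                refine (ContinuousLinearMap.le_opNorm _ _).trans ?_
                rw [norm_eb, mul_one]
              rw [norm_mul, norm_mul, norm_mul, Complex.norm_conj]
              exact mul_le_mul (mul_le_mul (h2 k l z.2) (norm_dx_le U l z) (norm_nonneg _) (by norm_num))
                (mul_le_mul_of_nonneg_right h3 (norm_nonneg _)) (by positivity)
                (mul_nonneg (by norm_num) (gradn_nonneg U z))
            refine (norm_sum_le _ _).trans ((Finset.sum_le_sum fun k _ =>
              (norm_sum_le _ _).trans (Finset.sum_le_sum fun l _ => this k l)).trans (le_of_eq ?_))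
            simp
            ring
          · rw [norm_mul, norm_mul, Complex.norm_conj, Complex.norm_real, Real.norm_of_nonneg (hβ0 _)]
            ring
        have e2 : (2 : ℝ≥0∞) * ‖(weakForm H U f (fun x => Z (z.1, x)) z).im‖ₑ
            = ENNReal.ofReal (2 * |(weakForm H U f (fun x => Z (z.1, x)) z).im|) := by
          rw [ENNReal.ofReal_mul (by norm_num), ENNReal.ofReal_ofNat, ← ofReal_norm, Real.norm_eq_abs]
        rw [e2]
        refine ENNReal.ofReal_le_ofReal ?_
        linarith

/-- The density in the Morawetz identity. Here `ξ` stands for the gradient of the solution, `u` for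
its value, `b` for the vector field, `B k m` for `∂_k b_m`, `A m` for `∂_m` of the metric, `δ` for the
divergence of `b` and `η` for the gradient of the divergence. -/
def morawetzDensity (a : Fin d → Fin d → ℝ) (A : Fin d → Fin d → Fin d → ℝ) (ξ : Fin d → ℂ)
    (b : Fin d → ℝ) (B : Fin d → Fin d → ℝ) (δ : ℝ) (η : Fin d → ℝ) (u f : ℂ) : ℝ :=
  (∑ k, ∑ l, ∑ m, 2 * (a k l * (ξ l * conj (ξ m)).re * B k m))
    - (∑ m, ∑ k, ∑ l, b m * A m k l * (ξ l * conj (ξ k)).re)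
    + (∑ k, ∑ l, a k l * η k * (ξ l * conj u).re)
    + 2 * (((∑ m, (b m : ℂ) * conj (ξ m)) + (δ : ℂ) / 2 * conj u) * f).re

theorem morawetz_algebra (a : Fin d → Fin d → ℝ) (ha : ∀ k l, a k l = a l k)
    (A : Fin d → Fin d → Fin d → ℝ) (ξ : Fin d → ℂ) (X : Fin d → Fin d → ℂ)
    (hX : ∀ k l, X k l = X l k) (b : Fin d → ℝ) (B : Fin d → Fin d → ℝ) (δ : ℝ)
    (hδ : δ = ∑ m, B m m) (η : Fin d → ℝ) (u f : ℂ) :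
    2 * ((∑ k, ∑ l, (a k l : ℂ) * ξ l * (Complex.I * ((∑ m, ((B k m : ℂ) * conj (ξ m)
        + (b m : ℂ) * conj (X m k))) + ((η k : ℂ) / 2 * conj u + (δ : ℂ) / 2 * conj (ξ k)))))
      + Complex.I * ((∑ m, (b m : ℂ) * conj (ξ m)) + (δ : ℂ) / 2 * conj u) * f).im
    = morawetzDensity a A ξ b B δ η u f
      + ∑ m, (B m m * (∑ k, ∑ l, a k l * (ξ l * conj (ξ k)).re)
        + b m * ∑ k, ∑ l, (A m k l * (ξ l * conj (ξ k)).re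
          + a k l * ((X l m) * conj (ξ k) + ξ l * conj (X k m)).re)) := by
  have hI : ∀ w : ℂ, (Complex.I * w).im = w.re := fun w => by simp
  have hre : ∀ (r : ℝ) (w : ℂ), ((r : ℂ) * w).re = r * w.re := fun r w => Complex.re_ofReal_mul r w
  have e1 : ∀ k l, (a k l : ℂ) * ξ l * (Complex.I * ((∑ m, ((B k m : ℂ) * conj (ξ m)
        + (b m : ℂ) * conj (X m k))) + ((η k : ℂ) / 2 * conj u + (δ : ℂ) / 2 * conj (ξ k))))
      = Complex.I * ((∑ m, (((a k l * B k m : ℝ) : ℂ) * (ξ l * conj (ξ m))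
        + ((a k l * b m : ℝ) : ℂ) * (ξ l * conj (X m k))))
        + (((a k l * η k / 2 : ℝ) : ℂ) * (ξ l * conj u)
        + ((a k l * δ / 2 : ℝ) : ℂ) * (ξ l * conj (ξ k)))) := by
    intro k l
    have : ∑ m, (((a k l * B k m : ℝ) : ℂ) * (ξ l * conj (ξ m))
        + ((a k l * b m : ℝ) : ℂ) * (ξ l * conj (X m k)))
        = (a k l : ℂ) * ξ l * ∑ m, ((B k m : ℂ) * conj (ξ m) + (b m : ℂ) * conj (X m k)) := by
      rw [Finset.mul_sum]
      refine Finset.sum_congr rfl fun m _ => ?_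
      push_cast; ring
    rw [this]
    push_cast
    ring
  have e2 : (∑ k, ∑ l, (a k l : ℂ) * ξ l * (Complex.I * ((∑ m, ((B k m : ℂ) * conj (ξ m)
        + (b m : ℂ) * conj (X m k))) + ((η k : ℂ) / 2 * conj u + (δ : ℂ) / 2 * conj (ξ k))))).im
      = ∑ k, ∑ l, ((∑ m, (a k l * B k m * (ξ l * conj (ξ m)).re
        + a k l * b m * (ξ l * conj (X m k)).re))
        + (a k l * η k / 2 * (ξ l * conj u).re + a k l * δ / 2 * (ξ l * conj (ξ k)).re)) := by
    rw [Complex.im_sum]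
    refine Finset.sum_congr rfl fun k _ => ?_
    rw [Complex.im_sum]
    refine Finset.sum_congr rfl fun l _ => ?_
    rw [e1, hI, Complex.add_re, Complex.add_re, Complex.re_sum, hre, hre]
    simp_rw [Complex.add_re, hre]
  have e3 : ∀ m, ∑ k, ∑ l, a k l * ((X l m) * conj (ξ k) + ξ l * conj (X k m)).re
      = ∑ k, ∑ l, 2 * (a k l * (ξ l * conj (X m k)).re) := by
    intro m
    have s1 : ∑ k, ∑ l, a k l * ((X l m) * conj (ξ k)).re = ∑ k, ∑ l, a k l * (ξ l * conj (X m k)).re := by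
      rw [Finset.sum_comm]
      refine Finset.sum_congr rfl fun k _ => Finset.sum_congr rfl fun l _ => ?_
      rw [ha l k, hX k m]
      congr 1
      rw [← Complex.conj_re, map_mul, Complex.conj_conj, mul_comm]
    simp_rw [Complex.add_re, mul_add, Finset.sum_add_distrib]
    rw [s1]
    simp_rw [hX _ m, two_mul, Finset.sum_add_distrib]
  have e4 : ∑ m, (B m m * (∑ k, ∑ l, a k l * (ξ l * conj (ξ k)).re)
        + b m * ∑ k, ∑ l, (A m k l * (ξ l * conj (ξ k)).re
          + a k l * ((X l m) * conj (ξ k) + ξ l * conj (X k m)).re))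
      = δ * (∑ k, ∑ l, a k l * (ξ l * conj (ξ k)).re)
        + (∑ m, ∑ k, ∑ l, b m * A m k l * (ξ l * conj (ξ k)).re)
        + ∑ k, ∑ l, ∑ m, 2 * (a k l * b m * (ξ l * conj (X m k)).re) := by
    have s2 : ∑ k, ∑ l, ∑ m, 2 * (a k l * b m * (ξ l * conj (X m k)).re)
        = ∑ m, b m * ∑ k, ∑ l, a k l * ((X l m) * conj (ξ k) + ξ l * conj (X k m)).re := by
      simp_rw [e3, Finset.mul_sum]
      calc _ = ∑ k, ∑ m, ∑ l, 2 * (a k l * b m * (ξ l * conj (X m k)).re) :=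
            Finset.sum_congr rfl fun k _ => Finset.sum_comm
        _ = ∑ m, ∑ k, ∑ l, 2 * (a k l * b m * (ξ l * conj (X m k)).re) := Finset.sum_comm
        _ = _ := by
            refine Finset.sum_congr rfl fun m _ => Finset.sum_congr rfl fun k _ =>
              Finset.sum_congr rfl fun l _ => ?_
            ring
    rw [s2, hδ, Finset.sum_mul, ← Finset.sum_add_distrib, ← Finset.sum_add_distrib]
    refine Finset.sum_congr rfl fun m _ => ?_
    simp_rw [Finset.sum_add_distrib, mul_add, Finset.mul_sum, mul_assoc]
    ring
  rw [Complex.add_im, e2, e4, mul_assoc Complex.I, hI, morawetzDensity]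
  have e5 : ∑ k, ∑ l, ((∑ m, (a k l * B k m * (ξ l * conj (ξ m)).re
        + a k l * b m * (ξ l * conj (X m k)).re))
        + (a k l * η k / 2 * (ξ l * conj u).re + a k l * δ / 2 * (ξ l * conj (ξ k)).re))
      = (∑ k, ∑ l, ∑ m, 2 * (a k l * (ξ l * conj (ξ m)).re * B k m)) / 2
        + (∑ k, ∑ l, ∑ m, 2 * (a k l * b m * (ξ l * conj (X m k)).re)) / 2
        + (∑ k, ∑ l, a k l * η k * (ξ l * conj u).re) / 2
        + δ * (∑ k, ∑ l, a k l * (ξ l * conj (ξ k)).re) / 2 := by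
    simp_rw [Finset.mul_sum, Finset.sum_div, ← Finset.sum_add_distrib]
    refine Finset.sum_congr rfl fun k _ => Finset.sum_congr rfl fun l _ => ?_
    have : ∀ m, 2 * (a k l * (ξ l * conj (ξ m)).re * B k m) / 2 + 2 * (a k l * b m * (ξ l * conj (X m k)).re) / 2
        = a k l * B k m * (ξ l * conj (ξ m)).re + a k l * b m * (ξ l * conj (X m k)).re := fun m => by ring
    simp_rw [this]
    ring
  rw [e5]
  ring

/-- The lower bound on the density in the Morawetz identity. -/
theorem le_morawetzDensity (h : Fin d → Fin d → ℝ) (A : Fin d → Fin d → Fin d → ℝ) (ξ : Fin d → ℂ)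
    (b : Fin d → ℝ) (B : Fin d → Fin d → ℝ) (δ : ℝ) (η : Fin d → ℝ) (u f : ℂ) {ρ E₀ E₁ p g : ℝ}
    (hE₀ : 0 ≤ E₀) (hE₁ : 0 ≤ E₁) (hp : 0 ≤ p) (hp1 : p ≤ 1) (hg : 0 ≤ g) (hξ : ∀ k, ‖ξ k‖ ≤ g)
    (hh : ∀ k l, |h k l| ≤ p) (hA : ∀ m k l, |A m k l| ≤ p) (hb : ∀ m, |b m| ≤ E₁)
    (hB : ∀ k m, |B k m| ≤ E₁) (hδ : |δ| ≤ E₁) (hη : ∀ k, |η k| ≤ E₁)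
    (hlow : ρ * (∑ k, ‖ξ k‖ ^ 2) - E₀ * (∑ k, ‖ξ k‖ ^ 2) ≤ ∑ k, ∑ m, B k m * (ξ k * conj (ξ m)).re) :
    2 * (ρ * ∑ k, ‖ξ k‖ ^ 2) - morawetzDensity (fun k l => (1 : Matrix (Fin d) (Fin d) ℝ) k l + h k l)
        A ξ b B δ η u f
      ≤ 2 * d * (E₀ * g ^ 2) + 4 * (d + 1) ^ 3 * (E₁ * (p * g ^ 2 + g * ‖u‖ + (g + ‖u‖) * ‖f‖)) := by
  have hre : ∀ {w z : ℂ} {s t : ℝ}, ‖w‖ ≤ s → ‖z‖ ≤ t → |(w * conj z).re| ≤ s * t := by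
    intro w z s t hw hz
    refine (Complex.abs_re_le_norm _).trans ?_
    rw [norm_mul, Complex.norm_conj]
    exact mul_le_mul hw hz (norm_nonneg _) ((norm_nonneg _).trans hw)
  have s1 : ∑ k, ∑ l, ∑ m, 2 * (((1 : Matrix (Fin d) (Fin d) ℝ) k l + h k l) * (ξ l * conj (ξ m)).re * B k m)
      = 2 * (∑ k, ∑ m, B k m * (ξ k * conj (ξ m)).re)
        + ∑ k, ∑ l, ∑ m, 2 * (h k l * (ξ l * conj (ξ m)).re * B k m) := by
    simp_rw [add_mul, mul_add, Finset.sum_add_distrib, Finset.mul_sum]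
    congr 1
    refine Finset.sum_congr rfl fun k _ => ?_
    rw [Finset.sum_eq_single k]
    · refine Finset.sum_congr rfl fun m _ => ?_
      rw [Matrix.one_apply_eq]; ring
    · intro l _ hl
      rw [Matrix.one_apply_ne hl.symm]; simp
    · simp
  have t1 : |∑ k, ∑ l, ∑ m, 2 * (h k l * (ξ l * conj (ξ m)).re * B k m)| ≤ d ^ 3 * (2 * (p * (g * g) * E₁)) := by
    have : ∀ k l m, |2 * (h k l * (ξ l * conj (ξ m)).re * B k m)| ≤ 2 * (p * (g * g) * E₁) := by
      intro k l m
      rw [abs_mul, abs_mul, abs_mul, abs_two]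
      have := hre (hξ l) (hξ m)
      have h1 := hh k l
      have h2 := hB k m
      gcongr
    refine (Finset.abs_sum_le_sum_abs _ _).trans ((Finset.sum_le_sum fun k _ =>
      (Finset.abs_sum_le_sum_abs _ _).trans (Finset.sum_le_sum fun l _ =>
      (Finset.abs_sum_le_sum_abs _ _).trans (Finset.sum_le_sum fun m _ => this k l m))).trans (le_of_eq ?_))
    simp; ring
  have t2 : |∑ m, ∑ k, ∑ l, b m * A m k l * (ξ l * conj (ξ k)).re| ≤ d ^ 3 * (E₁ * p * (g * g)) := by
    have : ∀ m k l, |b m * A m k l * (ξ l * conj (ξ k)).re| ≤ E₁ * p * (g * g) := by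
      intro m k l
      rw [abs_mul, abs_mul]
      have := hre (hξ l) (hξ k)
      have h1 := hb m
      have h2 := hA m k l
      gcongr
    refine (Finset.abs_sum_le_sum_abs _ _).trans ((Finset.sum_le_sum fun k _ =>
      (Finset.abs_sum_le_sum_abs _ _).trans (Finset.sum_le_sum fun l _ =>
      (Finset.abs_sum_le_sum_abs _ _).trans (Finset.sum_le_sum fun m _ => this k l m))).trans (le_of_eq ?_))
    simp; ring
  have t3 : |∑ k, ∑ l, ((1 : Matrix (Fin d) (Fin d) ℝ) k l + h k l) * η k * (ξ l * conj u).re|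
      ≤ d ^ 2 * (2 * E₁ * (g * ‖u‖)) := by
    have : ∀ k l, |((1 : Matrix (Fin d) (Fin d) ℝ) k l + h k l) * η k * (ξ l * conj u).re|
        ≤ 2 * E₁ * (g * ‖u‖) := by
      intro k l
      rw [abs_mul, abs_mul]
      have := hre (hξ l) (le_refl ‖u‖)
      have h1 : |(1 : Matrix (Fin d) (Fin d) ℝ) k l + h k l| ≤ 2 := by
        refine (abs_add_le _ _).trans ?_
        have : |(1 : Matrix (Fin d) (Fin d) ℝ) k l| ≤ 1 := by
          rw [Matrix.one_apply]; split_ifs <;> simp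
        linarith [hh k l]
      have h2 := hη k
      gcongr
    refine (Finset.abs_sum_le_sum_abs _ _).trans ((Finset.sum_le_sum fun k _ =>
      (Finset.abs_sum_le_sum_abs _ _).trans (Finset.sum_le_sum fun l _ => this k l)).trans (le_of_eq ?_))
    simp; ring
  have t4 : |(((∑ m, (b m : ℂ) * conj (ξ m)) + (δ : ℂ) / 2 * conj u) * f).re|
      ≤ (d * (E₁ * g) + E₁ / 2 * ‖u‖) * ‖f‖ := by
    refine (Complex.abs_re_le_norm _).trans ?_
    rw [norm_mul]
    gcongr
    refine (norm_add_le _ _).trans (add_le_add ?_ ?_)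
    · refine (norm_sum_le _ _).trans ((Finset.sum_le_sum (g := fun _ => E₁ * g) fun m _ => ?_).trans (by simp))
      rw [norm_mul, Complex.norm_conj, Complex.norm_real, Real.norm_eq_abs]
      exact mul_le_mul (hb m) (hξ m) (norm_nonneg _) hE₁
    · rw [norm_mul, norm_div, Complex.norm_conj, Complex.norm_real, Complex.norm_ofNat, Real.norm_eq_abs]
      gcongr
  have t5 : E₀ * (∑ k, ‖ξ k‖ ^ 2) ≤ d * (E₀ * g ^ 2) := by
    have : ∑ k, ‖ξ k‖ ^ 2 ≤ d * g ^ 2 := by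
      refine (Finset.sum_le_sum (g := fun _ => g ^ 2) fun k _ => ?_).trans (by simp)
      have := hξ k
      gcongr
    calc _ ≤ E₀ * (d * g ^ 2) := by gcongr
      _ = _ := by ring
  rw [morawetzDensity, s1]
  have d0 : (0 : ℝ) ≤ d := by positivity
  have a1 := (abs_le.1 t1).1
  have a2 := (abs_le.1 t2).2
  have a3 := (abs_le.1 t3).1
  have a4 := (abs_le.1 t4).1
  have n1 : 0 ≤ E₁ * (p * g ^ 2) := by positivity
  have n2 : 0 ≤ E₁ * (g * ‖u‖) := by positivity
  have n3 : 0 ≤ E₁ * g * ‖f‖ := by positivity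
  have n4 : 0 ≤ E₁ * ‖u‖ * ‖f‖ := by positivity
  have c1 : 3 * (d : ℝ) ^ 3 ≤ 4 * (d + 1) ^ 3 := by nlinarith [pow_nonneg d0 3, pow_nonneg d0 2]
  have c2 : 2 * (d : ℝ) ^ 2 ≤ 4 * (d + 1) ^ 3 := by nlinarith [pow_nonneg d0 3, pow_nonneg d0 2]
  have c3 : 2 * (d : ℝ) ≤ 4 * (d + 1) ^ 3 := by nlinarith [pow_nonneg d0 3, pow_nonneg d0 2]
  have c4 : (1 : ℝ) ≤ 4 * (d + 1) ^ 3 := by nlinarith [pow_nonneg d0 3, pow_nonneg d0 2]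
  have m1 := mul_le_mul_of_nonneg_right c1 n1
  have m2 := mul_le_mul_of_nonneg_right c2 n2
  have m3 := mul_le_mul_of_nonneg_right c3 n3
  have m4 := mul_le_mul_of_nonneg_right c4 n4
  nlinarith

section Morawetz

theorem integral_fderiv_apply_eq_zero {𝕜 : Type*} [RCLike 𝕜] {v : Rd d → 𝕜} (hv : ContDiff ℝ 1 v) (hc : HasCompactSupport v)
    (e : Rd d) : ∫ x, fderiv ℝ v x e = 0 := by
  have hi : Integrable fun x => fderiv ℝ v x e :=
    ((hv.continuous_fderiv (by norm_num)).clm_apply continuous_const).integrable_of_hasCompactSupport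
      ((hc.fderiv ℝ).comp_left (g := fun A : Rd d →L[ℝ] 𝕜 => A e) (by simp))
  have := integral_mul_fderiv_eq_neg_fderiv_mul_of_integrable (μ := (volume : Measure (Rd d)))
    (f := fun _ : Rd d => (1 : 𝕜)) (g := v) (v := e) (by simp) (by simpa using hi)
    (by simpa using hv.continuous.integrable_of_hasCompactSupport hc)
    (fun x _ => differentiableAt_const _) (fun x _ => hv.differentiable (by norm_num) x)
  simpa using this

theorem ofReal_integral_le {α : Type*} [MeasurableSpace α] {μ : Measure α} {F : α → ℝ}
    (hF : Integrable F μ) : ENNReal.ofReal (∫ x, F x ∂μ) ≤ ∫⁻ x, ENNReal.ofReal (F x) ∂μ := by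
  calc _ ≤ ENNReal.ofReal (∫ x, max (F x) 0 ∂μ) :=
        ENNReal.ofReal_le_ofReal (integral_mono hF hF.pos_part fun x => le_max_left _ _)
    _ = ∫⁻ x, ENNReal.ofReal (max (F x) 0) ∂μ :=
        ofReal_integral_eq_lintegral_ofReal hF.pos_part (Eventually.of_forall fun x => le_max_right _ _)
    _ = _ := by simp [ENNReal.ofReal_max]

/-- The divergence of a vector field. -/
def dvg (b : Fin d → Rd d → ℝ) (x : Rd d) : ℝ := ∑ m, fderiv ℝ (b m) x (eb m)

/-- The density in the Morawetz identity for a solution and a vector field. -/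
def morawetzAt (H : Coeff d) (U f : ℝ × Rd d → ℂ) (b : Fin d → Rd d → ℝ)
    (z : ℝ × Rd d) : ℝ :=
  morawetzDensity (fun k l => met H k l z)
    (fun m k l => fderiv ℝ (fun y => H k l (z.1, y)) z.2 (eb m)) (fun k => dx k U z)
    (fun m => b m z.2) (fun k m => fderiv ℝ (b m) z.2 (eb k)) (dvg b z.2)
    (fun k => fderiv ℝ (dvg b) z.2 (eb k)) (U z) (f z)

theorem integrable_fderiv_mul
    (hH : TamePerturbation H P B) {G : ℝ × Rd d → ℂ} (hG : ContinuousOn G (𝕀 ×ˢ univ))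
    {K : Set (Rd d)} (hK : IsCompact K) (h0 : ∀ t ∈ 𝕀, ∀ x ∉ K, G (t, x) = 0)
    (k l m : Fin d) :
    Integrable (fun z => ((fderiv ℝ (fun y => H k l (z.1, y)) z.2 (eb m) : ℝ) : ℂ) * G z) (slab d) := by
  have h1 : IntegrableOn (fun z => ((fderiv ℝ (fun y => H k l (z.1, y)) z.2 (eb m) : ℝ) : ℂ) * G z)
      (univ ×ˢ K) (slab d) := by
    refine Integrable.bdd_mul (continuousOn_integrableOn hG hK) (c := 1)
      (Complex.continuous_ofReal.comp_aestronglyMeasurable (hH.measurable_fderiv k l (eb m))).restrict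
      (ae_restrict_of_ae ?_)
    filter_upwards [ae_slab_of_ae_tm hH.norm_le] with z hz
    rw [Complex.norm_real]
    refine (ContinuousLinearMap.le_opNorm _ _).trans ?_
    rw [norm_eb, mul_one]
    exact (hz k l z.2).2
  refine h1.integrable_of_ae_notMem_eq_zero ?_
  filter_upwards [ae_slab_mem] with z hz hzK
  rw [show z = (z.1, z.2) from rfl, h0 z.1 hz.1 z.2 (fun h => hzK ⟨mem_univ _, h⟩), mul_zero]

/-- The regularity of a compactly supported vector field that is used over and over. -/
structure TestField (b : Fin d → Rd d → ℝ) (K : Set (Rd d)) : Prop where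
  contDiff : ∀ m, ContDiff ℝ ∞ (b m)
  isCompact : IsCompact K
  eq_zero : ∀ m, ∀ x ∉ K, b m x = 0

namespace TestField

variable {b : Fin d → Rd d → ℝ} {K : Set (Rd d)}

theorem hasCompactSupport (hb : TestField b K) (m : Fin d) : HasCompactSupport (b m) :=
  HasCompactSupport.intro hb.isCompact (hb.eq_zero m)

theorem fderiv_eq_zero (hb : TestField b K) (m : Fin d) {x : Rd d} (hx : x ∉ K) :
    fderiv ℝ (b m) x = 0 := by
  have : b m =ᶠ[𝓝 x] fun _ => 0 := by
    filter_upwards [hb.isCompact.isClosed.isOpen_compl.mem_nhds hx] with y hy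
    exact hb.eq_zero m y hy
  rw [this.fderiv_eq]; simp

theorem contDiff_dvg (hb : TestField b K) : ContDiff ℝ ∞ (dvg b) :=
  ContDiff.sum fun m _ => ((hb.contDiff m).fderiv_right (by norm_cast)).clm_apply contDiff_const

theorem dvg_eq_zero (hb : TestField b K) {x : Rd d} (hx : x ∉ K) : dvg b x = 0 := by
  simp [dvg, hb.fderiv_eq_zero _ hx]

theorem fderiv_dvg_eq_zero (hb : TestField b K) {x : Rd d} (hx : x ∉ K) : fderiv ℝ (dvg b) x = 0 := by
  have : dvg b =ᶠ[𝓝 x] fun _ => 0 := by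
    filter_upwards [hb.isCompact.isClosed.isOpen_compl.mem_nhds hx] with y hy
    exact hb.dvg_eq_zero hy
  rw [this.fderiv_eq]; simp

theorem continuous_fderiv (hb : TestField b K) (m : Fin d) (e : Rd d) :
    Continuous fun x => fderiv ℝ (b m) x e :=
  ((hb.contDiff m).continuous_fderiv (by norm_num)).clm_apply continuous_const

theorem continuous_fderiv_dvg (hb : TestField b K) (e : Rd d) :
    Continuous fun x => fderiv ℝ (dvg b) x e :=
  ((hb.contDiff_dvg).continuous_fderiv (by norm_num)).clm_apply continuous_const

end TestField

theorem integrable_morawetzAt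
    (hH : TamePerturbation H P B)
    (hU : SmoothSolution H u₀ U f) {b : Fin d → Rd d → ℝ} {K : Set (Rd d)} (hb : TestField b K) :
    Integrable (morawetzAt H U f b) (slab d) := by
  have hr : ∀ {F : Rd d → ℝ}, Continuous F → ContinuousOn (fun z : ℝ × Rd d => ((F z.2 : ℝ) : ℂ))
      (𝕀 ×ˢ univ) := fun hF =>
    (Complex.continuous_ofReal.comp (hF.comp continuous_snd)).continuousOn
  have hconj : ∀ {F : ℝ × Rd d → ℂ}, ContinuousOn F (𝕀 ×ˢ univ) →
      ContinuousOn (fun z => conj (F z)) (𝕀 ×ˢ univ) := fun hF =>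
    Complex.continuous_conj.comp_continuousOn hF
  have hd := hU.continuousOn_dx
  unfold morawetzAt morawetzDensity
  refine ((Integrable.sub ?_ ?_).add ?_).add ?_
  · refine integrable_finsetSum _ fun k _ => integrable_finsetSum _ fun l _ => integrable_finsetSum _ fun m _ => ?_
    have := (integrable_met_mul hH (((hd l).mul (hconj (hd m))).mul (hr (hb.continuous_fderiv m (eb k))))
      hb.isCompact (fun t _ x hx => by simp [hb.fderiv_eq_zero m hx]) k l).re.const_mul 2
    refine this.congr (Eventually.of_forall fun z => ?_)
    simp only [RCLike.re_to_complex, Pi.mul_apply]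
    rw [Complex.re_ofReal_mul, Complex.re_mul_ofReal]
    ring
  · refine integrable_finsetSum _ fun m _ => integrable_finsetSum _ fun k _ => integrable_finsetSum _ fun l _ => ?_
    have := (integrable_fderiv_mul hH (((hd l).mul (hconj (hd k))).mul (hr (hb.contDiff m).continuous))
      hb.isCompact (fun t _ x hx => by simp [hb.eq_zero m x hx]) k l m).re
    refine this.congr (Eventually.of_forall fun z => ?_)
    simp only [RCLike.re_to_complex, Pi.mul_apply]
    rw [Complex.re_ofReal_mul, Complex.re_mul_ofReal]
    ring
  · refine integrable_finsetSum _ fun k _ => integrable_finsetSum _ fun l _ => ?_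
    have := (integrable_met_mul hH (((hd l).mul (hconj hU.continuousOn)).mul (hr (hb.continuous_fderiv_dvg (eb k))))
      hb.isCompact (fun t _ x hx => by simp [hb.fderiv_dvg_eq_zero hx]) k l).re
    refine this.congr (Eventually.of_forall fun z => ?_)
    simp only [RCLike.re_to_complex, Pi.mul_apply]
    rw [Complex.re_ofReal_mul, Complex.re_mul_ofReal]
    ring
  · have hG : ContinuousOn (fun z : ℝ × Rd d => (∑ m, ((b m z.2 : ℝ) : ℂ) * conj (dx m U z))
        + ((dvg b z.2 : ℝ) : ℂ) / 2 * conj (U z)) (𝕀 ×ˢ univ) := by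
      refine (continuousOn_finsetSum _ fun m _ => (hr (hb.contDiff m).continuous).mul (hconj (hd m))).add ?_
      exact ((hr hb.contDiff_dvg.continuous).div_const 2).mul (hconj hU.continuousOn)
    exact (integrable_mul_forcing hU.forcing hG hb.isCompact (fun t _ x hx => by
      simp [hb.eq_zero _ x hx, hb.dvg_eq_zero hx])).re.const_mul 2

/-- The Morawetz multiplier. -/
def multiplier (U : ℝ × Rd d → ℂ) (b : Fin d → Rd d → ℝ) (z : ℝ × Rd d) : ℂ :=
  Complex.I * ((∑ m, ((b m z.2 : ℝ) : ℂ) * conj (dx m U z)) + ((dvg b z.2 : ℝ) : ℂ) / 2 * conj (U z))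

theorem dx_contDiff {U : ℝ × Rd d → ℂ} {t : ℝ} (hU : ContDiff ℝ ∞ fun x => U (t, x)) (k : Fin d) :
    ContDiff ℝ ∞ fun x => dx k U (t, x) :=
  (hU.fderiv_right (m := ∞) (by norm_cast)).clm_apply contDiff_const

theorem dx_dx_comm {U : ℝ × Rd d → ℂ} {t : ℝ} (hU : ContDiff ℝ ∞ fun x => U (t, x)) (k l : Fin d)
    (x : Rd d) : dx l (dx k U) (t, x) = dx k (dx l U) (t, x) := by
  have hsym : IsSymmSndFDerivAt ℝ (fun x => U (t, x)) x :=
    hU.contDiffAt.isSymmSndFDerivAt (by simp only [minSmoothness_of_isRCLikeNormedField]; exact WithTop.coe_le_coe.2 le_top)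
  have hd : DifferentiableAt ℝ (fderiv ℝ fun x => U (t, x)) x :=
    (hU.fderiv_right (m := ∞) (by norm_cast)).differentiable (by norm_num) x
  have e : ∀ k l : Fin d, dx l (dx k U) (t, x) = fderiv ℝ (fderiv ℝ fun x => U (t, x)) x (eb l) (eb k) := by
    intro k l
    have : (fun x => dx k U (t, x)) = fun x => fderiv ℝ (fun x => U (t, x)) x (eb k) := rfl
    rw [dx]
    simp only
    rw [this, fderiv_clm_apply hd (differentiableAt_const _)]
    simp
  rw [e, e, hsym]

theorem multiplier_contDiff {U : ℝ × Rd d → ℂ} {t : ℝ} (hU : ContDiff ℝ ∞ fun x => U (t, x))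
    {b : Fin d → Rd d → ℝ} {K : Set (Rd d)} (hb : TestField b K) :
    ContDiff ℝ ∞ fun x => multiplier U b (t, x) := by
  unfold multiplier
  refine contDiff_const.mul ((ContDiff.sum fun m _ => ?_).add ?_)
  · exact (Complex.ofRealCLM.contDiff.comp (hb.contDiff m)).mul (contDiff_conj (dx_contDiff hU m))
  · exact ((Complex.ofRealCLM.contDiff.comp hb.contDiff_dvg).div_const _).mul (contDiff_conj hU)

theorem dx_multiplier {U : ℝ × Rd d → ℂ} {t : ℝ} (hU : ContDiff ℝ ∞ fun x => U (t, x))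
    {b : Fin d → Rd d → ℝ} {K : Set (Rd d)} (hb : TestField b K) (k : Fin d) (x : Rd d) :
    dx k (multiplier U b) (t, x) = Complex.I *
      ((∑ m, (((fderiv ℝ (b m) x (eb k) : ℝ) : ℂ) * conj (dx m U (t, x))
        + ((b m x : ℝ) : ℂ) * conj (dx k (dx m U) (t, x))))
      + (((fderiv ℝ (dvg b) x (eb k) : ℝ) : ℂ) / 2 * conj (U (t, x))
        + ((dvg b x : ℝ) : ℂ) / 2 * conj (dx k U (t, x)))) := by
  have hof : ∀ {F : Rd d → ℝ}, ContDiff ℝ ∞ F → HasFDerivAt (fun x => ((F x : ℝ) : ℂ))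
      (Complex.ofRealCLM.comp (fderiv ℝ F x)) x := fun hF =>
    Complex.ofRealCLM.hasFDerivAt.comp x (hF.differentiable (by norm_num) x).hasFDerivAt
  have hcj : ∀ {F : Rd d → ℂ}, ContDiff ℝ ∞ F → HasFDerivAt (fun x => conj (F x))
      ((Complex.conjCLE : ℂ →L[ℝ] ℂ).comp (fderiv ℝ F x)) x := fun hF =>
    (Complex.conjCLE : ℂ →L[ℝ] ℂ).hasFDerivAt.comp x (hF.differentiable (by norm_num) x).hasFDerivAt
  have h1 := HasFDerivAt.fun_sum (u := Finset.univ) fun m _ =>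
    (hof (hb.contDiff m)).fun_mul (hcj (dx_contDiff hU m))
  have h2 := ((hof hb.contDiff_dvg).mul_const ((2 : ℂ)⁻¹)).fun_mul (hcj hU)
  have h3 := (h1.add h2).const_mul Complex.I
  have e : (fun x => multiplier U b (t, x)) = fun x => Complex.I *
      (((fun y => ∑ m, ((b m y : ℝ) : ℂ) * conj (dx m U (t, y))) +
      fun y => ((dvg b y : ℝ) : ℂ) * (2 : ℂ)⁻¹ * conj (U (t, y))) x) := by
    ext y
    simp only [multiplier, Pi.add_apply, div_eq_mul_inv]
  rw [dx]
  simp only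
  rw [e, h3.fderiv]
  simp only [_root_.smul_apply, _root_.add_apply, smul_eq_mul, _root_.sum_apply,
    ContinuousLinearMap.comp_apply, Complex.ofRealCLM_apply, ContinuousLinearEquiv.coe_coe,
    Complex.conjCLE_apply]
  congr 2
  · refine Finset.sum_congr rfl fun m _ => ?_
    rw [add_comm, show fderiv ℝ (fun x => dx m U (t, x)) x (eb k) = dx k (dx m U) (t, x) from rfl]
    ring
  · rw [show fderiv ℝ (fun x => U (t, x)) x (eb k) = dx k U (t, x) from rfl]
    ring

end Morawetz

theorem integral_divergence_eq_zero {v : Fin d → Rd d → ℝ} (hv : ∀ m, ContDiff ℝ 1 (v m))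
    (hc : ∀ m, HasCompactSupport (v m)) : ∫ x, ∑ m, fderiv ℝ (v m) x (eb m) = 0 := by
  rw [integral_finsetSum]
  · exact Finset.sum_eq_zero fun m _ => integral_fderiv_apply_eq_zero (hv m) (hc m) _
  · intro m _
    exact (((hv m).continuous_fderiv (by norm_num)).clm_apply continuous_const).integrable_of_hasCompactSupport
      (((hc m).fderiv ℝ).comp_left (g := fun A : Rd d →L[ℝ] ℝ => A (eb m)) (by simp))

theorem multiplier_eq_zero {U : ℝ × Rd d → ℂ} {b : Fin d → Rd d → ℝ} {K : Set (Rd d)}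
    (hb : TestField b K) {z : ℝ × Rd d} (hz : z.2 ∉ K) : multiplier U b z = 0 := by
  simp [multiplier, hb.eq_zero _ _ hz, hb.dvg_eq_zero hz]

theorem integral_multiplier_symm {U : ℝ × Rd d → ℂ} {s t : ℝ} (hs : ContDiff ℝ ∞ fun x => U (s, x))
    (ht : ContDiff ℝ ∞ fun x => U (t, x)) {b : Fin d → Rd d → ℝ} {K : Set (Rd d)} (hb : TestField b K) :
    (∫ x, multiplier U b (t, x) * U (s, x)).re = (∫ x, multiplier U b (s, x) * U (t, x)).re := by
  have hint : ∀ {s t : ℝ}, (ContDiff ℝ ∞ fun x => U (s, x)) → (ContDiff ℝ ∞ fun x => U (t, x)) →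
      Integrable fun x => multiplier U b (t, x) * U (s, x) := fun hs ht =>
    ((multiplier_contDiff ht hb).continuous.mul hs.continuous).integrable_of_hasCompactSupport
      (HasCompactSupport.intro hb.isCompact fun x hx => by
        rw [Pi.mul_apply, multiplier_eq_zero hb (z := (_, x)) hx, zero_mul])
  set V : Fin d → Rd d → ℂ := fun m x => ((b m x : ℝ) : ℂ) * (conj (U (t, x)) * U (s, x)) with hV
  have hVs : ∀ m, ContDiff ℝ 1 (V m) := fun m =>
    ((Complex.ofRealCLM.contDiff.comp (hb.contDiff m)).mul ((contDiff_conj ht).mul hs)).of_le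
      (by norm_cast)
  have hVc : ∀ m, HasCompactSupport (V m) := fun m =>
    HasCompactSupport.intro hb.isCompact fun x hx => by simp [hV, hb.eq_zero m x hx]
  have hVd : ∀ m x, fderiv ℝ (V m) x (eb m) = ((fderiv ℝ (b m) x (eb m) : ℝ) : ℂ) * (conj (U (t, x)) * U (s, x))
      + ((b m x : ℝ) : ℂ) * (conj (dx m U (t, x)) * U (s, x) + conj (U (t, x)) * dx m U (s, x)) := by
    intro m x
    have hbd : DifferentiableAt ℝ (fun x => ((b m x : ℝ) : ℂ)) x :=
      (Complex.ofRealCLM.contDiff.comp (hb.contDiff m)).differentiable (by norm_num : (∞ : WithTop ℕ∞) ≠ 0) x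
    have h1 : DifferentiableAt ℝ (fun x => conj (U (t, x))) x :=
      (contDiff_conj ht).differentiable (by norm_num) x
    have h2 : DifferentiableAt ℝ (fun x => U (s, x)) x := hs.differentiable (by norm_num) x
    simp only [hV]
    rw [fderiv_fun_mul hbd (h1.fun_mul h2), fderiv_fun_mul h1 h2]
    simp only [_root_.add_apply, _root_.smul_apply, smul_eq_mul]
    rw [fderiv_ofReal ((hb.contDiff m).differentiable (by norm_num)),
      fderiv_conj (ht.differentiable (by norm_num))]
    simp only [dx]
    ring
  have hVi : ∀ m, Integrable fun x => fderiv ℝ (V m) x (eb m) := fun m =>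
    (((hVs m).continuous_fderiv (by norm_num)).clm_apply continuous_const).integrable_of_hasCompactSupport
      (((hVc m).fderiv ℝ).comp_left (g := fun A : Rd d →L[ℝ] ℂ => A (eb m)) (by simp))
  have key : ∀ x, multiplier U b (t, x) * U (s, x) - conj (multiplier U b (s, x) * U (t, x))
      = Complex.I * ∑ m, fderiv ℝ (V m) x (eb m) := by
    intro x
    simp_rw [hVd, multiplier, dvg]
    simp only [map_mul, map_add, map_sum, Complex.conj_I, Complex.conj_conj, Complex.conj_ofReal,
      Finset.sum_add_distrib, mul_add, map_div₀, Complex.conj_ofNat, Complex.ofReal_sum]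
    simp only [← Finset.sum_mul, Finset.mul_sum, Finset.sum_div]
    simp only [Finset.sum_mul, Finset.mul_sum, ← Finset.sum_add_distrib, ← Finset.sum_sub_distrib]
    refine Finset.sum_congr rfl fun m _ => ?_
    ring
  have h0 : ∫ x, (multiplier U b (t, x) * U (s, x) - conj (multiplier U b (s, x) * U (t, x))) = 0 := by
    simp_rw [key]
    rw [integral_const_mul, integral_finsetSum _ fun m _ => hVi m]
    rw [Finset.sum_eq_zero fun m _ => integral_fderiv_apply_eq_zero (hVs m) (hVc m) _, mul_zero]
  have hci : Integrable fun x => conj (multiplier U b (s, x) * U (t, x)) :=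
    (Complex.conjCLE : ℂ →L[ℝ] ℂ).integrable_comp (hint ht hs)
  rw [integral_sub (hint hs ht) hci, integral_conj, sub_eq_zero] at h0
  rw [h0, Complex.conj_re]

theorem continuousOn_multiplier
    (hU : SmoothSolution H u₀ U f) {b : Fin d → Rd d → ℝ} {K : Set (Rd d)}
    (hb : TestField b K) : ContinuousOn (multiplier U b) (𝕀 ×ˢ univ) ∧
      ∀ k, ContinuousOn (dx k (multiplier U b)) (𝕀 ×ˢ univ) := by
  have hr : ∀ {F : Rd d → ℝ}, Continuous F → ContinuousOn (fun z : ℝ × Rd d => ((F z.2 : ℝ) : ℂ))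
      (𝕀 ×ˢ univ) := fun hF =>
    (Complex.continuous_ofReal.comp (hF.comp continuous_snd)).continuousOn
  have hconj : ∀ {F : ℝ × Rd d → ℂ}, ContinuousOn F (𝕀 ×ˢ univ) →
      ContinuousOn (fun z => conj (F z)) (𝕀 ×ˢ univ) := fun hF =>
    Complex.continuous_conj.comp_continuousOn hF
  refine ⟨continuousOn_const.mul ((continuousOn_finsetSum _ fun m _ =>
    (hr (hb.contDiff m).continuous).mul (hconj (hU.continuousOn_dx m))).add
    (((hr hb.contDiff_dvg.continuous).div_const 2).mul (hconj hU.continuousOn))), fun k => ?_⟩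
  refine ContinuousOn.congr ?_ fun z hz => dx_multiplier (hU.contDiff z.1 hz.1) hb k z.2
  refine continuousOn_const.mul ((continuousOn_finsetSum _ fun m _ => ?_).add ?_)
  · exact ((hr (hb.continuous_fderiv m (eb k))).mul (hconj (hU.continuousOn_dx m))).add
      ((hr (hb.contDiff m).continuous).mul (hconj (hU.continuousOn_dx_dx m k)))
  · exact (((hr (hb.continuous_fderiv_dvg (eb k))).div_const 2).mul (hconj hU.continuousOn)).add
      (((hr hb.contDiff_dvg.continuous).div_const 2).mul (hconj (hU.continuousOn_dx k)))

/-- The derivative of the energy density. -/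
theorem fderiv_met_energy {U : ℝ × Rd d → ℂ} {t : ℝ}
    (hH : ∀ k l, ContDiff ℝ 1 fun x => H k l (t, x)) (hU : ContDiff ℝ ∞ fun x => U (t, x))
    (m : Fin d) (x : Rd d) :
    DifferentiableAt ℝ (fun x => ∑ k, ∑ l, met H k l (t, x) * (dx l U (t, x) * conj (dx k U (t, x))).re) x ∧
    fderiv ℝ (fun x => ∑ k, ∑ l, met H k l (t, x) * (dx l U (t, x) * conj (dx k U (t, x))).re) x (eb m)
      = ∑ k, ∑ l, (fderiv ℝ (fun y => H k l (t, y)) x (eb m) * (dx l U (t, x) * conj (dx k U (t, x))).re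
          + met H k l (t, x) * (dx m (dx l U) (t, x) * conj (dx k U (t, x))
            + dx l U (t, x) * conj (dx m (dx k U) (t, x))).re) := by
  have h1 : ∀ k l, HasFDerivAt (fun x => met H k l (t, x)) (fderiv ℝ (fun y => H k l (t, y)) x) x :=
    fun k l => ((hH k l).differentiable (by norm_num) x).hasFDerivAt.const_add _
  have h2 : ∀ k, HasFDerivAt (fun x => dx k U (t, x)) (fderiv ℝ (fun x => dx k U (t, x)) x) x :=
    fun k => ((dx_contDiff hU k).differentiable (by norm_num) x).hasFDerivAt
  have h3 : ∀ k, HasFDerivAt (fun x => conj (dx k U (t, x)))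
      ((Complex.conjCLE : ℂ →L[ℝ] ℂ).comp (fderiv ℝ (fun x => dx k U (t, x)) x)) x :=
    fun k => (Complex.conjCLE : ℂ →L[ℝ] ℂ).hasFDerivAt.comp x (h2 k)
  have h4 := fun k l => Complex.reCLM.hasFDerivAt.comp x ((h2 l).fun_mul (h3 k))
  have h5 := HasFDerivAt.fun_sum (u := Finset.univ) fun k _ =>
    HasFDerivAt.fun_sum (u := Finset.univ) fun l _ => (h1 k l).fun_mul (h4 k l)
  simp only [Function.comp_def, Complex.reCLM_apply] at h5
  refine ⟨h5.differentiableAt, ?_⟩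
  rw [h5.fderiv]
  simp only [_root_.sum_apply, _root_.add_apply, _root_.smul_apply, smul_eq_mul,
    ContinuousLinearMap.comp_apply, Complex.reCLM_apply, ContinuousLinearEquiv.coe_coe,
    Complex.conjCLE_apply]
  refine Finset.sum_congr rfl fun k _ => Finset.sum_congr rfl fun l _ => ?_
  rw [show fderiv ℝ (fun x => dx k U (t, x)) x (eb m) = dx m (dx k U) (t, x) from rfl,
    show fderiv ℝ (fun x => dx l U (t, x)) x (eb m) = dx m (dx l U) (t, x) from rfl]
  simp only [Complex.add_re]
  rw [mul_comm (conj (dx k U (t, x))) (dx m (dx l U) (t, x))]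
  ring

theorem contDiff_met_energy {U : ℝ × Rd d → ℂ} {t : ℝ}
    (hH : ∀ k l, ContDiff ℝ 1 fun x => H k l (t, x)) (hU : ContDiff ℝ ∞ fun x => U (t, x)) :
    ContDiff ℝ 1 (fun x => ∑ k, ∑ l, met H k l (t, x) * (dx l U (t, x) * conj (dx k U (t, x))).re) :=
  ContDiff.sum fun k _ => ContDiff.sum fun l _ => (contDiff_const.add (hH k l)).mul
    (Complex.reCLM.contDiff.comp (((dx_contDiff hU l).mul (contDiff_conj (dx_contDiff hU k))).of_le
      (by norm_cast)))

/-- The Morawetz identity. -/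
theorem SmoothSolution.morawetz_identity
    (hH : TamePerturbation H P B)
    (hU : SmoothSolution H u₀ U f) {b : Fin d → Rd d → ℝ} {K : Set (Rd d)} (hb : TestField b K) :
    (∫ x, multiplier U b (1, x) * U (1, x)).re - (∫ x, multiplier U b (0, x) * U (0, x)).re
      = ∫ z, morawetzAt H U f b z ∂(slab d) := by
  obtain ⟨hZc, hZd⟩ := continuousOn_multiplier hU hb
  have hZ0 : ∀ t ∈ 𝕀, ∀ x ∉ K, multiplier U b (t, x) = 0 := fun t _ x hx =>
    multiplier_eq_zero hb hx
  have hMi := integrable_morawetzAt hH hU hb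
  rw [hU.quadratic_identity hH hb.isCompact (fun t ht => multiplier_contDiff (hU.contDiff t ht) hb)
    hZ0 hZc hZd (fun s hs t ht => integral_multiplier_symm (hU.contDiff s hs) (hU.contDiff t ht) hb)
    (T := 1) (by simp), slab, integral_prod _ hMi, intervalIntegral.integral_of_le zero_le_one,
    ← integral_Icc_eq_integral_Ioc]
  refine integral_congr_ae ?_
  filter_upwards [hH.contDiff, hH.symm, ae_tm_mem, hMi.prod_right_ae,
    (integrable_weakForm_family hH hU hb.isCompact hZ0 hZc hZd).prod_right_ae] with t hHt hsym ht hMt hWt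
  have hUt := hU.contDiff t ht
  set e : Rd d → ℝ := fun x => ∑ k, ∑ l, met H k l (t, x) * (dx l U (t, x) * conj (dx k U (t, x))).re with he
  have hes := contDiff_met_energy hHt hUt
  have hv : ∀ m, ContDiff ℝ 1 fun x => b m x * e x := fun m =>
    ((hb.contDiff m).of_le (by norm_cast)).mul hes
  have hvc : ∀ m, HasCompactSupport fun x => b m x * e x := fun m =>
    (hb.hasCompactSupport m).mul_right
  have hvi : Integrable fun x => ∑ m, fderiv ℝ (fun x => b m x * e x) x (eb m) :=
    integrable_finsetSum _ fun m _ =>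
    (((hv m).continuous_fderiv (by norm_num)).clm_apply continuous_const).integrable_of_hasCompactSupport
      (((hvc m).fderiv ℝ).comp_left (g := fun A : Rd d →L[ℝ] ℝ => A (eb m)) (by simp))
  have him : (∫ x, weakForm H U f (fun x => multiplier U b (t, x)) (t, x)).im
      = ∫ x, (weakForm H U f (fun x => multiplier U b (t, x)) (t, x)).im := by
    have := Complex.imCLM.integral_comp_comm hWt
    simpa using this.symm
  have key : ∀ x, 2 * (weakForm H U f (fun x => multiplier U b (t, x)) (t, x)).im
      = morawetzAt H U f b (t, x) + ∑ m, fderiv ℝ (fun x => b m x * e x) x (eb m) := by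
    intro x
    have hm := morawetz_algebra (fun k l => met H k l (t, x)) (fun k l => by
        simp only [met]
        rw [← Matrix.transpose_apply 1 l k, Matrix.transpose_one]
        congr 1
        exact hsym k l x)
      (fun m k l => fderiv ℝ (fun y => H k l (t, y)) x (eb m)) (fun k => dx k U (t, x))
      (fun k l => dx l (dx k U) (t, x)) (fun k l => dx_dx_comm hUt k l x)
      (fun m => b m x) (fun k m => fderiv ℝ (b m) x (eb k)) (dvg b x) rfl
      (fun k => fderiv ℝ (dvg b) x (eb k)) (U (t, x)) (f (t, x))
    have hdiv : ∀ m, fderiv ℝ (fun x => b m x * e x) x (eb m) = fderiv ℝ (b m) x (eb m) * e x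
        + b m x * ∑ k, ∑ l, (fderiv ℝ (fun y => H k l (t, y)) x (eb m) * (dx l U (t, x) * conj (dx k U (t, x))).re
          + met H k l (t, x) * (dx m (dx l U) (t, x) * conj (dx k U (t, x))
            + dx l U (t, x) * conj (dx m (dx k U) (t, x))).re) := by
      intro m
      obtain ⟨h1, h2⟩ := fderiv_met_energy hHt hUt m x
      rw [fderiv_fun_mul ((hb.contDiff m).differentiable (by norm_num) x) h1]
      simp only [_root_.add_apply, _root_.smul_apply, smul_eq_mul]
      rw [h2]
      ring
    simp_rw [hdiv]
    rw [morawetzAt]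
    rw [← hm, weakForm]
    congr 2
    congr 1
    refine Finset.sum_congr rfl fun k _ => Finset.sum_congr rfl fun l _ => ?_
    rw [← dx_multiplier hUt hb k x]
    rfl
  rw [him, ← integral_const_mul]
  simp_rw [key]
  rw [integral_add hMt hvi, integral_divergence_eq_zero hv hvc, add_zero]

theorem norm_multiplier_le {U : ℝ × Rd d → ℂ} {b : Fin d → Rd d → ℝ} {z : ℝ × Rd d} {E : ℝ}
    (hb : ∀ m, |b m z.2| ≤ E) (hE : |dvg b z.2| ≤ E) :
    ‖multiplier U b z‖ ≤ (d + 1) * (E * (gradn U z + ‖U z‖)) := by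
  have hE0 : 0 ≤ E := (abs_nonneg _).trans hE
  have hg := gradn_nonneg U z
  have h1 : ‖∑ m, ((b m z.2 : ℝ) : ℂ) * conj (dx m U z)‖ ≤ d * (E * gradn U z) := by
    have hm : ∀ m, ‖((b m z.2 : ℝ) : ℂ) * conj (dx m U z)‖ ≤ E * gradn U z := fun m => by
      rw [norm_mul, Complex.norm_conj, Complex.norm_real]
      exact mul_le_mul (hb m) (norm_dx_le U m z) (norm_nonneg _) hE0
    exact (norm_sum_le _ _).trans ((Finset.sum_le_sum fun m _ => hm m).trans_eq (by simp))
  have h2 : ‖((dvg b z.2 : ℝ) : ℂ) / 2 * conj (U z)‖ ≤ E * ‖U z‖ := by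
    rw [norm_mul, Complex.norm_conj, norm_div, Complex.norm_real, Complex.norm_ofNat]
    refine mul_le_mul_of_nonneg_right ?_ (norm_nonneg _)
    rw [Real.norm_eq_abs]
    linarith
  rw [multiplier, norm_mul, Complex.norm_I, one_mul]
  refine (norm_add_le _ _).trans ((add_le_add h1 h2).trans ?_)
  have : 0 ≤ E * gradn U z := mul_nonneg hE0 hg
  have : 0 ≤ (d : ℝ) * (E * ‖U z‖) := by positivity
  nlinarith

/-- The Morawetz inequality. -/
theorem SmoothSolution.morawetz_le
    (hH : TamePerturbation H P B)
    (hU : SmoothSolution H u₀ U f) {b : Fin d → Rd d → ℝ} {K : Set (Rd d)} (hb : TestField b K)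
    {ρ E₀ E₁ : Rd d → ℝ} (hρ : Continuous ρ) (hρ0 : ∀ x, 0 ≤ ρ x) (hρK : ∀ x ∉ K, ρ x = 0)
    (hE₀ : ∀ x, 0 ≤ E₀ x) (h1 : ∀ m x, |b m x| ≤ E₁ x) (h2 : ∀ k m x, |fderiv ℝ (b m) x (eb k)| ≤ E₁ x)
    (h3 : ∀ x, |dvg b x| ≤ E₁ x) (h4 : ∀ k x, |fderiv ℝ (dvg b) x (eb k)| ≤ E₁ x)
    (hlow : ∀ x (ξ : Fin d → ℂ), ρ x * (∑ k, ‖ξ k‖ ^ 2) - E₀ x * (∑ k, ‖ξ k‖ ^ 2)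
      ≤ ∑ k, ∑ m, fderiv ℝ (b m) x (eb k) * (ξ k * conj (ξ m)).re) :
    ∫⁻ z, ENNReal.ofReal (2 * (ρ z.2 * ∑ k, ‖dx k U z‖ ^ 2)) ∂(slab d)
      ≤ (∫⁻ x, ENNReal.ofReal ((d + 1) * (E₁ x * ((gradn U (1, x) + ‖U (1, x)‖) * ‖U (1, x)‖))))
        + (∫⁻ x, ENNReal.ofReal ((d + 1) * (E₁ x * ((gradn U (0, x) + ‖U (0, x)‖) * ‖U (0, x)‖))))
        + ∫⁻ z, ENNReal.ofReal (2 * d * (E₀ z.2 * gradn U z ^ 2) + 4 * (d + 1) ^ 3 * (E₁ z.2 *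
          ((P z.2).toReal * gradn U z ^ 2 + gradn U z * ‖U z‖ + (gradn U z + ‖U z‖) * ‖f z‖))) ∂(slab d) := by
  have hMi := integrable_morawetzAt hH hU hb
  have hRi : Integrable (fun z => 2 * (ρ z.2 * ∑ k, ‖dx k U z‖ ^ 2)) (slab d) := by
    have hc : ContinuousOn (fun z : ℝ × Rd d => 2 * (ρ z.2 * ∑ k, ‖dx k U z‖ ^ 2))
        (𝕀 ×ˢ univ) :=
      continuousOn_const.mul ((hρ.comp continuous_snd).continuousOn.mul
        (continuousOn_finsetSum _ fun k _ => (hU.continuousOn_dx k).norm.pow 2))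
    refine (continuousOn_integrableOn hc hb.isCompact).integrable_of_forall_notMem_eq_zero fun z hz => ?_
    rw [hρK z.2 (fun h => hz ⟨mem_univ _, h⟩), zero_mul, mul_zero]
  have hid := hU.morawetz_identity hH hb
  have hq : ∀ t ∈ 𝕀, ENNReal.ofReal |(∫ x, multiplier U b (t, x) * U (t, x)).re|
      ≤ ∫⁻ x, ENNReal.ofReal ((d + 1) * (E₁ x * ((gradn U (t, x) + ‖U (t, x)‖) * ‖U (t, x)‖))) := by
    intro t _
    calc _ ≤ ENNReal.ofReal ‖∫ x, multiplier U b (t, x) * U (t, x)‖ :=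
          ENNReal.ofReal_le_ofReal (Complex.abs_re_le_norm _)
      _ = ‖∫ x, multiplier U b (t, x) * U (t, x)‖ₑ := ofReal_norm _
      _ ≤ _ := enorm_integral_le_lintegral_enorm _
      _ ≤ _ := lintegral_mono fun x => by
        rw [← ofReal_norm, norm_mul]
        refine ENNReal.ofReal_le_ofReal ?_
        have := mul_le_mul_of_nonneg_right (norm_multiplier_le (U := U) (z := (t, x)) (fun m => h1 m x) (h3 x))
          (norm_nonneg (U (t, x)))
        linarith
  have hint : ∫ z, 2 * (ρ z.2 * ∑ k, ‖dx k U z‖ ^ 2) ∂(slab d)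
      = (∫ x, multiplier U b (1, x) * U (1, x)).re - (∫ x, multiplier U b (0, x) * U (0, x)).re
        + ∫ z, (2 * (ρ z.2 * ∑ k, ‖dx k U z‖ ^ 2) - morawetzAt H U f b z) ∂(slab d) := by
    rw [hid, integral_sub hRi hMi]; ring
  rw [← ofReal_integral_eq_lintegral_ofReal hRi (Eventually.of_forall fun z =>
    mul_nonneg zero_le_two (mul_nonneg (hρ0 _) (by positivity))), hint]
  refine (ENNReal.ofReal_add_le).trans (add_le_add ?_ ?_)
  · calc _ ≤ ENNReal.ofReal (|(∫ x, multiplier U b (1, x) * U (1, x)).re|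
          + |(∫ x, multiplier U b (0, x) * U (0, x)).re|) :=
          ENNReal.ofReal_le_ofReal ((le_abs_self _).trans (abs_sub _ _))
      _ ≤ _ := ENNReal.ofReal_add_le
      _ ≤ _ := add_le_add (hq 1 (by simp)) (hq 0 (by simp))
  · refine (ofReal_integral_le (hRi.sub hMi)).trans (lintegral_mono_ae ?_)
    filter_upwards [ae_slab_of_ae_tm hH.enorm_le, ae_slab_of_ae_tm hH.enorm_fderiv_le] with z hz1 hz2
    refine ENNReal.ofReal_le_ofReal ?_
    have hPt : P z.2 ≠ ⊤ := ((hH.bound_le_one z.2).trans_lt ENNReal.one_lt_top).ne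
    refine le_morawetzDensity (fun k l => H k l z) _ _ _ _ _ _ _ _ (hE₀ z.2)
      ((abs_nonneg _).trans (h3 z.2)) ENNReal.toReal_nonneg
      (ENNReal.toReal_le_of_le_ofReal zero_le_one (by simpa using hH.bound_le_one z.2))
      (gradn_nonneg U z) (fun k => norm_dx_le U k z) (fun k l => ?_) (fun m k l => ?_)
      (fun m => h1 m z.2) (fun k m => h2 k m z.2) (h3 z.2) (fun k => h4 k z.2) (hlow z.2 _)
    · have := hz1 k l z.2
      rw [← ofReal_norm] at this
      exact (ENNReal.ofReal_le_iff_le_toReal hPt).1 this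
    · have := hz2 k l z.2
      rw [← ofReal_norm] at this
      refine le_trans ?_ ((ENNReal.ofReal_le_iff_le_toReal hPt).1 this)
      refine ((fderiv ℝ (fun y => H k l (z.1, y)) z.2).le_opNorm (eb m)).trans ?_
      rw [norm_eb, mul_one]

section Weights

/-- A smooth function that is bounded by `C * W`, together with its derivatives of order at most two. -/
structure Controlled (C : ℝ) (W v : Rd d → ℝ) : Prop where
  contDiff : ContDiff ℝ ∞ v
  abs_le : ∀ x, |v x| ≤ C * W x
  fderiv_le : ∀ x, ‖fderiv ℝ v x‖ ≤ C * W x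
  fderiv_fderiv_le : ∀ x, ‖fderiv ℝ (fderiv ℝ v) x‖ ≤ C * W x

namespace Controlled

variable {C C' : ℝ} {W W' v v' : Rd d → ℝ}

theorem mono (h : Controlled C W v) (hW : ∀ x, C * W x ≤ C' * W' x) : Controlled C' W' v :=
  ⟨h.contDiff, fun x => (h.abs_le x).trans (hW x), fun x => (h.fderiv_le x).trans (hW x),
    fun x => (h.fderiv_fderiv_le x).trans (hW x)⟩

theorem iteratedFDeriv_le (h : Controlled C W v) {i : ℕ} (hi : i ≤ 2) (x : Rd d) :
    ‖iteratedFDeriv ℝ i v x‖ ≤ C * W x := by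
  interval_cases i
  · rw [norm_iteratedFDeriv_zero]; exact h.abs_le x
  · rw [norm_iteratedFDeriv_one]; exact h.fderiv_le x
  · rw [← norm_iteratedFDeriv_fderiv, norm_iteratedFDeriv_one]; exact h.fderiv_fderiv_le x

theorem mul (h : Controlled C W v) (h' : Controlled C' W' v') :
    Controlled (4 * (C * C')) (fun x => W x * W' x) fun x => v x * v' x := by
  have hb : ∀ i ≤ 2, ∀ x, ‖iteratedFDeriv ℝ i (fun x => v x * v' x) x‖ ≤ 4 * (C * C') * (W x * W' x) := by
    intro i hi x
    have h0 : 0 ≤ (C * W x) * (C' * W' x) :=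
      mul_nonneg ((abs_nonneg _).trans (h.abs_le x)) ((abs_nonneg _).trans (h'.abs_le x))
    refine (norm_iteratedFDeriv_mul_le h.contDiff h'.contDiff x (n := i) (by norm_cast; exact le_top)).trans ?_
    calc _ ≤ ∑ k ∈ Finset.range (i + 1), (i.choose k : ℝ) * ((C * W x) * (C' * W' x)) := by
          refine Finset.sum_le_sum fun k hk => ?_
          have hk' : k ≤ i := Nat.lt_succ_iff.1 (Finset.mem_range.1 hk)
          rw [mul_assoc]
          refine mul_le_mul_of_nonneg_left ?_ (by positivity)
          exact mul_le_mul (h.iteratedFDeriv_le (hk'.trans hi) x)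
            (h'.iteratedFDeriv_le ((Nat.sub_le _ _).trans hi) x) (norm_nonneg _)
            ((abs_nonneg _).trans (h.abs_le x))
      _ = 2 ^ i * ((C * W x) * (C' * W' x)) := by
          rw [← Finset.sum_mul]
          congr 1
          exact_mod_cast Nat.sum_range_choose i
      _ ≤ 4 * ((C * W x) * (C' * W' x)) := by
          refine mul_le_mul_of_nonneg_right ?_ h0
          calc (2 : ℝ) ^ i ≤ 2 ^ 2 := pow_le_pow_right₀ one_le_two hi
            _ = 4 := by norm_num
      _ = _ := by ring
  refine ⟨h.contDiff.mul h'.contDiff, fun x => ?_, fun x => ?_, fun x => ?_⟩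
  · simpa only [norm_iteratedFDeriv_zero, Real.norm_eq_abs] using hb 0 (by norm_num) x
  · simpa only [norm_iteratedFDeriv_one] using hb 1 (by norm_num) x
  · have := hb 2 le_rfl x
    rwa [← norm_iteratedFDeriv_fderiv, norm_iteratedFDeriv_one] at this

theorem pow (h : Controlled C W v) (p : ℕ) :
    Controlled (4 ^ p * C ^ (p + 1)) (fun x => W x ^ (p + 1)) fun x => v x ^ (p + 1) := by
  induction p with
  | zero => simpa using h
  | succ p ih =>
    have := ih.mul h
    simp only [← pow_succ] at this
    refine this.mono fun x => le_of_eq ?_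
    ring

end Controlled

theorem norm_smul_clm {E F : Type*} [NormedAddCommGroup E] [NormedSpace ℝ E] [NormedAddCommGroup F]
    [NormedSpace ℝ F] (r : ℝ) (A : E →L[ℝ] F) : ‖r • A‖ = ‖r‖ * ‖A‖ := norm_smul r A

/-- The dilation by `r` around the point `c`. -/
def dil (r : ℝ) (c x : Rd d) : Rd d := r • (x - c)

theorem contDiff_dil (r : ℝ) (c : Rd d) : ContDiff ℝ ∞ (dil r c) :=
  (contDiff_id.sub contDiff_const).const_smul r

theorem fderiv_comp_dil {E : Type*} [NormedAddCommGroup E] [NormedSpace ℝ E] {F : Rd d → E}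
    (hF : Differentiable ℝ F) (r : ℝ) (c x : Rd d) :
    fderiv ℝ (fun x => F (dil r c x)) x = r • fderiv ℝ F (dil r c x) := by
  have h1 : HasFDerivAt (dil r c) (r • ContinuousLinearMap.id ℝ (Rd d)) x :=
    ((hasFDerivAt_id x).sub_const c).const_smul r
  have h2 : HasFDerivAt (fun x => F (dil r c x)) _ x := (hF (dil r c x)).hasFDerivAt.comp x h1
  rw [h2.fderiv]
  ext y
  simp

namespace Controlled

variable {C C' : ℝ} {W W' v v' : Rd d → ℝ}

theorem norm_fderiv_dil_le (h : Controlled C W v) {r : ℝ} (hr : 0 ≤ r) (c x : Rd d) :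
    ‖fderiv ℝ (fun x => v (dil r c x)) x‖ ≤ r * (C * W (dil r c x)) := by
  rw [fderiv_comp_dil (h.contDiff.differentiable (by norm_num)), norm_smul, Real.norm_of_nonneg hr]
  exact mul_le_mul_of_nonneg_left (h.fderiv_le _) hr

theorem comp_dil (h : Controlled C W v) {r : ℝ} (hr : 0 ≤ r) (hr1 : r ≤ 1) (c : Rd d) :
    Controlled C (fun x => W (dil r c x)) fun x => v (dil r c x) := by
  have h0 : ∀ x, 0 ≤ C * W (dil r c x) := fun x => (abs_nonneg _).trans (h.abs_le _)
  refine ⟨h.contDiff.comp (contDiff_dil r c), fun x => h.abs_le _, fun x => ?_, fun x => ?_⟩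
  · exact (h.norm_fderiv_dil_le hr c x).trans (mul_le_of_le_one_left (h0 x) hr1)
  · have hv : Differentiable ℝ (fderiv ℝ v) :=
      (h.contDiff.fderiv_right (m := ∞) (by norm_cast)).differentiable (by norm_num)
    have e : fderiv ℝ (fun x => v (dil r c x)) = fun x => r • fderiv ℝ v (dil r c x) :=
      funext fun x => fderiv_comp_dil (h.contDiff.differentiable (by norm_num)) r c x
    have h2 : DifferentiableAt ℝ (fun x => fderiv ℝ v (dil r c x)) x :=
      (hv.comp ((contDiff_dil r c).differentiable (by norm_num))) x
    rw [e, fderiv_fun_const_smul h2, fderiv_comp_dil hv, norm_smul_clm, norm_smul_clm, Real.norm_of_nonneg hr]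
    exact (mul_le_of_le_one_left (mul_nonneg hr (norm_nonneg _)) hr1).trans
      ((mul_le_of_le_one_left (norm_nonneg _) hr1).trans (h.fderiv_fderiv_le _))

end Controlled

/-- The function `(1 + |x|²)⁻¹`. -/
def jap (x : Rd d) : ℝ := (1 + ‖x‖ ^ 2)⁻¹

theorem jap_pos (x : Rd d) : 0 < jap x := by unfold jap; positivity

theorem jap_le_one (x : Rd d) : jap x ≤ 1 := inv_le_one_of_one_le₀ (by nlinarith [sq_nonneg ‖x‖])

theorem contDiff_jap : ContDiff ℝ ∞ (jap : Rd d → ℝ) :=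
  (contDiff_const.add (contDiff_norm_sq ℝ)).inv fun x => by positivity

theorem hasFDerivAt_jap (x : Rd d) :
    HasFDerivAt jap (-(jap x ^ 2) • ((2 : ℝ) • innerSL ℝ x)) x := by
  have h1 : HasFDerivAt (fun x : Rd d => 1 + ‖x‖ ^ 2) (2 • innerSL ℝ x) x :=
    ((hasStrictFDerivAt_norm_sq x).hasFDerivAt).const_add 1
  have h2 := (hasDerivAt_inv (x := 1 + ‖x‖ ^ 2) (by positivity)).comp_hasFDerivAt x h1
  refine h2.congr_fderiv ?_
  ext y
  simp [jap]

theorem jap_mul_sq (x : Rd d) : jap x * ‖x‖ ^ 2 ≤ 1 := by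
  rw [jap, inv_mul_le_one₀ (by positivity)]; linarith

theorem controlled_jap : Controlled 10 jap (jap : Rd d → ℝ) := by
  have hj := fun x : Rd d => jap_pos x
  have h1 := fun x : Rd d => jap_le_one x
  have h2 := fun x : Rd d => jap_mul_sq x
  have hb : ∀ x : Rd d, jap x * ‖x‖ ≤ 1 := fun x => by
    have := h2 x; have := h1 x; have := hj x
    nlinarith [sq_nonneg (‖x‖ - 1)]
  refine ⟨contDiff_jap, fun x => ?_, fun x => ?_, fun x => ?_⟩
  · rw [abs_of_pos (hj x)]; linarith [hj x]
  · rw [(hasFDerivAt_jap x).fderiv, norm_smul, norm_smul, innerSL_apply_norm, norm_neg, norm_pow,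
      Real.norm_of_nonneg (hj x).le, Real.norm_ofNat]
    have : jap x * (jap x * ‖x‖) ≤ jap x * 1 := mul_le_mul_of_nonneg_left (hb x) (hj x).le
    nlinarith [hj x]
  · have e : fderiv ℝ (jap : Rd d → ℝ) = fun x => -(jap x ^ 2) • ((2 : ℝ) • innerSL ℝ x) :=
      funext fun x => (hasFDerivAt_jap x).fderiv
    have h3 : HasFDerivAt (fun x : Rd d => (2 : ℝ) • innerSL ℝ x) ((2 : ℝ) • (innerSL ℝ : Rd d →L[ℝ] Rd d →L[ℝ] ℝ)) x :=
      ((innerSL ℝ : Rd d →L[ℝ] Rd d →L[ℝ] ℝ).hasFDerivAt).fun_const_smul 2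
    have h4 : HasFDerivAt (fun x : Rd d => -(jap x ^ 2)) _ x := ((hasFDerivAt_jap x).pow 2).neg
    rw [e, (h4.fun_smul h3).fderiv]
    refine (ContinuousLinearMap.opNorm_add_le _ _).trans ?_
    rw [ContinuousLinearMap.norm_smulRight_apply]
    have hin : ‖(innerSL ℝ : Rd d →L[ℝ] Rd d →L[ℝ] ℝ)‖ ≤ 1 := norm_innerSL_le _
    have a1 : ‖-(jap x ^ 2) • ((2 : ℝ) • (innerSL ℝ : Rd d →L[ℝ] Rd d →L[ℝ] ℝ))‖ ≤ 2 * jap x := by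
      rw [norm_smul_clm, norm_smul_clm, norm_neg, norm_pow, Real.norm_of_nonneg (hj x).le, Real.norm_ofNat]
      have : jap x ^ 2 ≤ jap x := by nlinarith [hj x, h1 x]
      calc _ ≤ jap x * (2 * 1) :=
            mul_le_mul this (mul_le_mul_of_nonneg_left hin zero_le_two)
              (mul_nonneg zero_le_two (ContinuousLinearMap.opNorm_nonneg _)) (hj x).le
        _ = _ := by ring
    have a2 : jap x * (jap x * ‖x‖ ^ 2) * jap x ≤ jap x := by
      have := mul_le_mul (h1 x) (h2 x) (mul_nonneg (hj x).le (sq_nonneg _)) zero_le_one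
      nlinarith [hj x]
    have := hj x
    refine (add_le_add_left a1 _).trans ?_
    simp only [norm_smul, norm_neg, norm_pow, innerSL_apply_norm, Real.norm_of_nonneg (hj x).le, Real.norm_ofNat,
      Nat.add_one_sub_one, pow_one, nsmul_eq_mul, Nat.cast_ofNat]
    rw [Real.norm_of_nonneg (by linarith)]
    nlinarith

end Weights

theorem SlowWeight.mul {K K' : ℝ} {N N' : ℕ} {θ θ' : Rd d → ℝ} (h : SlowWeight K N θ)
    (h' : SlowWeight K' N' θ') : SlowWeight (K * K') (N + N') fun x => θ x * θ' x := by
  refine ⟨fun x => mul_pos (h.pos x) (h'.pos x), h.cont.mul h'.cont, fun x y => ?_⟩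
  refine (mul_le_mul (h.slow x y) (h'.slow x y) (h'.pos x).le
    ((h.pos x).le.trans (h.slow x y))).trans_eq ?_
  ring

theorem SlowWeight.pow {K : ℝ} {N : ℕ} {θ : Rd d → ℝ} (h : SlowWeight K N θ) (p : ℕ) :
    SlowWeight (K ^ p) (N * p) fun x => θ x ^ p := by
  refine ⟨fun x => pow_pos (h.pos x) p, h.cont.pow p, fun x y => ?_⟩
  refine (pow_le_pow_left₀ (h.pos x).le (h.slow x y) p).trans_eq ?_
  ring

theorem SlowWeight.const_mul {K : ℝ} {N : ℕ} {θ : Rd d → ℝ} (h : SlowWeight K N θ) {a : ℝ}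
    (ha : 0 < a) : SlowWeight K N fun x => a * θ x := by
  refine ⟨fun x => mul_pos ha (h.pos x), h.cont.const_mul a, fun x y => ?_⟩
  refine (mul_le_mul_of_nonneg_left (h.slow x y) ha.le).trans_eq ?_
  ring

theorem slowWeight_jap : SlowWeight 2 2 (jap : Rd d → ℝ) := by
  refine ⟨jap_pos, contDiff_jap.continuous, fun x y => ?_⟩
  rw [jap, jap, ← div_eq_mul_inv, le_div_iff₀ (by positivity), inv_mul_le_iff₀ (by positivity)]
  have h := norm_sub_le x y
  have h2 : ‖x - y‖ ^ 2 ≤ (‖x‖ + ‖y‖) ^ 2 := pow_le_pow_left₀ (norm_nonneg _) h 2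
  have := norm_nonneg x; have := norm_nonneg y
  nlinarith [sq_nonneg (‖x‖ - ‖y‖), mul_nonneg (norm_nonneg y) (sq_nonneg ‖x‖),
    mul_nonneg (sq_nonneg ‖y‖) (sq_nonneg ‖x‖)]

theorem SlowWeight.comp_dil {K : ℝ} {N : ℕ} {θ : Rd d → ℝ} (h : SlowWeight K N θ) {r : ℝ}
    (hr : 0 ≤ r) (hr1 : r ≤ 1) (c : Rd d) : SlowWeight K N fun x => θ (dil r c x) := by
  refine ⟨fun x => h.pos _, h.cont.comp (contDiff_dil r c).continuous, fun x y => ?_⟩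
  have e : dil r c (x - y) = dil r c x - r • y := by
    simp only [dil, ← smul_sub]; congr 1; abel
  rw [e]
  have h1 := h.slow (dil r c x) (r • y)
  have hK : 0 ≤ K := by
    have := h.slow 0 0
    simp at this
    nlinarith [h.pos 0]
  have h2 : ‖r • y‖ ≤ ‖y‖ := by
    rw [norm_smul, Real.norm_of_nonneg hr]
    exact mul_le_of_le_one_left (norm_nonneg _) hr1
  refine h1.trans (mul_le_mul_of_nonneg_right (mul_le_mul_of_nonneg_left ?_ hK) (h.pos _).le)
  exact pow_le_pow_left₀ (by positivity) (by linarith) N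

/-- The weight `θ` attached to a ball of radius `1 / r` around `c`. -/
def wt (r : ℝ) (c x : Rd d) : ℝ := jap (dil r c x) ^ (d + 1)

theorem wt_pos (r : ℝ) (c x : Rd d) : 0 < wt r c x := pow_pos (jap_pos _) _

theorem wt_le_one (r : ℝ) (c x : Rd d) : wt r c x ≤ 1 := pow_le_one₀ (jap_pos _).le (jap_le_one _)

theorem slowWeight_wt {r : ℝ} (hr : 0 ≤ r) (hr1 : r ≤ 1) (c : Rd d) :
    SlowWeight (2 ^ (d + 1)) (2 * (d + 1)) (wt r c) :=
  (slowWeight_jap.pow (d + 1)).comp_dil hr hr1 c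

theorem continuous_wt (r : ℝ) (c : Rd d) : Continuous (wt r c) :=
  (contDiff_jap.continuous.comp (contDiff_dil r c).continuous).pow _

/-- The lower bound for the gradient of the Morawetz vector field associated with a ball of radius
`2^l` around `c`. -/
def nu (l : ℕ) (c x : Rd d) : ℝ := (2 ^ l)⁻¹ * jap (dil (2 ^ l)⁻¹ c x)

theorem slowWeight_nu (l : ℕ) (c : Rd d) : SlowWeight 2 2 (nu l c) :=
  (slowWeight_jap.comp_dil (by positivity) (inv_le_one_of_one_le₀ (one_le_pow₀ one_le_two)) c).const_mul
    (by positivity)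

/-- The function `arctan (x_m)`. -/
def atn (m : Fin d) (x : Rd d) : ℝ := Real.arctan (x m)

theorem hasFDerivAt_atn (m : Fin d) (x : Rd d) :
    HasFDerivAt (atn m) ((1 + x m ^ 2)⁻¹ • (EuclideanSpace.proj m : Rd d →L[ℝ] ℝ)) x := by
  have h := (Real.hasDerivAt_arctan (x m)).comp_hasFDerivAt x
    (EuclideanSpace.proj m : Rd d →L[ℝ] ℝ).hasFDerivAt
  rw [one_div] at h
  exact h

theorem norm_proj_le (m : Fin d) : ‖(EuclideanSpace.proj m : Rd d →L[ℝ] ℝ)‖ ≤ 1 :=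
  ContinuousLinearMap.opNorm_le_bound _ zero_le_one fun x => by
    rw [one_mul]; exact PiLp.norm_apply_le x m

theorem controlled_atn (m : Fin d) : Controlled 2 (fun _ => 1) (atn m : Rd d → ℝ) := by
  have hq : ∀ τ : ℝ, (1 + τ ^ 2)⁻¹ ≤ 1 := fun τ => inv_le_one_of_one_le₀ (by nlinarith [sq_nonneg τ])
  have hsm : ContDiff ℝ ∞ (atn m : Rd d → ℝ) :=
    Real.contDiff_arctan.comp (EuclideanSpace.proj m : Rd d →L[ℝ] ℝ).contDiff
  refine ⟨hsm, fun x => ?_, fun x => ?_, fun x => ?_⟩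
  · have h1 := Real.arctan_lt_pi_div_two (x m)
    have h2 := Real.neg_pi_div_two_lt_arctan (x m)
    have h3 := Real.pi_lt_four
    rw [atn, abs_le]
    constructor <;> linarith
  · rw [(hasFDerivAt_atn m x).fderiv, norm_smul_clm, Real.norm_of_nonneg (by positivity)]
    refine (mul_le_mul (hq _) (norm_proj_le m) (norm_nonneg _) zero_le_one).trans ?_
    norm_num
  · have e : fderiv ℝ (atn m : Rd d → ℝ) = fun x => (1 + x m ^ 2)⁻¹ • (EuclideanSpace.proj m : Rd d →L[ℝ] ℝ) :=
      funext fun x => (hasFDerivAt_atn m x).fderiv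
    have h1 : HasDerivAt (fun τ : ℝ => (1 + τ ^ 2)⁻¹) (-(2 * x m) / (1 + x m ^ 2) ^ 2) (x m) := by
      have : HasDerivAt (fun τ : ℝ => 1 + τ ^ 2) (2 * x m) (x m) := by
        simpa using (hasDerivAt_pow 2 (x m)).const_add 1
      exact this.fun_inv (by positivity)
    have h2 := (h1.comp_hasFDerivAt x (EuclideanSpace.proj m : Rd d →L[ℝ] ℝ).hasFDerivAt).smul_const
      (EuclideanSpace.proj m : Rd d →L[ℝ] ℝ)
    rw [e]
    rw [show (fun x : Rd d => (1 + x m ^ 2)⁻¹ • (EuclideanSpace.proj m : Rd d →L[ℝ] ℝ)) = fun y =>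
      ((fun τ : ℝ => (1 + τ ^ 2)⁻¹) ∘ ⇑(EuclideanSpace.proj m : Rd d →L[ℝ] ℝ)) y • (EuclideanSpace.proj m : Rd d →L[ℝ] ℝ) from rfl,
      h2.fderiv, ContinuousLinearMap.norm_smulRight_apply, norm_smul_clm, norm_div, norm_neg, norm_mul, norm_pow,
      Real.norm_ofNat, Real.norm_of_nonneg (by positivity : 0 ≤ 1 + x m ^ 2)]
    have h3 : 2 * ‖x m‖ / (1 + x m ^ 2) ^ 2 ≤ 2 := by
      rw [div_le_iff₀ (by positivity)]
      rw [Real.norm_eq_abs]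
      have := sq_abs (x m)
      nlinarith [abs_nonneg (x m), sq_nonneg (|x m| - 1), sq_nonneg (x m ^ 2)]
    have hp := norm_proj_le m
    have hp0 := norm_nonneg (EuclideanSpace.proj m : Rd d →L[ℝ] ℝ)
    have h4 : 0 ≤ 2 * ‖x m‖ / (1 + x m ^ 2) ^ 2 := by positivity
    rw [mul_assoc]
    exact mul_le_mul h3 (mul_le_one₀ hp hp0 hp) (by positivity) zero_le_two

/-- A bump function at the origin. -/
def originBump (d : ℕ) : ContDiffBump (0 : Rd d) := ⟨1, 2, one_pos, one_lt_two⟩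

theorem exists_controlled_bump (d : ℕ) : ∃ C : ℝ, 0 ≤ C ∧ Controlled C (fun _ => 1) (originBump d) := by
  have h0 : ContDiff ℝ ∞ (originBump d) := (originBump d).contDiff
  have hs : HasCompactSupport (originBump d) := (originBump d).hasCompactSupport
  obtain ⟨C0, hC0⟩ := h0.continuous.bounded_above_of_compact_support hs
  obtain ⟨C1, hC1⟩ := (h0.continuous_fderiv (by norm_num)).bounded_above_of_compact_support (hs.fderiv ℝ)
  obtain ⟨C2, hC2⟩ := ((h0.fderiv_right (m := ∞) (by norm_cast)).continuous_fderiv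
    (by norm_num)).bounded_above_of_compact_support ((hs.fderiv ℝ).fderiv ℝ)
  refine ⟨|C0| + |C1| + |C2|, by positivity, h0, fun x => ?_, fun x => ?_, fun x => ?_⟩
  · have := hC0 x; rw [Real.norm_eq_abs] at this
    linarith [le_abs_self C0, abs_nonneg C1, abs_nonneg C2]
  · linarith [hC1 x, le_abs_self C1, abs_nonneg C0, abs_nonneg C2]
  · linarith [hC2 x, le_abs_self C2, abs_nonneg C0, abs_nonneg C1]

/-- Compactly supported truncations of the square of the weight `wt 1 0`. -/
def truncProfile (n : ℕ) (y : Rd d) : ℝ :=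
  originBump d (dil ((n : ℝ) + 1)⁻¹ 0 y) * jap y ^ (2 * d + 1 + 1)

/-- Compactly supported truncations of the square of the weight `wt r c`. -/
def trunc (n : ℕ) (r : ℝ) (c x : Rd d) : ℝ := truncProfile n (dil r c x)

theorem wt_sq (r : ℝ) (c x : Rd d) : wt r c x ^ 2 = jap (dil r c x) ^ (2 * d + 1 + 1) := by
  rw [wt, ← pow_mul]; congr 1; ring

theorem exists_controlled_truncProfile (d : ℕ) : ∃ C : ℝ, 0 ≤ C ∧
    ∀ n, Controlled C (fun y : Rd d => jap y ^ (2 * d + 1 + 1)) (truncProfile n) := by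
  obtain ⟨C, hC, h⟩ := exists_controlled_bump d
  refine ⟨4 * (C * (4 ^ (2 * d + 1) * 10 ^ (2 * d + 1 + 1))), by positivity, fun n => ((h.comp_dil (r := ((n : ℝ) + 1)⁻¹) (by positivity)
    (inv_le_one_of_one_le₀ (by linarith [(n.cast_nonneg : (0 : ℝ) ≤ n)])) 0).mul
    (controlled_jap.pow (2 * d + 1))).mono fun y => le_of_eq ?_⟩
  rw [one_mul]

theorem trunc_nonneg (n : ℕ) (r : ℝ) (c x : Rd d) : 0 ≤ trunc n r c x :=
  mul_nonneg (originBump d).nonneg (pow_pos (jap_pos _) _).le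

theorem trunc_le (n : ℕ) (r : ℝ) (c x : Rd d) : trunc n r c x ≤ wt r c x ^ 2 := by
  rw [wt_sq]
  exact mul_le_of_le_one_left (pow_pos (jap_pos _) _).le (originBump d).le_one

theorem contDiff_trunc (n : ℕ) (r : ℝ) (c : Rd d) : ContDiff ℝ ∞ (trunc n r c) :=
  ((((originBump d).contDiff (n := (⊤ : ℕ∞))).comp (contDiff_dil _ _)).mul (contDiff_jap.pow _)).comp (contDiff_dil r c)

theorem trunc_eq_zero (n : ℕ) {r : ℝ} (hr : 0 < r) (c : Rd d) {x : Rd d}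
    (hx : x ∉ Metric.closedBall c (2 * ((n : ℝ) + 1) / r)) : trunc n r c x = 0 := by
  rw [trunc, truncProfile, (originBump d).zero_of_le_dist, zero_mul]
  rw [Metric.mem_closedBall, dist_eq_norm, not_le, div_lt_iff₀ hr] at hx
  rw [dist_zero_right, dil, dil, sub_zero, norm_smul, norm_smul, norm_inv, Real.norm_of_nonneg hr.le,
    Real.norm_of_nonneg (by positivity), ← div_eq_inv_mul]
  show (2 : ℝ) ≤ _
  rw [le_div_iff₀ (by positivity)]
  linarith

theorem tendsto_trunc (r : ℝ) (c x : Rd d) :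
    Tendsto (fun n => trunc n r c x) atTop (𝓝 (wt r c x ^ 2)) := by
  refine tendsto_const_nhds.congr' ?_
  obtain ⟨n0, hn0⟩ := exists_nat_ge ‖dil r c x‖
  filter_upwards [eventually_ge_atTop n0] with n hn
  rw [trunc, truncProfile, (originBump d).one_of_mem_closedBall, one_mul, wt_sq]
  rw [mem_closedBall_zero_iff, dil, sub_zero, norm_smul, norm_inv, Real.norm_of_nonneg (by positivity),
    ← div_eq_inv_mul]
  show _ ≤ (1 : ℝ)
  rw [div_le_one (by positivity)]
  have : (n0 : ℝ) ≤ n := by exact_mod_cast hn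
  linarith

/-- The Morawetz vector field. -/
def morawetzField (n : ℕ) (r : ℝ) (c : Rd d) (l : ℕ) (c' : Rd d) (m : Fin d) (x : Rd d) : ℝ :=
  trunc n r c x * atn m (dil (2 ^ l)⁻¹ c' x)

theorem testField_morawetzField (n : ℕ) {r : ℝ} (hr : 0 < r) (c : Rd d) (l : ℕ) (c' : Rd d) :
    TestField (morawetzField n r c l c') (Metric.closedBall c (2 * ((n : ℝ) + 1) / r)) :=
  ⟨fun m => (contDiff_trunc n r c).mul ((controlled_atn m).contDiff.comp (contDiff_dil _ c')),
    isCompact_closedBall _ _, fun m x hx => by rw [morawetzField, trunc_eq_zero n hr c hx, zero_mul]⟩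

theorem norm_fderiv_trunc_le {C : ℝ} {n : ℕ} (hC : Controlled C (fun y : Rd d => jap y ^ (2 * d + 1 + 1)) (truncProfile n))
    {r : ℝ} (hr : 0 ≤ r) (c x : Rd d) : ‖fderiv ℝ (trunc n r c) x‖ ≤ C * r * wt r c x ^ 2 := by
  refine (hC.norm_fderiv_dil_le hr c x).trans_eq ?_
  rw [wt_sq]; ring

theorem controlled_morawetzField {C : ℝ} {n : ℕ}
    (hC : Controlled C (fun y : Rd d => jap y ^ (2 * d + 1 + 1)) (truncProfile n)) {r : ℝ} (hr : 0 ≤ r)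
    (hr1 : r ≤ 1) (c : Rd d) (l : ℕ) (c' : Rd d) (m : Fin d) :
    Controlled (8 * C) (fun x => wt r c x ^ 2) (morawetzField n r c l c' m) := by
  refine ((hC.comp_dil hr hr1 c).mul ((controlled_atn m).comp_dil (r := (2 ^ l)⁻¹) (by positivity)
    (inv_le_one_of_one_le₀ (one_le_pow₀ one_le_two)) c')).mono fun x => le_of_eq ?_
  rw [wt_sq]; ring

theorem Controlled.abs_dvg_le {b : Fin d → Rd d → ℝ} {C : ℝ} {W : Rd d → ℝ} (hb : ∀ m, Controlled C W (b m))
    (x : Rd d) : |dvg b x| ≤ d * (C * W x) ∧ ∀ k, |fderiv ℝ (dvg b) x (eb k)| ≤ d * (C * W x) := by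
  have hle : ∀ (A : Rd d →L[ℝ] ℝ) (k : Fin d), |A (eb k)| ≤ ‖A‖ := fun A k => by
    have := A.le_opNorm (eb k)
    rwa [norm_eb, mul_one] at this
  constructor
  · exact (Finset.abs_sum_le_sum_abs _ _).trans ((Finset.sum_le_sum fun m _ =>
      (hle _ m).trans ((hb m).fderiv_le x)).trans_eq (by simp))
  · intro k
    have hd : ∀ m, DifferentiableAt ℝ (fderiv ℝ (b m)) x := fun m =>
      (((hb m).contDiff.fderiv_right (m := ∞) (by norm_cast)).differentiable (by norm_num)) x
    have hs : HasFDerivAt (dvg b) (∑ m, (fderiv ℝ (fderiv ℝ (b m)) x).flip (eb m)) x := by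
      refine HasFDerivAt.fun_sum fun m _ => ?_
      have := (hd m).hasFDerivAt.clm_apply (hasFDerivAt_const (eb m) x)
      simpa using this
    rw [hs.fderiv]
    have : ∀ m, |fderiv ℝ (fderiv ℝ (b m)) x (eb k) (eb m)| ≤ C * W x := fun m => by
      refine (hle _ m).trans (le_trans ?_ ((hb m).fderiv_fderiv_le x))
      have := (fderiv ℝ (fderiv ℝ (b m)) x).le_opNorm (eb k)
      rwa [norm_eb, mul_one] at this
    rw [_root_.sum_apply]
    exact (Finset.abs_sum_le_sum_abs _ _).trans ((Finset.sum_le_sum fun m _ => this m).trans_eq (by simp))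

theorem fderiv_morawetzField (n : ℕ) (r : ℝ) (c : Rd d) (l : ℕ) (c' : Rd d) (k m : Fin d) (x : Rd d) :
    fderiv ℝ (morawetzField n r c l c' m) x (eb k) =
      fderiv ℝ (trunc n r c) x (eb k) * atn m (dil (2 ^ l)⁻¹ c' x)
        + trunc n r c x * ((2 ^ l)⁻¹ * ((1 + dil (2 ^ l)⁻¹ c' x m ^ 2)⁻¹ * if k = m then 1 else 0)) := by
  have h1 : DifferentiableAt ℝ (trunc n r c) x := (contDiff_trunc n r c).differentiable (by norm_num) x
  have h2 : DifferentiableAt ℝ (fun x => atn m (dil (2 ^ l)⁻¹ c' x)) x :=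
    ((controlled_atn m).contDiff.comp (contDiff_dil _ c')).differentiable (by norm_num) x
  have e : morawetzField n r c l c' m = fun x => trunc n r c x * atn m (dil (2 ^ l)⁻¹ c' x) := rfl
  rw [e, fderiv_fun_mul h1 h2, fderiv_comp_dil ((controlled_atn m).contDiff.differentiable (by norm_num)),
    (hasFDerivAt_atn m _).fderiv]
  have hp : (EuclideanSpace.proj m : Rd d →L[ℝ] ℝ) (eb k) = if k = m then 1 else 0 := by
    show (eb k : Rd d) m = _
    simp [eq_comm (a := m)]
  simp only [_root_.add_apply, _root_.smul_apply, smul_eq_mul, hp]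
  ring

theorem jap_le_inv (y : Rd d) (m : Fin d) : jap y ≤ (1 + y m ^ 2)⁻¹ := by
  refine inv_anti₀ (by positivity) ?_
  have := PiLp.norm_apply_le y m
  rw [Real.norm_eq_abs] at this
  have h := pow_le_pow_left₀ (abs_nonneg _) this 2
  rw [sq_abs] at h
  linarith

theorem le_morawetzField_form {C : ℝ} {n : ℕ}
    (hC : Controlled C (fun y : Rd d => jap y ^ (2 * d + 1 + 1)) (truncProfile n)) {r : ℝ} (hr : 0 ≤ r)
    (c : Rd d) (l : ℕ) (c' : Rd d) (x : Rd d) (ξ : Fin d → ℂ) :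
    trunc n r c x * nu l c' x * (∑ k, ‖ξ k‖ ^ 2) - 2 * d * (C * r * wt r c x ^ 2) * (∑ k, ‖ξ k‖ ^ 2)
      ≤ ∑ k, ∑ m, fderiv ℝ (morawetzField n r c l c' m) x (eb k) * (ξ k * conj (ξ m)).re := by
  set D := C * r * wt r c x ^ 2 with hD
  have hβ := norm_fderiv_trunc_le hC hr c x
  have hD0 : 0 ≤ D := (norm_nonneg _).trans hβ
  have e : ∑ k, ∑ m, fderiv ℝ (morawetzField n r c l c' m) x (eb k) * (ξ k * conj (ξ m)).re
      = (∑ k, trunc n r c x * ((2 ^ l)⁻¹ * (1 + dil (2 ^ l)⁻¹ c' x k ^ 2)⁻¹) * ‖ξ k‖ ^ 2)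
        + ∑ k, ∑ m, fderiv ℝ (trunc n r c) x (eb k) * atn m (dil (2 ^ l)⁻¹ c' x) * (ξ k * conj (ξ m)).re := by
    rw [← Finset.sum_add_distrib]
    refine Finset.sum_congr rfl fun k _ => ?_
    simp_rw [fderiv_morawetzField, add_mul, Finset.sum_add_distrib]
    rw [add_comm]
    congr 1
    rw [Finset.sum_eq_single k]
    · rw [if_pos rfl, Complex.mul_conj']
      norm_cast
      ring
    · intro m _ hm
      rw [if_neg hm.symm]; simp
    · simp
  rw [e]
  have h1 : trunc n r c x * nu l c' x * (∑ k, ‖ξ k‖ ^ 2)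
      ≤ ∑ k, trunc n r c x * ((2 ^ l)⁻¹ * (1 + dil (2 ^ l)⁻¹ c' x k ^ 2)⁻¹) * ‖ξ k‖ ^ 2 := by
    rw [Finset.mul_sum]
    refine Finset.sum_le_sum fun k _ => mul_le_mul_of_nonneg_right ?_ (by positivity)
    refine mul_le_mul_of_nonneg_left ?_ (trunc_nonneg n r c x)
    exact mul_le_mul_of_nonneg_left (jap_le_inv _ k) (by positivity)
  have h2 : |∑ k, ∑ m, fderiv ℝ (trunc n r c) x (eb k) * atn m (dil (2 ^ l)⁻¹ c' x) * (ξ k * conj (ξ m)).re|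
      ≤ 2 * d * D * (∑ k, ‖ξ k‖ ^ 2) := by
    have hkm : ∀ k m, |fderiv ℝ (trunc n r c) x (eb k) * atn m (dil (2 ^ l)⁻¹ c' x) * (ξ k * conj (ξ m)).re|
        ≤ D * (‖ξ k‖ ^ 2 + ‖ξ m‖ ^ 2) := by
      intro k m
      rw [abs_mul, abs_mul]
      have a1 : |fderiv ℝ (trunc n r c) x (eb k)| ≤ D := by
        have := (fderiv ℝ (trunc n r c) x).le_opNorm (eb k)
        rw [norm_eb, mul_one] at this
        exact this.trans hβ
      have a2 : |atn m (dil (2 ^ l)⁻¹ c' x)| ≤ 2 := by simpa using (controlled_atn m).abs_le (dil (2 ^ l)⁻¹ c' x)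
      have a3 : |(ξ k * conj (ξ m)).re| ≤ ‖ξ k‖ * ‖ξ m‖ := by
        refine (Complex.abs_re_le_norm _).trans ?_
        rw [norm_mul, Complex.norm_conj]
      calc _ ≤ D * 2 * (‖ξ k‖ * ‖ξ m‖) := by gcongr
        _ ≤ _ := by nlinarith [mul_nonneg hD0 (sq_nonneg (‖ξ k‖ - ‖ξ m‖))]
    refine (Finset.abs_sum_le_sum_abs _ _).trans ((Finset.sum_le_sum fun k _ =>
      (Finset.abs_sum_le_sum_abs _ _).trans (Finset.sum_le_sum fun m _ => hkm k m)).trans_eq ?_)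
    simp only [← Finset.mul_sum, Finset.sum_add_distrib, Finset.sum_const, Finset.card_univ, Fintype.card_fin,
      nsmul_eq_mul]
    ring
  have := neg_abs_le (∑ k, ∑ m, fderiv ℝ (trunc n r c) x (eb k) * atn m (dil (2 ^ l)⁻¹ c' x) * (ξ k * conj (ξ m)).re)
  linarith

section Localized

/-- A smooth solution that is localized at frequency `2^j`. -/
structure LocalizedSolution (φ : LPBump d) (j : ℕ) (H : Coeff d) (u₀ : Rd d → ℂ)
    (U f : ℝ × Rd d → ℂ) : Prop extends SmoothSolution H u₀ U f where
  convDefined : ∀ t ∈ 𝕀, ConvDefined fun x => U (t, x)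
  dx_eq : ∀ t ∈ 𝕀, ∀ k x, dx k U (t, x)
    = cv (∂_{(eb k : Rd d)} (φ.Phi (j + 1)) : 𝓢(Rd d, ℂ)) (fun y => U (t, y)) x
  low_eq_zero : ∀ r, r + 2 ≤ j → ∀ t ∈ 𝕀, cv (φ.Phi r) (fun x => U (t, x)) = 0

/-- The square of the weight `wt r c`. -/
def ww (r : ℝ) (c x : Rd d) : ℝ≥0∞ := ‖wt r c x‖ₑ ^ 2

theorem ww_eq (r : ℝ) (c x : Rd d) : ww r c x = ENNReal.ofReal (wt r c x ^ 2) := by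
  rw [ww, ← ofReal_norm, Real.norm_of_nonneg (wt_pos r c x).le, ENNReal.ofReal_pow (wt_pos r c x).le]

theorem ww_eq_enorm (r : ℝ) (c x : Rd d) : ww r c x = ‖wt r c x ^ 2‖ₑ := by rw [ww, enorm_pow]

theorem measurable_ww (r : ℝ) (c : Rd d) : Measurable (ww r c) :=
  (continuous_wt r c).enorm.measurable.pow_const 2

theorem ww_le_one (r : ℝ) (c x : Rd d) : ww r c x ≤ 1 := by
  rw [ww_eq, ENNReal.ofReal_le_one]
  exact pow_le_one₀ (wt_pos r c x).le (wt_le_one r c x)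

/-- The weighted mass at time `t`. -/
def mass (r : ℝ) (c : Rd d) (U : ℝ × Rd d → ℂ) (t : ℝ) : ℝ≥0∞ := ∫⁻ x, ww r c x * ‖U (t, x)‖ₑ ^ 2

/-- The largest weighted mass. -/
def energy (r : ℝ) (c : Rd d) (U : ℝ × Rd d → ℂ) : ℝ≥0∞ := ⨆ t ∈ 𝕀, mass r c U t

/-- The sum of the absolute values of the spatial derivatives. -/
def gsum (U : ℝ × Rd d → ℂ) (z : ℝ × Rd d) : ℝ≥0∞ := ∑ k, ‖dx k U z‖ₑ

/-- The interaction of the solution with the forcing term. -/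
def interaction (j : ℕ) (r : ℝ) (c : Rd d) (U f : ℝ × Rd d → ℂ) : ℝ≥0∞ :=
  ∫⁻ z, ww r c z.2 * ((‖U z‖ₑ + (2 ^ j)⁻¹ * gsum U z) * ‖f z‖ₑ) ∂(slab d)

/-- The constant in the weighted Bernstein inequalities. -/
def bern (φ : LPBump d) : ℝ≥0∞ :=
  4 * (∑ k, mom (∂_{(eb k : Rd d)} (φ.Phi 0) : 𝓢(Rd d, ℂ)) (4 * (d + 1))) ^ 2
    * (ENNReal.ofReal (2 ^ (d + 1)) ^ 2 * 2 ^ d)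

theorem bern_lt_top (φ : LPBump d) : bern φ < ⊤ := by
  unfold bern
  refine ENNReal.mul_lt_top (ENNReal.mul_lt_top (by simp) (ENNReal.pow_lt_top ?_)) (by finiteness)
  exact ENNReal.sum_lt_top.2 fun k _ => mom_lt_top _ _

theorem mom_mul_mom_le (φ : LPBump d) (j : ℕ) (k : Fin d) {N : ℕ} (hN : N ≤ 4 * (d + 1)) :
    mom (∂_{(eb k : Rd d)} (φ.Phi (j + 1)) : 𝓢(Rd d, ℂ)) 0 * mom (∂_{(eb k : Rd d)} (φ.Phi (j + 1)) : 𝓢(Rd d, ℂ)) N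
      ≤ 4 ^ j * (4 * (∑ k, mom (∂_{(eb k : Rd d)} (φ.Phi 0) : 𝓢(Rd d, ℂ)) (4 * (d + 1))) ^ 2) := by
  set D := ∑ k, mom (∂_{(eb k : Rd d)} (φ.Phi 0) : 𝓢(Rd d, ℂ)) (4 * (d + 1)) with hD
  have h : ∀ N ≤ 4 * (d + 1), mom (∂_{(eb k : Rd d)} (φ.Phi (j + 1)) : 𝓢(Rd d, ℂ)) N ≤ 2 ^ (j + 1) * D := by
    intro N hN
    refine (φ.mom_lineDeriv_Phi (j + 1) N (eb k)).trans (mul_le_mul' le_rfl ((mom_mono _ hN).trans ?_))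
    exact Finset.single_le_sum (f := fun k => mom (∂_{(eb k : Rd d)} (φ.Phi 0) : 𝓢(Rd d, ℂ)) (4 * (d + 1)))
      (fun _ _ => zero_le) (Finset.mem_univ k)
  refine (mul_le_mul' (h 0 (by omega)) (h N hN)).trans_eq ?_
  rw [show (4 : ℝ≥0∞) = 2 ^ 2 by norm_num, ← pow_mul]
  ring

namespace LocalizedSolution

variable {j : ℕ}

theorem continuous_slice (hU : LocalizedSolution φ j H u₀ U f) {t : ℝ} (ht : t ∈ 𝕀) :
    Continuous fun x => U (t, x) := (hU.contDiff t ht).continuous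

theorem continuous_dx_slice (hU : LocalizedSolution φ j H u₀ U f) {t : ℝ} (ht : t ∈ 𝕀)
    (k : Fin d) : Continuous fun x => dx k U (t, x) := (dx_contDiff (hU.contDiff t ht) k).continuous

theorem aestronglyMeasurable (hU : LocalizedSolution φ j H u₀ U f) : AEStronglyMeasurable U (slab d) :=
  continuousOn_aestronglyMeasurable hU.continuousOn

theorem aestronglyMeasurable_dx (hU : LocalizedSolution φ j H u₀ U f) (k : Fin d) :
    AEStronglyMeasurable (dx k U) (slab d) :=
  continuousOn_aestronglyMeasurable (hU.continuousOn_dx k)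

theorem aemeasurable_gsum (hU : LocalizedSolution φ j H u₀ U f) : AEMeasurable (gsum U) (slab d) :=
  Finset.aemeasurable_fun_sum _ fun k _ => (hU.aestronglyMeasurable_dx k).enorm

theorem measurable_gsum_slice (hU : LocalizedSolution φ j H u₀ U f) {t : ℝ} (ht : t ∈ 𝕀) :
    Measurable fun x => gsum U (t, x) :=
  Finset.measurable_fun_sum _ fun k _ => (hU.continuous_dx_slice ht k).enorm.measurable

theorem mass_le_energy {r : ℝ} {c : Rd d} {t : ℝ} (ht : t ∈ 𝕀) :
    mass r c U t ≤ energy r c U := le_iSup₂ (f := fun t (_ : t ∈ 𝕀) => mass r c U t) t ht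

theorem energy_lt_top (hU : LocalizedSolution φ j H u₀ U f) (r : ℝ) (c : Rd d) : energy r c U < ⊤ := by
  obtain ⟨M, hM, hb⟩ := hU.exists_bound
  refine lt_of_le_of_lt (iSup₂_le fun t ht => ?_) (ENNReal.pow_lt_top hM : M ^ 2 < ⊤)
  calc _ ≤ ∫⁻ x, ‖U (t, x)‖ₑ ^ 2 := lintegral_mono fun x => mul_le_of_le_one_left' (ww_le_one r c x)
    _ = eLpNorm (fun x => U (t, x)) 2 volume ^ 2 := (eLpNorm_two_sq _).symm
    _ ≤ _ := by gcongr; exact hb t ht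

theorem lintegral_slab_le {F : ℝ × Rd d → ℝ≥0∞} (hF : AEMeasurable F (slab d)) {R : ℝ≥0∞}
    (h : ∀ t ∈ 𝕀, ∫⁻ x, F (t, x) ≤ R) : ∫⁻ z, F z ∂(slab d) ≤ R := by
  rw [lintegral_slab hF]
  refine (setLIntegral_mono' measurableSet_Icc h).trans ?_
  simp

theorem Xsq_le_energy (hU : LocalizedSolution φ j H u₀ U f) (r : ℝ) (c : Rd d) :
    Xsq (fun z => wt r c z.2 • U z) ≤ energy r c U := by
  have hm : AEMeasurable (fun z : ℝ × Rd d => ww r c z.2 * ‖U z‖ₑ ^ 2) (slab d) :=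
    ((measurable_ww r c).comp measurable_snd).aemeasurable.mul (hU.aestronglyMeasurable.enorm.pow_const 2)
  refine Xsq_le fun l k => ?_
  calc _ ≤ ∫⁻ z, ww r c z.2 * ‖U z‖ₑ ^ 2 ∂(slab d) := by
        refine lintegral_mono fun z => ?_
        rw [enorm_smul, mul_pow]
        refine mul_le_of_le_one_left' ?_
        exact indicator_le (fun _ _ => le_rfl) _ |>.trans (by simp)
    _ ≤ energy r c U := lintegral_slab_le hm fun t ht => mass_le_energy ht
    _ ≤ _ := le_mul_of_one_le_left' (one_le_pow₀ one_le_two)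

theorem lintegral_dx_sq_le (hU : LocalizedSolution φ j H u₀ U f) {r : ℝ} (hr : 0 ≤ r) (hr1 : r ≤ 1)
    (c : Rd d) {t : ℝ} (ht : t ∈ 𝕀) (k : Fin d) :
    ∫⁻ x, ww r c x * ‖dx k U (t, x)‖ₑ ^ 2 ≤ bern φ * (4 ^ j * mass r c U t) := by
  have h := lintegral_weighted_cv_le (κ := (∂_{(eb k : Rd d)} (φ.Phi (j + 1)) : 𝓢(Rd d, ℂ)))
    (hU.continuous_slice ht).aestronglyMeasurable ((slowWeight_wt hr hr1 c).pow 2)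
  simp_rw [hU.dx_eq t ht, ww_eq_enorm]
  refine h.trans ?_
  rw [ENNReal.ofReal_pow (by positivity)]
  calc _ ≤ (4 ^ j * (4 * (∑ k, mom (∂_{(eb k : Rd d)} (φ.Phi 0) : 𝓢(Rd d, ℂ)) (4 * (d + 1))) ^ 2))
        * (ENNReal.ofReal (2 ^ (d + 1)) ^ 2 * 2 ^ d) * mass r c U t := by
        refine mul_le_mul' (mul_le_mul' (mom_mul_mom_le φ j k (by omega)) ?_) (le_of_eq ?_)
        · exact le_mul_of_one_le_right' (one_le_pow₀ one_le_two)
        · simp_rw [mass, ww_eq_enorm]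
    _ = _ := by rw [bern]; ring

theorem Xsq_dx_le (hU : LocalizedSolution φ j H u₀ U f) {r : ℝ} (hr : 0 ≤ r) (hr1 : r ≤ 1)
    (c : Rd d) (k : Fin d) :
    Xsq (fun z => wt r c z.2 • dx k U z) ≤ bern φ * (4 ^ j * Xsq (fun z => wt r c z.2 • U z)) := by
  have h := Xsq_weighted_cv_le (κ := (∂_{(eb k : Rd d)} (φ.Phi (j + 1)) : 𝓢(Rd d, ℂ)))
    hU.aestronglyMeasurable (slowWeight_wt hr hr1 c)
  refine (Xsq_mono ?_).trans (h.trans ?_)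
  · filter_upwards [ae_slab_mem] with z hz
    rw [show z = (z.1, z.2) from rfl, hU.dx_eq z.1 hz.1]
  · calc _ ≤ (4 ^ j * (4 * (∑ k, mom (∂_{(eb k : Rd d)} (φ.Phi 0) : 𝓢(Rd d, ℂ)) (4 * (d + 1))) ^ 2))
        * (ENNReal.ofReal (2 ^ (d + 1)) ^ 2 * 2 ^ d) * Xsq (fun z => wt r c z.2 • U z) := by
          exact mul_le_mul' (mul_le_mul' (mom_mul_mom_le φ j k (N := 2 * (2 * (d + 1))) (by omega)) le_rfl) le_rfl
      _ = _ := by rw [bern]; ring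

theorem sum_sq_le {ι : Type*} [Fintype ι] (a : ι → ℝ≥0∞) :
    (∑ k, a k) ^ 2 ≤ Fintype.card ι * ∑ k, a k ^ 2 := by
  have := tsum_mul_sq_le_weighted (fun _ : ι => 1) a
  simpa [tsum_fintype] using this

theorem mul_le_add_sq {a b q : ℝ≥0∞} (hq : q ≠ 0) (hq' : q ≠ ⊤) : a * b ≤ q * b ^ 2 + q⁻¹ * a ^ 2 := by
  rcases le_total a (q * b) with h | h
  · refine le_trans ?_ le_self_add
    calc a * b ≤ q * b * b := by gcongr
      _ = _ := by ring
  · refine le_trans ?_ le_add_self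
    have hb : b ≤ q⁻¹ * a := by
      rw [mul_comm, ← div_eq_mul_inv]
      exact ENNReal.le_div_iff_mul_le (Or.inl hq) (Or.inl hq') |>.2 (by rwa [mul_comm])
    calc a * b ≤ a * (q⁻¹ * a) := by gcongr
      _ = _ := by ring

/-- The constant in the weighted estimates of the gradient. -/
def _root_.QuasiSchrodinger.gradConst (φ : LPBump d) : ℝ≥0∞ := 1 + (d + 1) ^ 2 * bern φ

theorem gsum_sq_le (z : ℝ × Rd d) : gsum U z ^ 2 ≤ d * ∑ k, ‖dx k U z‖ₑ ^ 2 := by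
  simpa [gsum] using sum_sq_le fun k => ‖dx k U z‖ₑ

theorem lintegral_gsum_sq_le (hU : LocalizedSolution φ j H u₀ U f) {r : ℝ} (hr : 0 ≤ r) (hr1 : r ≤ 1)
    (c : Rd d) {t : ℝ} (ht : t ∈ 𝕀) :
    ∫⁻ x, ww r c x * gsum U (t, x) ^ 2 ≤ (d + 1) ^ 2 * bern φ * (4 ^ j * mass r c U t) := by
  calc _ ≤ ∫⁻ x, d * ∑ k, ww r c x * ‖dx k U (t, x)‖ₑ ^ 2 := by
        refine lintegral_mono fun x => ?_
        rw [← Finset.mul_sum, mul_left_comm]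
        exact mul_le_mul' le_rfl (gsum_sq_le _)
    _ = d * ∑ k, ∫⁻ x, ww r c x * ‖dx k U (t, x)‖ₑ ^ 2 := by
        have hm : ∀ k : Fin d, Measurable fun x => ww r c x * ‖dx k U (t, x)‖ₑ ^ 2 := fun k =>
          (measurable_ww r c).mul ((hU.continuous_dx_slice ht k).enorm.measurable.pow_const 2)
        rw [lintegral_const_mul _ (Finset.measurable_fun_sum _ fun k _ => hm k),
          lintegral_finsetSum _ fun k _ => hm k]
    _ ≤ d * ∑ _k : Fin d, bern φ * (4 ^ j * mass r c U t) := by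
        gcongr with k
        exact hU.lintegral_dx_sq_le hr hr1 c ht k
    _ = (d : ℝ≥0∞) ^ 2 * bern φ * (4 ^ j * mass r c U t) := by
        simp only [Finset.sum_const, Finset.card_univ, Fintype.card_fin, nsmul_eq_mul]
        ring
    _ ≤ _ := by gcongr; exact le_self_add

theorem lintegral_gsum_mul_le (hU : LocalizedSolution φ j H u₀ U f) {r : ℝ} (hr : 0 ≤ r) (hr1 : r ≤ 1)
    (c : Rd d) {t : ℝ} (ht : t ∈ 𝕀) :
    ∫⁻ x, ww r c x * (gsum U (t, x) * ‖U (t, x)‖ₑ) ≤ gradConst φ * (2 ^ j * mass r c U t) := by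
  have hm : Measurable fun x => ww r c x * ‖U (t, x)‖ₑ ^ 2 :=
    (measurable_ww r c).mul ((hU.continuous_slice ht).enorm.measurable.pow_const 2)
  have h2 : (2 : ℝ≥0∞) ^ j ≠ 0 := by positivity
  calc _ ≤ ∫⁻ x, (2 ^ j * (ww r c x * ‖U (t, x)‖ₑ ^ 2) + (2 ^ j)⁻¹ * (ww r c x * gsum U (t, x) ^ 2)) := by
        refine lintegral_mono fun x => ?_
        refine (mul_le_mul' le_rfl (mul_le_add_sq h2 (by simp))).trans_eq ?_
        ring
    _ = 2 ^ j * mass r c U t + (2 ^ j)⁻¹ * ∫⁻ x, ww r c x * gsum U (t, x) ^ 2 := by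
        rw [lintegral_add_left (hm.const_mul _), lintegral_const_mul _ hm,
          lintegral_const_mul' _ _ (ENNReal.inv_ne_top.2 h2)]
        rfl
    _ ≤ 2 ^ j * mass r c U t + (2 ^ j)⁻¹ * ((d + 1) ^ 2 * bern φ * (4 ^ j * mass r c U t)) := by
        gcongr
        exact hU.lintegral_gsum_sq_le hr hr1 c ht
    _ = _ := by
        have : ((2 : ℝ≥0∞) ^ j)⁻¹ * 4 ^ j = 2 ^ j := by
          rw [show (4 : ℝ≥0∞) = 2 * 2 by norm_num, mul_pow, ← mul_assoc, ENNReal.inv_mul_cancel h2 (by simp), one_mul]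
        rw [gradConst, add_mul, one_mul]
        congr 1
        calc _ = (d + 1) ^ 2 * bern φ * (((2 ^ j)⁻¹ * 4 ^ j) * mass r c U t) := by ring
          _ = _ := by rw [this]

end LocalizedSolution

end Localized

section WeightedEstimates

theorem lintegral_ww_le {α : Type*} [MeasurableSpace α] {μ : Measure α} {X : α → Rd d}
    (hX : Measurable X) {G : α → ℝ≥0∞} (hG : AEMeasurable G μ) (hG' : ∀ a, G a ≠ ⊤) {r : ℝ} {c : Rd d}
    {R : ℝ≥0∞} (h : ∀ n, ∫⁻ a, ENNReal.ofReal (trunc n r c (X a)) * G a ∂μ ≤ R) :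
    ∫⁻ a, ww r c (X a) * G a ∂μ ≤ R := by
  have hm : ∀ n, AEMeasurable (fun a => ENNReal.ofReal (trunc n r c (X a)) * G a) μ := fun n =>
    ((contDiff_trunc n r c).continuous.measurable.comp hX).ennreal_ofReal.aemeasurable.mul hG
  calc _ = ∫⁻ a, liminf (fun n => ENNReal.ofReal (trunc n r c (X a)) * G a) atTop ∂μ := by
        refine lintegral_congr fun a => (Tendsto.liminf_eq ?_).symm
        rw [ww_eq]
        exact ENNReal.Tendsto.mul_const ((ENNReal.continuous_ofReal.tendsto _).comp
          (tendsto_trunc r c (X a))) (Or.inr (hG' a))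
    _ ≤ liminf (fun n => ∫⁻ a, ENNReal.ofReal (trunc n r c (X a)) * G a ∂μ) atTop := lintegral_liminf_le' hm
    _ ≤ R := liminf_le_of_le (by isBoundedDefault) fun b hb => by
        obtain ⟨n, hn⟩ := hb.exists
        exact hn.trans (h n)

theorem ofReal_gradn_le (U : ℝ × Rd d → ℂ) (z : ℝ × Rd d) : ENNReal.ofReal (gradn U z) ≤ gsum U z := by
  rw [gradn, ofReal_norm]
  exact opENorm_le_sum_basis _

namespace LocalizedSolution

variable {j : ℕ}
  {C : ℝ}

theorem aemeasurable_ww_gsum_mul (hU : LocalizedSolution φ j H u₀ U f) (r : ℝ) (c : Rd d) :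
    AEMeasurable (fun z => ww r c z.2 * (gsum U z * ‖U z‖ₑ)) (slab d) :=
  ((measurable_ww r c).comp measurable_snd).aemeasurable.mul
    (hU.aemeasurable_gsum.mul hU.aestronglyMeasurable.enorm)

theorem aemeasurable_ww_gsum_sq (hU : LocalizedSolution φ j H u₀ U f) (r : ℝ) (c : Rd d) :
    AEMeasurable (fun z => ww r c z.2 * gsum U z ^ 2) (slab d) :=
  ((measurable_ww r c).comp measurable_snd).aemeasurable.mul (hU.aemeasurable_gsum.pow_const 2)

theorem slab_gsum_mul_le (hU : LocalizedSolution φ j H u₀ U f) {r : ℝ} (hr : 0 ≤ r) (hr1 : r ≤ 1)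
    (c : Rd d) :
    ∫⁻ z, ww r c z.2 * (gsum U z * ‖U z‖ₑ) ∂(slab d) ≤ gradConst φ * (2 ^ j * energy r c U) :=
  lintegral_slab_le (hU.aemeasurable_ww_gsum_mul r c) fun t ht =>
    (hU.lintegral_gsum_mul_le hr hr1 c ht).trans (by gcongr; exact mass_le_energy ht)

theorem slab_gsum_sq_le (hU : LocalizedSolution φ j H u₀ U f) {r : ℝ} (hr : 0 ≤ r) (hr1 : r ≤ 1)
    (c : Rd d) :
    ∫⁻ z, ww r c z.2 * gsum U z ^ 2 ∂(slab d) ≤ gradConst φ * (4 ^ j * energy r c U) :=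
  lintegral_slab_le (hU.aemeasurable_ww_gsum_sq r c) fun _ ht =>
    (hU.lintegral_gsum_sq_le hr hr1 c ht).trans (mul_le_mul' le_add_self
      (mul_le_mul' le_rfl (mass_le_energy ht)))

/-- The weighted energy inequality. -/
theorem mass_le (hU : LocalizedSolution φ j H u₀ U f) (hH : TamePerturbation H P B) (hC0 : 0 ≤ C)
    (hC : ∀ n, Controlled C (fun y : Rd d => jap y ^ (2 * d + 1 + 1)) (truncProfile n)) {r : ℝ} (hr : 0 < r)
    (hr1 : r ≤ 1) (c : Rd d) {T : ℝ} (hT : T ∈ 𝕀) :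
    mass r c U T ≤ mass r c U 0 + (ENNReal.ofReal (4 * d ^ 2 * C * r) * (gradConst φ * (2 ^ j * energy r c U))
      + 2 * interaction j r c U f) := by
  have hq : ∀ (n : ℕ) (t : ℝ), ∫⁻ x, ENNReal.ofReal (trunc n r c x * ‖U (t, x)‖ ^ 2)
      = ∫⁻ x, ENNReal.ofReal (trunc n r c x) * ‖U (t, x)‖ₑ ^ 2 := fun n _ => by
    congr 1; ext x
    rw [ENNReal.ofReal_mul (trunc_nonneg n r c x), ENNReal.ofReal_pow (norm_nonneg _), ofReal_norm]
  have htr : ∀ n x, ENNReal.ofReal (trunc n r c x) ≤ ww r c x := fun n x => by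
    rw [ww_eq]; exact ENNReal.ofReal_le_ofReal (trunc_le n r c x)
  refine lintegral_ww_le (X := fun x => x) measurable_id
    ((hU.continuous_slice hT).enorm.measurable.pow_const 2).aemeasurable (fun x => by finiteness) fun n => ?_
  rw [← hq]
  refine (hU.energy_le hH (contDiff_trunc n r c) (HasCompactSupport.intro (isCompact_closedBall c _)
    fun x hx => trunc_eq_zero n hr c hx) (trunc_nonneg n r c) hT).trans ?_
  refine add_le_add ?_ ?_
  · rw [hq]
    exact lintegral_mono fun x => mul_le_mul' (htr n x) le_rfl
  · calc _ ≤ ∫⁻ z, ENNReal.ofReal (4 * d ^ 2 * C * r) * (ww r c z.2 * (gsum U z * ‖U z‖ₑ))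
          + 2 * (ww r c z.2 * ((‖U z‖ₑ + (2 ^ j)⁻¹ * gsum U z) * ‖f z‖ₑ)) ∂(slab d) := by
          refine lintegral_mono fun z => ?_
          have hb := norm_fderiv_trunc_le (hC n) hr.le c z.2
          have hg := gradn_nonneg U z
          have e1 : 4 * (d : ℝ) ^ 2 * ‖fderiv ℝ (trunc n r c) z.2‖ * (gradn U z * ‖U z‖)
              ≤ 4 * d ^ 2 * C * r * (wt r c z.2 ^ 2 * (gradn U z * ‖U z‖)) := by
            calc _ ≤ 4 * (d : ℝ) ^ 2 * (C * r * wt r c z.2 ^ 2) * (gradn U z * ‖U z‖) := by gcongr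
              _ = _ := by ring
          have e2 : 2 * trunc n r c z.2 * (‖U z‖ * ‖f z‖) ≤ 2 * (wt r c z.2 ^ 2 * (‖U z‖ * ‖f z‖)) := by
            rw [mul_assoc]
            have := trunc_le n r c z.2
            gcongr
          refine (ENNReal.ofReal_le_ofReal (add_le_add e1 e2)).trans (ENNReal.ofReal_add_le.trans ?_)
          rw [ENNReal.ofReal_mul (p := 4 * (d : ℝ) ^ 2 * C * r) (by positivity),
            ENNReal.ofReal_mul (p := wt r c z.2 ^ 2) (q := gradn U z * ‖U z‖) (by positivity), ← ww_eq,
            ENNReal.ofReal_mul hg, ENNReal.ofReal_mul (p := 2) (by norm_num),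
            ENNReal.ofReal_mul (p := wt r c z.2 ^ 2) (by positivity), ← ww_eq,
            ENNReal.ofReal_mul (p := ‖U z‖) (norm_nonneg _), ofReal_norm, ofReal_norm, ENNReal.ofReal_ofNat]
          gcongr
          · exact ofReal_gradn_le U z
          · exact le_self_add
      _ = ENNReal.ofReal (4 * d ^ 2 * C * r) * ∫⁻ z, ww r c z.2 * (gsum U z * ‖U z‖ₑ) ∂(slab d)
          + 2 * interaction j r c U f := by
          rw [lintegral_add_left' ((hU.aemeasurable_ww_gsum_mul r c).const_mul _),
            lintegral_const_mul' _ _ ENNReal.ofReal_ne_top, lintegral_const_mul' _ _ (by simp)]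
          rfl
      _ ≤ _ := by
          gcongr
          exact hU.slab_gsum_mul_le hr.le hr1 c

theorem lintegral_bound_gsum_le (hU : LocalizedSolution φ j H u₀ U f) (hH : TamePerturbation H P B) {r : ℝ}
    (hr : 0 ≤ r) (hr1 : r ≤ 1) (c : Rd d) :
    ∫⁻ z, ww r c z.2 * (P z.2 * gsum U z ^ 2) ∂(slab d)
      ≤ gradConst φ * (B * (4 ^ j * Xsq (fun z => wt r c z.2 • U z))) := by
  have hm : ∀ k : Fin d, AEStronglyMeasurable (fun z => wt r c z.2 • dx k U z) (slab d) := fun k =>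
    ((continuous_wt r c).comp continuous_snd).aestronglyMeasurable.smul (hU.aestronglyMeasurable_dx k)
  have hm2 : ∀ k : Fin d, AEMeasurable (fun z => P z.2 * ‖wt r c z.2 • dx k U z‖ₑ ^ 2) (slab d) := fun k =>
    (hH.measurable_bound.comp measurable_snd).aemeasurable.mul ((hm k).enorm.pow_const 2)
  calc _ ≤ ∫⁻ z, d * ∑ k, P z.2 * ‖wt r c z.2 • dx k U z‖ₑ ^ 2 ∂(slab d) := by
        refine lintegral_mono fun z => ?_
        calc _ ≤ ww r c z.2 * (P z.2 * (d * ∑ k, ‖dx k U z‖ₑ ^ 2)) := by gcongr; exact gsum_sq_le z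
          _ = _ := by
            simp_rw [enorm_smul, mul_pow, Finset.mul_sum, ww]
            refine Finset.sum_congr rfl fun k _ => ?_
            ring
    _ = d * ∑ k, ∫⁻ z, P z.2 * ‖wt r c z.2 • dx k U z‖ₑ ^ 2 ∂(slab d) := by
        rw [lintegral_const_mul'' _ (Finset.aemeasurable_fun_sum _ fun k _ => hm2 k),
          lintegral_finsetSum' _ fun k _ => hm2 k]
    _ ≤ d * ∑ _k : Fin d, B * (bern φ * (4 ^ j * Xsq (fun z => wt r c z.2 • U z))) := by
        gcongr with k
        exact (hH.bound_le _ (hm k)).trans (by gcongr; exact hU.Xsq_dx_le hr hr1 c k)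
    _ = (d : ℝ≥0∞) ^ 2 * bern φ * (B * (4 ^ j * Xsq (fun z => wt r c z.2 • U z))) := by
        simp only [Finset.sum_const, Finset.card_univ, Fintype.card_fin, nsmul_eq_mul]
        ring
    _ ≤ _ := by
        refine mul_le_mul' (le_trans ?_ le_add_self) le_rfl
        gcongr
        exact le_self_add

theorem boundary_le (hU : LocalizedSolution φ j H u₀ U f) {r : ℝ} (hr : 0 ≤ r) (hr1 : r ≤ 1) (c : Rd d)
    {K : ℝ} {E : Rd d → ℝ} (hK : 0 ≤ K) (hE : ∀ x, E x ≤ K * wt r c x ^ 2) {t : ℝ} (ht : t ∈ 𝕀) :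
    ∫⁻ x, ENNReal.ofReal (E x * ((gradn U (t, x) + ‖U (t, x)‖) * ‖U (t, x)‖))
      ≤ ENNReal.ofReal K * (2 * (gradConst φ * (2 ^ j * energy r c U))) := by
  have hm : Measurable fun x => ww r c x * (gsum U (t, x) * ‖U (t, x)‖ₑ) :=
    (measurable_ww r c).mul ((hU.measurable_gsum_slice ht).mul (hU.continuous_slice ht).enorm.measurable)
  calc _ ≤ ∫⁻ x, ENNReal.ofReal K * (ww r c x * (gsum U (t, x) * ‖U (t, x)‖ₑ) + ww r c x * ‖U (t, x)‖ₑ ^ 2) := by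
        refine lintegral_mono fun x => ?_
        have hg := gradn_nonneg U (t, x)
        calc _ ≤ ENNReal.ofReal (K * (wt r c x ^ 2 * ((gradn U (t, x) + ‖U (t, x)‖) * ‖U (t, x)‖))) := by
              refine ENNReal.ofReal_le_ofReal ?_
              rw [← mul_assoc K]
              exact mul_le_mul_of_nonneg_right (hE x) (by positivity)
          _ = ENNReal.ofReal K * (ww r c x * ((ENNReal.ofReal (gradn U (t, x)) + ‖U (t, x)‖ₑ) * ‖U (t, x)‖ₑ)) := by
              rw [ENNReal.ofReal_mul hK, ENNReal.ofReal_mul (by positivity), ← ww_eq,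
                ENNReal.ofReal_mul (by positivity), ENNReal.ofReal_add hg (norm_nonneg _), ofReal_norm]
          _ ≤ ENNReal.ofReal K * (ww r c x * ((gsum U (t, x) + ‖U (t, x)‖ₑ) * ‖U (t, x)‖ₑ)) := by
              gcongr; exact ofReal_gradn_le U _
          _ = _ := by ring
    _ = ENNReal.ofReal K * ((∫⁻ x, ww r c x * (gsum U (t, x) * ‖U (t, x)‖ₑ)) + mass r c U t) := by
        rw [lintegral_const_mul' _ _ ENNReal.ofReal_ne_top, lintegral_add_left hm]
        rfl
    _ ≤ ENNReal.ofReal K * (gradConst φ * (2 ^ j * energy r c U) + gradConst φ * (2 ^ j * energy r c U)) := by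
        have hme : mass r c U t ≤ energy r c U := mass_le_energy ht
        gcongr
        · exact (hU.lintegral_gsum_mul_le hr hr1 c ht).trans (by gcongr)
        · refine hme.trans ?_
          rw [← mul_assoc]
          exact le_mul_of_one_le_left' (one_le_mul le_self_add (one_le_pow₀ one_le_two))
    _ = _ := by ring

/-- The Morawetz inequality for a weighted vector field. -/
theorem lintegral_nu_le (hU : LocalizedSolution φ j H u₀ U f) (hH : TamePerturbation H P B) (hC0 : 0 ≤ C)
    (hC : ∀ n, Controlled C (fun y : Rd d => jap y ^ (2 * d + 1 + 1)) (truncProfile n)) {r : ℝ} (hr : 0 < r)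
    (hrj : r * 2 ^ j ≤ 1) (c : Rd d) (l : ℕ) (c' : Rd d) :
    ∫⁻ z, ww r c z.2 * (ENNReal.ofReal (nu l c' z.2) * ∑ k, ‖dx k U z‖ₑ ^ 2) ∂(slab d)
      ≤ ENNReal.ofReal (32 * (d + 1) ^ 4 * C) * (6 * gradConst φ * (2 ^ j * energy r c U
        + B * (4 ^ j * Xsq (fun z => wt r c z.2 • U z)) + 2 ^ j * interaction j r c U f)) := by
  have hr1 : r ≤ 1 := by
    have : (1 : ℝ) ≤ 2 ^ j := one_le_pow₀ one_le_two
    nlinarith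
  have hgc : 1 ≤ gradConst φ := le_self_add
  set K : ℝ := 32 * (d + 1) ^ 4 * C with hK
  have hK0 : 0 ≤ K := by positivity
  have hd1 : (1 : ℝ) ≤ d + 1 := by linarith [(d.cast_nonneg : (0 : ℝ) ≤ d)]
  have hd0 : (0 : ℝ) ≤ d := d.cast_nonneg
  have hGm : AEMeasurable (fun z => ENNReal.ofReal (nu l c' z.2) * ∑ k, ‖dx k U z‖ₑ ^ 2) (slab d) :=
    ((slowWeight_nu l c').cont.measurable.comp measurable_snd).ennreal_ofReal.aemeasurable.mul
      (Finset.aemeasurable_fun_sum _ fun k _ => (hU.aestronglyMeasurable_dx k).enorm.pow_const 2)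
  refine lintegral_ww_le measurable_snd hGm (fun z => ENNReal.mul_ne_top ENNReal.ofReal_ne_top
    (ENNReal.sum_ne_top.2 fun _ _ => by finiteness)) fun n => ?_
  have hcm := controlled_morawetzField (hC n) hr.le hr1 c l c'
  have hW0 : ∀ x, 0 ≤ 8 * C * wt r c x ^ 2 := fun x => by positivity
  have hW1 : ∀ x, 8 * C * wt r c x ^ 2 ≤ (d + 1) * (8 * C * wt r c x ^ 2) := fun x =>
    le_mul_of_one_le_left (hW0 x) hd1
  have hW2 : ∀ x, (d : ℝ) * (8 * C * wt r c x ^ 2) ≤ (d + 1) * (8 * C * wt r c x ^ 2) := fun x =>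
    mul_le_mul_of_nonneg_right (by linarith) (hW0 x)
  have hmor := hU.morawetz_le hH (testField_morawetzField n hr c l c')
    (ρ := fun x => trunc n r c x * nu l c' x) (E₀ := fun x => 2 * d * (C * r * wt r c x ^ 2))
    (E₁ := fun x => (d + 1) * (8 * C * wt r c x ^ 2))
    ((contDiff_trunc n r c).continuous.mul (slowWeight_nu l c').cont)
    (fun x => mul_nonneg (trunc_nonneg n r c x) ((slowWeight_nu l c').pos x).le)
    (fun x hx => by rw [trunc_eq_zero n hr c hx, zero_mul]) (fun x => by positivity)
    (fun m x => ((hcm m).abs_le x).trans (hW1 x))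
    (fun k m x => by
      have := (fderiv ℝ (morawetzField n r c l c' m) x).le_opNorm (eb k)
      rw [norm_eb, mul_one] at this
      exact (this.trans ((hcm m).fderiv_le x)).trans (hW1 x))
    (fun x => (Controlled.abs_dvg_le hcm x).1.trans (hW2 x))
    (fun k x => ((Controlled.abs_dvg_le hcm x).2 k).trans (hW2 x))
    (fun x ξ => le_morawetzField_form (hC n) hr.le c l c' x ξ)
  have hbd : ∀ t ∈ 𝕀, ∫⁻ x, ENNReal.ofReal ((d + 1) * ((d + 1) * (8 * C * wt r c x ^ 2) *
      ((gradn U (t, x) + ‖U (t, x)‖) * ‖U (t, x)‖)))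
      ≤ ENNReal.ofReal K * (2 * (gradConst φ * (2 ^ j * energy r c U))) := by
    intro t ht
    refine le_trans (le_of_eq ?_) (hU.boundary_le hr.le hr1 c (K := K)
      (E := fun x => (d + 1) * ((d + 1) * (8 * C * wt r c x ^ 2))) hK0 (fun x => ?_) ht)
    · simp_rw [mul_assoc]
    · have h1 : ((d : ℝ) + 1) ^ 2 ≤ (d + 1) ^ 4 := pow_le_pow_right₀ hd1 (by norm_num)
      have h2 : 0 ≤ C * wt r c x ^ 2 := by positivity
      rw [hK]
      nlinarith [mul_le_mul_of_nonneg_right h1 h2, mul_nonneg (by positivity : 0 ≤ ((d : ℝ) + 1) ^ 4) h2]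
  have hslab : ∫⁻ z, ENNReal.ofReal (2 * d * (2 * d * (C * r * wt r c z.2 ^ 2) * gradn U z ^ 2) + 4 * (d + 1) ^ 3 *
      ((d + 1) * (8 * C * wt r c z.2 ^ 2) * ((P z.2).toReal * gradn U z ^ 2 + gradn U z * ‖U z‖
        + (gradn U z + ‖U z‖) * ‖f z‖))) ∂(slab d)
      ≤ ENNReal.ofReal K * (2 * (gradConst φ * (2 ^ j * energy r c U))
        + gradConst φ * (B * (4 ^ j * Xsq (fun z => wt r c z.2 • U z))) + 2 ^ j * interaction j r c U f) := by
    calc _ ≤ ∫⁻ z, ENNReal.ofReal K * (ENNReal.ofReal r * (ww r c z.2 * gsum U z ^ 2)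
          + ww r c z.2 * (P z.2 * gsum U z ^ 2) + ww r c z.2 * (gsum U z * ‖U z‖ₑ)
          + 2 ^ j * (ww r c z.2 * ((‖U z‖ₑ + (2 ^ j)⁻¹ * gsum U z) * ‖f z‖ₑ))) ∂(slab d) := by
          refine lintegral_mono fun z => ?_
          have hg := gradn_nonneg U z
          have hp : (0 : ℝ) ≤ (P z.2).toReal := ENNReal.toReal_nonneg
          have hPt : P z.2 ≠ ⊤ := ((hH.bound_le_one z.2).trans_lt ENNReal.one_lt_top).ne
          have hw : 0 ≤ wt r c z.2 ^ 2 := sq_nonneg _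
          set S : ℝ := r * gradn U z ^ 2 + (P z.2).toReal * gradn U z ^ 2 + gradn U z * ‖U z‖
            + (gradn U z + ‖U z‖) * ‖f z‖ with hS
          have hreal : 2 * d * (2 * d * (C * r * wt r c z.2 ^ 2) * gradn U z ^ 2) + 4 * (d + 1) ^ 3 *
              ((d + 1) * (8 * C * wt r c z.2 ^ 2) * ((P z.2).toReal * gradn U z ^ 2 + gradn U z * ‖U z‖
              + (gradn U z + ‖U z‖) * ‖f z‖)) ≤ K * (wt r c z.2 ^ 2 * S) := by
            have h1 : (d : ℝ) ^ 2 ≤ (d + 1) ^ 4 :=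
              (pow_le_pow_left₀ hd0 (by linarith) 2).trans (pow_le_pow_right₀ hd1 (by norm_num))
            have h2 : 0 ≤ C * wt r c z.2 ^ 2 * (r * gradn U z ^ 2) := by positivity
            have h3 := mul_le_mul_of_nonneg_right h1 h2
            have h4 : 0 ≤ (d : ℝ) ^ 2 * (C * wt r c z.2 ^ 2 * (r * gradn U z ^ 2)) := by positivity
            rw [hK, hS]
            nlinarith
          refine (ENNReal.ofReal_le_ofReal hreal).trans ?_
          rw [ENNReal.ofReal_mul hK0, ENNReal.ofReal_mul hw, ← ww_eq]
          refine mul_le_mul' le_rfl ?_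
          have hS' : ENNReal.ofReal S ≤ ENNReal.ofReal r * gsum U z ^ 2 + P z.2 * gsum U z ^ 2
              + gsum U z * ‖U z‖ₑ + (gsum U z + ‖U z‖ₑ) * ‖f z‖ₑ := by
            rw [hS, ENNReal.ofReal_add (by positivity) (by positivity), ENNReal.ofReal_add (by positivity) (by positivity),
              ENNReal.ofReal_add (by positivity) (by positivity), ENNReal.ofReal_mul hr.le, ENNReal.ofReal_mul hp,
              ENNReal.ofReal_mul hg, ENNReal.ofReal_mul (by positivity), ENNReal.ofReal_add hg (norm_nonneg _),
              ENNReal.ofReal_pow hg, ENNReal.ofReal_toReal hPt, ofReal_norm, ofReal_norm]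
            have := ofReal_gradn_le U z
            gcongr
          have h2 : (2 : ℝ≥0∞) ^ j * (2 ^ j)⁻¹ = 1 := ENNReal.mul_inv_cancel (by positivity) (by simp)
          calc _ ≤ ww r c z.2 * (ENNReal.ofReal r * gsum U z ^ 2 + P z.2 * gsum U z ^ 2
              + gsum U z * ‖U z‖ₑ + (gsum U z + 2 ^ j * ‖U z‖ₑ) * ‖f z‖ₑ) := by
                refine mul_le_mul' le_rfl (hS'.trans ?_)
                gcongr
                exact le_mul_of_one_le_left' (one_le_pow₀ one_le_two)
            _ = ENNReal.ofReal r * (ww r c z.2 * gsum U z ^ 2) + ww r c z.2 * (P z.2 * gsum U z ^ 2)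
              + ww r c z.2 * (gsum U z * ‖U z‖ₑ)
              + ww r c z.2 * ((2 ^ j * ‖U z‖ₑ + (2 ^ j * (2 ^ j)⁻¹) * gsum U z) * ‖f z‖ₑ) := by rw [h2]; ring
            _ = _ := by ring
      _ = ENNReal.ofReal K * (ENNReal.ofReal r * ∫⁻ z, ww r c z.2 * gsum U z ^ 2 ∂(slab d)
          + ∫⁻ z, ww r c z.2 * (P z.2 * gsum U z ^ 2) ∂(slab d)
          + ∫⁻ z, ww r c z.2 * (gsum U z * ‖U z‖ₑ) ∂(slab d) + 2 ^ j * interaction j r c U f) := by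
          have m1 := (hU.aemeasurable_ww_gsum_sq r c).const_mul (ENNReal.ofReal r)
          have m2 : AEMeasurable (fun z => ww r c z.2 * (P z.2 * gsum U z ^ 2)) (slab d) :=
            ((measurable_ww r c).comp measurable_snd).aemeasurable.mul
              ((hH.measurable_bound.comp measurable_snd).aemeasurable.mul (hU.aemeasurable_gsum.pow_const 2))
          have m3 := hU.aemeasurable_ww_gsum_mul r c
          have m12 : AEMeasurable (fun z => ENNReal.ofReal r * (ww r c z.2 * gsum U z ^ 2)
              + ww r c z.2 * (P z.2 * gsum U z ^ 2)) (slab d) := m1.add m2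
          have m123 : AEMeasurable (fun z => ENNReal.ofReal r * (ww r c z.2 * gsum U z ^ 2)
              + ww r c z.2 * (P z.2 * gsum U z ^ 2) + ww r c z.2 * (gsum U z * ‖U z‖ₑ)) (slab d) := m12.add m3
          rw [lintegral_const_mul' _ _ ENNReal.ofReal_ne_top, lintegral_add_left' m123, lintegral_add_left' m12, lintegral_add_left' m1, lintegral_const_mul' _ _ ENNReal.ofReal_ne_top,
            lintegral_const_mul' _ _ (by simp)]
          rfl
      _ ≤ ENNReal.ofReal K * (gradConst φ * (2 ^ j * energy r c U)
          + gradConst φ * (B * (4 ^ j * Xsq (fun z => wt r c z.2 • U z)))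
          + gradConst φ * (2 ^ j * energy r c U) + 2 ^ j * interaction j r c U f) := by
          have h4 : ENNReal.ofReal r * 4 ^ j ≤ 2 ^ j := by
            have : r * 4 ^ j ≤ 2 ^ j := by
              rw [show (4 : ℝ) = 2 * 2 by norm_num, mul_pow, ← mul_assoc]
              exact mul_le_of_le_one_left (by positivity) hrj
            have := ENNReal.ofReal_le_ofReal this
            rwa [ENNReal.ofReal_mul hr.le, ENNReal.ofReal_pow (by norm_num), ENNReal.ofReal_pow (by norm_num),
              ENNReal.ofReal_ofNat, ENNReal.ofReal_ofNat] at this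
          refine mul_le_mul' le_rfl (add_le_add (add_le_add (add_le_add ?_
            (hU.lintegral_bound_gsum_le hH hr.le hr1 c)) (hU.slab_gsum_mul_le hr.le hr1 c)) le_rfl)
          calc _ ≤ ENNReal.ofReal r * (gradConst φ * (4 ^ j * energy r c U)) := by
                gcongr; exact hU.slab_gsum_sq_le hr.le hr1 c
            _ = gradConst φ * ((ENNReal.ofReal r * 4 ^ j) * energy r c U) := by ring
            _ ≤ _ := by gcongr
      _ = _ := by ring
  have hlhs : ∫⁻ z, ENNReal.ofReal (trunc n r c z.2) * (ENNReal.ofReal (nu l c' z.2) * ∑ k, ‖dx k U z‖ₑ ^ 2) ∂(slab d)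
      ≤ ∫⁻ z, ENNReal.ofReal (2 * (trunc n r c z.2 * nu l c' z.2 * ∑ k, ‖dx k U z‖ ^ 2)) ∂(slab d) := by
    refine lintegral_mono fun z => ?_
    have hn := ((slowWeight_nu l c').pos z.2).le
    have ht := trunc_nonneg n r c z.2
    have hs : 0 ≤ ∑ k, ‖dx k U z‖ ^ 2 := by positivity
    calc _ = ENNReal.ofReal (trunc n r c z.2 * nu l c' z.2 * ∑ k, ‖dx k U z‖ ^ 2) := by
          rw [ENNReal.ofReal_mul (mul_nonneg ht hn), ENNReal.ofReal_mul ht,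
            ENNReal.ofReal_sum_of_nonneg fun _ _ => by positivity, mul_assoc]
          simp_rw [ENNReal.ofReal_pow (norm_nonneg _), ofReal_norm]
      _ ≤ _ := ENNReal.ofReal_le_ofReal (by nlinarith [mul_nonneg (mul_nonneg ht hn) hs])
  refine hlhs.trans (hmor.trans ((add_le_add (add_le_add (hbd 1 (by simp)) (hbd 0 (by simp))) hslab).trans ?_))
  calc _ = ENNReal.ofReal K * (6 * gradConst φ * (2 ^ j * energy r c U)
        + gradConst φ * (B * (4 ^ j * Xsq (fun z => wt r c z.2 • U z))) + 2 ^ j * interaction j r c U f) := by ring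
    _ ≤ ENNReal.ofReal K * (6 * gradConst φ * (2 ^ j * energy r c U)
        + 6 * gradConst φ * (B * (4 ^ j * Xsq (fun z => wt r c z.2 • U z)))
        + 6 * gradConst φ * (2 ^ j * interaction j r c U f)) := by
        refine mul_le_mul' le_rfl (add_le_add (add_le_add le_rfl ?_) ?_)
        · exact mul_le_mul' (le_mul_of_one_le_left' (by norm_num)) le_rfl
        · exact le_mul_of_one_le_left' (one_le_mul (by norm_num) hgc)
    _ = _ := by ring

end LocalizedSolution

end WeightedEstimates

section Absorption

theorem le_two_mul_of_le_add_half {x a : ℝ≥0∞} (hx : x ≠ ⊤) (h : x ≤ a + 2⁻¹ * x) : x ≤ 2 * a := by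
  have e : x = 2⁻¹ * x + 2⁻¹ * x := by rw [← add_mul, ENNReal.inv_two_add_inv_two, one_mul]
  have h1 : 2⁻¹ * x ≤ a := by
    have hh : 2⁻¹ * x + 2⁻¹ * x ≤ a + 2⁻¹ * x := by rw [← e]; exact h
    exact (ENNReal.add_le_add_iff_right (ENNReal.mul_ne_top (by simp) hx)).1 hh
  calc x = 2 * (2⁻¹ * x) := by
        rw [← mul_assoc, ENNReal.mul_inv_cancel two_ne_zero ENNReal.ofNat_ne_top, one_mul]
    _ ≤ _ := by gcongr

/-- The constant in the weighted Bernstein inequality for functions without low frequencies. -/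
def lowConst (φ : LPBump d) : ℝ≥0∞ :=
  16 * mom (φ.Phi 0) (2 * (d + 1) * 2 + 2 + 1) ^ 2 * ENNReal.ofReal ((2 ^ (d + 1)) ^ 2 * 2) * d

theorem lowConst_lt_top (φ : LPBump d) : lowConst φ < ⊤ := by
  have := mom_lt_top (φ.Phi 0) (2 * (d + 1) * 2 + 2 + 1)
  unfold lowConst
  finiteness

theorem gradConst_lt_top (φ : LPBump d) : gradConst φ < ⊤ := by
  have := bern_lt_top φ
  unfold gradConst
  finiteness

theorem one_le_nu {l : ℕ} {k : Fin d → ℤ} {x : Rd d} (hx : x ∈ cube l k) :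
    1 ≤ (1 + (d : ℝ≥0∞) ^ 2) * (2 ^ l * ENNReal.ofReal (nu l ((2 : ℝ) ^ l • latticePoint k) x)) := by
  have h := enorm_sub_latticePoint_le hx
  rw [← ofReal_norm, ← ENNReal.ofReal_natCast, ENNReal.ofReal_le_ofReal_iff (by positivity)] at h
  have e : dil (2 ^ l)⁻¹ ((2 : ℝ) ^ l • latticePoint k) x = ((2 : ℝ) ^ l)⁻¹ • x - latticePoint k := by
    rw [dil, smul_sub, smul_smul, inv_mul_cancel₀ (by positivity), one_smul]
  have e2 : (1 + (d : ℝ≥0∞) ^ 2) * (2 ^ l * ENNReal.ofReal (nu l ((2 : ℝ) ^ l • latticePoint k) x))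
      = ENNReal.ofReal ((1 + (d : ℝ) ^ 2) * (2 ^ l * nu l ((2 : ℝ) ^ l • latticePoint k) x)) := by
    rw [ENNReal.ofReal_mul (by positivity), ENNReal.ofReal_mul (by positivity), ENNReal.ofReal_add (by norm_num)
      (by positivity), ENNReal.ofReal_pow (by positivity), ENNReal.ofReal_pow (by norm_num), ENNReal.ofReal_one,
      ENNReal.ofReal_natCast, ENNReal.ofReal_ofNat]
  rw [e2, ENNReal.one_le_ofReal, nu, ← mul_assoc (2 ^ l), mul_inv_cancel₀ (by positivity), one_mul, e, jap,
    ← div_eq_mul_inv, le_div_iff₀ (by positivity), one_mul]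
  have := pow_le_pow_left₀ (norm_nonneg _) h 2
  linarith

namespace LocalizedSolution

variable {j : ℕ}
  {C : ℝ}

theorem lintegral_nu_mass_le (hU : LocalizedSolution φ j H u₀ U f) (hj : 2 ≤ j) {r : ℝ} (hr : 0 ≤ r)
    (hr1 : r ≤ 1) (c : Rd d) (l : ℕ) (c' : Rd d) :
    ∫⁻ z, ww r c z.2 * (ENNReal.ofReal (nu l c' z.2) * ‖U z‖ₑ ^ 2) ∂(slab d)
      ≤ lowConst φ * (4 ^ j)⁻¹ *
        ∫⁻ z, ww r c z.2 * (ENNReal.ofReal (nu l c' z.2) * ∑ k, ‖dx k U z‖ₑ ^ 2) ∂(slab d) := by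
  obtain ⟨q, rfl⟩ := Nat.exists_eq_add_of_le' hj
  have hw := (((slowWeight_wt hr hr1 c).pow 2).mul (slowWeight_nu l c'))
  have hnm : Measurable fun x => ENNReal.ofReal (nu l c' x) := (slowWeight_nu l c').cont.measurable.ennreal_ofReal
  have hwe : ∀ x, ‖wt r c x ^ 2 * nu l c' x‖ₑ = ww r c x * ENNReal.ofReal (nu l c' x) := fun x => by
    rw [enorm_mul, ← ww_eq_enorm, ← ofReal_norm, Real.norm_of_nonneg ((slowWeight_nu l c').pos x).le]
  have hm0 : AEMeasurable (fun z => ww r c z.2 * (ENNReal.ofReal (nu l c' z.2) * ‖U z‖ₑ ^ 2)) (slab d) :=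
    ((measurable_ww r c).comp measurable_snd).aemeasurable.mul
      ((hnm.comp measurable_snd).aemeasurable.mul (hU.aestronglyMeasurable.enorm.pow_const 2))
  have hm1 : AEMeasurable (fun z => ww r c z.2 * (ENNReal.ofReal (nu l c' z.2) * ∑ k, ‖dx k U z‖ₑ ^ 2)) (slab d) :=
    ((measurable_ww r c).comp measurable_snd).aemeasurable.mul
      ((hnm.comp measurable_snd).aemeasurable.mul
      (Finset.aemeasurable_fun_sum _ fun k _ => (hU.aestronglyMeasurable_dx k).enorm.pow_const 2))
  have h4 : (((2 : ℝ≥0∞) ^ q)⁻¹) ^ 2 = 16 * (4 ^ (q + 2))⁻¹ := by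
    rw [pow_add, ENNReal.mul_inv (Or.inr (by simp)) (Or.inl (by simp)), show (4 : ℝ≥0∞) = 2 ^ 2 by norm_num,
      ← pow_mul, ENNReal.inv_pow, ← pow_mul, show ((2 : ℝ≥0∞) ^ 2) ^ 2 = 16 by norm_num, mul_comm 2 q,
      ENNReal.inv_pow, mul_left_comm, ENNReal.mul_inv_cancel (by norm_num) (by norm_num), mul_one]
  rw [lintegral_slab hm0, lintegral_slab hm1, ← lintegral_const_mul'' _ hm1.lintegral_prod_right']
  refine setLIntegral_mono' measurableSet_Icc fun t ht => ?_
  have h := lintegral_weighted_le_fderiv φ q ((hU.contDiff t ht).of_le (by norm_cast)) (hU.convDefined t ht)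
    (hU.low_eq_zero q le_rfl t ht) hw
  simp_rw [hwe] at h
  have hm2 : Measurable fun x => ww r c x * (ENNReal.ofReal (nu l c' x) * ∑ k, ‖dx k U (t, x)‖ₑ ^ 2) :=
    (measurable_ww r c).mul (hnm.mul (Finset.measurable_fun_sum _ fun k _ =>
      (hU.continuous_dx_slice ht k).enorm.measurable.pow_const 2))
  calc _ = ∫⁻ x, ww r c x * ENNReal.ofReal (nu l c' x) * ‖U (t, x)‖ₑ ^ 2 := by simp_rw [mul_assoc]
    _ ≤ _ := h
    _ ≤ ((2 ^ q)⁻¹ * mom (φ.Phi 0) (2 * (d + 1) * 2 + 2 + 1)) ^ 2 * ENNReal.ofReal ((2 ^ (d + 1)) ^ 2 * 2) *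
        (d * ∫⁻ x, ww r c x * (ENNReal.ofReal (nu l c' x) * ∑ k, ‖dx k U (t, x)‖ₑ ^ 2)) := by
        rw [← lintegral_const_mul _ hm2]
        refine mul_le_mul' le_rfl (lintegral_mono fun x => ?_)
        calc _ ≤ ww r c x * ENNReal.ofReal (nu l c' x) * (d * ∑ k, ‖dx k U (t, x)‖ₑ ^ 2) := by
              gcongr
              refine le_trans ?_ (gsum_sq_le (U := U) (t, x))
              exact pow_le_pow_left' (opENorm_le_sum_basis _) 2
          _ = _ := by ring
    _ = _ := by rw [mul_pow, h4, lowConst]; ring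

/-- The constant in the local smoothing estimate. -/
def _root_.QuasiSchrodinger.smoothingConst (φ : LPBump d) (C : ℝ) : ℝ≥0∞ :=
  (1 + (d : ℝ≥0∞) ^ 2) * (lowConst φ * (ENNReal.ofReal (32 * (d + 1) ^ 4 * C) * (6 * gradConst φ)))

theorem _root_.QuasiSchrodinger.smoothingConst_lt_top (φ : LPBump d) (C : ℝ) : smoothingConst φ C < ⊤ := by
  have := gradConst_lt_top φ
  have := lowConst_lt_top φ
  unfold smoothingConst
  finiteness

/-- The local smoothing estimate. -/
theorem Xsq_le (hU : LocalizedSolution φ j H u₀ U f) (hH : TamePerturbation H P B) (hC0 : 0 ≤ C)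
    (hC : ∀ n, Controlled C (fun y : Rd d => jap y ^ (2 * d + 1 + 1)) (truncProfile n)) {r : ℝ} (hr : 0 < r)
    (hrj : r * 2 ^ j ≤ 1) (c : Rd d) (hj : 2 ≤ j) :
    Xsq (fun z => wt r c z.2 • U z) ≤ smoothingConst φ C * ((2 ^ j)⁻¹ * energy r c U
      + B * Xsq (fun z => wt r c z.2 • U z) + (2 ^ j)⁻¹ * interaction j r c U f) := by
  have hr1 : r ≤ 1 := by
    have : (1 : ℝ) ≤ 2 ^ j := one_le_pow₀ one_le_two
    nlinarith
  set X := Xsq (fun z => wt r c z.2 • U z) with hX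
  refine QuasiSchrodinger.Xsq_le fun l k => ?_
  set c' : Rd d := (2 : ℝ) ^ l • latticePoint k with hc'
  have e4 : ((4 : ℝ≥0∞) ^ j)⁻¹ * 4 ^ j = 1 := ENNReal.inv_mul_cancel (by positivity) (by simp)
  have e2 : ((4 : ℝ≥0∞) ^ j)⁻¹ * 2 ^ j = (2 ^ j)⁻¹ := by
    rw [show (4 : ℝ≥0∞) = 2 * 2 by norm_num, mul_pow, ENNReal.mul_inv (Or.inr (by simp)) (Or.inl (by simp)), mul_assoc,
      ENNReal.inv_mul_cancel (by positivity) (by simp), mul_one]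
  calc ∫⁻ z, (cube l k).indicator 1 z.2 * ‖wt r c z.2 • U z‖ₑ ^ 2 ∂(slab d)
      ≤ ∫⁻ z, ((1 + (d : ℝ≥0∞) ^ 2) * 2 ^ l) * (ww r c z.2 * (ENNReal.ofReal (nu l c' z.2) * ‖U z‖ₑ ^ 2)) ∂(slab d) := by
        refine lintegral_mono fun z => ?_
        rw [enorm_smul, mul_pow, ← ww]
        by_cases hz : z.2 ∈ cube l k
        · rw [indicator_of_mem hz, Pi.one_apply]
          calc _ ≤ ((1 + (d : ℝ≥0∞) ^ 2) * (2 ^ l * ENNReal.ofReal (nu l c' z.2))) * (ww r c z.2 * ‖U z‖ₑ ^ 2) :=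
                mul_le_mul' (one_le_nu hz) le_rfl
            _ = _ := by ring
        · rw [indicator_of_notMem hz, zero_mul]
          exact zero_le
    _ = ((1 + (d : ℝ≥0∞) ^ 2) * 2 ^ l) * ∫⁻ z, ww r c z.2 * (ENNReal.ofReal (nu l c' z.2) * ‖U z‖ₑ ^ 2) ∂(slab d) :=
        lintegral_const_mul' _ _ (by finiteness)
    _ ≤ ((1 + (d : ℝ≥0∞) ^ 2) * 2 ^ l) * (lowConst φ * (4 ^ j)⁻¹ * (ENNReal.ofReal (32 * (d + 1) ^ 4 * C) *
        (6 * gradConst φ * (2 ^ j * energy r c U + B * (4 ^ j * X) + 2 ^ j * interaction j r c U f)))) := by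
        gcongr
        exact (hU.lintegral_nu_mass_le hj hr.le hr1 c l c').trans
          (mul_le_mul' le_rfl (hU.lintegral_nu_le hH hC0 hC hr hrj c l c'))
    _ = 2 ^ l * (smoothingConst φ C * (((4 ^ j)⁻¹ * 2 ^ j) * energy r c U + B * (((4 ^ j)⁻¹ * 4 ^ j) * X)
        + ((4 ^ j)⁻¹ * 2 ^ j) * interaction j r c U f)) := by rw [smoothingConst]; ring
    _ = _ := by rw [e4, e2, one_mul]

end LocalizedSolution

/-- The local energy estimate for localized solutions and metrics close to the identity. -/
theorem exists_local_estimate (φ : LPBump d) : ∃ (μ : ℝ) (b C : ℝ≥0), 0 < μ ∧ μ ≤ 1 ∧ 0 < b ∧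
    ∀ (j : ℕ) (H : Coeff d) (P : Rd d → ℝ≥0∞) (B : ℝ≥0∞) (u₀ : Rd d → ℂ)
      (U f : ℝ × Rd d → ℂ), TamePerturbation H P B → B ≤ b → LocalizedSolution φ j H u₀ U f → ∀ c,
      energy (μ * (2 ^ j)⁻¹) c U + 2 ^ j * Xsq (fun z => wt (μ * (2 ^ j)⁻¹) c z.2 • U z)
        ≤ C * (mass (μ * (2 ^ j)⁻¹) c U 0 + interaction j (μ * (2 ^ j)⁻¹) c U f) := by
  obtain ⟨C, hC0, hC⟩ := exists_controlled_truncProfile d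
  have hgt := gradConst_lt_top φ
  have hst := smoothingConst_lt_top φ C
  set gc : ℝ := (gradConst φ).toReal with hgc
  have hgc1 : 1 ≤ gc := by
    rw [hgc, ← ENNReal.toReal_one]
    exact ENNReal.toReal_mono hgt.ne le_self_add
  set S : ℝ≥0 := (smoothingConst φ C).toNNReal with hS
  have hSe : smoothingConst φ C = S := (ENNReal.coe_toNNReal hst.ne).symm
  have hdC : 0 ≤ (d : ℝ) ^ 2 * C := by positivity
  set μ : ℝ := (8 * (d ^ 2 * C + 1) * gc)⁻¹ with hμ
  have hμ0 : 0 < μ := by positivity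
  have hμ1 : μ ≤ 1 := by
    refine inv_le_one_of_one_le₀ ?_
    nlinarith
  refine ⟨μ, (2 * (S + 1))⁻¹, 5 * (3 + 2 * S), hμ0, hμ1, by positivity, fun j H P B u₀ U f hH hB hU c => ?_⟩
  set r : ℝ := μ * (2 ^ j)⁻¹ with hr
  have hr0 : 0 < r := by positivity
  have hrj : r * 2 ^ j = μ := by rw [hr, mul_assoc, inv_mul_cancel₀ (by positivity), mul_one]
  have hr1 : r ≤ 1 := by
    have : (1 : ℝ) ≤ 2 ^ j := one_le_pow₀ one_le_two
    nlinarith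
  set E := energy r c U with hE
  set F := interaction j r c U f with hF
  set A := mass r c U 0 with hA
  set X := Xsq (fun z => wt r c z.2 • U z) with hX
  have hEt : E ≠ ⊤ := (hU.energy_lt_top r c).ne
  have hXE : X ≤ E := hU.Xsq_le_energy r c
  have hsmall : ENNReal.ofReal (4 * d ^ 2 * C * r) * (gradConst φ * 2 ^ j) ≤ 2⁻¹ := by
    have e1 : gradConst φ * 2 ^ j = ENNReal.ofReal (gc * 2 ^ j) := by
      rw [ENNReal.ofReal_mul (by positivity), hgc, ENNReal.ofReal_toReal hgt.ne, ENNReal.ofReal_pow (by norm_num),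
        ENNReal.ofReal_ofNat]
    have e3 : (2⁻¹ : ℝ≥0∞) = ENNReal.ofReal 2⁻¹ := by
      rw [ENNReal.ofReal_inv_of_pos (by norm_num), ENNReal.ofReal_ofNat]
    rw [e1, e3, ← ENNReal.ofReal_mul (by positivity)]
    refine ENNReal.ofReal_le_ofReal ?_
    calc 4 * d ^ 2 * C * r * (gc * 2 ^ j) = 4 * (d ^ 2 * C) * gc * (r * 2 ^ j) := by ring
      _ ≤ 2⁻¹ := by
        rw [hrj, hμ, ← div_eq_mul_inv, div_le_iff₀ (by positivity)]
        nlinarith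
  have h1 : E ≤ 2 * (A + 2 * F) := by
    refine le_two_mul_of_le_add_half hEt (iSup₂_le fun t ht => ?_)
    refine (hU.mass_le hH hC0 hC hr0 hr1 c ht).trans ?_
    calc _ = A + 2 * F + ENNReal.ofReal (4 * d ^ 2 * C * r) * (gradConst φ * 2 ^ j) * E := by ring
      _ ≤ _ := by gcongr
  have h2 : 2 ^ j * X ≤ (2 + 2 * S) * (E + F) := by
    rcases lt_or_ge j 2 with hj | hj
    · have h2j : (2 : ℝ≥0∞) ^ j ≤ 2 := by
        calc (2 : ℝ≥0∞) ^ j ≤ 2 ^ 1 := pow_le_pow_right₀ one_le_two (by omega)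
          _ = 2 := pow_one 2
      exact mul_le_mul' (h2j.trans le_self_add) (hXE.trans le_self_add)
    · have h3 := hU.Xsq_le hH hC0 hC hr0 (by rw [hrj]; exact hμ1) c hj
      rw [hSe] at h3
      have hSB : (S : ℝ≥0∞) * B ≤ 2⁻¹ := by
        calc (S : ℝ≥0∞) * B ≤ S * ((2 * (S + 1))⁻¹ : ℝ≥0) := by gcongr
          _ ≤ ((2⁻¹ : ℝ≥0) : ℝ≥0∞) := by
            rw [← ENNReal.coe_mul, ENNReal.coe_le_coe, ← div_eq_mul_inv, div_le_iff₀ (by positivity), ← mul_assoc,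
              inv_mul_cancel₀ two_ne_zero, one_mul]
            exact le_self_add
          _ = 2⁻¹ := by rw [ENNReal.coe_inv two_ne_zero]; rfl
      have h4 : X ≤ 2 * (S * ((2 ^ j)⁻¹ * (E + F))) := by
        refine le_two_mul_of_le_add_half (ne_top_of_le_ne_top hEt hXE) (h3.trans ?_)
        calc _ = S * ((2 ^ j)⁻¹ * (E + F)) + (S * B) * X := by ring
          _ ≤ _ := by gcongr
      calc 2 ^ j * X ≤ 2 ^ j * (2 * (S * ((2 ^ j)⁻¹ * (E + F)))) := by gcongr
        _ = (2 ^ j * (2 ^ j)⁻¹) * (2 * S * (E + F)) := by ring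
        _ = 2 * S * (E + F) := by rw [ENNReal.mul_inv_cancel (by positivity) (by simp), one_mul]
        _ ≤ _ := by gcongr; exact le_add_self
  calc E + 2 ^ j * X ≤ (E + F) + (2 + 2 * S) * (E + F) := add_le_add le_self_add h2
    _ = (3 + 2 * S) * (E + F) := by ring
    _ ≤ (3 + 2 * S) * (2 * (A + 2 * F) + F) := by gcongr
    _ ≤ (3 + 2 * S) * (5 * A + 5 * F) := by
        refine mul_le_mul' le_rfl ?_
        calc 2 * (A + 2 * F) + F = 2 * A + 5 * F := by ring
          _ ≤ _ := by gcongr; norm_num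
    _ = _ := by push_cast; ring

end Absorption

section Duality

/-- The center of a cube. -/
def corner (j : ℕ) (k : Fin d → ℤ) : Rd d := (2 : ℝ) ^ j • latticePoint k

theorem dil_corner (μ : ℝ) (j : ℕ) (k : Fin d → ℤ) (x : Rd d) :
    dil (μ * (2 ^ j)⁻¹) (corner j k) x = μ • (((2 : ℝ) ^ j)⁻¹ • x - latticePoint k) := by
  rw [dil, corner, mul_smul, smul_sub ((2 ^ j : ℝ)⁻¹), smul_smul ((2 ^ j : ℝ)⁻¹), inv_mul_cancel₀ (by positivity),
    one_smul]

theorem jap_smul_le {μ : ℝ} (hμ : 0 < μ) (hμ1 : μ ≤ 1) (y : Rd d) :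
    jap (μ • y) ≤ 2 / μ ^ 2 * (1 + ‖y‖)⁻¹ := by
  rw [jap, norm_smul, Real.norm_of_nonneg hμ.le, ← div_eq_mul_inv, div_div, inv_eq_one_div,
    div_le_div_iff₀ (by positivity) (by positivity), mul_pow]
  have h1 : μ ^ 2 ≤ 1 := pow_le_one₀ hμ.le hμ1
  have h2 := norm_nonneg y
  nlinarith [sq_nonneg (‖y‖ - 1), mul_nonneg (sq_nonneg μ) (sq_nonneg (‖y‖ - 1)), mul_nonneg (sq_nonneg μ) h2]

theorem enorm_wt_le_bw {μ : ℝ} (hμ : 0 < μ) (hμ1 : μ ≤ 1) (j : ℕ) (k : Fin d → ℤ) (x : Rd d) :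
    ‖wt (μ * (2 ^ j)⁻¹) (corner j k) x‖ₑ ≤ ENNReal.ofReal (2 / μ ^ 2) ^ (d + 1)
      * bw (((2 : ℝ) ^ j)⁻¹ • x - latticePoint k) := by
  rw [wt, dil_corner, enorm_pow, bw, ENNReal.inv_pow, ← mul_pow]
  refine pow_le_pow_left' ?_ _
  set y := ((2 : ℝ) ^ j)⁻¹ • x - latticePoint k
  rw [← ofReal_norm, Real.norm_of_nonneg (jap_pos _).le, ← ofReal_norm, ← ENNReal.ofReal_one,
    ← ENNReal.ofReal_add zero_le_one (norm_nonneg _), ← ENNReal.ofReal_inv_of_pos (by positivity),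
    ← ENNReal.ofReal_mul (by positivity)]
  exact ENNReal.ofReal_le_ofReal (jap_smul_le hμ hμ1 y)

theorem CubePartition.profile_le_one (χ : CubePartition d) (x : Rd d) : χ.profile x ≤ 1 := by
  have h := le_hasSum (χ.hasSum_one x) 0 fun k _ => χ.nonneg _
  simpa [latticePoint, show (WithLp.toLp 2 fun _ => (0 : ℝ) : Rd d) = 0 from rfl] using h

theorem CubePartition.cutoff_nonneg (χ : CubePartition d) (j : ℕ) (k : Fin d → ℤ) (x : Rd d) :
    0 ≤ χ.cutoff j k x := χ.nonneg _

theorem CubePartition.continuous_cutoff (χ : CubePartition d) (j : ℕ) (k : Fin d → ℤ) :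
    Continuous (χ.cutoff j k) :=
  χ.smooth.continuous.comp ((continuous_const_smul _).sub continuous_const)

/-- On the support of a cutoff, the weight of another cube is small if the cubes are far from each
other. -/
theorem exists_cutoff_mul_wt_le (χ : CubePartition d) {μ : ℝ} (hμ : 0 < μ) (hμ1 : μ ≤ 1) :
    ∃ C : ℝ≥0, ∀ (j : ℕ) (k k' : Fin d → ℤ) (x : Rd d),
      ‖χ.cutoff j k' x‖ₑ * ‖wt (μ * (2 ^ j)⁻¹) (corner j k) x‖ₑ
        ≤ C * bw (latticePoint k' - latticePoint k) * ‖χ.cutoff j k' x‖ₑ := by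
  obtain ⟨R, hR⟩ := χ.exists_radius
  refine ⟨(2 / μ ^ 2).toNNReal ^ (d + 1) * (1 + R) ^ (d + 1), fun j k k' x => ?_⟩
  by_cases h : χ.cutoff j k' x = 0
  · rw [h]; simp
  rw [mul_comm]
  refine mul_le_mul' ((enorm_wt_le_bw hμ hμ1 j k x).trans ?_) le_rfl
  have hx := hR _ h
  push_cast
  rw [mul_assoc]
  refine mul_le_mul' le_rfl ((bw_le _ (latticePoint k' - latticePoint k)).trans ?_)
  rw [sub_sub_sub_cancel_right]
  gcongr

theorem exists_cutoff_le_wt (χ : CubePartition d) {μ : ℝ} (hμ : 0 < μ) (hμ1 : μ ≤ 1) :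
    ∃ C : ℝ≥0, ∀ (j : ℕ) (k : Fin d → ℤ) (x : Rd d),
      ‖χ.cutoff j k x‖ₑ ≤ C * ‖wt (μ * (2 ^ j)⁻¹) (corner j k) x‖ₑ := by
  obtain ⟨R, hR⟩ := χ.exists_radius
  refine ⟨(1 + R ^ 2) ^ (d + 1), fun j k x => ?_⟩
  by_cases h : χ.cutoff j k x = 0
  · rw [h]; simp
  have hx := hR _ h
  rw [← ofReal_norm, ← ENNReal.ofReal_coe_nnreal, ENNReal.ofReal_le_ofReal_iff (NNReal.coe_nonneg R)] at hx
  have h1 : χ.cutoff j k x ≤ 1 := χ.profile_le_one _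
  have h2 : (1 : ℝ) ≤ ((1 + R ^ 2) ^ (d + 1) : ℝ≥0) * wt (μ * (2 ^ j)⁻¹) (corner j k) x := by
    rw [wt, dil_corner]
    push_cast
    rw [← mul_pow]
    refine one_le_pow₀ ?_
    rw [jap, ← div_eq_mul_inv, le_div_iff₀ (by positivity), one_mul, norm_smul, Real.norm_of_nonneg hμ.le]
    have h3 : μ * ‖((2 : ℝ) ^ j)⁻¹ • x - latticePoint k‖ ≤ R :=
      (mul_le_of_le_one_left (norm_nonneg _) hμ1).trans hx
    have := pow_le_pow_left₀ (by positivity) h3 2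
    linarith
  rw [← ofReal_norm, ← ofReal_norm, Real.norm_of_nonneg (χ.cutoff_nonneg j k x), Real.norm_of_nonneg (wt_pos _ _ _).le,
    ← ENNReal.ofReal_coe_nnreal, ← ENNReal.ofReal_mul (NNReal.coe_nonneg _)]
  exact ENNReal.ofReal_le_ofReal (h1.trans h2)

theorem normXj_sq_le {V : Type*} [NormedAddCommGroup V] [NormedSpace ℂ V] {j : ℕ} {Ψ : ℝ × Rd d → V}
    {M X : ℝ≥0∞} (hX : Xsq Ψ ≤ X)
    (h : ∀ t ∈ 𝕀, ∫⁻ x, ‖Ψ (t, x)‖ₑ ^ 2 ≤ M) : normXj j Ψ ^ 2 ≤ 2 * (M + 2 ^ j * X) := by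
  have h1 : normLinftyL2 Ψ ≤ M ^ (1 / 2 : ℝ) := by
    refine essSup_le_of_ae_le _ ?_
    filter_upwards [ae_tm_mem] with t ht
    rw [eLpNorm_two_eq]
    exact ENNReal.rpow_le_rpow (h t ht) (by norm_num)
  have h2 : ((2 : ℝ≥0∞) ^ ((j : ℝ) / 2)) ^ 2 = 2 ^ j := by
    rw [← ENNReal.rpow_mul_natCast, ← ENNReal.rpow_natCast]; congr 1; push_cast; ring
  have h3 : ∀ a b : ℝ≥0∞, (a + b) ^ 2 ≤ 2 * (a ^ 2 + b ^ 2) := fun a b => by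
    have := LocalizedSolution.sum_sq_le ![a, b]
    simpa [Fin.sum_univ_two] using this
  refine (h3 _ _).trans ?_
  rw [mul_pow, h2, normX_sq, add_comm]
  gcongr
  calc _ ≤ (M ^ (1 / 2 : ℝ)) ^ 2 := by gcongr
    _ = M := ennreal_half_sq M

theorem CubePartition.tsum_enorm_cutoff (χ : CubePartition d) (j : ℕ) (x : Rd d) :
    ∑' k : Fin d → ℤ, ‖χ.cutoff j k x‖ₑ = 1 := by
  rw [← χ.tsum_ofReal (((2 : ℝ) ^ j)⁻¹ • x)]
  refine tsum_congr fun k => ?_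
  rw [← ofReal_norm, Real.norm_of_nonneg (χ.cutoff_nonneg j k x)]
  rfl

/-- Duality of `X_j` and `Y_j`, localized to cubes. -/
theorem lintegral_weighted_mul_le {V : Type*} [NormedAddCommGroup V] [NormedSpace ℂ V] (χ : CubePartition d)
    {μ : ℝ} {C : ℝ≥0} (hC : ∀ (j : ℕ) (k k' : Fin d → ℤ) (x : Rd d),
      ‖χ.cutoff j k' x‖ₑ * ‖wt (μ * (2 ^ j)⁻¹) (corner j k) x‖ₑ
        ≤ C * bw (latticePoint k' - latticePoint k) * ‖χ.cutoff j k' x‖ₑ)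
    {j : ℕ} {f : ℝ × Rd d → V} (hf : AEStronglyMeasurable f (slab d))
    (hY : ∀ k', normYj j (fun z => (χ.cutoff j k' z.2 : ℂ) • f z) ≠ ⊤) {Φ : ℝ × Rd d → ℂ}
    (hΦ : AEStronglyMeasurable Φ (slab d)) (k : Fin d → ℤ)
    (hX : normXj j (fun z => wt (μ * (2 ^ j)⁻¹) (corner j k) z.2 • Φ z) ≠ ⊤) :
    ∫⁻ z, ww (μ * (2 ^ j)⁻¹) (corner j k) z.2 * (‖Φ z‖ₑ * ‖f z‖ₑ) ∂(slab d)
      ≤ C * (∑' k' : Fin d → ℤ, bw (latticePoint k' - latticePoint k)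
          * normYj j (fun z => (χ.cutoff j k' z.2 : ℂ) • f z))
        * normXj j (fun z => wt (μ * (2 ^ j)⁻¹) (corner j k) z.2 • Φ z) := by
  set r := μ * (2 ^ j)⁻¹
  set c : Rd d := corner j k
  have hwΦ : AEStronglyMeasurable (fun z => wt r c z.2 • Φ z) (slab d) :=
    ((continuous_wt r c).comp continuous_snd).aestronglyMeasurable.smul hΦ
  have hχ : ∀ k' : Fin d → ℤ, AEStronglyMeasurable (fun z : ℝ × Rd d => (χ.cutoff j k' z.2 : ℂ) • f z) (slab d) :=
    fun k' => (Complex.continuous_ofReal.comp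
      ((χ.continuous_cutoff j k').comp continuous_snd)).aestronglyMeasurable.smul hf
  calc _ = ∫⁻ z, ∑' k' : Fin d → ℤ, ‖χ.cutoff j k' z.2‖ₑ * (ww r c z.2 * (‖Φ z‖ₑ * ‖f z‖ₑ)) ∂(slab d) := by
        refine lintegral_congr fun z => ?_
        rw [ENNReal.tsum_mul_right, χ.tsum_enorm_cutoff, one_mul]
    _ ≤ ∫⁻ z, ∑' k' : Fin d → ℤ, (C * bw (latticePoint k' - latticePoint k)) *
          (‖(χ.cutoff j k' z.2 : ℂ) • f z‖ₑ * ‖wt r c z.2 • Φ z‖ₑ) ∂(slab d) := by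
        refine lintegral_mono fun z => ENNReal.tsum_le_tsum fun k' => ?_
        have e : ‖(χ.cutoff j k' z.2 : ℂ)‖ₑ = ‖χ.cutoff j k' z.2‖ₑ := by
          rw [← ofReal_norm, Complex.norm_real, ofReal_norm]
        rw [enorm_smul, enorm_smul, e, ww]
        calc _ = (‖χ.cutoff j k' z.2‖ₑ * ‖wt r c z.2‖ₑ) * (‖wt r c z.2‖ₑ * (‖Φ z‖ₑ * ‖f z‖ₑ)) := by ring
          _ ≤ (C * bw (latticePoint k' - latticePoint k) * ‖χ.cutoff j k' z.2‖ₑ)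
              * (‖wt r c z.2‖ₑ * (‖Φ z‖ₑ * ‖f z‖ₑ)) := mul_le_mul' (hC j k k' z.2) le_rfl
          _ = _ := by ring
    _ = ∑' k' : Fin d → ℤ, (C * bw (latticePoint k' - latticePoint k)) *
          ∫⁻ z, ‖(χ.cutoff j k' z.2 : ℂ) • f z‖ₑ * ‖wt r c z.2 • Φ z‖ₑ ∂(slab d) := by
        have hm : ∀ k' : Fin d → ℤ, AEMeasurable (fun z : ℝ × Rd d =>
            ‖(χ.cutoff j k' z.2 : ℂ) • f z‖ₑ * ‖wt r c z.2 • Φ z‖ₑ) (slab d) := fun k' =>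
          (hχ k').enorm.mul hwΦ.enorm
        rw [lintegral_tsum fun k' => (hm k').const_mul _]
        refine tsum_congr fun k' => lintegral_const_mul'' _ (hm k')
    _ ≤ ∑' k' : Fin d → ℤ, (C * bw (latticePoint k' - latticePoint k)) *
          (normYj j (fun z => (χ.cutoff j k' z.2 : ℂ) • f z) * normXj j (fun z => wt r c z.2 • Φ z)) :=
        ENNReal.tsum_le_tsum fun k' => mul_le_mul' le_rfl
          (lintegral_le_normYj_mul_normXj (hY k') hwΦ hX)
    _ = _ := by
        simp_rw [← mul_assoc]
        rw [ENNReal.tsum_mul_right]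
        simp_rw [mul_assoc]
        rw [ENNReal.tsum_mul_left, mul_assoc]

end Duality

section CubeEstimate

/-- The average of a function of the cubes, as seen from a given cube. -/
def latticeAvg (a : (Fin d → ℤ) → ℝ≥0∞) (k : Fin d → ℤ) : ℝ≥0∞ :=
  ∑' k', bw (latticePoint k' - latticePoint k) * a k'

theorem tsum_latticeAvg_sq_le (a : (Fin d → ℤ) → ℝ≥0∞) :
    ∑' k, latticeAvg a k ^ 2 ≤ (∑' c : Fin d → ℤ, bw (latticePoint c)) ^ 2 * ∑' k, a k ^ 2 := by
  have h : ∀ k : Fin d → ℤ, ∑' k' : Fin d → ℤ, bw (latticePoint k' - latticePoint k)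
      = ∑' c : Fin d → ℤ, bw (latticePoint c) := fun k => by
    rw [← tsum_bw_lattice_sub k]
    refine tsum_congr fun k' => ?_
    rw [← bw_neg, neg_sub]
  calc _ ≤ ∑' k : Fin d → ℤ, (∑' c : Fin d → ℤ, bw (latticePoint c)) *
        ∑' k', bw (latticePoint k' - latticePoint k) * a k' ^ 2 := by
        refine ENNReal.tsum_le_tsum fun k => ?_
        rw [← h k]
        exact tsum_mul_sq_le_weighted _ _
    _ = (∑' c : Fin d → ℤ, bw (latticePoint c)) *
        ∑' k' : Fin d → ℤ, ∑' k : Fin d → ℤ, bw (latticePoint k' - latticePoint k) * a k' ^ 2 := by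
        rw [ENNReal.tsum_mul_left, ENNReal.tsum_comm]
    _ = _ := by
        simp_rw [ENNReal.tsum_mul_right, tsum_bw_lattice_sub]
        rw [ENNReal.tsum_mul_left]
        ring

variable {j : ℕ}

theorem LocalizedSolution.tsum_mass_le (hU : LocalizedSolution φ j H u₀ U f) {μ : ℝ} (hμ : 0 < μ)
    (hμ1 : μ ≤ 1) : ∑' k : Fin d → ℤ, mass (μ * (2 ^ j)⁻¹) (corner j k) U 0
      ≤ ENNReal.ofReal (2 / μ ^ 2) ^ (d + 1) * latticeConst d * ∫⁻ x, ‖U (0, x)‖ₑ ^ 2 := by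
  have hm := (hU.continuous_slice (t := 0) (by simp)).enorm.measurable.pow_const 2
  have hm' : ∀ k : Fin d → ℤ, AEMeasurable (fun x => ww (μ * (2 ^ j)⁻¹) (corner j k) x * ‖U (0, x)‖ₑ ^ 2) volume :=
    fun k => ((measurable_ww _ _).mul hm).aemeasurable
  unfold mass
  rw [← lintegral_tsum hm', ← lintegral_const_mul _ hm]
  refine lintegral_mono fun x => ?_
  rw [ENNReal.tsum_mul_right]
  refine mul_le_mul' ?_ le_rfl
  calc _ ≤ ∑' k : Fin d → ℤ, ENNReal.ofReal (2 / μ ^ 2) ^ (d + 1)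
        * bw (((2 : ℝ) ^ j)⁻¹ • x - latticePoint k) := by
        refine ENNReal.tsum_le_tsum fun k => ?_
        refine le_trans ?_ (enorm_wt_le_bw hμ hμ1 j k x)
        refine pow_le_of_le_one zero_le ?_ two_ne_zero
        rw [← ofReal_norm, Real.norm_of_nonneg (wt_pos _ _ _).le]
        exact ENNReal.ofReal_le_one.2 (wt_le_one _ _ _)
    _ ≤ _ := by
        rw [ENNReal.tsum_mul_left]
        exact mul_le_mul' le_rfl (tsum_bw_sub_le j x)

theorem normXj_wt_sq_le (j : ℕ) (U : ℝ × Rd d → ℂ) (r : ℝ) (c : Rd d) :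
    normXj j (fun z => wt r c z.2 • U z) ^ 2
      ≤ 2 * (energy r c U + 2 ^ j * Xsq fun z => wt r c z.2 • U z) := by
  refine normXj_sq_le le_rfl fun t ht => ?_
  simp_rw [enorm_smul, mul_pow]
  exact LocalizedSolution.mass_le_energy ht

theorem LocalizedSolution.normXj_dx_sq_le (hU : LocalizedSolution φ j H u₀ U f) {r : ℝ} (hr : 0 ≤ r)
    (hr1 : r ≤ 1) (c : Rd d) (k : Fin d) :
    ((2 ^ j)⁻¹ * normXj j (fun z => wt r c z.2 • dx k U z)) ^ 2
      ≤ 2 * bern φ * (energy r c U + 2 ^ j * Xsq fun z => wt r c z.2 • U z) := by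
  have h : normXj j (fun z => wt r c z.2 • dx k U z) ^ 2 ≤
      2 * (bern φ * (4 ^ j * energy r c U)
        + 2 ^ j * (bern φ * (4 ^ j * Xsq fun z => wt r c z.2 • U z))) := by
    refine normXj_sq_le (hU.Xsq_dx_le hr hr1 c k) fun t ht => ?_
    simp_rw [enorm_smul, mul_pow]
    refine (hU.lintegral_dx_sq_le hr hr1 c ht k).trans ?_
    gcongr
    exact mass_le_energy ht
  rw [mul_pow]
  calc _ ≤ ((2 ^ j)⁻¹) ^ 2 * (2 * (bern φ * (4 ^ j * energy r c U)
        + 2 ^ j * (bern φ * (4 ^ j * Xsq fun z => wt r c z.2 • U z)))) := by gcongr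
    _ = ((2 ^ j)⁻¹ * 2 ^ j) ^ 2 * (2 * bern φ * (energy r c U + 2 ^ j * Xsq fun z => wt r c z.2 • U z)) := by
        rw [show (4 : ℝ≥0∞) ^ j = (2 ^ j) ^ 2 by rw [← pow_mul, mul_comm, pow_mul]; norm_num]
        ring
    _ = _ := by rw [ENNReal.inv_mul_cancel (by positivity) (by simp)]; simp

theorem LocalizedSolution.interaction_le {V : Type*} [NormedAddCommGroup V] [NormedSpace ℂ V]
    (hU : LocalizedSolution φ j H u₀ U f) (χ : CubePartition d)
    {μ : ℝ} (hμ : 0 < μ) (hμ1 : μ ≤ 1) {C : ℝ≥0} (hC : ∀ (j : ℕ) (k k' : Fin d → ℤ) (x : Rd d),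
      ‖χ.cutoff j k' x‖ₑ * ‖wt (μ * (2 ^ j)⁻¹) (corner j k) x‖ₑ
        ≤ C * bw (latticePoint k' - latticePoint k) * ‖χ.cutoff j k' x‖ₑ)
    {F : ℝ × Rd d → V} (hF : AEStronglyMeasurable F (slab d)) (hfF : ∀ z, ‖f z‖ₑ ≤ ‖F z‖ₑ)
    (hY : ∀ k', normYj j (fun z => (χ.cutoff j k' z.2 : ℂ) • F z) ≠ ⊤) (k : Fin d → ℤ)
    {q : ℝ≥0∞} (hq : q ≠ 0) (hq' : q ≠ ⊤) :
    interaction j (μ * (2 ^ j)⁻¹) (corner j k) U f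
      ≤ q * (2 * (1 + d * bern φ) * (energy (μ * (2 ^ j)⁻¹) (corner j k) U
          + 2 ^ j * Xsq fun z => wt (μ * (2 ^ j)⁻¹) (corner j k) z.2 • U z))
        + q⁻¹ * ((1 + d) * (C * latticeAvg (fun k' =>
            normYj j (fun z => (χ.cutoff j k' z.2 : ℂ) • F z)) k) ^ 2) := by
  set r := μ * (2 ^ j)⁻¹ with hr
  have hr0 : 0 ≤ r := by positivity
  have hr1 : r ≤ 1 := mul_le_one₀ hμ1 (by positivity) (inv_le_one_of_one_le₀ (one_le_pow₀ one_le_two))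
  set c : Rd d := corner j k with hc
  set E := energy r c U + 2 ^ j * Xsq fun z => wt r c z.2 • U z with hE
  set A := latticeAvg (fun k' => normYj j (fun z => (χ.cutoff j k' z.2 : ℂ) • F z)) k with hA
  have hEt : E ≠ ⊤ := by
    have h1 := (hU.energy_lt_top r c).ne
    have h2 := ((hU.Xsq_le_energy r c).trans_lt (hU.energy_lt_top r c)).ne
    rw [hE]; finiteness
  have hbt := (bern_lt_top φ).ne
  have hX0 : normXj j (fun z => wt r c z.2 • U z) ≠ ⊤ := by
    intro h
    have := normXj_wt_sq_le j U r c
    rw [h] at this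
    simp only [ne_eq, OfNat.ofNat_ne_zero, not_false_eq_true, ENNReal.top_pow, top_le_iff] at this
    exact ENNReal.mul_ne_top (by simp) hEt this
  have hX1 : ∀ i, normXj j (fun z => wt r c z.2 • dx i U z) ≠ ⊤ := by
    intro i h
    have := hU.normXj_dx_sq_le hr0 hr1 c i
    rw [h, ENNReal.mul_top (by simp)] at this
    simp only [ne_eq, OfNat.ofNat_ne_zero, not_false_eq_true, ENNReal.top_pow, top_le_iff] at this
    exact ENNReal.mul_ne_top (ENNReal.mul_ne_top (by simp) hbt) hEt this
  have hm : ∀ Φ : ℝ × Rd d → ℂ, AEStronglyMeasurable Φ (slab d) →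
      AEMeasurable (fun z => ww r c z.2 * (‖Φ z‖ₑ * ‖F z‖ₑ)) (slab d) := fun Φ hΦ =>
    ((measurable_ww r c).comp measurable_snd).aemeasurable.mul (hΦ.enorm.mul hF.enorm)
  have h0 : ∫⁻ z, ww r c z.2 * (‖U z‖ₑ * ‖F z‖ₑ) ∂(slab d) ≤ q * (2 * E) + q⁻¹ * (C * A) ^ 2 :=
    calc _ ≤ (C * A) * normXj j (fun z => wt r c z.2 • U z) :=
          lintegral_weighted_mul_le χ hC hF hY hU.aestronglyMeasurable k hX0
      _ ≤ _ := (LocalizedSolution.mul_le_add_sq hq hq').trans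
          (add_le_add (mul_le_mul' le_rfl (normXj_wt_sq_le j U r c)) le_rfl)
  have h1 : ∀ i, (2 ^ j)⁻¹ * ∫⁻ z, ww r c z.2 * (‖dx i U z‖ₑ * ‖F z‖ₑ) ∂(slab d)
      ≤ q * (2 * bern φ * E) + q⁻¹ * (C * A) ^ 2 := fun i =>
    calc _ ≤ (2 ^ j)⁻¹ * ((C * A) * normXj j (fun z => wt r c z.2 • dx i U z)) :=
          mul_le_mul' le_rfl (lintegral_weighted_mul_le χ hC hF hY (hU.aestronglyMeasurable_dx i) k (hX1 i))
      _ = (C * A) * ((2 ^ j)⁻¹ * normXj j (fun z => wt r c z.2 • dx i U z)) := by ring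
      _ ≤ _ := (LocalizedSolution.mul_le_add_sq hq hq').trans
          (add_le_add (mul_le_mul' le_rfl (hU.normXj_dx_sq_le hr0 hr1 c i)) le_rfl)
  have h2 : ∀ i, AEMeasurable (fun z => (2 ^ j)⁻¹ * (ww r c z.2 * (‖dx i U z‖ₑ * ‖F z‖ₑ))) (slab d) :=
    fun i => (hm _ (hU.aestronglyMeasurable_dx i)).const_mul _
  calc _ ≤ ∫⁻ z, (ww r c z.2 * (‖U z‖ₑ * ‖F z‖ₑ)
        + ∑ i, (2 ^ j)⁻¹ * (ww r c z.2 * (‖dx i U z‖ₑ * ‖F z‖ₑ))) ∂(slab d) := by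
        refine lintegral_mono fun z => ?_
        calc _ ≤ ww r c z.2 * ((‖U z‖ₑ + (2 ^ j)⁻¹ * gsum U z) * ‖F z‖ₑ) := by gcongr; exact hfF z
          _ = _ := by
            rw [← Finset.mul_sum, ← Finset.mul_sum, ← Finset.sum_mul, gsum]; ring
    _ = ∫⁻ z, ww r c z.2 * (‖U z‖ₑ * ‖F z‖ₑ) ∂(slab d)
        + ∑ i, (2 ^ j)⁻¹ * ∫⁻ z, ww r c z.2 * (‖dx i U z‖ₑ * ‖F z‖ₑ) ∂(slab d) := by
        rw [lintegral_add_left' (hm _ hU.aestronglyMeasurable), lintegral_finsetSum' _ fun i _ => h2 i]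
        congr 1
        exact Finset.sum_congr rfl fun i _ => lintegral_const_mul'' _ (hm _ (hU.aestronglyMeasurable_dx i))
    _ ≤ (q * (2 * E) + q⁻¹ * (C * A) ^ 2) + ∑ _i : Fin d, (q * (2 * bern φ * E) + q⁻¹ * (C * A) ^ 2) :=
        add_le_add h0 (Finset.sum_le_sum fun i _ => h1 i)
    _ = _ := by
        simp only [Finset.sum_const, Finset.card_univ, Fintype.card_fin, nsmul_eq_mul]
        ring

/-- The local energy decay of a localized solution around the cubes of its own scale. -/
theorem exists_cube_estimate (φ : LPBump d) (χ : CubePartition d) (V : Type*) [NormedAddCommGroup V]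
    [NormedSpace ℂ V] : ∃ (μ : ℝ) (b C : ℝ≥0), 0 < μ ∧ μ ≤ 1 ∧ 0 < b ∧
    ∀ (j : ℕ) (H : Coeff d) (P : Rd d → ℝ≥0∞) (B : ℝ≥0∞) (u₀ : Rd d → ℂ)
      (U f : ℝ × Rd d → ℂ) (F : ℝ × Rd d → V), TamePerturbation H P B → B ≤ b →
      LocalizedSolution φ j H u₀ U f → AEStronglyMeasurable F (slab d) → (∀ z, ‖f z‖ₑ ≤ ‖F z‖ₑ) →
      (∀ k', normYj j (fun z => (χ.cutoff j k' z.2 : ℂ) • F z) ≠ ⊤) → ∀ k : Fin d → ℤ,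
      energy (μ * (2 ^ j)⁻¹) (corner j k) U
          + 2 ^ j * Xsq (fun z => wt (μ * (2 ^ j)⁻¹) (corner j k) z.2 • U z)
        ≤ C * (mass (μ * (2 ^ j)⁻¹) (corner j k) U 0 + latticeAvg (fun k' =>
            normYj j (fun z => (χ.cutoff j k' z.2 : ℂ) • F z)) k ^ 2) := by
  obtain ⟨μ, b, K, hμ, hμ1, hb, hK⟩ := exists_local_estimate φ
  obtain ⟨D, hD⟩ := exists_cutoff_mul_wt_le χ hμ hμ1
  obtain ⟨β, hβ⟩ : ∃ β : ℝ≥0, bern φ = β := ⟨_, (ENNReal.coe_toNNReal (bern_lt_top φ).ne).symm⟩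
  set M : ℝ≥0 := 4 * K * (1 + d * β) + 1 with hM
  have hM0 : M ≠ 0 := by positivity
  refine ⟨μ, b, 2 * K + 2 * K * M * (1 + d) * D ^ 2, hμ, hμ1, hb,
    fun j H P B u₀ U f F hH hB hU hF hfF hY k => ?_⟩
  have h := hK j H P B u₀ U f hH hB hU (corner j k)
  have hi := hU.interaction_le χ hμ hμ1 hD hF hfF hY k (q := (M : ℝ≥0∞)⁻¹) (by simp)
    (ENNReal.inv_ne_top.2 (by simpa using hM0))
  set E := energy (μ * (2 ^ j)⁻¹) (corner j k) U
          + 2 ^ j * Xsq (fun z => wt (μ * (2 ^ j)⁻¹) (corner j k) z.2 • U z) with hE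
  have hEt : E ≠ ⊤ := by
    have h1 := (hU.energy_lt_top (μ * (2 ^ j)⁻¹) (corner j k)).ne
    have h2 := ((hU.Xsq_le_energy (μ * (2 ^ j)⁻¹) (corner j k)).trans_lt (hU.energy_lt_top _ _)).ne
    rw [hE]; finiteness
  set m := mass (μ * (2 ^ j)⁻¹) (corner j k) U 0
  set A := latticeAvg (fun k' => normYj j (fun z => (χ.cutoff j k' z.2 : ℂ) • F z)) k
  have hq : K * ((M : ℝ≥0∞)⁻¹ * (2 * (1 + d * bern φ) * E)) ≤ 2⁻¹ * E := by
    have h3 : ((K * (M⁻¹ * (2 * (1 + d * β))) : ℝ≥0) : ℝ≥0∞) ≤ ((2⁻¹ : ℝ≥0) : ℝ≥0∞) := by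
      rw [ENNReal.coe_le_coe]
      have e : K * (M⁻¹ * (2 * (1 + d * β))) = (2 * K * (1 + d * β)) / M := by rw [div_eq_mul_inv]; ring
      rw [e, div_le_iff₀ (by positivity), hM]
      have : (2⁻¹ : ℝ≥0) * (4 * K * (1 + d * β) + 1) = 2 * K * (1 + d * β) + 2⁻¹ := by
        rw [mul_add, ← mul_assoc, ← mul_assoc, mul_one]; norm_num
      rw [this]
      exact le_self_add
    rw [hβ]
    push_cast [ENNReal.coe_inv hM0, ENNReal.coe_inv (two_ne_zero : (2 : ℝ≥0) ≠ 0)] at h3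
    calc _ = K * ((M : ℝ≥0∞)⁻¹ * (2 * (1 + d * β))) * E := by ring
      _ ≤ _ := mul_le_mul' h3 le_rfl
  have h4 : E ≤ (K * m + K * (M * ((1 + d) * (D * A) ^ 2))) + 2⁻¹ * E := by
    calc E ≤ K * (m + _) := h
      _ ≤ K * (m + ((M : ℝ≥0∞)⁻¹ * (2 * (1 + d * bern φ) * E) + M * ((1 + d) * (D * A) ^ 2))) := by
          rw [inv_inv] at hi
          exact mul_le_mul' le_rfl (add_le_add le_rfl hi)
      _ = (K * m + K * (M * ((1 + d) * (D * A) ^ 2))) + K * ((M : ℝ≥0∞)⁻¹ * (2 * (1 + d * bern φ) * E)) := by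
          ring
      _ ≤ _ := add_le_add le_rfl hq
  refine (le_two_mul_of_le_add_half hEt h4).trans ?_
  push_cast
  calc 2 * (K * m + K * (M * ((1 + d) * (D * A) ^ 2)))
      = 2 * K * m + 2 * K * M * (1 + d) * D ^ 2 * A ^ 2 := by ring
    _ ≤ (2 * K + 2 * K * M * (1 + d) * D ^ 2) * m + (2 * K + 2 * K * M * (1 + d) * D ^ 2) * A ^ 2 := by
        gcongr
        · exact le_self_add
        · exact le_add_self
    _ = _ := by ring

end CubeEstimate

section Main

/-- The smooth representative of a component of a function that is localized at frequency `2^j`. -/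
def smoothRep {m : ℕ} (φ : LPBump d) (j : ℕ) (u : ℝ × Rd d → EuclideanSpace ℂ (Fin m)) (i : Fin m)
    (z : ℝ × Rd d) : ℂ := cv (φ.Phi (j + 1)) (fun y => u (z.1, y) i) z.2

section Rep

variable {m j : ℕ} {a : Fin d → Fin d → ℝ × Rd d → ℂ}
  {u₀ : Rd d → EuclideanSpace ℂ (Fin m)}
  {u f : ℝ × Rd d → EuclideanSpace ℂ (Fin m)}

theorem smoothRep_ae_eq (hs : IsSolution a u₀ u f)
    (hu : ∀ t ∈ 𝕀, FreqLocalized j fun x => u (t, x)) (i : Fin m) {t : ℝ}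
    (ht : t ∈ 𝕀) : (fun x => smoothRep φ j u i (t, x)) =ᵐ[volume] fun x => u (t, x) i := by
  filter_upwards [(hu t ht).cv_eq_self φ le_rfl] with x hx
  rw [smoothRep, cv_component _ (ConvDefined.of_memLp_two (hs.memL2 t ht)) i x, hx]

theorem localizedSolution_smoothRep (hH : TamePerturbation H P B) (ha : IsPerturbed a H)
    (hs : IsSolution a u₀ u f) (hu : ∀ t ∈ 𝕀, FreqLocalized j fun x => u (t, x)) (i : Fin m) :
    LocalizedSolution φ j H (fun x => u₀ x i) (smoothRep φ j u i) (fun z => f z i) := by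
  have hsi := hs.component hH ha i
  have hcd : ∀ t ∈ 𝕀, ConvDefined fun x => u (t, x) i := fun t ht =>
    ConvDefined.of_memLp_two (hsi.memL2 t ht)
  have hae := fun t ht => smoothRep_ae_eq (φ := φ) hs hu i (t := t) ht
  have hcv : ∀ κ : 𝓢(Rd d, ℂ), ∀ t ∈ 𝕀,
      cv κ (fun x => smoothRep φ j u i (t, x)) = cv κ (fun x => u (t, x) i) := fun κ t ht => by
    ext x
    refine integral_congr_ae ?_
    filter_upwards [hae t ht] with y hy
    rw [hy]
  refine ⟨hsi.smoothSolution hH ha hae, fun t ht => ?_, fun t ht k x => ?_, fun r hr t ht => ?_⟩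
  · refine ConvDefined.of_memLp_two ((memLp_congr_ae (hae t ht)).2 (hsi.memL2 t ht))
  · rw [hcv _ t ht]
    exact dx_cv (φ.Phi (j + 1)) (u := fun z => u z i) (z := (t, x)) (hcd t ht) k
  · rw [hcv _ t ht]
    ext x
    rw [cv_component _ (ConvDefined.of_memLp_two (hs.memL2 t ht)) i x, (hu t ht).cv_eq_zero φ hr]
    rfl

theorem smoothRep_ae_eq_slab (hH : TamePerturbation H P B) (ha : IsPerturbed a H)
    (hs : IsSolution a u₀ u f) (hu : ∀ t ∈ 𝕀, FreqLocalized j fun x => u (t, x)) (i : Fin m) :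
    ∀ᵐ z ∂(slab d), smoothRep φ j u i z = u z i := by
  have h1 := (localizedSolution_smoothRep (φ := φ) hH ha hs hu i).aestronglyMeasurable
  have h2 := (hs.component hH ha i).measurable
  have hm : AEMeasurable (fun z => ‖smoothRep φ j u i z - u z i‖ₑ) (slab d) := (h1.sub h2).enorm
  have h3 : ∫⁻ z, ‖smoothRep φ j u i z - u z i‖ₑ ∂(slab d) ≤ 0 := by
    refine LocalizedSolution.lintegral_slab_le hm fun t ht => ?_
    rw [nonpos_iff_eq_zero]
    refine lintegral_eq_zero_of_ae_eq_zero ?_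
    filter_upwards [smoothRep_ae_eq (φ := φ) hs hu i ht] with x hx
    simp [hx]
  rw [nonpos_iff_eq_zero, lintegral_eq_zero_iff' hm] at h3
  filter_upwards [h3] with z hz
  simpa [sub_eq_zero] using hz

end Rep

theorem enorm_sq_eq_sum {m : ℕ} (v : EuclideanSpace ℂ (Fin m)) : ‖v‖ₑ ^ 2 = ∑ i, ‖v i‖ₑ ^ 2 := by
  rw [← ofReal_norm, ← ENNReal.ofReal_pow (norm_nonneg _), EuclideanSpace.norm_sq_eq,
    ENNReal.ofReal_sum_of_nonneg fun _ _ => by positivity]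
  refine Finset.sum_congr rfl fun i _ => ?_
  rw [← ofReal_norm, ENNReal.ofReal_pow (norm_nonneg _)]

/-- The norm of the part of a vector valued function on a cube is controlled by the weighted norms of
its components. -/
theorem normXj_cutoff_sq_le {m : ℕ} (χ : CubePartition d) {μ : ℝ} {C : ℝ≥0}
    (hC : ∀ (j : ℕ) (k : Fin d → ℤ) (x : Rd d),
      ‖χ.cutoff j k x‖ₑ ≤ C * ‖wt (μ * (2 ^ j)⁻¹) (corner j k) x‖ₑ) {j : ℕ}
    {u : ℝ × Rd d → EuclideanSpace ℂ (Fin m)} {U : Fin m → ℝ × Rd d → ℂ}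
    (hm : ∀ i, AEStronglyMeasurable (U i) (slab d))
    (hmt : ∀ i, ∀ t ∈ 𝕀, Continuous fun x => U i (t, x))
    (hu : ∀ i, ∀ᵐ z ∂(slab d), U i z = u z i)
    (hut : ∀ i, ∀ t ∈ 𝕀, (fun x => U i (t, x)) =ᵐ[volume] fun x => u (t, x) i)
    (k : Fin d → ℤ) :
    normXj j (fun z => (χ.cutoff j k z.2 : ℂ) • u z) ^ 2
      ≤ 2 * C ^ 2 * ∑ i, (energy (μ * (2 ^ j)⁻¹) (corner j k) (U i)
        + 2 ^ j * Xsq (fun z => wt (μ * (2 ^ j)⁻¹) (corner j k) z.2 • U i z)) := by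
  set r := μ * (2 ^ j)⁻¹
  set c : Rd d := corner j k
  have hp : ∀ (x : Rd d) (v : EuclideanSpace ℂ (Fin m)), ‖(χ.cutoff j k x : ℂ) • v‖ₑ ^ 2
      ≤ C ^ 2 * ∑ i, ww r c x * ‖v i‖ₑ ^ 2 := fun x v => by
    have e : ‖(χ.cutoff j k x : ℂ)‖ₑ = ‖χ.cutoff j k x‖ₑ := by
      rw [← ofReal_norm, Complex.norm_real, ofReal_norm]
    rw [enorm_smul, mul_pow, e, enorm_sq_eq_sum, ← Finset.mul_sum, ← mul_assoc, ww, ← mul_pow]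
    gcongr
    exact hC j k x
  have hX : Xsq (fun z => (χ.cutoff j k z.2 : ℂ) • u z)
      ≤ C ^ 2 * ∑ i, Xsq (fun z => wt r c z.2 • U i z) := by
    refine Xsq_le fun l k' => ?_
    have hmw : ∀ i, AEMeasurable (fun z => (cube l k').indicator 1 z.2 * ‖wt r c z.2 • U i z‖ₑ ^ 2) (slab d) :=
      fun i => aemeasurable_cube_mul (((continuous_wt r c).comp continuous_snd).aestronglyMeasurable.smul (hm i)) _ _
    calc _ ≤ ∫⁻ z, C ^ 2 * ∑ i, (cube l k').indicator 1 z.2 * ‖wt r c z.2 • U i z‖ₑ ^ 2 ∂(slab d) := by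
          refine lintegral_mono_ae ?_
          filter_upwards [ae_all_iff.2 hu] with z hz
          calc _ ≤ (cube l k').indicator 1 z.2 * (C ^ 2 * ∑ i, ww r c z.2 * ‖u z i‖ₑ ^ 2) :=
                mul_le_mul' le_rfl (hp z.2 (u z))
            _ = _ := by
                rw [mul_left_comm, Finset.mul_sum]
                congr 1
                refine Finset.sum_congr rfl fun i _ => ?_
                rw [enorm_smul, mul_pow, hz i, ww]
      _ = C ^ 2 * ∑ i, ∫⁻ z, (cube l k').indicator 1 z.2 * ‖wt r c z.2 • U i z‖ₑ ^ 2 ∂(slab d) := by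
          rw [lintegral_const_mul' _ _ (by finiteness), lintegral_finsetSum' _ fun i _ => hmw i]
      _ ≤ C ^ 2 * ∑ i, 2 ^ l * Xsq (fun z => wt r c z.2 • U i z) :=
          mul_le_mul' le_rfl (Finset.sum_le_sum fun i _ => le_Xsq _ l k')
      _ = _ := by rw [← Finset.mul_sum, mul_left_comm]
  have hE : ∀ t ∈ 𝕀, ∫⁻ x, ‖(χ.cutoff j k x : ℂ) • u (t, x)‖ₑ ^ 2
      ≤ C ^ 2 * ∑ i, energy r c (U i) := fun t ht => by
    calc _ ≤ ∫⁻ x, C ^ 2 * ∑ i, ww r c x * ‖U i (t, x)‖ₑ ^ 2 := by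
          refine lintegral_mono_ae ?_
          filter_upwards [ae_all_iff.2 fun i => hut i t ht] with x hx
          simp_rw [hx]
          exact hp x (u (t, x))
      _ = C ^ 2 * ∑ i, mass r c (U i) t := by
          have hmw : ∀ i, Measurable fun x => ww r c x * ‖U i (t, x)‖ₑ ^ 2 := fun i =>
            (measurable_ww r c).mul ((hmt i t ht).enorm.measurable.pow_const 2)
          rw [lintegral_const_mul' _ _ (by finiteness), lintegral_finsetSum _ fun i _ => hmw i]
          rfl
      _ ≤ _ := mul_le_mul' le_rfl (Finset.sum_le_sum fun i _ => LocalizedSolution.mass_le_energy ht)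
  refine (normXj_sq_le hX hE).trans_eq ?_
  rw [Finset.sum_add_distrib, ← Finset.mul_sum]
  ring

theorem l2Norm_sq {V : Type*} [NormedAddCommGroup V] [NormedSpace ℂ V] (χ : CubePartition d) (j : ℕ)
    (N : (ℝ × Rd d → V) → ℝ≥0∞) (u : ℝ × Rd d → V) :
    l2Norm χ j N u ^ 2 = ∑' k : Fin d → ℤ, N (fun z => (χ.cutoff j k z.2 : ℂ) • u z) ^ 2 :=
  ennreal_half_sq _

theorem IsSolution.aestronglyMeasurable_forcing {V : Type*} [NormedAddCommGroup V] [NormedSpace ℂ V]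
    {a : Fin d → Fin d → ℝ × Rd d → ℂ} {u₀ : Rd d → V} {u f : ℝ × Rd d → V} (hs : IsSolution a u₀ u f) :
    AEStronglyMeasurable f (slab d) := by
  rw [slab_eq]
  exact hs.forcing.aestronglyMeasurable

/-- The estimate for the solutions of the frequency localized equation, with a tame perturbation of the
flat metric. -/
theorem exists_localized_estimate (φ : LPBump d) (χ : CubePartition d) (m : ℕ) :
    ∃ b C : ℝ≥0, 0 < b ∧ ∀ (j : ℕ) (a : Fin d → Fin d → ℝ × Rd d → ℂ)
      (H : Coeff d) (P : Rd d → ℝ≥0∞) (B : ℝ≥0∞)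
      (u₀ : Rd d → EuclideanSpace ℂ (Fin m)) (u f : ℝ × Rd d → EuclideanSpace ℂ (Fin m)),
      TamePerturbation H P B → B ≤ b → IsPerturbed a H → IsSolution a u₀ u f →
      (∀ t ∈ 𝕀, FreqLocalized j fun x => u (t, x)) →
      l2Norm χ j (normXj j) u ≤ C * (eLpNorm u₀ 2 volume + l2Norm χ j (normYj j) f) := by
  obtain ⟨μ, b, K, hμ, hμ1, hb, hK⟩ := exists_cube_estimate φ χ (EuclideanSpace ℂ (Fin m))
  obtain ⟨D, hD⟩ := exists_cutoff_le_wt χ hμ hμ1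
  obtain ⟨L, hL⟩ : ∃ L : ℝ≥0, ENNReal.ofReal (2 / μ ^ 2) ^ (d + 1) * latticeConst d = L := by
    have := (latticeConst_lt_top d).ne
    exact ⟨_, (ENNReal.coe_toNNReal (by finiteness)).symm⟩
  obtain ⟨S, hS⟩ : ∃ S : ℝ≥0, ∑' c : Fin d → ℤ, bw (latticePoint c) = S :=
    ⟨_, (ENNReal.coe_toNNReal (tsum_bw_lt_top d).ne).symm⟩
  set M : ℝ≥0 := 2 * D ^ 2 * K * (L + m * S ^ 2) + 1 with hM
  have hM1 : 1 ≤ M := le_add_self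
  refine ⟨b, M, hb, fun j a H P B u₀ u f hH hB ha hs hu => ?_⟩
  by_cases hY : ∃ k, normYj j (fun z => (χ.cutoff j k z.2 : ℂ) • f z) = ⊤
  · obtain ⟨k, hk⟩ := hY
    have : l2Norm χ j (normYj j) f = ⊤ := by
      have h1 : (⊤ : ℝ≥0∞) ≤ l2Norm χ j (normYj j) f ^ 2 := by
        rw [l2Norm_sq]
        refine le_trans ?_ (ENNReal.le_tsum k)
        rw [hk]; simp
      by_contra h
      exact ENNReal.pow_ne_top h (top_le_iff.1 h1)
    rw [this, add_top, ENNReal.mul_top (by simpa using (zero_lt_one.trans_le hM1).ne')]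
    exact le_top
  push Not at hY
  have hU := fun i => localizedSolution_smoothRep (φ := φ) hH ha hs hu i
  have hf := hs.aestronglyMeasurable_forcing
  have hfi : ∀ i z, ‖f z i‖ₑ ≤ ‖f z‖ₑ := fun i z => by
    rw [← ofReal_norm, ← ofReal_norm]
    exact ENNReal.ofReal_le_ofReal (PiLp.norm_apply_le _ _)
  set A := latticeAvg fun k' => normYj j (fun z => (χ.cutoff j k' z.2 : ℂ) • f z) with hA
  have h1 : ∀ k : Fin d → ℤ, normXj j (fun z => (χ.cutoff j k z.2 : ℂ) • u z) ^ 2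
      ≤ 2 * D ^ 2 * K * ∑ i, (mass (μ * (2 ^ j)⁻¹) (corner j k) (smoothRep φ j u i) 0 + A k ^ 2) := fun k => by
    refine (normXj_cutoff_sq_le χ hD (fun i => (hU i).aestronglyMeasurable)
      (fun i t ht => (hU i).continuous_slice ht) (fun i => smoothRep_ae_eq_slab hH ha hs hu i)
      (fun i t ht => smoothRep_ae_eq hs hu i ht) k).trans ?_
    rw [mul_assoc _ (K : ℝ≥0∞), Finset.mul_sum (a := (K : ℝ≥0∞))]
    exact mul_le_mul' le_rfl (Finset.sum_le_sum fun i _ =>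
      hK j H P B _ _ _ f hH hB (hU i) hf (hfi i) hY k)
  have h2 : ∑ i, ∫⁻ x, ‖smoothRep φ j u i (0, x)‖ₑ ^ 2 = eLpNorm u₀ 2 volume ^ 2 := by
    rw [← lintegral_finsetSum _ fun i _ =>
      ((hU i).continuous_slice (t := 0) (by simp)).enorm.measurable.pow_const 2, eLpNorm_two_sq]
    refine lintegral_congr_ae ?_
    filter_upwards [ae_all_iff.2 fun i => (hU i).initial] with x hx
    rw [enorm_sq_eq_sum]
    exact Finset.sum_congr rfl fun i _ => by rw [hx i]
  have h3 : l2Norm χ j (normXj j) u ^ 2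
      ≤ (M * (eLpNorm u₀ 2 volume + l2Norm χ j (normYj j) f)) ^ 2 := by
    rw [l2Norm_sq]
    calc _ ≤ ∑' k : Fin d → ℤ, 2 * D ^ 2 * K *
          ∑ i, (mass (μ * (2 ^ j)⁻¹) (corner j k) (smoothRep φ j u i) 0 + A k ^ 2) := ENNReal.tsum_le_tsum h1
      _ = 2 * D ^ 2 * K * ((∑ i, ∑' k : Fin d → ℤ, mass (μ * (2 ^ j)⁻¹) (corner j k) (smoothRep φ j u i) 0)
          + m * ∑' k, A k ^ 2) := by
          rw [ENNReal.tsum_mul_left]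
          congr 1
          simp_rw [Finset.sum_add_distrib]
          rw [ENNReal.tsum_add, Summable.tsum_finsetSum fun _ _ => ENNReal.summable]
          simp [ENNReal.tsum_mul_left]
      _ ≤ 2 * D ^ 2 * K * ((∑ i, L * ∫⁻ x, ‖smoothRep φ j u i (0, x)‖ₑ ^ 2)
          + m * (S ^ 2 * l2Norm χ j (normYj j) f ^ 2)) := by
          refine mul_le_mul' le_rfl (add_le_add (Finset.sum_le_sum fun i _ => ?_) (mul_le_mul' le_rfl ?_))
          · rw [← hL]
            exact (hU i).tsum_mass_le hμ hμ1
          · rw [← hS, l2Norm_sq]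
            exact tsum_latticeAvg_sq_le _
      _ = 2 * D ^ 2 * K * (L * eLpNorm u₀ 2 volume ^ 2 + m * S ^ 2 * l2Norm χ j (normYj j) f ^ 2) := by
          rw [← Finset.mul_sum, h2, mul_assoc (m : ℝ≥0∞)]
      _ ≤ M * (eLpNorm u₀ 2 volume ^ 2 + l2Norm χ j (normYj j) f ^ 2) := by
          have c1 : ((2 * D ^ 2 * K * L : ℝ≥0) : ℝ≥0∞) ≤ M := by
            rw [ENNReal.coe_le_coe, hM, mul_add]
            exact le_self_add.trans le_self_add
          have c2 : ((2 * D ^ 2 * K * (m * S ^ 2) : ℝ≥0) : ℝ≥0∞) ≤ M := by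
            rw [ENNReal.coe_le_coe, hM, mul_add]
            exact le_add_self.trans le_self_add
          push_cast at c1 c2
          rw [mul_add, mul_add, ← mul_assoc, ← mul_assoc]
          exact add_le_add (mul_le_mul' c1 le_rfl) (mul_le_mul' c2 le_rfl)
      _ ≤ M ^ 2 * (eLpNorm u₀ 2 volume + l2Norm χ j (normYj j) f) ^ 2 := by
          refine mul_le_mul' ?_ ?_
          · exact_mod_cast le_self_pow hM1 two_ne_zero
          · rw [add_sq, add_assoc, add_comm (2 * _ * _), ← add_assoc]
            exact le_self_add
      _ = _ := by rw [mul_pow]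
  exact (ENNReal.pow_le_pow_left_iff two_ne_zero).1 h3

end Main

end QuasiSchrodinger

end

theorem proposition4p1
    {d m n : ℕ} (hd : 1 ≤ d) (s : ℝ) (hs : ((d : ℝ) + 3) / 2 < s)
    (φ : LPBump d) (χ : CubePartition d)
    (h : EuclideanSpace ℂ (Fin n) → Matrix (Fin d) (Fin d) ℝ)
    (h_smooth : ∀ k l, ContDiff ℝ ∞ fun y => h y k l)
    (h_symm : ∀ y, (h y).IsSymm)
    (h_quad : ∀ k l, (fun y => h y k l) =O[𝓝 0] fun y => ‖y‖ ^ 2) :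
    ∃ ε : ℝ≥0, 0 < ε ∧ ∃ C : ℝ≥0,
      ∀ (w : ℝ × Rd d → EuclideanSpace ℂ (Fin n)) (g : ℝ × Rd d → Matrix (Fin d) (Fin d) ℝ),
        Meml2Xs φ χ s w → norml2Xs φ χ s w ≤ ε →
        (∀ᵐ z ∂(slab d), g z - 1 = h (w z)) →
        ∀ (j : ℕ) (u₀ : Rd d → EuclideanSpace ℂ (Fin m))
          (u f : ℝ × Rd d → EuclideanSpace ℂ (Fin m)),
          IsSolution (lowMetric φ (j - 4) g) u₀ u f →
          (∀ t ∈ Icc (0 : ℝ) 1, FreqLocalized j fun x => u (t, x)) →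
          l2Norm χ j (normXj j) u
            ≤ C * (eLpNorm u₀ 2 volume + l2Norm χ j (normYj j) f) := by
  obtain ⟨A, hA⟩ := exists_tamePerturbation hs φ χ h h_smooth h_symm h_quad
  obtain ⟨b, C, hb, hC⟩ := exists_localized_estimate φ χ m
  set ε : ℝ≥0 := min 1 (min 1 b / (A + 1)) with hε
  have hε0 : 0 < ε := by positivity
  have hεb : A * ε ^ 2 ≤ min 1 b := by
    have h1 : ε ^ 2 ≤ min 1 b / (A + 1) :=
      (pow_le_of_le_one zero_le (min_le_left _ _) two_ne_zero).trans (min_le_right _ _)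
    calc A * ε ^ 2 ≤ (A + 1) * (min 1 b / (A + 1)) := mul_le_mul' le_self_add h1
      _ = min 1 b := mul_div_cancel₀ _ (by positivity)
  refine ⟨ε, hε0, C, fun w g hw hwε hg j u₀ u f hs hu => ?_⟩
  have hB : (A : ℝ≥0∞) * norml2Xs φ χ s w ^ 2 ≤ ((min 1 b : ℝ≥0) : ℝ≥0∞) :=
    calc (A : ℝ≥0∞) * norml2Xs φ χ s w ^ 2 ≤ A * ε ^ 2 := by gcongr
      _ ≤ _ := by exact_mod_cast hεb
  obtain ⟨H, P, hH, ha⟩ := hA w g hw (hB.trans (by exact_mod_cast min_le_left _ _)) hg (j - 4)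
  exact hC j _ H P _ u₀ u f hH (hB.trans (by exact_mod_cast min_le_right _ _)) ha hs hu
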